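/- **Setting.** Let $\tau\in\mathbb C$ with $\operatorname{Im}\tau>0$, and let $\theta$ be the odd theta function: the odd entire function with $\theta(u+1)=-\theta(u)$, $\theta(u+\tau)=-e^{-2\pi i u-\pi i\tau}\theta(u)$, $\theta'(0)=1$. Let $n\ge 0$, let $\mathbb A_n=\mathbb C((\lambda_1,\dots,\lambda_n))$ be the field of fractions of $\mathbb C[[\lambda_1,\dots,\lambda_n]]$, and let $\hbar$ be a formal parameter. Write $\lambda_{ij}=\lambda_i-\lambda_j$ and let $E_{ij}$ be the matrix units of $\operatorname{End}\mathbb C^n$. A superscript $(i)$ means action in the $i$-th tensor factor, and $\lambda+\hbar P$ in an argument denotes the Taylor expansion $F(\lambda+\hbar P)=\sum_\alpha \frac{\hbar^{|\alpha|}}{\alpha!}(\partial_\lambda^\alpha F)\,P^\alpha$. The symbol $\lambda+\hbar E^{(s)}$ means $P_k=E^{(s)}_{kk}$. For $u\in\mathbb C$ with $\theta(u)\ne0$ the Felder $R$-matrix is $$R(u;\lambda)=\frac{\theta(u+\hbar)}{\theta(u)}\sum_{i}E_{ii}\otimes E_{ii}+\sum_{i\ne j}\Big(\frac{\theta(\lambda_{ij}+\hbar)}{\theta(\lambda_{ij})}E_{ii}\otimes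 E_{jj}+\frac{\theta(u-\lambda_{ij})\theta(\hbar)}{\theta(u)\theta(-\lambda_{ij})}E_{ij}\otimes E_{ji}\Big),$$ expanded in powers of $\hbar$. Let $\mathfrak R$ be a (unital, associative) $\mathbb C[[\hbar]]$-algebra and $U\subseteq\mathbb C$ an open set. Let $L(u;\lambda)$ be an $n\times n$ matrix of $\mathfrak R$-valued functions of $(u,\lambda)$, holomorphic in $u\in U$ and of Laurent type in $\lambda$. Precisely, its entries lie in the $\hbar$-adically completed tensor product over $\mathbb C$ of $\mathfrak R$ with the algebra of fractions $p/q$, where $p,q$ are formal power series in $\lambda$ with coefficients holomorphic on $U$ and $q(u;\cdot)\neq0$ for every $u\in U$. Shifts $u\mapsto u+k\hbar$ are Taylor expansions in $\hbar$. Assume that $L$ is a *dynamical elliptic $L$-operator with Cartan elements* $h_1,\dots,h_n\in\mathfrak R$. That is, the $h_k$ commute pairwise, the matrix $L(u;\lambda)$ is invertible for each $u\in U$, and for all $u,v\in U$ (with $\theta(u-v)\neq0$ in the first relation) and all $i$ $$R^{(12)}(u-v;\lambda)L^{(1)}(u;\lambda+\hbar E^{(2)})L^{(2)}(v;\lambda)=L^{(2)}(v;\lambda+\hbar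 E^{(1)})L^{(1)}(u;\lambda)R^{(12)}(u-v;\lambda+\hbar h),$$ $$(E_{ii}+h_i)L(u;\lambda)=L(u;\lambda)(E_{ii}+h_i).$$ Let $\mathfrak A_n=\mathbb A_n[e^{\pm\hbar\partial_\lambda}]\otimes\mathfrak R$ be the algebra of finite sums $\sum_{\mu\in\mathbb Z^n}F_\mu(\lambda)\,e^{\hbar\sum_k\mu_k\partial_{\lambda_k}}$ with $F_\mu$ in the $\hbar$-adic completion of $\mathbb A_n\otimes\mathfrak R$, where $e^{\hbar\sum_k\mu_k\partial_{\lambda_k}}F(\lambda)=F(\lambda+\hbar\mu)e^{\hbar\sum_k\mu_k\partial_{\lambda_k}}$. Let $\mathfrak h$ be the subalgebra without unit generated by the $h_k$, let $\mathfrak A_n\mathfrak h$ be the left ideal of $\mathfrak A_n$ generated by $\mathfrak h$, and let $\mathfrak N_n=\{x\in\mathfrak A_n\mid \mathfrak h x\subset\mathfrak A_n\mathfrak h\}$. For $m\ge0$ let $A^{[0,m]}=\frac1{m!}\sum_{\sigma\in S_m}(-1)^\sigma\pi(\sigma)$ be the antisymmetrizer on $(\mathbb C^n)^{\otimes m}$,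 where $\pi(\sigma)$ permutes the tensor factors. With $\widehat D_\lambda=\sum_kE_{kk}\partial_{\lambda_k}$, for $u\in U$ put $$\mathbb L^{[0,m]}(u;\lambda)=e^{-\hbar\widehat D_\lambda^{(1)}}L^{(1)}(u;\lambda)\,e^{-\hbar\widehat D_\lambda^{(2)}}L^{(2)}(u+\hbar;\lambda)\cdots e^{-\hbar\widehat D_\lambda^{(m)}}L^{(m)}(u+(m-1)\hbar;\lambda),$$ $$t_m(u)=\operatorname{tr}\big(A^{[0,m]}\,\mathbb L^{[0,m]}(u;\lambda)\big)\in\mathfrak A_n,$$ where the trace is taken over all $m$ factors $\mathbb C^n$. **Theorem.** 1. $h_k\,t_m(u)=t_m(u)\,h_k$ for all $m\ge0$, all $u\in U$ and all $k=1,\dots,n$. 2. $t_m(u)\in\mathfrak N_n$ for all $m\ge0$ and all $u\in U$. Here $\mathfrak N_n$ is a subalgebra of $\mathfrak A_n$ which contains $\mathfrak A_n\mathfrak h$ as a two-sided ideal. 3. $t_m(u)\,t_s(v)\equiv t_s(v)\,t_m(u)\pmod{\mathfrak A_n\mathfrak h}$ for all $m,s\ge0$ and all $u,v\in U$. -/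

import Mathlib

noncomputable section
open scoped PowerSeries TensorProduct
open Finset.HasAntidiagonal (antidiagonal mem_antidiagonal)
namespace DynamicalElliptic

section ExpShift
variable {K : Type*} [CommRing K] [Algebra ℂ K]

/-- The divided power `Dⁱ / i!` of a derivation. -/
def divPow (D : Derivation ℂ K K) (i : ℕ) : Module.End ℂ K :=
  ((i.factorial : ℂ)⁻¹) • (D : K →ₗ[ℂ] K) ^ i

lemma divPow_zero (D : Derivation ℂ K K) : divPow D 0 = 1 := by simp [divPow]

lemma divPow_succ (D : Derivation ℂ K K) (i : ℕ) (a : K) :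
    ((i + 1 : ℕ) : ℂ) • divPow D (i + 1) a = D (divPow D i a) := by
  have h : ((i + 1 : ℕ) : ℂ) ≠ 0 := by exact_mod_cast Nat.succ_ne_zero i
  have e : D (divPow D i a) = ((i.factorial : ℂ)⁻¹) • D (((D : K →ₗ[ℂ] K) ^ i) a) := by
    simp only [divPow, LinearMap.smul_apply]
    exact (D : K →ₗ[ℂ] K).map_smul _ _
  rw [e]
  simp only [divPow, LinearMap.smul_apply, smul_smul, Nat.factorial_succ, pow_succ',
    Module.End.mul_apply, Derivation.coeFn_coe]
  congr 1
  push_cast at h ⊢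
  field_simp

lemma divPow_mul (D : Derivation ℂ K K) (m : ℕ) (a b : K) :
    divPow D m (a * b)
      = ∑ p ∈ antidiagonal m, divPow D p.1 a * divPow D p.2 b := by
  induction m with
  | zero => simp [divPow_zero]
  | succ m ih =>
    have h : ((m + 1 : ℕ) : ℂ) ≠ 0 := by exact_mod_cast Nat.succ_ne_zero m
    refine smul_right_injective K h ?_
    show ((m + 1 : ℕ) : ℂ) • _ = ((m + 1 : ℕ) : ℂ) • _
    rw [divPow_succ, ih, map_sum]
    have e1 : ∀ p ∈ antidiagonal m, D (divPow D p.1 a * divPow D p.2 b)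
        = (((p.2 + 1 : ℕ) : ℂ) • (divPow D p.1 a * divPow D (p.2 + 1) b))
          + (((p.1 + 1 : ℕ) : ℂ) • (divPow D (p.1 + 1) a * divPow D p.2 b)) := by
      intro p _
      rw [D.leibniz, ← divPow_succ, ← divPow_succ, smul_eq_mul, smul_eq_mul, mul_smul_comm,
        mul_smul_comm, mul_comm (divPow D p.2 b)]
    rw [Finset.sum_congr rfl e1, Finset.sum_add_distrib]
    have e2 : ((m + 1 : ℕ) : ℂ) • ∑ p ∈ antidiagonal (m + 1), divPow D p.1 a * divPow D p.2 b
        = (∑ p ∈ antidiagonal (m + 1), (p.2 : ℂ) • (divPow D p.1 a * divPow D p.2 b))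
          + ∑ p ∈ antidiagonal (m + 1), (p.1 : ℂ) • (divPow D p.1 a * divPow D p.2 b) := by
      rw [Finset.smul_sum, ← Finset.sum_add_distrib]
      refine Finset.sum_congr rfl fun p hp => ?_
      rw [← add_smul, ← mem_antidiagonal.1 hp]
      push_cast
      rw [add_comm]
    rw [e2, Finset.Nat.sum_antidiagonal_succ' (f := fun p => (p.2 : ℂ) • _),
      Finset.Nat.sum_antidiagonal_succ (f := fun p => (p.1 : ℂ) • _)]
    simp

lemma divPow_zero_der (i : ℕ) (hi : i ≠ 0) : divPow (0 : Derivation ℂ K K) i = 0 := by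
  simp [divPow, zero_pow hi]

lemma divPow_add {D D' : Derivation ℂ K K}
    (h : Commute (D : K →ₗ[ℂ] K) (D' : K →ₗ[ℂ] K)) (m : ℕ) :
    divPow (D + D') m = ∑ p ∈ antidiagonal m, divPow D p.1 * divPow D' p.2 := by
  have h' : ((D + D' : Derivation ℂ K K) : K →ₗ[ℂ] K) = (D : K →ₗ[ℂ] K) + D' := rfl
  rw [divPow, h', h.add_pow', Finset.smul_sum]
  refine Finset.sum_congr rfl fun p hp => ?_
  obtain ⟨i, j⟩ := p
  have hij : i + j = m := mem_antidiagonal.1 hp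
  subst hij
  simp only [divPow, smul_mul_smul_comm]
  rw [← Nat.cast_smul_eq_nsmul ℂ, smul_smul]
  congr 1
  have := Nat.add_choose_mul_factorial_mul_factorial i j
  have h1 : ((i + j).factorial : ℂ) ≠ 0 := by exact_mod_cast Nat.factorial_ne_zero _
  have h2 : (i.factorial : ℂ) ≠ 0 := by exact_mod_cast Nat.factorial_ne_zero _
  have h3 : (j.factorial : ℂ) ≠ 0 := by exact_mod_cast Nat.factorial_ne_zero _
  field_simp
  rw [Nat.choose_symm_add]
  exact_mod_cast this

lemma divPow_algebraMap (D : Derivation ℂ K K) (i : ℕ) (hi : i ≠ 0) (c : ℂ) :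
    divPow D i (algebraMap ℂ K c) = 0 := by
  obtain ⟨j, rfl⟩ := Nat.exists_eq_succ_of_ne_zero hi
  simp [divPow, pow_succ, Module.End.mul_apply]

/-- The operator `exp(ℏ D) : f ↦ ∑ᵢ ℏⁱ Dⁱ f / i!` on `K⟦ℏ⟧`. -/
def expFun (D : Derivation ℂ K K) (f : K⟦X⟧) : K⟦X⟧ :=
  PowerSeries.mk fun m => ∑ p ∈ antidiagonal m, divPow D p.1 (PowerSeries.coeff p.2 f)

lemma expFun_mul (D : Derivation ℂ K K) (f g : K⟦X⟧) :
    expFun D (f * g) = expFun D f * expFun D g := by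
  ext m
  simp only [expFun, PowerSeries.coeff_mk, PowerSeries.coeff_mul, map_sum, divPow_mul,
    Finset.sum_mul, Finset.mul_sum, Finset.sum_sigma']
  refine Finset.sum_bij'
    (fun x _ => ⟨(x.2.2.1 + x.2.1.1, x.2.2.2 + x.2.1.2), (x.2.2.2, x.2.1.2), (x.2.2.1, x.2.1.1)⟩)
    (fun x _ => ⟨(x.2.2.1 + x.2.1.1, x.2.2.2 + x.2.1.2), (x.2.2.2, x.2.1.2), (x.2.2.1, x.2.1.1)⟩)
    ?_ ?_ ?_ ?_ ?_
  · rintro ⟨⟨a, b⟩, ⟨c, d⟩, ⟨e, k⟩⟩ hx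
    simp only [Finset.mem_sigma, mem_antidiagonal, and_true] at hx ⊢
    omega
  · rintro ⟨⟨a, b⟩, ⟨c, d⟩, ⟨e, k⟩⟩ hx
    simp only [Finset.mem_sigma, mem_antidiagonal, and_true] at hx ⊢
    omega
  · rintro ⟨⟨a, b⟩, ⟨c, d⟩, ⟨e, k⟩⟩ hx
    simp only [Finset.mem_sigma, mem_antidiagonal] at hx
    obtain ⟨-, rfl, rfl⟩ := hx
    rfl
  · rintro ⟨⟨a, b⟩, ⟨c, d⟩, ⟨e, k⟩⟩ hx
    simp only [Finset.mem_sigma, mem_antidiagonal] at hx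
    obtain ⟨-, rfl, rfl⟩ := hx
    rfl
  · rintro x -
    rfl

lemma expFun_algebraMap (D : Derivation ℂ K K) (c : ℂ⟦X⟧) :
    expFun D (algebraMap ℂ⟦X⟧ K⟦X⟧ c) = algebraMap ℂ⟦X⟧ K⟦X⟧ c := by
  ext m
  have hc : ∀ j, PowerSeries.coeff j (algebraMap ℂ⟦X⟧ K⟦X⟧ c)
      = algebraMap ℂ K (PowerSeries.coeff j c) := fun j => by
    rw [PowerSeries.algebraMap_apply'', PowerSeries.coeff_map]
  simp only [expFun, PowerSeries.coeff_mk, hc]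
  rw [Finset.sum_eq_single (0, m)]
  · simp [divPow_zero]
  · rintro ⟨i, j⟩ hij hne
    refine divPow_algebraMap D i ?_ _
    rintro rfl
    exact hne (by simpa using hij)
  · simp

/-- The automorphism `exp(ℏ D)` of `K⟦ℏ⟧` attached to a derivation `D` of `K`:
`f ↦ ∑ᵢ ℏⁱ Dⁱ f / i!`, with `D` acting on the coefficients of the powers of `ℏ`. -/
def expShift (D : Derivation ℂ K K) : K⟦X⟧ →ₐ[ℂ⟦X⟧] K⟦X⟧ where
  toFun := expFun D
  map_one' := by simpa using expFun_algebraMap D 1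
  map_zero' := by simpa using expFun_algebraMap D 0
  map_mul' := expFun_mul D
  map_add' f g := by
    ext m
    simp [expFun, Finset.sum_add_distrib]
  commutes' := expFun_algebraMap D

lemma coeff_expShift (D : Derivation ℂ K K) (f : K⟦X⟧) (m : ℕ) :
    PowerSeries.coeff m (expShift D f)
      = ∑ p ∈ antidiagonal m, divPow D p.1 (PowerSeries.coeff p.2 f) := by
  change PowerSeries.coeff m (expFun D f) = _
  rw [expFun, PowerSeries.coeff_mk]

lemma expShift_zero : expShift (0 : Derivation ℂ K K) = AlgHom.id ℂ⟦X⟧ K⟦X⟧ := by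
  ext f m
  rw [coeff_expShift, Finset.sum_eq_single (0, m)]
  · simp [divPow_zero]
  · rintro ⟨i, j⟩ hij hne
    have hi : i ≠ 0 := by
      rintro rfl
      exact hne (by simpa using hij)
    simp [divPow_zero_der i hi]
  · simp

lemma expShift_add {D D' : Derivation ℂ K K}
    (h : Commute (D : K →ₗ[ℂ] K) (D' : K →ₗ[ℂ] K)) :
    expShift (D + D') = (expShift D).comp (expShift D') := by
  ext f m
  simp only [AlgHom.comp_apply, coeff_expShift, divPow_add h, LinearMap.sum_apply, map_sum,
    Module.End.mul_apply, Finset.sum_sigma']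
  refine Finset.sum_bij'
    (fun x _ => ⟨(x.2.1, x.2.2 + x.1.2), (x.2.2, x.1.2)⟩)
    (fun x _ => ⟨(x.1.1 + x.2.1, x.2.2), (x.1.1, x.2.1)⟩) ?_ ?_ ?_ ?_ ?_
  · rintro ⟨⟨a, b⟩, ⟨c, d⟩⟩ hx
    simp only [Finset.mem_sigma, mem_antidiagonal, and_true] at hx ⊢
    omega
  · rintro ⟨⟨a, b⟩, ⟨c, d⟩⟩ hx
    simp only [Finset.mem_sigma, mem_antidiagonal, and_true] at hx ⊢
    omega
  · rintro ⟨⟨a, b⟩, ⟨c, d⟩⟩ hx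
    simp only [Finset.mem_sigma, mem_antidiagonal] at hx
    obtain ⟨-, rfl⟩ := hx
    rfl
  · rintro ⟨⟨a, b⟩, ⟨c, d⟩⟩ hx
    simp only [Finset.mem_sigma, mem_antidiagonal] at hx
    obtain ⟨-, rfl⟩ := hx
    rfl
  · rintro x -
    rfl

end ExpShift

set_option linter.unusedSectionVars false

section LocalizedDerivation
variable {A : Type*} [CommRing A] [Algebra ℂ A]
  (B : Type*) [CommRing B] [Algebra A B] [Algebra ℂ B] [IsScalarTower ℂ A B]

/-- The homomorphism `a ↦ a + D(a) ε` into the dual numbers over a localization. -/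
def dualHom (D : Derivation ℂ A A) :
    A →+* TrivSqZeroExt B B where
  toFun a := TrivSqZeroExt.inl (algebraMap A B a)
    + TrivSqZeroExt.inr (algebraMap A B (D a))
  map_one' := by
    refine TrivSqZeroExt.ext ?_ ?_ <;> simp
  map_zero' := by
    refine TrivSqZeroExt.ext ?_ ?_ <;> simp
  map_mul' a b := by
    refine TrivSqZeroExt.ext ?_ ?_
    · simp
    · simp only [TrivSqZeroExt.snd_add, TrivSqZeroExt.snd_inl, TrivSqZeroExt.snd_inr, zero_add,
        TrivSqZeroExt.snd_mul, TrivSqZeroExt.fst_add, TrivSqZeroExt.fst_inl,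
        TrivSqZeroExt.fst_inr, add_zero, D.leibniz, map_add, map_mul, smul_eq_mul,
        MulOpposite.smul_eq_mul_unop, MulOpposite.unop_op]
      ring
  map_add' a b := by
    refine TrivSqZeroExt.ext ?_ ?_
    · simp
    · simp only [TrivSqZeroExt.snd_add, TrivSqZeroExt.snd_inl, TrivSqZeroExt.snd_inr, zero_add,
        map_add]

lemma dualHom_isUnit (S : Submonoid A) [IsLocalization S B] (D : Derivation ℂ A A) (s : S) :
    IsUnit (dualHom B D s) := by
  rw [TrivSqZeroExt.isUnit_iff_isUnit_fst]
  simpa [dualHom] using IsLocalization.map_units B s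

/-- Extension of `dualHom` to the localization. -/
def dualLift (S : Submonoid A) [IsLocalization S B] (D : Derivation ℂ A A) :
    B →+* TrivSqZeroExt B B :=
  IsLocalization.lift (dualHom_isUnit B S D)

lemma dualLift_algebraMap (S : Submonoid A) [IsLocalization S B] (D : Derivation ℂ A A) (a : A) :
    dualLift B S D (algebraMap A _ a) = dualHom B D a :=
  IsLocalization.lift_eq _ _

lemma fst_dualLift (S : Submonoid A) [IsLocalization S B] (D : Derivation ℂ A A) (x : B) :
    (dualLift B S D x).fst = x := by
  have h : ((TrivSqZeroExt.fstHom B B B :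
      _ →+* B).comp (dualLift B S D)) = RingHom.id _ := by
    refine IsLocalization.ringHom_ext S ?_
    ext a
    simp [dualLift_algebraMap, dualHom]
  exact congrArg (fun f => f x) h

/-- The extension of a derivation `D` of `A` to the localization `S⁻¹A` (quotient rule). -/
def locDer (S : Submonoid A) [IsLocalization S B] (D : Derivation ℂ A A) :
    Derivation ℂ B B :=
  Derivation.mk'
    { toFun := fun x => (dualLift B S D x).snd
      map_add' := fun x y => by simp
      map_smul' := fun c x => by
        rw [Algebra.smul_def, IsScalarTower.algebraMap_apply ℂ A B, map_mul,
          dualLift_algebraMap]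
        simp [dualHom, fst_dualLift, Algebra.smul_def,
          IsScalarTower.algebraMap_apply ℂ A B] }
    (fun x y => by
      simp [fst_dualLift, mul_comm])

lemma locDer_algebraMap (S : Submonoid A) [IsLocalization S B] (D : Derivation ℂ A A) (a : A) :
    locDer B S D (algebraMap A _ a) = algebraMap A _ (D a) := by
  change (dualLift B S D (algebraMap A _ a)).snd = _
  rw [dualLift_algebraMap]
  change (TrivSqZeroExt.inl _ + TrivSqZeroExt.inr _ :
    TrivSqZeroExt B B).snd = _
  rw [TrivSqZeroExt.snd_add, TrivSqZeroExt.snd_inl, TrivSqZeroExt.snd_inr, zero_add]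

lemma locDer_ext (S : Submonoid A) [IsLocalization S B] {D D' : Derivation ℂ B B}
    (h : ∀ a, D (algebraMap A _ a) = D' (algebraMap A _ a)) : D = D' := by
  ext x
  obtain ⟨a, s, rfl⟩ := IsLocalization.exists_mk'_eq S x
  have hu := IsLocalization.map_units B s
  refine hu.mul_left_cancel ?_
  have key : ∀ E : Derivation ℂ B B,
      algebraMap A B s * E (IsLocalization.mk' _ a s)
        = E (algebraMap A _ a)
          - IsLocalization.mk' B a s * E (algebraMap A _ (s : A)) := by
    intro E
    conv_rhs => rw [← IsLocalization.mk'_spec' B a s]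
    rw [E.leibniz]
    simp
  rw [key, key, h, h]

lemma locDer_commute (S : Submonoid A) [IsLocalization S B] {D D' : Derivation ℂ A A}
    (h : ∀ a, D (D' a) = D' (D a)) (x : B) :
    locDer B S D (locDer B S D' x) = locDer B S D' (locDer B S D x) := by
  have e : ⁅locDer B S D, locDer B S D'⁆ = 0 := by
    refine locDer_ext B S fun a => ?_
    simp [Derivation.commutator_apply, locDer_algebraMap, h]
  have := congrArg (fun E => E x) e
  simpa [Derivation.commutator_apply, sub_eq_zero] using this

end LocalizedDerivation

/-! ### Functions of the dynamical and of the spectral parameter -/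

/-- `𝔸ₙ = ℂ((λ₁, …, λₙ))`, the field of fractions of `ℂ⟦λ₁, …, λₙ⟧`. -/
def LambdaField (n : ℕ) : Type := FractionRing (MvPowerSeries (Fin n) ℂ)

instance (n : ℕ) : Field (LambdaField n) :=
  inferInstanceAs (Field (FractionRing (MvPowerSeries (Fin n) ℂ)))

instance (n : ℕ) : Algebra (MvPowerSeries (Fin n) ℂ) (LambdaField n) :=
  inferInstanceAs (Algebra _ (FractionRing (MvPowerSeries (Fin n) ℂ)))

instance (n : ℕ) : IsFractionRing (MvPowerSeries (Fin n) ℂ) (LambdaField n) :=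
  inferInstanceAs (IsFractionRing _ (FractionRing (MvPowerSeries (Fin n) ℂ)))

instance (n : ℕ) : Algebra ℂ (LambdaField n) :=
  inferInstanceAs (Algebra ℂ (FractionRing (MvPowerSeries (Fin n) ℂ)))

instance (n : ℕ) : IsScalarTower ℂ (MvPowerSeries (Fin n) ℂ) (LambdaField n) :=
  inferInstanceAs (IsScalarTower ℂ _ (FractionRing (MvPowerSeries (Fin n) ℂ)))

/-- The partial derivative `∂/∂λₖ` on `𝔸ₙ`. -/
def dLambda {n : ℕ} (k : Fin n) : Derivation ℂ (LambdaField n) (LambdaField n) :=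
  locDer _ (nonZeroDivisors (MvPowerSeries (Fin n) ℂ)) (MvPowerSeries.pderiv ℂ k)

lemma dLambda_commute {n : ℕ} (k l : Fin n) (x : LambdaField n) :
    dLambda k (dLambda l x) = dLambda l (dLambda k x) := by
  refine locDer_commute _ _ (fun a => ?_) x
  ext d
  simp only [MvPowerSeries.coeff_pderiv, add_right_comm d, Finsupp.add_apply]
  rcases eq_or_ne k l with rfl | h
  · rfl
  · simp [h, h.symm]
    ring

/-- The directional derivative `∑ₖ μₖ ∂/∂λₖ` on `𝔸ₙ`. -/
def dLambdaDir {n : ℕ} (μ : Fin n → ℤ) : Derivation ℂ (LambdaField n) (LambdaField n) :=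
  ∑ k, μ k • dLambda k

lemma dLambdaDir_zero {n : ℕ} : dLambdaDir (0 : Fin n → ℤ) = 0 := by simp [dLambdaDir]

lemma dLambdaDir_add {n : ℕ} (μ ν : Fin n → ℤ) :
    dLambdaDir (μ + ν) = dLambdaDir μ + dLambdaDir ν := by
  simp [dLambdaDir, add_smul, Finset.sum_add_distrib]

lemma dLambdaDir_apply {n : ℕ} (μ : Fin n → ℤ) (x : LambdaField n) :
    dLambdaDir μ x = ∑ k, μ k • dLambda k x := by
  change (Derivation.coeFnAddMonoidHom (∑ k, μ k • dLambda k)) x = _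
  rw [map_sum, Finset.sum_apply]
  rfl

lemma dLambdaDir_commute {n : ℕ} (μ ν : Fin n → ℤ) :
    Commute (dLambdaDir μ : LambdaField n →ₗ[ℂ] LambdaField n) (dLambdaDir ν) := by
  refine LinearMap.ext fun x => ?_
  change dLambdaDir μ (dLambdaDir ν x) = dLambdaDir ν (dLambdaDir μ x)
  simp only [dLambdaDir_apply, map_sum, map_zsmul, Finset.smul_sum]
  rw [Finset.sum_comm]
  refine Finset.sum_congr rfl fun k _ => Finset.sum_congr rfl fun l _ => ?_
  rw [dLambda_commute, smul_comm]

section Spectral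
open TopologicalSpace

open Classical in
/-- Extension by zero of a function on an open subset of `ℂ`. -/
def extendZero {U : Opens ℂ} (f : U → ℂ) (z : ℂ) : ℂ := if h : z ∈ U then f ⟨z, h⟩ else 0

lemma extendZero_coe {U : Opens ℂ} (f : U → ℂ) (u : U) : extendZero f u = f u := by
  simp [extendZero]

lemma extendZero_add {U : Opens ℂ} (f g : U → ℂ) :
    extendZero (f + g) = extendZero f + extendZero g := by
  funext z
  by_cases h : z ∈ U <;> simp [extendZero, h]

lemma extendZero_mul {U : Opens ℂ} (f g : U → ℂ) :
    extendZero (f * g) = extendZero f * extendZero g := by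
  funext z
  by_cases h : z ∈ U <;> simp [extendZero, h]

lemma extendZero_eqOn {U : Opens ℂ} {f : U → ℂ} {F : ℂ → ℂ} (h : ∀ u : U, f u = F u) :
    Set.EqOn (extendZero f) F U := fun z hz => by
  rw [← h ⟨z, hz⟩, ← extendZero_coe f ⟨z, hz⟩]

/-- The algebra of holomorphic functions on an open set `U ⊆ ℂ`. -/
def Hol (U : Opens ℂ) : Subalgebra ℂ (U → ℂ) where
  carrier := {f | DifferentiableOn ℂ (extendZero f) U}
  mul_mem' {f g} hf hg := by
    rw [Set.mem_ofPred_eq, extendZero_mul]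
    exact DifferentiableOn.mul hf hg
  add_mem' {f g} hf hg := by
    rw [Set.mem_ofPred_eq, extendZero_add]
    exact DifferentiableOn.add hf hg
  algebraMap_mem' c :=
    (differentiableOn_const c).congr (extendZero_eqOn (F := fun _ => c) fun _ => rfl)

lemma Hol_differentiableAt {U : Opens ℂ} (f : Hol U) (u : U) :
    DifferentiableAt ℂ (extendZero f.1) u :=
  DifferentiableOn.differentiableAt f.2 (U.isOpen.mem_nhds u.2)

/-- The complex derivative `d/du` on holomorphic functions on `U`. -/
def holDeriv (U : Opens ℂ) : Derivation ℂ (Hol U) (Hol U) :=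
  Derivation.mk'
    { toFun := fun f => ⟨fun u => deriv (extendZero f.1) u,
        ((DifferentiableOn.analyticOnNhd f.2 U.isOpen).deriv.differentiableOn).congr
          (extendZero_eqOn fun _ => rfl)⟩
      map_add' := fun f g => by
        refine Subtype.ext (funext fun u => ?_)
        change deriv (extendZero (f.1 + g.1)) u = deriv _ _ + deriv _ _
        rw [extendZero_add, deriv_add (Hol_differentiableAt f u) (Hol_differentiableAt g u)]
      map_smul' := fun c f => by
        refine Subtype.ext (funext fun u => ?_)
        change deriv (extendZero (c • f.1)) u = c • deriv _ _
        have : extendZero (c • f.1) = c • extendZero f.1 := by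
          funext z
          by_cases h : z ∈ U <;> simp [extendZero, h]
        rw [this, deriv_const_smul _ (Hol_differentiableAt f u)] }
    (fun f g => by
      refine Subtype.ext (funext fun u => ?_)
      change deriv (extendZero (f.1 * g.1)) u = f.1 u * deriv _ _ + g.1 u * deriv _ _
      rw [extendZero_mul, deriv_mul (Hol_differentiableAt f u) (Hol_differentiableAt g u),
        extendZero_coe, extendZero_coe]
      ring)

/-- A derivation acting on the coefficients of formal power series. -/
def coeffDer {σ A : Type*} [CommRing A] [Algebra ℂ A] (D : Derivation ℂ A A) :
    Derivation ℂ (MvPowerSeries σ A) (MvPowerSeries σ A) :=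
  Derivation.mk'
    { toFun := fun f d => D (MvPowerSeries.coeff d f)
      map_add' := fun f g => by
        ext d
        change D (MvPowerSeries.coeff d (f + g)) = D _ + D _
        rw [map_add, map_add]
      map_smul' := fun c f => by
        ext d
        change D (MvPowerSeries.coeff d (c • f)) = c • D _
        rw [← D.map_smul]
        rfl }
    (fun f g => by
      classical
      ext d
      change D (MvPowerSeries.coeff d (f * g)) = MvPowerSeries.coeff d (f * _ + g * _)
      rw [map_add, mul_comm g, MvPowerSeries.coeff_mul, MvPowerSeries.coeff_mul,
        MvPowerSeries.coeff_mul, map_sum, ← Finset.sum_add_distrib]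
      refine Finset.sum_congr rfl fun p _ => ?_
      rw [D.leibniz, smul_eq_mul, smul_eq_mul, mul_comm (MvPowerSeries.coeff p.2 g)]
      rfl)

/-- Evaluation of holomorphic functions at a point `u ∈ U`. -/
def evalHol {U : Opens ℂ} (u : U) : Hol U →ₐ[ℂ] ℂ :=
  (Pi.evalAlgHom ℂ (fun _ : U => ℂ) u).comp (Hol U).val

/-- Power series in `λ` with coefficients holomorphic in `u ∈ U`, that do not vanish identically
in `λ` for any `u ∈ U`. -/
def denominators (U : Opens ℂ) (n : ℕ) : Submonoid (MvPowerSeries (Fin n) (Hol U)) where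
  carrier := {q | ∀ u : U, MvPowerSeries.map (evalHol u : Hol U →+* ℂ) q ≠ 0}
  one_mem' u := by simp
  mul_mem' {p q} hp hq u := by
    rw [map_mul]
    exact mul_ne_zero (hp u) (hq u)

/-- Functions of the spectral parameter `u` and of the dynamical parameters `λ`: fractions of
formal power series in `λ` with coefficients holomorphic in `u ∈ U`, with denominators that are
nonzero for every `u ∈ U`. -/
def SpectralFun (U : Opens ℂ) (n : ℕ) : Type := Localization (denominators U n)

instance (U : Opens ℂ) (n : ℕ) : CommRing (SpectralFun U n) :=
  inferInstanceAs (CommRing (Localization (denominators U n)))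

instance (U : Opens ℂ) (n : ℕ) : Algebra (MvPowerSeries (Fin n) (Hol U)) (SpectralFun U n) :=
  inferInstanceAs (Algebra _ (Localization (denominators U n)))

instance (U : Opens ℂ) (n : ℕ) : IsLocalization (denominators U n) (SpectralFun U n) :=
  inferInstanceAs (IsLocalization _ (Localization (denominators U n)))

instance (U : Opens ℂ) (n : ℕ) : Algebra ℂ (SpectralFun U n) :=
  inferInstanceAs (Algebra ℂ (Localization (denominators U n)))

instance (U : Opens ℂ) (n : ℕ) :
    IsScalarTower ℂ (MvPowerSeries (Fin n) (Hol U)) (SpectralFun U n) :=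
  inferInstanceAs (IsScalarTower ℂ _ (Localization (denominators U n)))

/-- The derivative `∂/∂u` on functions of `(u, λ)`. -/
def dSpectral (U : Opens ℂ) (n : ℕ) : Derivation ℂ (SpectralFun U n) (SpectralFun U n) :=
  locDer _ (denominators U n) (coeffDer (holDeriv U))

/-- The value `F(u; λ) ∈ 𝔸ₙ` of a function `F` of `(u, λ)` at a point `u ∈ U`. -/
def evalSpectral {U : Opens ℂ} (n : ℕ) (u : U) : SpectralFun U n →ₐ[ℂ] LambdaField n :=
  IsLocalization.liftAlgHom (M := denominators U n)
    (f := (IsScalarTower.toAlgHom ℂ (MvPowerSeries (Fin n) ℂ) (LambdaField n)).comp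
      (MvPowerSeries.mapAlgHom (evalHol u)))
    (fun q => by
      refine isUnit_iff_ne_zero.2 fun h => q.2 u ?_
      exact IsFractionRing.injective (MvPowerSeries (Fin n) ℂ) (LambdaField n)
        (h.trans (map_zero _).symm))

/-- Application of an algebra homomorphism to the coefficients of power series in `ℏ`. -/
def mapHbar {K K' : Type*} [CommRing K] [CommRing K'] [Algebra ℂ K] [Algebra ℂ K']
    (φ : K →ₐ[ℂ] K') : K⟦X⟧ →ₐ[ℂ⟦X⟧] K'⟦X⟧ where
  __ := PowerSeries.map (φ : K →+* K')
  commutes' c := by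
    ext m
    change PowerSeries.coeff m (PowerSeries.map (φ : K →+* K') _) = _
    simp [PowerSeries.algebraMap_apply'']

/-- The Taylor expansion `F ↦ F(u + cℏ; λ) = ∑ⱼ (cℏ)ʲ (∂ʲF/∂uʲ)(u; λ) / j!`. -/
def evalShifted {U : Opens ℂ} (n : ℕ) (u : U) (c : ℂ) :
    (SpectralFun U n)⟦X⟧ →ₐ[ℂ⟦X⟧] (LambdaField n)⟦X⟧ :=
  (mapHbar (evalSpectral n u)).comp (expShift (c • dSpectral U n))

end Spectral

/-! ### Completed tensor products -/

section Completion
variable (T : Type*) [Ring T] [Algebra ℂ⟦X⟧ T]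

/-- The two-sided ideal `ℏᴺ T` of a `ℂ⟦ℏ⟧`-algebra `T`. -/
def hbarIdeal (N : ℕ) : Ideal T :=
  Ideal.span {algebraMap ℂ⟦X⟧ T ((PowerSeries.X : ℂ⟦X⟧) ^ N)}

variable {T} in
lemma mem_hbarIdeal {N : ℕ} {x : T} :
    x ∈ hbarIdeal T N ↔ ∃ a : T, ((PowerSeries.X : ℂ⟦X⟧) ^ N) • a = x := by
  simp only [hbarIdeal, Ideal.mem_span_singleton', Algebra.smul_def, Algebra.commutes]

instance (N : ℕ) : (hbarIdeal T N).IsTwoSided where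
  mul_mem_of_left b h := by
    obtain ⟨a, rfl⟩ := mem_hbarIdeal.1 h
    exact mem_hbarIdeal.2 ⟨a * b, by rw [smul_mul_assoc]⟩

lemma hbarIdeal_anti {M N : ℕ} (h : M ≤ N) : hbarIdeal T N ≤ hbarIdeal T M := fun x hx => by
  obtain ⟨a, rfl⟩ := mem_hbarIdeal.1 hx
  refine mem_hbarIdeal.2 ⟨(PowerSeries.X : ℂ⟦X⟧) ^ (N - M) • a, ?_⟩
  rw [smul_smul, ← pow_add, Nat.add_sub_cancel' h]

/-- Compatible families in `∏ T / ℏᴺ T`. -/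
def hbarFamilies : Subring (∀ N, T ⧸ hbarIdeal T N) where
  carrier := {f | ∀ (M N : ℕ) (h : M ≤ N), Ideal.Quotient.factor (hbarIdeal_anti T h) (f N) = f M}
  one_mem' _ _ _ := map_one _
  zero_mem' _ _ _ := map_zero _
  mul_mem' hf hg M N h := by simp [hf M N h, hg M N h]
  add_mem' hf hg M N h := by simp [hf M N h, hg M N h]
  neg_mem' hf M N h := by simp [hf M N h]

/-- The `ℏ`-adic completion `lim T / ℏᴺ T` of a `ℂ⟦ℏ⟧`-algebra `T`. -/
abbrev HbarCompletion : Type _ := hbarFamilies T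

variable {T}

/-- The canonical homomorphism `T → lim T / ℏᴺ T`. -/
def toHbar : T →+* HbarCompletion T where
  toFun x := ⟨fun N => Ideal.Quotient.mk (hbarIdeal T N) x, fun _ _ _ => rfl⟩
  map_one' := rfl
  map_zero' := rfl
  map_mul' _ _ := rfl
  map_add' _ _ := rfl

/-- The sum of an `ℏ`-adically convergent series `∑ a_d` with `a_d ∈ ℏᵈ T`. -/
def hbarSum (a : ℕ → T) (ha : ∀ d, a d ∈ hbarIdeal T d) : HbarCompletion T :=
  ⟨fun N => Ideal.Quotient.mk (hbarIdeal T N) (∑ d ∈ Finset.range N, a d), fun M N h => by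
    rw [Ideal.Quotient.factor_mk, Ideal.Quotient.eq, ← Finset.sum_Ico_eq_sub _ h]
    exact Ideal.sum_mem _ fun d hd => hbarIdeal_anti T (Finset.mem_Ico.1 hd).1 (ha d)⟩

variable {T' : Type*} [Ring T'] [Algebra ℂ⟦X⟧ T'] {T'' : Type*} [Ring T''] [Algebra ℂ⟦X⟧ T'']

lemma hbarIdeal_le_comap (φ : T →ₐ[ℂ⟦X⟧] T') (N : ℕ) :
    hbarIdeal T N ≤ (hbarIdeal T' N).comap (φ : T →+* T') := fun x hx => by
  obtain ⟨a, rfl⟩ := mem_hbarIdeal.1 hx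
  exact mem_hbarIdeal.2 ⟨φ a, (map_smul φ _ _).symm⟩

/-- The extension of a `ℂ⟦ℏ⟧`-algebra homomorphism to the completions. -/
def hbarMap (φ : T →ₐ[ℂ⟦X⟧] T') : HbarCompletion T →+* HbarCompletion T' where
  toFun f := ⟨fun N => Ideal.quotientMap (hbarIdeal T' N) (φ : T →+* T')
      (hbarIdeal_le_comap φ N) (f.1 N), fun M N h => by
    change Ideal.Quotient.factor _ (Ideal.quotientMap _ _ _ (f.1 N))
      = Ideal.quotientMap _ _ _ (f.1 M)
    rw [← f.2 M N h]
    obtain ⟨x, hx⟩ := Ideal.Quotient.mk_surjective (f.1 N)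
    rw [← hx]
    rfl⟩
  map_one' := Subtype.ext (funext fun _ => map_one _)
  map_zero' := Subtype.ext (funext fun _ => map_zero _)
  map_mul' _ _ := Subtype.ext (funext fun _ => map_mul _ _ _)
  map_add' _ _ := Subtype.ext (funext fun _ => map_add _ _ _)

lemma hbarMap_id : hbarMap (AlgHom.id ℂ⟦X⟧ T) = RingHom.id _ := by
  refine RingHom.ext fun f => Subtype.ext (funext fun N => ?_)
  obtain ⟨x, hx⟩ := Ideal.Quotient.mk_surjective (f.1 N)
  change Ideal.quotientMap _ _ _ (f.1 N) = f.1 N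
  rw [← hx]
  rfl

lemma hbarMap_comp (ψ : T' →ₐ[ℂ⟦X⟧] T'') (φ : T →ₐ[ℂ⟦X⟧] T') :
    hbarMap (ψ.comp φ) = (hbarMap ψ).comp (hbarMap φ) := by
  refine RingHom.ext fun f => Subtype.ext (funext fun N => ?_)
  obtain ⟨x, hx⟩ := Ideal.Quotient.mk_surjective (f.1 N)
  change Ideal.quotientMap _ _ _ (f.1 N)
    = Ideal.quotientMap _ _ _ (Ideal.quotientMap _ _ _ (f.1 N))
  rw [← hx]
  rfl

end Completion

section CompletedTensor
variable (K : Type*) [CommRing K] [Algebra ℂ K] (R : Type*) [Ring R] [Algebra ℂ⟦X⟧ R]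

/-- The `ℏ`-adically completed tensor product of a commutative `ℂ`-algebra `K` of functions with a
`ℂ⟦ℏ⟧`-algebra `R`, that is `lim K ⊗_ℂ (R / ℏᴺ R)`: functions with values in `R`. -/
def CompletedTensor : Type _ := HbarCompletion (K⟦X⟧ ⊗[ℂ⟦X⟧] R)

instance : Ring (CompletedTensor K R) := inferInstanceAs (Ring (HbarCompletion _))

variable {K R}

/-- Scalar functions (power series in `ℏ` over `K`) as functions with values in `R`. -/
def ofFun : K⟦X⟧ →+* CompletedTensor K R :=
  toHbar.comp (Algebra.TensorProduct.includeLeft : K⟦X⟧ →ₐ[ℂ⟦X⟧] K⟦X⟧ ⊗[ℂ⟦X⟧] R).toRingHom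

/-- Elements of `R` as constant functions. -/
def ofAlg : R →+* CompletedTensor K R :=
  toHbar.comp (Algebra.TensorProduct.includeRight : R →ₐ[ℂ⟦X⟧] K⟦X⟧ ⊗[ℂ⟦X⟧] R).toRingHom

/-- A homomorphism of functions, applied to functions with values in `R`. -/
def tensorMap {K' : Type*} [CommRing K'] [Algebra ℂ K'] (φ : K⟦X⟧ →ₐ[ℂ⟦X⟧] K'⟦X⟧) :
    CompletedTensor K R →+* CompletedTensor K' R :=
  hbarMap (Algebra.TensorProduct.map φ (AlgHom.id ℂ⟦X⟧ R))

variable {n : ℕ}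

/-- The translation `F(λ) ↦ F(λ + ℏμ) = ∑ᵢ ℏⁱ (∑ₖ μₖ ∂/∂λₖ)ⁱ F / i!` for `μ ∈ ℤⁿ`. -/
def translate (μ : Fin n → ℤ) :
    CompletedTensor (LambdaField n) R →+* CompletedTensor (LambdaField n) R :=
  tensorMap (expShift (dLambdaDir μ))

lemma translate_zero : translate (R := R) (0 : Fin n → ℤ) = RingHom.id _ := by
  rw [translate, dLambdaDir_zero, expShift_zero, tensorMap, Algebra.TensorProduct.map_id]
  exact hbarMap_id

lemma translate_add (μ ν : Fin n → ℤ) :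
    translate (R := R) (μ + ν) = (translate μ).comp (translate ν) := by
  rw [translate, dLambdaDir_add, expShift_add (dLambdaDir_commute μ ν), tensorMap]
  refine Eq.trans ?_ (hbarMap_comp _ _)
  rw [← Algebra.TensorProduct.map_comp, AlgHom.id_comp]

/-- `ℤⁿ` acts on functions of `λ` with values in `R` by translations. -/
instance : MulSemiringAction (Multiplicative (Fin n → ℤ))
    (CompletedTensor (LambdaField n) R) where
  smul μ F := translate μ.toAdd F
  one_smul F := congrArg (fun f => f F) translate_zero
  mul_smul μ ν F := congrArg (fun f => f F) (translate_add μ.toAdd ν.toAdd)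
  smul_zero μ := map_zero (translate μ.toAdd)
  smul_add μ := map_add (translate μ.toAdd)
  smul_one μ := map_one (translate μ.toAdd)
  smul_mul μ := map_mul (translate μ.toAdd)

/-- `F(λ + ℏh) = ∑_α (1/α!) (∂^α F/∂λ^α) (ℏh₁)^α₁ ⋯ (ℏhₙ)^αₙ` for a scalar function `F` and
(commuting) elements `h₁, …, hₙ` of `R`. -/
def cartanShift (h : Fin n → R) (F : (LambdaField n)⟦X⟧) : CompletedTensor (LambdaField n) R :=
  hbarSum
    (fun d => ∑ α ∈ Finset.piAntidiag Finset.univ d,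
      (PowerSeries.mk fun m =>
          (List.ofFn fun k => divPow (dLambda k) (α k)).prod (PowerSeries.coeff m F))
        ⊗ₜ[ℂ⟦X⟧] ((PowerSeries.X : ℂ⟦X⟧) ^ d • (List.ofFn fun k => h k ^ α k).prod))
    (fun _ => Ideal.sum_mem _ fun _ _ => mem_hbarIdeal.2 ⟨_, (TensorProduct.tmul_smul _ _ _).symm⟩)

end CompletedTensor

/-! ### The theta function and the Felder `R`-matrix -/

/-- The (non-normalized) odd theta function
`e^{πiu} ∑ₖ e^{2πik(u + (1+τ)/2) + πik²τ} = e^{-πiτ/4} ∑ₖ (-1)ᵏ e^{2πi(k+1/2)u + πi(k+1/2)²τ}`. -/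
def thetaOne (τ u : ℂ) : ℂ :=
  Complex.exp (Real.pi * Complex.I * u) * jacobiTheta₂ (u + (1 + τ) / 2) τ

/-- The odd theta function, normalized by `θ'(0) = 1`. -/
def theta (τ u : ℂ) : ℂ := thetaOne τ u / deriv (thetaOne τ) 0

/-- The Taylor series `∑ⱼ θ⁽ʲ⁾(u) xʲ / j!` of `θ(u + x)`. -/
def thetaSeries (τ u : ℂ) : ℂ⟦X⟧ :=
  PowerSeries.mk fun j => iteratedDeriv j (theta τ) u / (j.factorial : ℂ)

/-- `θ(u + λᵢ - λⱼ)` as an element of `𝔸ₙ`. -/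
def thetaLambda {n : ℕ} (τ u : ℂ) (i j : Fin n) : LambdaField n :=
  algebraMap (MvPowerSeries (Fin n) ℂ) (LambdaField n)
    (PowerSeries.subst (MvPowerSeries.X i - MvPowerSeries.X j : MvPowerSeries (Fin n) ℂ)
      (thetaSeries τ u))

/-- The Felder dynamical `R`-matrix `R(u; λ)`, expanded in powers of `ℏ`, for `θ(u) ≠ 0`:
`θ(u+ℏ)/θ(u) ∑ᵢ Eᵢᵢ ⊗ Eᵢᵢ
  + ∑_{i≠j} (θ(λᵢⱼ+ℏ)/θ(λᵢⱼ) Eᵢᵢ ⊗ Eⱼⱼ + θ(u-λᵢⱼ)θ(ℏ)/(θ(u)θ(-λᵢⱼ)) Eᵢⱼ ⊗ Eⱼᵢ)`. -/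
def felderR (n : ℕ) (τ u : ℂ) : Matrix (Fin n × Fin n) (Fin n × Fin n) (LambdaField n)⟦X⟧ :=
  fun p q =>
    if p = q then
      if p.1 = p.2 then
        algebraMap ℂ⟦X⟧ _ (PowerSeries.C (theta τ u)⁻¹ * thetaSeries τ u)
      else
        PowerSeries.C (thetaLambda τ 0 p.1 p.2)⁻¹
          * expShift (dLambda p.1) (PowerSeries.C (thetaLambda τ 0 p.1 p.2))
    else if p = q.swap then
      PowerSeries.C (thetaLambda τ u p.2 p.1
          * (algebraMap ℂ _ (theta τ u) * thetaLambda τ 0 p.2 p.1)⁻¹)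
        * algebraMap ℂ⟦X⟧ _ (thetaSeries τ 0)
    else 0

/-! ### Dynamical elliptic `L`-operators -/

section LOperator
open TopologicalSpace
variable {n : ℕ} {R : Type*} [Ring R] [Algebra ℂ⟦X⟧ R]

/-- The matrix `L⁽¹⁾` on `ℂⁿ ⊗ ℂⁿ`. -/
def leg₁ {B : Type*} [Zero B] (M : Matrix (Fin n) (Fin n) B) :
    Matrix (Fin n × Fin n) (Fin n × Fin n) B :=
  fun p q => if p.2 = q.2 then M p.1 q.1 else 0

/-- The matrix `L⁽²⁾` on `ℂⁿ ⊗ ℂⁿ`. -/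
def leg₂ {B : Type*} [Zero B] (M : Matrix (Fin n) (Fin n) B) :
    Matrix (Fin n × Fin n) (Fin n × Fin n) B :=
  fun p q => if p.1 = q.1 then M p.2 q.2 else 0

/-- The matrix `L⁽¹⁾(λ + ℏE⁽²⁾)`: since the `Eₖₖ` are orthogonal idempotents with sum `1`,
it is `∑ₖ L(λ + ℏeₖ) ⊗ Eₖₖ`. -/
def leg₁Shift (M : Matrix (Fin n) (Fin n) (CompletedTensor (LambdaField n) R)) :
    Matrix (Fin n × Fin n) (Fin n × Fin n) (CompletedTensor (LambdaField n) R) :=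
  fun p q => if p.2 = q.2 then translate (Pi.single p.2 1) (M p.1 q.1) else 0

/-- The matrix `L⁽²⁾(λ + ℏE⁽¹⁾) = ∑ₖ Eₖₖ ⊗ L(λ + ℏeₖ)`. -/
def leg₂Shift (M : Matrix (Fin n) (Fin n) (CompletedTensor (LambdaField n) R)) :
    Matrix (Fin n × Fin n) (Fin n × Fin n) (CompletedTensor (LambdaField n) R) :=
  fun p q => if p.1 = q.1 then translate (Pi.single p.1 1) (M p.2 q.2) else 0

/-- The value `L(u + cℏ; λ)` of a matrix of functions of `(u, λ)` with values in `R`. -/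
def evalL {U : Opens ℂ} (L : Matrix (Fin n) (Fin n) (CompletedTensor (SpectralFun U n) R))
    (u : U) (c : ℂ) : Matrix (Fin n) (Fin n) (CompletedTensor (LambdaField n) R) :=
  L.map (tensorMap (evalShifted n u c))

/-- `L(u; λ)` is a dynamical elliptic `L`-operator over `R`, regular for `u ∈ U`, with Cartan
elements `h₁, …, hₙ`. -/
structure IsDynamicalLOperator (τ : ℂ) {U : Opens ℂ}
    (L : Matrix (Fin n) (Fin n) (CompletedTensor (SpectralFun U n) R)) (h : Fin n → R) :
    Prop where
  cartan_commute : ∀ i j, Commute (h i) (h j)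
  invertible : ∀ u : U, IsUnit (evalL L u 0)
  rll : ∀ u v : U, theta τ (u - v) ≠ 0 →
    (felderR n τ (u - v)).map ofFun * leg₁Shift (evalL L u 0) * leg₂ (evalL L v 0)
      = leg₂Shift (evalL L v 0) * leg₁ (evalL L u 0)
          * (felderR n τ (u - v)).map (cartanShift h)
  weight : ∀ (u : U) (i : Fin n),
    (Matrix.single i i 1 + Matrix.scalar (Fin n) (ofAlg (h i))) * evalL L u 0
      = evalL L u 0 * (Matrix.single i i 1 + Matrix.scalar (Fin n) (ofAlg (h i)))

/-! ### The commuting families -/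

variable (n R) in
/-- The algebra `𝔄ₙ = 𝔸ₙ[e^{±ℏ∂_λ}] ⊗ R`: finite sums `∑_μ F_μ(λ) e^{ℏμ∂_λ}` over `μ ∈ ℤⁿ`, where
`e^{ℏμ∂_λ} F(λ) = F(λ + ℏμ) e^{ℏμ∂_λ}`. -/
abbrev ShiftAlgebra : Type _ :=
  SkewMonoidAlgebra (CompletedTensor (LambdaField n) R) (Multiplicative (Fin n → ℤ))

/-- A function of `λ` as an element of `𝔄ₙ`. -/
def ofFunction (F : CompletedTensor (LambdaField n) R) : ShiftAlgebra n R :=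
  SkewMonoidAlgebra.single 1 F

/-- The shift operator `e^{ℏμ∂_λ} = exp(ℏ ∑ₖ μₖ ∂/∂λₖ)`. -/
def shiftOp (μ : Fin n → ℤ) : ShiftAlgebra n R :=
  SkewMonoidAlgebra.single (Multiplicative.ofAdd μ) 1

/-- An element of `R` as an element of `𝔄ₙ`. -/
def ofR (x : R) : ShiftAlgebra n R := ofFunction (ofAlg x)

/-- A complex number as an element of `𝔄ₙ`. -/
def ofComplex (z : ℂ) : ShiftAlgebra n R := ofFunction (ofFun (algebraMap ℂ _ z))

/-- The subalgebra `𝔥` (without unit) of `R` generated by the Cartan elements. -/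
def cartanSubalgebra (h : Fin n → R) : NonUnitalSubalgebra ℂ⟦X⟧ R :=
  NonUnitalAlgebra.adjoin ℂ⟦X⟧ (Set.range h)

/-- The left ideal `𝔄ₙ𝔥` of `𝔄ₙ`. -/
def cartanIdeal (h : Fin n → R) : Ideal (ShiftAlgebra n R) :=
  Ideal.span (ofR '' (cartanSubalgebra h : Set R))

/-- `𝔑ₙ = {x ∈ 𝔄ₙ ∣ 𝔥x ⊆ 𝔄ₙ𝔥}`. -/
def cartanNormalizer (h : Fin n → R) : Subring (ShiftAlgebra n R) where
  carrier := {x | ∀ y ∈ cartanSubalgebra h, ofR y * x ∈ cartanIdeal h}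
  one_mem' y hy := by
    rw [mul_one]
    exact Ideal.subset_span ⟨y, hy, rfl⟩
  zero_mem' y _ := by
    rw [mul_zero]
    exact zero_mem _
  add_mem' ha hb y hy := by
    rw [mul_add]
    exact add_mem (ha y hy) (hb y hy)
  neg_mem' ha y hy := by
    rw [mul_neg]
    exact neg_mem (ha y hy)
  mul_mem' {a b} ha hb y hy := by
    rw [← mul_assoc]
    have key : ∀ z ∈ cartanIdeal h, z * b ∈ cartanIdeal h := fun z hz => by
      refine Submodule.span_induction ?_ ?_ ?_ ?_ hz
      · rintro _ ⟨w, hw, rfl⟩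
        exact hb w hw
      · rw [zero_mul]
        exact zero_mem _
      · intro x y _ _ hx hy
        rw [add_mul]
        exact add_mem hx hy
      · intro c x _ hx
        rw [smul_eq_mul, mul_assoc]
        exact Ideal.mul_mem_left _ c hx
    exact key _ (ha y hy)

/-- `L_D(u + cℏ) = e^{-ℏD̂_λ} L(u + cℏ; λ)`, where `D̂_λ = ∑ₖ Eₖₖ ∂/∂λₖ`. -/
def shiftedL {U : Opens ℂ} (L : Matrix (Fin n) (Fin n) (CompletedTensor (SpectralFun U n) R))
    (u : U) (c : ℂ) : Matrix (Fin n) (Fin n) (ShiftAlgebra n R) :=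
  Matrix.diagonal (fun k => shiftOp (-Pi.single k 1)) * (evalL L u c).map ofFunction

/-- The matrix `M⁽ⁱ⁾` on `(ℂⁿ)^{⊗m}`: `M` acting in the `i`-th tensor factor. -/
def leg {B : Type*} [Zero B] {m : ℕ} (i : Fin m) (M : Matrix (Fin n) (Fin n) B) :
    Matrix (Fin m → Fin n) (Fin m → Fin n) B :=
  fun a b => if ∀ j, j ≠ i → a j = b j then M (a i) (b i) else 0

/-- `𝕃^{[0,m]}(u; λ) = L_D⁽¹⁾(u) L_D⁽²⁾(u + ℏ) ⋯ L_D⁽ᵐ⁾(u + (m - 1)ℏ)`. -/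
def fusedL {U : Opens ℂ} (L : Matrix (Fin n) (Fin n) (CompletedTensor (SpectralFun U n) R))
    (m : ℕ) (u : U) : Matrix (Fin m → Fin n) (Fin m → Fin n) (ShiftAlgebra n R) :=
  (List.ofFn fun i : Fin m => leg i (shiftedL L u (i : ℕ))).prod

/-- The matrix of `π(σ)`, where `π(σ)(v₁ ⊗ ⋯ ⊗ vₘ) = v_{σ⁻¹(1)} ⊗ ⋯ ⊗ v_{σ⁻¹(m)}`. -/
def permMatrix (n : ℕ) {m : ℕ} (σ : Equiv.Perm (Fin m)) :
    Matrix (Fin m → Fin n) (Fin m → Fin n) ℂ :=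
  fun a b => if a = b ∘ ⇑σ⁻¹ then 1 else 0

/-- The antisymmetrizer `A_m = (1/m!) ∑_σ (-1)^σ π(σ)` on `(ℂⁿ)^{⊗m}`. -/
def antisymmetrizer (n m : ℕ) : Matrix (Fin m → Fin n) (Fin m → Fin n) ℂ :=
  (m.factorial : ℂ)⁻¹ • ∑ σ : Equiv.Perm (Fin m), ((Equiv.Perm.sign σ : ℤ) : ℂ) • permMatrix n σ

/-- `t_m(u) = tr(A^{[0,m]} 𝕃^{[0,m]}(u; λ))`, the trace over all `m` factors `ℂⁿ`. -/
def transfer {U : Opens ℂ} (L : Matrix (Fin n) (Fin n) (CompletedTensor (SpectralFun U n) R))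
    (m : ℕ) (u : U) : ShiftAlgebra n R :=
  ((antisymmetrizer n m).map ofComplex * fusedL L m u).trace

end LOperator

end DynamicalElliptic

end

open DynamicalElliptic PowerSeries

/-! Statements 1 and 2 are weight bookkeeping. The antisymmetrizer preserves the weight of the basis
vectors of (ℂⁿ)^{⊗m}, and an entry of 𝕃 between two basis vectors of equal weight commutes with
every hₖ. So t_m(u) commutes with the hₖ, and such an element normalizes the left ideal.

For statement 3, move all shift operators to the left. Then t_m(u) t_s(v) becomes a sum over weights
μ of e^{-ℏμ∂} times a trace, over the basis vectors of weight μ, of A·W (`transfer_mul_transfer`).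
Here A is the product of the antisymmetrizers of the two blocks of factors. The matrix W
(`wordMatrix`) is the product of the L⁽ⁱ⁾, each with λ shifted by the weight of the later factors.
It remains to compare, modulo the left ideal J of the hₖ, the traces for the words UV and VU, where
U = L(u), L(u+ℏ), … and V is the same at v. A product G of exchange operators (`braidOp`) satisfies
G(λ) W_{UV} = W_{VU} G(λ+ℏh). Since F(λ+ℏh) - F(λ) lies in J (`cartanHom_sub_ofFun`) and the shifted
factor stands on the right, it may be replaced by its unshifted form modulo J; cyclicity of the
trace then applies, because scalar functions are central.

The antisymmetrizers are handled by three facts, with A' belonging to VU. First, A W A = A W,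
because L(u) and L(u+ℏ) are fused (`IsDynamicalLOperator.fused`). Second, A' G A = A' G, a
consequence of the scalar identities `LeftFusion` and `RightFusion`. Third, A G⁻¹ A' = A G⁻¹, which
follows from the second by linear algebra (`corner_inverse`). No Yang–Baxter equation for R is used.
The scalar identities are instances of the three-term relation of θ, which is a Plücker relation for
2×2 determinants built from theta series of 2τ. It is carried from numbers to formal series by ring
homomorphisms and jointly injective families of evaluations.

Two difficulties remain, because R is arbitrary and may have ℏ-torsion. The exchange relation at u -
v = -ℏ yields fusion only after multiplication by θ(ℏ), which is ℏ times a unit. So u is varied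
first and the relation is divided by u - u₀ before u is specialized to u₀ - ℏ (`fused_of_exchange`).
Moreover G is invertible only where θ(u - v) ≠ 0. So the comparison of traces is made over the ring
of all functions on the generic points, and membership in the left ideal is pulled back along a
ℂ-linear left inverse (`spectral_blockTrace_sub`). Both devices rest on the isomorphism of K⟦ℏ⟧ ⊗ R
modulo ℏᴺ with K ⊗_ℂ (R/ℏᴺR), which lets ℂ-linear maps of functions act on functions with values in
R. -/

noncomputable section
namespace DynamicalElliptic
open Matrix PowerSeries

/-! ### Exchange operators on tensor powers -/

/-- An action of `ℤⁿ` on a ring by translations. -/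
structure Translations (n : ℕ) (S : Type*) [Ring S] where
  map : (Fin n → ℤ) → S →+* S
  map_zero : map 0 = RingHom.id S
  map_add : ∀ μ ν, map (μ + ν) = (map μ).comp (map ν)

/-- The weight of a basis vector of `ℂⁿ`. -/
abbrev unitWeight {n : ℕ} (a : Fin n) : Fin n → ℤ := Pi.single a 1

/-- The total weight of the tensor factors behind the `k`-th one. -/
def weightAbove {n N : ℕ} (k : ℕ) (b : Fin N → Fin n) : Fin n → ℤ :=
  ∑ j : Fin N, if k < j then unitWeight (b j) else 0

/-- The total weight of a basis vector of `(ℂⁿ)^{⊗N}`. -/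
def weight {n N : ℕ} (b : Fin N → Fin n) : Fin n → ℤ := ∑ j, unitWeight (b j)

/-- The transposition of the positions `i` and `i + 1`. -/
def adjSwap (N i : ℕ) : Equiv.Perm (Fin N) :=
  if h : i + 1 < N then Equiv.swap ⟨i, by omega⟩ ⟨i + 1, h⟩ else 1

lemma adjSwap_symm (N i : ℕ) (k : Fin N) : adjSwap N i (adjSwap N i k) = k := by
  unfold adjSwap
  split_ifs <;> simp

lemma adjSwap_apply_of_ne {N i : ℕ} {k : Fin N} (h₁ : (k : ℕ) ≠ i) (h₂ : (k : ℕ) ≠ i + 1) :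
    adjSwap N i k = k := by
  unfold adjSwap
  split_ifs
  · exact Equiv.swap_apply_of_ne_of_ne (fun h => h₁ (by simp [h])) (fun h => h₂ (by simp [h]))
  · rfl

lemma adjSwap_left {N i : ℕ} (h : i + 1 < N) :
    adjSwap N i ⟨i, by omega⟩ = ⟨i + 1, h⟩ := by simp [adjSwap, h]

lemma adjSwap_right {N i : ℕ} (h : i + 1 < N) :
    adjSwap N i ⟨i + 1, h⟩ = ⟨i, by omega⟩ := by simp [adjSwap, h]

/-- The threshold `k` separates `i` from `i + 1` only when `k = i`, the one value that the
hypothesis excludes. -/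
lemma lt_adjSwap_iff {N i k : ℕ} (h : k < i ∨ i + 1 ≤ k) (j : Fin N) :
    k < (adjSwap N i j : ℕ) ↔ k < (j : ℕ) := by
  by_cases hN : i + 1 < N
  · by_cases h1 : (j : ℕ) = i
    · have : j = ⟨i, by omega⟩ := Fin.ext h1
      rw [this, adjSwap_left hN]
      simp only
      omega
    · by_cases h2 : (j : ℕ) = i + 1
      · have : j = ⟨i + 1, hN⟩ := Fin.ext h2
        rw [this, adjSwap_right hN]
        simp only
        omega
      · rw [adjSwap_apply_of_ne h1 h2]
  · simp [adjSwap, hN]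

variable {n N : ℕ}

lemma weightAbove_adjSwap {i k : ℕ} (h : k < i ∨ i + 1 ≤ k) (b : Fin N → Fin n) :
    weightAbove k (b ∘ adjSwap N i) = weightAbove k b := by
  unfold weightAbove
  rw [← Equiv.sum_comp (adjSwap N i) fun j => if k < (j : ℕ) then unitWeight (b j) else 0]
  refine Finset.sum_congr rfl fun j _ => ?_
  simp only [lt_adjSwap_iff h, Function.comp]

lemma weight_comp (b : Fin N → Fin n) (σ : Equiv.Perm (Fin N)) :
    weight (b ∘ σ) = weight b :=
  Equiv.sum_comp σ fun j => unitWeight (b j)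

lemma weightAbove_eq_add {k : ℕ} (h : k + 1 < N) (b : Fin N → Fin n) :
    weightAbove k b = unitWeight (b ⟨k + 1, h⟩) + weightAbove (k + 1) b := by
  have : unitWeight (b ⟨k + 1, h⟩)
      = ∑ j : Fin N, if j = ⟨k + 1, h⟩ then unitWeight (b j) else 0 := by simp
  rw [this, weightAbove, weightAbove, ← Finset.sum_add_distrib]
  refine Finset.sum_congr rfl fun j _ => ?_
  simp only [Fin.ext_iff]
  rcases lt_trichotomy (j : ℕ) (k + 1) with h' | h' | h'
  · rw [if_neg (by omega), if_neg (by omega), if_neg (by omega), add_zero]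
  · rw [if_pos (by omega), if_pos (by omega), if_neg (by omega), add_zero]
  · rw [if_pos (by omega), if_neg (by omega), if_pos (by omega), zero_add]

variable {S : Type*} [CommRing S] (sh : Translations n S)

/-- The value of a two-index coefficient at the positions `i`, `i + 1`, shifted by the weight of
the factors behind. -/
def localCoeff (i : ℕ) (α : Fin n → Fin n → S) (b : Fin N → Fin n) : S :=
  if h : i + 1 < N then sh.map (weightAbove (i + 1) b) (α (b ⟨i, by omega⟩) (b ⟨i + 1, h⟩)) else 0

lemma localCoeff_of_lt {i : ℕ} (h : i + 1 < N) (α : Fin n → Fin n → S) (b : Fin N → Fin n) :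
    localCoeff sh i α b
      = sh.map (weightAbove (i + 1) b) (α (b ⟨i, by omega⟩) (b ⟨i + 1, h⟩)) := dif_pos h

/-- The two swapped positions are either both behind the pair `i`, `i + 1` or both in front of it.
So neither the two indices nor the total weight behind them changes. -/
lemma localCoeff_comp_adjSwap {i j : ℕ} (h : i + 1 < j ∨ j + 1 < i) (α : Fin n → Fin n → S)
    (b : Fin N → Fin n) : localCoeff sh i α (b ∘ adjSwap N j) = localCoeff sh i α b := by
  unfold localCoeff
  split_ifs with hN
  · rw [weightAbove_adjSwap (by omega)]
    simp only [Function.comp]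
    rw [adjSwap_apply_of_ne (by simp; omega) (by simp; omega),
      adjSwap_apply_of_ne (by simp; omega) (by simp; omega)]
  · rfl

/-- The operator on `(ℂⁿ)^{⊗N}` that acts in the factors `i`, `i + 1` by
`e_a ⊗ e_b ↦ α_{ab} e_b ⊗ e_a + β_{ab} e_a ⊗ e_b`, with the dynamical shift by the weight of the
factors behind. -/
def exchangeOp (N i : ℕ) (α β : Fin n → Fin n → S) :
    Matrix (Fin N → Fin n) (Fin N → Fin n) S :=
  if i + 1 < N then
    Matrix.of fun a b => (if a = b ∘ adjSwap N i then localCoeff sh i α b else 0)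
      + (if a = b then localCoeff sh i β b else 0)
  else 1

/-- The permutation of the factors `i` and `i + 1`. -/
def flipOp (S : Type*) [CommRing S] (n N i : ℕ) : Matrix (Fin N → Fin n) (Fin N → Fin n) S :=
  Matrix.of fun a b => if a = b ∘ adjSwap N i then 1 else 0

lemma exchangeOp_mulVec_single {i : ℕ} (h : i + 1 < N) (α β : Fin n → Fin n → S)
    (b : Fin N → Fin n) :
    exchangeOp sh N i α β *ᵥ Pi.single b 1
      = localCoeff sh i α b • Pi.single (b ∘ adjSwap N i) 1
        + localCoeff sh i β b • Pi.single b 1 := by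
  rw [mulVec_single_one]
  ext a
  simp [exchangeOp, h, Matrix.col, Pi.single_apply]

lemma flipOp_mulVec_single (i : ℕ) (b : Fin N → Fin n) :
    flipOp S n N i *ᵥ Pi.single b 1 = Pi.single (b ∘ adjSwap N i) 1 := by
  rw [mulVec_single_one]
  ext a
  simp [flipOp, Matrix.col, Pi.single_apply]

lemma comp_adjSwap_adjSwap (i : ℕ) (b : Fin N → Fin n) :
    (b ∘ adjSwap N i) ∘ adjSwap N i = b :=
  funext fun k => congrArg b (adjSwap_symm N i k)

lemma flipOp_mul_self (i : ℕ) : flipOp S n N i * flipOp S n N i = 1 := by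
  refine ext_of_mulVec_single fun b => ?_
  rw [← mulVec_mulVec, flipOp_mulVec_single, flipOp_mulVec_single, one_mulVec,
    comp_adjSwap_adjSwap]

lemma comp_adjSwap_comm {i j : ℕ} (h : i + 1 < j) (b : Fin N → Fin n) :
    (b ∘ adjSwap N i) ∘ adjSwap N j = (b ∘ adjSwap N j) ∘ adjSwap N i := by
  funext k
  simp only [Function.comp]
  congr 1
  by_cases hi : (k : ℕ) = i ∨ (k : ℕ) = i + 1
  · rw [adjSwap_apply_of_ne (i := j) (by omega) (by omega)]
    have : (adjSwap N i k : ℕ) ≤ i + 1 := by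
      have := lt_adjSwap_iff (N := N) (i := i) (k := i + 1) (by omega) k
      omega
    rw [adjSwap_apply_of_ne (i := j) (by omega) (by omega)]
  · rw [adjSwap_apply_of_ne (i := i) (k := k) (by omega) (by omega)]
    rw [adjSwap_apply_of_ne (i := i)]
    all_goals
      have h1 := lt_adjSwap_iff (N := N) (i := j) (k := i) (by omega) k
      have h2 := lt_adjSwap_iff (N := N) (i := j) (k := i + 1) (by omega) k
      have h3 : i = 0 ∨ (i - 1 < (adjSwap N j k : ℕ) ↔ i - 1 < (k : ℕ)) :=
        or_iff_not_imp_left.2 fun _ =>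
          lt_adjSwap_iff (N := N) (i := j) (k := i - 1) (by omega) k
      omega

/-- The dynamical shift of the front operator sees the back pair only through its total weight,
which an exchange does not alter. So the coefficients commute past each other as in the
non-dynamical case. -/
lemma exchangeOp_commute {i j : ℕ} (h : i + 1 < j) (α β γ δ : Fin n → Fin n → S) :
    Commute (exchangeOp sh N i α β) (exchangeOp sh N j γ δ) := by
  by_cases hj : j + 1 < N
  · have hi : i + 1 < N := by omega
    refine ext_of_mulVec_single fun b => ?_
    simp only [← mulVec_mulVec, exchangeOp_mulVec_single sh hi, exchangeOp_mulVec_single sh hj,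
      mulVec_add, mulVec_smul, localCoeff_comp_adjSwap sh (Or.inl h),
      localCoeff_comp_adjSwap sh (Or.inr h), comp_adjSwap_comm h, smul_add, smul_smul]
    simp only [mul_comm]
    abel
  · rw [exchangeOp, exchangeOp, if_neg hj]
    exact Commute.one_right _

/-- A bare permutation is an exchange operator with constant coefficients. This makes the general
commutation and entry formulas available for `flipOp`. -/
lemma flipOp_eq_exchangeOp {i : ℕ} (h : i + 1 < N) :
    flipOp S n N i = exchangeOp sh N i (fun _ _ => 1) (fun _ _ => 0) := by
  refine ext_of_mulVec_single fun b => ?_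
  rw [exchangeOp_mulVec_single sh h, flipOp_mulVec_single, localCoeff_of_lt sh h,
    localCoeff_of_lt sh h]
  simp

lemma flipOp_commute {i j : ℕ} (h : i + 1 < j ∨ j + 1 < i) (hi : i + 1 < N)
    (γ δ : Fin n → Fin n → S) : Commute (flipOp S n N i) (exchangeOp sh N j γ δ) := by
  rw [flipOp_eq_exchangeOp sh hi]
  rcases h with h | h
  · exact exchangeOp_commute sh h _ _ _ _
  · exact (exchangeOp_commute sh h _ _ _ _).symm

end DynamicalElliptic
end

/-! ### Fusion identities: pairs of exchange operators on symmetric tensors -/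

noncomputable section
namespace DynamicalElliptic
open Matrix PowerSeries

variable {n N : ℕ} {S : Type*} [CommRing S] (sh : Translations n S)

/-- The scalar identities behind `(1 - P₂₃) Ř₁₂ Ř'₂₃ (1 + P₁₂) = 0`. -/
structure LeftFusion (α β α' β' : Fin n → Fin n → S) : Prop where
  perm : ∀ a b c, c ≠ a → c ≠ b →
    α' b c * sh.map (unitWeight b) (α a c) = α' a c * sh.map (unitWeight a) (α b c)
  mixed : ∀ a b c, c ≠ a → c ≠ b →
    α' b c * sh.map (unitWeight b) (β a c)
      = β' b c * sh.map (unitWeight c) (β a b) + β' a c * sh.map (unitWeight c) (α b a)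
  double : ∀ a b, a ≠ b →
    α' b a * sh.map (unitWeight b) (α a a) + α' b a * sh.map (unitWeight b) (β a a)
      = α' a a * sh.map (unitWeight a) (α b a) + β' b a * sh.map (unitWeight a) (β a b)
        + β' a a * sh.map (unitWeight a) (α b a)

/-- The scalar identities behind `(1 - P₁₂) Ř'₂₃ Ř₁₂ (1 + P₂₃) = 0`. -/
structure RightFusion (α β α' β' : Fin n → Fin n → S) : Prop where
  perm : ∀ a b c, a ≠ b → a ≠ c →
    sh.map (unitWeight c) (α a b) * α' a c = sh.map (unitWeight b) (α a c) * α' a b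
  mixed : ∀ a b c, a ≠ b → a ≠ c →
    sh.map (unitWeight c) (α a b) * β' a c
      = sh.map (unitWeight c) (β a b) * β' b c + sh.map (unitWeight b) (β a c) * α' c b
  double : ∀ a c, a ≠ c →
    sh.map (unitWeight c) (α a a) * α' a c + sh.map (unitWeight c) (β a a) * α' a c
        + sh.map (unitWeight a) (β a c) * β' c a
      = sh.map (unitWeight a) (α a c) * α' a a + sh.map (unitWeight a) (α a c) * β' a a

/-- With the weight of the factor `i + 2` split off, the operators at `i` and at `i + 1` carry the
same outer shift. That shift is a ring homomorphism and can be applied to a whole scalar identity.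
-/
lemma localCoeff_eq_shift {i : ℕ} (h : i + 2 < N) (α : Fin n → Fin n → S) (b : Fin N → Fin n) :
    localCoeff sh i α b = sh.map (weightAbove (i + 2) b)
      (sh.map (unitWeight (b ⟨i + 2, h⟩)) (α (b ⟨i, by omega⟩) (b ⟨i + 1, by omega⟩))) := by
  rw [localCoeff_of_lt sh (by omega), weightAbove_eq_add (k := i + 1) h, add_comm, sh.map_add]
  rfl

lemma comp_adjSwap_apply₀ {i : ℕ} (h : i + 1 < N) (b : Fin N → Fin n) :
    (b ∘ adjSwap N i) ⟨i, by omega⟩ = b ⟨i + 1, h⟩ := by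
  simp [adjSwap_left h]

lemma comp_adjSwap_apply₁ {i : ℕ} (h : i + 1 < N) (b : Fin N → Fin n) :
    (b ∘ adjSwap N i) ⟨i + 1, h⟩ = b ⟨i, by omega⟩ := by
  simp [adjSwap_right h]

lemma comp_adjSwap_apply_of_ne {i k : ℕ} (hk : k < N) (h₁ : k ≠ i) (h₂ : k ≠ i + 1)
    (b : Fin N → Fin n) : (b ∘ adjSwap N i) ⟨k, hk⟩ = b ⟨k, hk⟩ := by
  simp only [Function.comp]
  rw [adjSwap_apply_of_ne h₁ h₂]

lemma comp_adjSwap_eq_self {i : ℕ} (h : i + 1 < N) (b : Fin N → Fin n)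
    (hb : b ⟨i, by omega⟩ = b ⟨i + 1, h⟩) : b ∘ adjSwap N i = b := by
  funext k
  by_cases h1 : (k : ℕ) = i
  · have : k = ⟨i, by omega⟩ := Fin.ext h1
    rw [this, comp_adjSwap_apply₀ h, hb]
  · by_cases h2 : (k : ℕ) = i + 1
    · have : k = ⟨i + 1, h⟩ := Fin.ext h2
      rw [this, comp_adjSwap_apply₁ h, hb]
    · exact comp_adjSwap_apply_of_ne k.2 h1 h2 b

lemma comp_adjSwap_braid {i : ℕ} (h : i + 2 < N) (b : Fin N → Fin n) :
    ((b ∘ adjSwap N i) ∘ adjSwap N (i + 1)) ∘ adjSwap N i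
      = ((b ∘ adjSwap N (i + 1)) ∘ adjSwap N i) ∘ adjSwap N (i + 1) := by
  have h0 : i + 1 < N := by omega
  funext k
  by_cases k0 : (k : ℕ) = i
  · have : k = ⟨i, by omega⟩ := Fin.ext k0
    rw [this, comp_adjSwap_apply₀ h0, comp_adjSwap_apply₀ h,
      comp_adjSwap_apply_of_ne (i := i) (k := i + 2) h (by omega) (by omega),
      comp_adjSwap_apply_of_ne (i := i + 1) (k := i) _ (by omega) (by omega),
      comp_adjSwap_apply₀ h0, comp_adjSwap_apply₀ h]
  · by_cases k1 : (k : ℕ) = i + 1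
    · have : k = ⟨i + 1, by omega⟩ := Fin.ext k1
      rw [this, comp_adjSwap_apply₁ h0,
        comp_adjSwap_apply_of_ne (i := i + 1) (k := i) _ (by omega) (by omega),
        comp_adjSwap_apply₀ h0, comp_adjSwap_apply₀ h,
        comp_adjSwap_apply_of_ne (i := i) (k := i + 2) h (by omega) (by omega),
        comp_adjSwap_apply₁ h]
    · by_cases k2 : (k : ℕ) = i + 2
      · have : k = ⟨i + 2, h⟩ := Fin.ext k2
        rw [this, comp_adjSwap_apply_of_ne (i := i) (k := i + 2) h (by omega) (by omega),
          comp_adjSwap_apply₁ h, comp_adjSwap_apply₁ h0, comp_adjSwap_apply₁ h,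
          comp_adjSwap_apply₁ h0,
          comp_adjSwap_apply_of_ne (i := i + 1) (k := i) _ (by omega) (by omega)]
      · rw [comp_adjSwap_apply_of_ne k.2 k0 k1, comp_adjSwap_apply_of_ne k.2 k1 k2,
          comp_adjSwap_apply_of_ne k.2 k0 k1, comp_adjSwap_apply_of_ne k.2 k1 k2,
          comp_adjSwap_apply_of_ne k.2 k0 k1, comp_adjSwap_apply_of_ne k.2 k1 k2]

/-- The claim is that the product maps tensors symmetric in `i`, `i + 1` to tensors symmetric in `i
+ 1`, `i + 2`. Apply it to a basis vector with entries `a`, `d`, `c` in the three positions.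
Comparing coefficients at vectors exchanged by the last flip gives the identities of `LeftFusion`.
The cases are whether `c` coincides with `a` or `d`; a coincidence `a = d` alone needs no separate
case. -/
theorem LeftFusion.flip_mul {α β α' β' : Fin n → Fin n → S} (hf : LeftFusion sh α β α' β') {i : ℕ}
    (h : i + 2 < N) :
    (1 - flipOp S n N (i + 1)) * (exchangeOp sh N i α β * exchangeOp sh N (i + 1) α' β')
      * (1 + flipOp S n N i) = 0 := by
  have h0 : i + 1 < N := by omega
  refine ext_of_mulVec_single fun b => ?_
  set t : Fin N := ⟨i + 2, h⟩ with ht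
  obtain ⟨a, ha⟩ : ∃ a, a = b ⟨i, by omega⟩ := ⟨_, rfl⟩
  obtain ⟨d, hd⟩ : ∃ a, a = b ⟨i + 1, by omega⟩ := ⟨_, rfl⟩
  obtain ⟨c, hc⟩ : ∃ a, a = b ⟨i + 2, h⟩ := ⟨_, rfl⟩
  set ρ := weightAbove (i + 2) b with hρ
  have hρ1 : ∀ b : Fin N → Fin n, weightAbove (i + 2) (b ∘ adjSwap N i)
    = weightAbove (i + 2) b := fun b => weightAbove_adjSwap (by omega) b
  have hρ2 : ∀ b : Fin N → Fin n, weightAbove (i + 2) (b ∘ adjSwap N (i + 1))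
    = weightAbove (i + 2) b := fun b => weightAbove_adjSwap (by omega) b
  simp only [← mulVec_mulVec, add_mulVec, sub_mulVec, one_mulVec, mulVec_add,
    flipOp_mulVec_single, exchangeOp_mulVec_single sh h, exchangeOp_mulVec_single sh h0,
    mulVec_smul, localCoeff_eq_shift sh h, localCoeff_of_lt sh h, zero_mulVec,
    show i + 1 + 1 = i + 2 from rfl, hρ1, hρ2, ← hρ, comp_adjSwap_apply₀ h0,
    comp_adjSwap_apply₀ h, comp_adjSwap_apply₁ h0, comp_adjSwap_apply₁ h,
    comp_adjSwap_apply_of_ne (i := i) (k := i + 2) h (by omega) (by omega),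
    comp_adjSwap_apply_of_ne (i := i + 1) (show i < N by omega) (by omega) (by omega),
    comp_adjSwap_adjSwap, ← ha, ← hc, ← hd, comp_adjSwap_braid h]
  have e1 : ∀ x y : S, sh.map ρ x * sh.map ρ y = sh.map ρ (x * y) := fun x y =>
    (map_mul _ x y).symm
  simp only [smul_add, smul_smul, e1]
  by_cases hca : c = a
  · subst hca
    by_cases hcd : c = d
    · subst hcd
      have q1 : b ∘ adjSwap N i = b := comp_adjSwap_eq_self h0 b (by rw [← ha, ← hd])
      have q2 : b ∘ adjSwap N (i + 1) = b := comp_adjSwap_eq_self h b (by rw [← hc, ← hd])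
      simp only [q1, q2, sub_self, smul_zero, add_zero]
    · have q1 : (b ∘ adjSwap N i) ∘ adjSwap N (i + 1) = b ∘ adjSwap N i :=
        comp_adjSwap_eq_self h _ (by
          rw [comp_adjSwap_apply₁ h0,
            comp_adjSwap_apply_of_ne (i := i) (k := i + 2) h (by omega) (by omega), ← ha, ← hc])
      have q2 : (b ∘ adjSwap N (i + 1)) ∘ adjSwap N i = b ∘ adjSwap N (i + 1) :=
        comp_adjSwap_eq_self h0 _ (by
          rw [comp_adjSwap_apply₀ h,
            comp_adjSwap_apply_of_ne (i := i + 1) (k := i) (by omega) (by omega) (by omega),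
            ← ha, ← hc])
      have q3 := congrArg (sh.map ρ) (hf.double c d hcd)
      simp only [map_add] at q3
      simp only [q1, q2, comp_adjSwap_adjSwap]
      -- Each scalar identity is multiplied by the difference of two basis vectors that the flip at
      -- `i + 1` exchanges.
      linear_combination (norm := module) q3 • (Pi.single (b ∘ adjSwap N (i + 1)) 1 - Pi.single b 1)
  · by_cases hcd : c = d
    · subst hcd
      have q1 : b ∘ adjSwap N (i + 1) = b := comp_adjSwap_eq_self h b (by rw [← hc, ← hd])
      have q2 : ((b ∘ adjSwap N i) ∘ adjSwap N (i + 1)) ∘ adjSwap N i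
          = (b ∘ adjSwap N i) ∘ adjSwap N (i + 1) := by
        rw [comp_adjSwap_braid h, q1]
      rw [comp_adjSwap_braid h] at q2
      have q3 := congrArg (sh.map ρ) (hf.double c a hca)
      simp only [map_add] at q3
      simp only [q1]
      linear_combination (norm := module) q3 • (Pi.single ((b ∘ adjSwap N i) ∘ adjSwap N (i + 1)) 1
        - Pi.single (b ∘ adjSwap N i) 1)
    · have q1 := congrArg (sh.map ρ) (hf.perm a d c hca hcd)
      have q2 := congrArg (sh.map ρ) (hf.mixed a d c hca hcd)
      have q3 := congrArg (sh.map ρ) (hf.mixed d a c hcd hca)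
      simp only [map_add] at q2 q3
      linear_combination (norm := module) q1 • (Pi.single ((b ∘ adjSwap N (i + 1)) ∘ adjSwap N i) 1
        - Pi.single (((b ∘ adjSwap N (i + 1)) ∘ adjSwap N i) ∘ adjSwap N (i + 1)) 1)
        + q2 • (Pi.single (b ∘ adjSwap N (i + 1)) 1 - Pi.single b 1)
        + q3 • (Pi.single ((b ∘ adjSwap N i) ∘ adjSwap N (i + 1)) 1
          - Pi.single (b ∘ adjSwap N i) 1)

/-- The same comparison, with the entry `a` at position `i` as the distinguished one. Reversing the
order of the factors does not turn this into the previous statement, because the dynamical shift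
depends only on the factors behind. -/
theorem RightFusion.flip_mul {α β α' β' : Fin n → Fin n → S} (hf : RightFusion sh α β α' β') {i : ℕ}
    (h : i + 2 < N) :
    (1 - flipOp S n N i) * (exchangeOp sh N (i + 1) α' β' * exchangeOp sh N i α β)
      * (1 + flipOp S n N (i + 1)) = 0 := by
  have h0 : i + 1 < N := by omega
  refine ext_of_mulVec_single fun b => ?_
  set t : Fin N := ⟨i + 2, h⟩ with ht
  obtain ⟨a, ha⟩ : ∃ a, a = b ⟨i, by omega⟩ := ⟨_, rfl⟩
  obtain ⟨d, hd⟩ : ∃ a, a = b ⟨i + 1, by omega⟩ := ⟨_, rfl⟩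
  obtain ⟨c, hc⟩ : ∃ a, a = b ⟨i + 2, h⟩ := ⟨_, rfl⟩
  set ρ := weightAbove (i + 2) b with hρ
  have hρ1 : ∀ b : Fin N → Fin n, weightAbove (i + 2) (b ∘ adjSwap N i)
    = weightAbove (i + 2) b := fun b => weightAbove_adjSwap (by omega) b
  have hρ2 : ∀ b : Fin N → Fin n, weightAbove (i + 2) (b ∘ adjSwap N (i + 1))
    = weightAbove (i + 2) b := fun b => weightAbove_adjSwap (by omega) b
  simp only [← mulVec_mulVec, add_mulVec, sub_mulVec, one_mulVec, mulVec_add,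
    flipOp_mulVec_single, exchangeOp_mulVec_single sh h, exchangeOp_mulVec_single sh h0,
    mulVec_smul, localCoeff_eq_shift sh h, localCoeff_of_lt sh h, zero_mulVec,
    show i + 1 + 1 = i + 2 from rfl, hρ1, hρ2, ← hρ,
    comp_adjSwap_apply₀ h, comp_adjSwap_apply₁ h0, comp_adjSwap_apply₁ h,
    comp_adjSwap_apply_of_ne (i := i) (k := i + 2) h (by omega) (by omega),
    comp_adjSwap_apply_of_ne (i := i + 1) (show i < N by omega) (by omega) (by omega),
    comp_adjSwap_adjSwap, ← ha, ← hc, ← hd, comp_adjSwap_braid h]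
  have e1 : ∀ x y : S, sh.map ρ x * sh.map ρ y = sh.map ρ (x * y) := fun x y =>
    (map_mul _ x y).symm
  simp only [smul_add, smul_smul, e1]
  by_cases hda : d = a
  · subst hda
    have q1 : b ∘ adjSwap N i = b := comp_adjSwap_eq_self h0 b (by rw [← ha, ← hd])
    by_cases hcd : d = c
    · subst hcd
      have q2 : b ∘ adjSwap N (i + 1) = b := comp_adjSwap_eq_self h b (by rw [← hc, ← hd])
      simp only [q1, q2, sub_self, smul_zero, add_zero]
    · have q2 : ((b ∘ adjSwap N (i + 1)) ∘ adjSwap N i) ∘ adjSwap N (i + 1)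
          = (b ∘ adjSwap N (i + 1)) ∘ adjSwap N i := by
        rw [← comp_adjSwap_braid h, q1]
      have q3 := congrArg (sh.map ρ) (hf.double d c hcd)
      simp only [map_add] at q3
      simp only [q2, q1]
      linear_combination (norm := module) q3 • (Pi.single (b ∘ adjSwap N (i + 1)) 1
        - Pi.single ((b ∘ adjSwap N (i + 1)) ∘ adjSwap N i) 1)
  · by_cases hca : c = a
    · subst hca
      have q1 : (b ∘ adjSwap N i) ∘ adjSwap N (i + 1) = b ∘ adjSwap N i :=
        comp_adjSwap_eq_self h _ (by
          rw [comp_adjSwap_apply₁ h0,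
            comp_adjSwap_apply_of_ne (i := i) (k := i + 2) h (by omega) (by omega), ← ha, ← hc])
      have q2 : (b ∘ adjSwap N (i + 1)) ∘ adjSwap N i = b ∘ adjSwap N (i + 1) :=
        comp_adjSwap_eq_self h0 _ (by
          rw [comp_adjSwap_apply₀ h,
            comp_adjSwap_apply_of_ne (i := i + 1) (k := i) (by omega) (by omega) (by omega),
            ← ha, ← hc])
      have q3 := congrArg (sh.map ρ) (hf.double c d (Ne.symm hda))
      simp only [map_add] at q3
      simp only [q1, q2, comp_adjSwap_adjSwap]
      linear_combination (norm := module) q3 • (Pi.single b 1 - Pi.single (b ∘ adjSwap N i) 1)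
    · have q1 := congrArg (sh.map ρ) (hf.perm a d c (Ne.symm hda) (Ne.symm hca))
      have q2 := congrArg (sh.map ρ) (hf.mixed a d c (Ne.symm hda) (Ne.symm hca))
      have q3 := congrArg (sh.map ρ) (hf.mixed a c d (Ne.symm hca) (Ne.symm hda))
      simp only [map_add] at q2 q3
      linear_combination (norm := module) q1 • (Pi.single ((b ∘ adjSwap N i) ∘ adjSwap N (i + 1)) 1
        - Pi.single (((b ∘ adjSwap N (i + 1)) ∘ adjSwap N i) ∘ adjSwap N (i + 1)) 1)
        + q2 • (Pi.single (b ∘ adjSwap N i) 1 - Pi.single b 1)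
        + q3 • (Pi.single ((b ∘ adjSwap N (i + 1)) ∘ adjSwap N i) 1
          - Pi.single (b ∘ adjSwap N (i + 1)) 1)

end DynamicalElliptic
end

noncomputable section
namespace DynamicalElliptic
open Matrix PowerSeries

/-! ### Braid operators and symmetry inside a block -/

section Braid
variable {n N : ℕ} {S : Type*} [CommRing S] (sh : Translations n S)
  (α β : ℕ → ℕ → Fin n → Fin n → S)

/-- The product of exchange operators moving the factor at position `p + r` to position `p`. -/
def moveOp (N p : ℕ) : ℕ → Matrix (Fin N → Fin n) (Fin N → Fin n) S
  | 0 => 1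
  | r + 1 => moveOp N p r * exchangeOp sh N (p + r) (α r p) (β r p)

/-- The product of exchange operators moving the `p` factors behind the first `m` ones to the
front. -/
def braidOp (N m : ℕ) : ℕ → Matrix (Fin N → Fin n) (Fin N → Fin n) S
  | 0 => 1
  | p + 1 => moveOp sh α β N p m * braidOp N m p

lemma flipOp_commute_moveOp {j p r : ℕ} (hj : j + 1 < N) (h : p + r < j ∨ j + 1 < p) :
    Commute (flipOp S n N j) (moveOp sh α β N p r) := by
  induction r with
  | zero => exact Commute.one_right _
  | succ r ih => exact (ih (by omega)).mul_right (flipOp_commute sh (by omega) hj _ _)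

lemma exchangeOp_commute_moveOp {j p r : ℕ} (h : p + r < j) (γ δ : Fin n → Fin n → S) :
    Commute (exchangeOp sh N j γ δ) (moveOp sh α β N p r) := by
  induction r with
  | zero => exact Commute.one_right _
  | succ r ih => exact (ih (by omega)).mul_right (exchangeOp_commute sh (by omega) _ _ _ _).symm

lemma flipOp_commute_braidOp {j m p : ℕ} (hj : j + 1 < N) (h : m + p ≤ j) :
    Commute (flipOp S n N j) (braidOp sh α β N m p) := by
  induction p with
  | zero => exact Commute.one_right _
  | succ p ih =>
    exact (flipOp_commute_moveOp sh α β hj (by omega)).mul_right (ih (by omega))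

lemma one_sub_flipOp_mul_one_add (j : ℕ) :
    (1 - flipOp S n N j) * (1 + flipOp S n N j) = 0 := by
  rw [sub_mul, mul_add, mul_add, flipOp_mul_self]
  simp [add_comm]

/-- The values of `Y` are symmetric and `X` kills symmetric tensors. Writing 2 = (1 + P) + (1 - P)
between `X` and `Y` shows this, and 2 is invertible. -/
lemma mul_eq_zero_of_flip [Algebra ℂ S] {j : ℕ} {X Y : Matrix (Fin N → Fin n) (Fin N → Fin n) S}
    (hX : X * (1 + flipOp S n N j) = 0) (hY : (1 - flipOp S n N j) * Y = 0) : X * Y = 0 := by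
  have h : (2 : ℂ) • (X * Y)
      = X * (1 + flipOp S n N j) * Y + X * ((1 - flipOp S n N j) * Y) := by
    rw [two_smul]
    noncomm_ring
  rw [hX, hY, zero_mul, mul_zero, add_zero] at h
  exact (smul_eq_zero_iff_right (two_ne_zero (α := ℂ))).1 h

variable {α β}

/-- One factor passing in front of a block pushes the block one position back, so a symmetry at `p +
i` becomes one at `p + i + 1`. Only the two exchange operators at these positions matter. The
earlier ones in the product commute with the left flip and the later ones with the right flip. -/
lemma one_sub_flipOp_mul_moveOp
    (hf : ∀ r p, LeftFusion sh (α r p) (β r p) (α (r + 1) p) (β (r + 1) p)) {i p r : ℕ}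
    (hi : i + 1 < r) (hN : p + r < N) :
    (1 - flipOp S n N (p + i + 1)) * moveOp sh α β N p r * (1 + flipOp S n N (p + i)) = 0 := by
  induction r with
  | zero => omega
  | succ r ih =>
    rcases Nat.lt_or_ge (i + 1) r with h | h
    · have hc : Commute (1 + flipOp S n N (p + i)) (exchangeOp sh N (p + r) (α r p) (β r p)) :=
        (Commute.one_left _).add_left (flipOp_commute sh (by omega) (by omega) _ _)
      rw [moveOp, mul_assoc, mul_assoc, ← hc.eq, ← mul_assoc, ← mul_assoc, ih h (by omega),
        zero_mul]
    · obtain rfl : r = i + 1 := by omega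
      have hc : Commute (1 - flipOp S n N (p + i + 1)) (moveOp sh α β N p i) :=
        (Commute.one_left _).sub_left (flipOp_commute_moveOp sh α β (by omega) (by omega))
      have := (hf i p).flip_mul sh (N := N) (i := p + i) (by omega)
      rw [moveOp, moveOp, mul_assoc (moveOp _ _ _ _ _ _), ← mul_assoc (1 - _), hc.eq, mul_assoc,
        mul_assoc, ← mul_assoc (1 - _), ← add_assoc p i 1, this, mul_zero]

variable [Algebra ℂ S]

/-- Two neighbouring factors travel together to the front. Each step adds a pair of exchange
operators to which `RightFusion` applies, and `mul_eq_zero_of_flip` links the steps through the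
intermediate symmetry. -/
lemma one_sub_flipOp_mul_moveOp_mul_moveOp
    (hf : ∀ r p, RightFusion sh (α r p) (β r p) (α r (p + 1)) (β r (p + 1))) {p r : ℕ}
    (hN : p + 1 + r < N) :
    (1 - flipOp S n N p) * (moveOp sh α β N (p + 1) r * moveOp sh α β N p r)
      * (1 + flipOp S n N (p + r)) = 0 := by
  induction r with
  | zero =>
    simpa [moveOp] using one_sub_flipOp_mul_one_add (S := S) (n := n) (N := N) p
  | succ r ih =>
    have hc := exchangeOp_commute_moveOp sh α β (N := N) (j := p + 1 + r) (p := p) (r := r)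
      (by omega) (α r (p + 1)) (β r (p + 1))
    -- The operator at `p + 1 + r` can be moved to the right, since `moveOp` with indices `p`, `r`
    -- touches only the positions `p, …, p + r`.
    have e : moveOp sh α β N (p + 1) (r + 1) * moveOp sh α β N p (r + 1)
        = (moveOp sh α β N (p + 1) r * moveOp sh α β N p r)
          * (exchangeOp sh N (p + r + 1) (α r (p + 1)) (β r (p + 1))
            * exchangeOp sh N (p + r) (α r p) (β r p)) := by
      rw [moveOp, moveOp, show p + r + 1 = p + 1 + r by omega, mul_assoc,
        ← mul_assoc (exchangeOp _ _ _ _ _), hc.eq]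
      simp only [mul_assoc]
    rw [e, ← mul_assoc, mul_assoc]
    refine mul_eq_zero_of_flip (ih (by omega)) ?_
    rw [← mul_assoc]
    exact (hf r p).flip_mul sh (i := p + r) (by omega)

lemma one_sub_flipOp_mul_braidOp
    (hf : ∀ r p, LeftFusion sh (α r p) (β r p) (α (r + 1) p) (β (r + 1) p)) {i m p : ℕ}
    (hi : i + 1 < m) (hN : m + p ≤ N) :
    (1 - flipOp S n N (p + i)) * braidOp sh α β N m p * (1 + flipOp S n N i) = 0 := by
  induction p with
  | zero => simpa [braidOp] using one_sub_flipOp_mul_one_add (S := S) (n := n) (N := N) i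
  | succ p ih =>
    rw [braidOp, ← mul_assoc, mul_assoc]
    refine mul_eq_zero_of_flip (j := p + i) ?_ (by rw [← mul_assoc]; exact ih (by omega))
    rw [show p + 1 + i = p + i + 1 by omega]
    exact one_sub_flipOp_mul_moveOp sh hf hi (by omega)

/-- The factors `m + j` and `m + j + 1` are brought to the front by the moves numbered `j` and `j +
1`. The moves made after these commute with the flip at `j`, and those made before commute with the
flip at `m + j`. -/
lemma one_sub_flipOp_mul_braidOp'
    (hf : ∀ r p, RightFusion sh (α r p) (β r p) (α r (p + 1)) (β r (p + 1))) {j m p : ℕ}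
    (hj : j + 1 < p) (hN : m + p ≤ N) :
    (1 - flipOp S n N j) * braidOp sh α β N m p * (1 + flipOp S n N (m + j)) = 0 := by
  induction p with
  | zero => omega
  | succ p ih =>
    rcases Nat.lt_or_ge (j + 1) p with h | h
    · have hc : Commute (1 - flipOp S n N j) (moveOp sh α β N p m) :=
        (Commute.one_left _).sub_left (flipOp_commute_moveOp sh α β (by omega) (by omega))
      rw [braidOp, ← mul_assoc, hc.eq, mul_assoc, mul_assoc, ← mul_assoc (1 - _), ih h (by omega),
        mul_zero]
    · obtain rfl : p = j + 1 := by omega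
      have hc : Commute (1 + flipOp S n N (m + j)) (braidOp sh α β N m j) :=
        (Commute.one_left _).add_left (flipOp_commute_braidOp sh α β (by omega) le_rfl)
      have := one_sub_flipOp_mul_moveOp_mul_moveOp sh hf (N := N) (p := j) (r := m) (by omega)
      rw [braidOp, braidOp, ← mul_assoc (moveOp _ _ _ _ _ _), mul_assoc, mul_assoc, ← hc.eq,
        ← mul_assoc, ← mul_assoc, mul_assoc, add_comm m j] at *
      rw [← mul_assoc (1 - _), ← mul_assoc] at *
      rw [this, zero_mul]

end Braid

/-! ### Zero weight matrices -/

section ZeroWeight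
variable {n N : ℕ} {S : Type*} [CommRing S]

/-- Matrices on `(ℂⁿ)^{⊗N}` that preserve the weight. -/
def IsZeroWeight (M : Matrix (Fin N → Fin n) (Fin N → Fin n) S) : Prop :=
  ∀ a b, weight a ≠ weight b → M a b = 0

/-- Commutation with the projectors to the weight spaces is visibly stable under products and
inverses, while the entrywise definition is not visibly stable under inverses. -/
lemma isZeroWeight_iff {M : Matrix (Fin N → Fin n) (Fin N → Fin n) S} :
    IsZeroWeight M ↔ ∀ μ, Commute M (diagonal fun a => if weight a = μ then 1 else 0) := by
  constructor
  · intro h μ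
    ext a b
    rw [mul_diagonal, diagonal_mul]
    by_cases e : weight a = weight b
    · rw [e, mul_comm]
    · rw [h a b e]; simp
  · intro h a b e
    have := congrFun (congrFun (h (weight a)).eq a) b
    rw [mul_diagonal, diagonal_mul] at this
    simpa [Ne.symm e] using this.symm

lemma IsZeroWeight.mul {M M' : Matrix (Fin N → Fin n) (Fin N → Fin n) S} (h : IsZeroWeight M)
    (h' : IsZeroWeight M') : IsZeroWeight (M * M') :=
  isZeroWeight_iff.2 fun μ => (isZeroWeight_iff.1 h μ).mul_left (isZeroWeight_iff.1 h' μ)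

lemma isZeroWeight_one : IsZeroWeight (1 : Matrix (Fin N → Fin n) (Fin N → Fin n) S) :=
  isZeroWeight_iff.2 fun _ => Commute.one_left _

lemma IsZeroWeight.of_mul_eq_one {M M' : Matrix (Fin N → Fin n) (Fin N → Fin n) S}
    (h : IsZeroWeight M) (h₁ : M * M' = 1) (h₂ : M' * M = 1) : IsZeroWeight M' :=
  isZeroWeight_iff.2 fun μ => by
    have := (isZeroWeight_iff.1 h μ).eq
    have e : M' * (M * diagonal fun a => if weight a = μ then (1 : S) else 0) * M'
      = M' * ((diagonal fun a => if weight a = μ then (1 : S) else 0) * M) * M' := by rw [this]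
    rw [← mul_assoc, h₂, one_mul, mul_assoc, mul_assoc, h₁, mul_one] at e
    exact e.symm

lemma isZeroWeight_exchangeOp (sh : Translations n S) (i : ℕ) (α β : Fin n → Fin n → S) :
    IsZeroWeight (exchangeOp sh N i α β) := by
  intro a b hab
  unfold exchangeOp
  split_ifs
  · rw [of_apply, if_neg, if_neg, add_zero]
    · rintro rfl; exact hab rfl
    · rintro rfl; exact hab (weight_comp b _)
  · exact isZeroWeight_one a b hab

lemma isZeroWeight_moveOp (sh : Translations n S) (α β : ℕ → ℕ → Fin n → Fin n → S) (p r : ℕ) :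
    IsZeroWeight (moveOp sh α β N p r) := by
  induction r with
  | zero => exact isZeroWeight_one
  | succ r ih => exact ih.mul (isZeroWeight_exchangeOp sh _ _ _)

lemma isZeroWeight_braidOp (sh : Translations n S) (α β : ℕ → ℕ → Fin n → Fin n → S) (m p : ℕ) :
    IsZeroWeight (braidOp sh α β N m p) := by
  induction p with
  | zero => exact isZeroWeight_one
  | succ p ih => exact (isZeroWeight_moveOp sh α β _ _).mul ih

end ZeroWeight

/-! ### Antisymmetrizers in groups of tensor factors -/

section Antisymmetrizer
variable {n N : ℕ} (S : Type*) [CommRing S]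

/-- The matrix of the permutation `σ` of the tensor factors. -/
def permOp (n : ℕ) {N : ℕ} (σ : Equiv.Perm (Fin N)) :
    Matrix (Fin N → Fin n) (Fin N → Fin n) S :=
  Matrix.of fun a b => if a = b ∘ ⇑σ⁻¹ then 1 else 0

lemma permOp_mulVec_single (σ : Equiv.Perm (Fin N)) (b : Fin N → Fin n) :
    permOp S n σ *ᵥ Pi.single b 1 = Pi.single (b ∘ ⇑σ⁻¹) 1 := by
  rw [mulVec_single_one]
  ext a
  simp [permOp, Matrix.col, Pi.single_apply]

lemma permOp_mul (σ τ : Equiv.Perm (Fin N)) : permOp S n (σ * τ) = permOp S n σ * permOp S n τ := by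
  refine ext_of_mulVec_single fun b => ?_
  rw [← mulVec_mulVec, permOp_mulVec_single, permOp_mulVec_single, permOp_mulVec_single, _root_.mul_inv_rev]
  rfl

lemma permOp_one : permOp S n (1 : Equiv.Perm (Fin N)) = 1 := by
  refine ext_of_mulVec_single fun b => ?_
  rw [permOp_mulVec_single, one_mulVec, inv_one]
  rfl

lemma adjSwap_inv (N i : ℕ) : (adjSwap N i)⁻¹ = adjSwap N i := by
  rw [_root_.inv_eq_iff_mul_eq_one]
  exact Equiv.ext fun k => adjSwap_symm N i k

lemma flipOp_eq_permOp (i : ℕ) : flipOp S n N i = permOp S n (adjSwap N i) := by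
  rw [permOp, adjSwap_inv, flipOp]

lemma isZeroWeight_permOp (σ : Equiv.Perm (Fin N)) : IsZeroWeight (permOp S n σ) := by
  intro a b hab
  rw [permOp, of_apply, if_neg]
  rintro rfl
  exact hab (weight_comp b _)

variable {m : ℕ} (e : Fin m ↪ Fin N)

lemma permOp_viaEmbedding_mul (σ τ : Equiv.Perm (Fin m)) :
    permOp S n ((σ * τ).viaEmbedding e)
      = permOp S n (σ.viaEmbedding e) * permOp S n (τ.viaEmbedding e) := by
  rw [← permOp_mul]
  exact congrArg _ (map_mul (Equiv.Perm.viaEmbeddingHom e) σ τ)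

variable [Algebra ℂ S]

/-- The antisymmetrizer in the tensor factors listed by `e`. -/
def partialAntisymmetrizer (n : ℕ) {m N : ℕ} (e : Fin m ↪ Fin N) :
    Matrix (Fin N → Fin n) (Fin N → Fin n) S :=
  (m.factorial : ℂ)⁻¹ • ∑ σ : Equiv.Perm (Fin m),
    ((Equiv.Perm.sign σ : ℤ) : ℂ) • permOp S n (σ.viaEmbedding e)

lemma sign_mul_self (τ : Equiv.Perm (Fin m)) :
    ((Equiv.Perm.sign τ : ℤ) : ℂ) * ((Equiv.Perm.sign τ : ℤ) : ℂ) = 1 := by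
  rw [← Int.cast_mul, ← Units.val_mul, Int.units_mul_self]
  simp

lemma partialAntisymmetrizer_mul_permOp (τ : Equiv.Perm (Fin m)) :
    partialAntisymmetrizer S n e * permOp S n (τ.viaEmbedding e)
      = ((Equiv.Perm.sign τ : ℤ) : ℂ) • partialAntisymmetrizer S n e := by
  rw [partialAntisymmetrizer, smul_mul_assoc, smul_comm ((Equiv.Perm.sign τ : ℤ) : ℂ),
    Finset.sum_mul]
  congr 1
  rw [Finset.smul_sum, ← Equiv.sum_comp (Equiv.mulRight τ)
    fun σ => ((Equiv.Perm.sign τ : ℤ) : ℂ) • ((Equiv.Perm.sign σ : ℤ) : ℂ) •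
      permOp S n (σ.viaEmbedding e)]
  refine Finset.sum_congr rfl fun σ _ => ?_
  rw [smul_mul_assoc, ← permOp_viaEmbedding_mul, smul_smul]
  simp only [Equiv.coe_mulRight, Equiv.Perm.sign_mul, Units.val_mul, Int.cast_mul]
  rw [mul_left_comm, sign_mul_self, mul_one]

/-- Adjacent transpositions generate the symmetric group, so every permutation acts on `X` by its
sign and averaging returns `X`. The homomorphism `φ` allows `X` to be a matrix over a noncommutative
ring on which the scalar matrices act through ι. -/
lemma mul_map_partialAntisymmetrizer {E : Type*} [Ring E]
    (φ : Matrix (Fin N → Fin n) (Fin N → Fin n) S →+* E) {X : E}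
    (h : ∀ k, k + 1 < m → X * φ (permOp S n ((adjSwap m k).viaEmbedding e)) = -X) :
    X * φ (partialAntisymmetrizer S n e) = X := by
  have key : ∀ σ : Equiv.Perm (Fin m),
      X * φ (permOp S n (σ.viaEmbedding e)) = (Equiv.Perm.sign σ : ℤ) • X := by
    intro σ
    obtain _ | m := m
    · obtain rfl : σ = 1 := Subsingleton.elim _ _
      have : (1 : Equiv.Perm (Fin 0)).viaEmbedding e = 1 :=
        map_one (Equiv.Perm.viaEmbeddingHom e)
      rw [this, permOp_one]
      simp
    · have hσ : σ ∈ Submonoid.closure (Set.range fun i : Fin m => Equiv.swap i.castSucc i.succ) := by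
        rw [Equiv.Perm.mclosure_swap_castSucc_succ]
        trivial
      induction hσ using Submonoid.closure_induction with
      | mem x hx =>
        obtain ⟨i, rfl⟩ := hx
        have e1 : Equiv.swap i.castSucc i.succ = adjSwap (m + 1) i := by
          rw [adjSwap, dif_pos (by omega)]
          rfl
        have e2 : Equiv.Perm.sign (Equiv.swap i.castSucc i.succ) = -1 :=
          Equiv.Perm.sign_swap (by simp [Fin.ext_iff])
        change X * φ (permOp S n ((Equiv.swap i.castSucc i.succ).viaEmbedding e))
          = (Equiv.Perm.sign (Equiv.swap i.castSucc i.succ) : ℤ) • X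
        rw [e2, e1, h i (by omega)]
        simp
      | one =>
        have : (1 : Equiv.Perm (Fin (m + 1))).viaEmbedding e = 1 :=
          map_one (Equiv.Perm.viaEmbeddingHom e)
        rw [this, permOp_one]
        simp
      | mul x y _ _ hx hy =>
        rw [permOp_viaEmbedding_mul, map_mul, ← mul_assoc, hx, smul_mul_assoc, hy, smul_smul]
        simp
  -- The map `φ` is additive but not assumed ℂ-linear. So 1/m! is written as a ring element, to be
  -- cancelled inside the source of `φ` against the number m! of permutations.
  have e1 : partialAntisymmetrizer S n e
      = (∑ σ : Equiv.Perm (Fin m), (Equiv.Perm.sign σ : ℤ) • permOp S n (σ.viaEmbedding e))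
        * algebraMap ℂ _ (m.factorial : ℂ)⁻¹ := by
    rw [← Algebra.commutes, ← Algebra.smul_def, partialAntisymmetrizer]
    simp only [Int.cast_smul_eq_zsmul]
  have e2 : ∀ σ : Equiv.Perm (Fin m), X * φ ((Equiv.Perm.sign σ : ℤ) • permOp S n
      (σ.viaEmbedding e)) = X := fun σ => by
    rw [map_zsmul, mul_smul_comm, key, smul_smul, ← Units.val_mul, Int.units_mul_self,
      Units.val_one, one_smul]
  rw [e1, map_mul, map_sum, ← mul_assoc, Finset.mul_sum]
  simp only [e2, Finset.sum_const, Finset.card_univ, Fintype.card_perm, Fintype.card_fin]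
  have h0 : ((m.factorial : ℕ) : ℂ) ≠ 0 := by exact_mod_cast Nat.factorial_ne_zero m
  rw [smul_mul_assoc, ← mul_smul_comm, ← map_nsmul, ← map_nsmul, nsmul_eq_mul, mul_inv_cancel₀ h0,
    map_one, map_one, mul_one]

lemma isZeroWeight_partialAntisymmetrizer : IsZeroWeight (partialAntisymmetrizer S n e) := by
  intro a b hab
  simp [partialAntisymmetrizer, Matrix.sum_apply, isZeroWeight_permOp S _ a b hab]

lemma viaEmbedding_conj (ρ : Equiv.Perm (Fin N)) (σ : Equiv.Perm (Fin m)) :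
    ρ * σ.viaEmbedding e = σ.viaEmbedding (e.trans ρ.toEmbedding) * ρ := by
  refine Equiv.ext fun k => ?_
  by_cases hk : k ∈ Set.range e
  · obtain ⟨j, rfl⟩ := hk
    rw [Equiv.Perm.mul_apply, Equiv.Perm.viaEmbedding_apply, Equiv.Perm.mul_apply]
    exact (Equiv.Perm.viaEmbedding_apply σ (e.trans ρ.toEmbedding) j).symm
  · rw [Equiv.Perm.mul_apply, Equiv.Perm.viaEmbedding_apply_of_notMem σ e k hk,
      Equiv.Perm.mul_apply, Equiv.Perm.viaEmbedding_apply_of_notMem]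
    rintro ⟨j, hj⟩
    exact hk ⟨j, ρ.injective hj⟩

lemma permOp_mul_partialAntisymmetrizer (ρ : Equiv.Perm (Fin N)) :
    permOp S n ρ * partialAntisymmetrizer S n e
      = partialAntisymmetrizer S n (e.trans ρ.toEmbedding) * permOp S n ρ := by
  simp only [partialAntisymmetrizer, mul_smul_comm, smul_mul_assoc, Finset.mul_sum, Finset.sum_mul,
    ← permOp_mul, viaEmbedding_conj]

end Antisymmetrizer

end DynamicalElliptic
end

noncomputable section
namespace DynamicalElliptic
open Matrix PowerSeries

/-! ### Antisymmetrizers in two blocks of tensor factors -/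

section Blocks
variable {n N m s : ℕ} (S : Type*) [CommRing S] [Algebra ℂ S]

/-- The tensor factors `p, …, p + m - 1`. -/
def blockEmb (p m N : ℕ) (h : p + m ≤ N) : Fin m ↪ Fin N where
  toFun i := ⟨p + i, by omega⟩
  inj' i j hij := by
    simp only [Fin.mk.injEq] at hij
    exact Fin.ext (by omega)

lemma blockEmb_val {p : ℕ} (h : p + m ≤ N) (i : Fin m) :
    (blockEmb p m N h i : ℕ) = p + i := rfl

lemma viaEmbedding_adjSwap {p k : ℕ} (h : p + m ≤ N) (hk : k + 1 < m) :
    (adjSwap m k).viaEmbedding (blockEmb p m N h) = adjSwap N (p + k) := by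
  refine Equiv.ext fun x => ?_
  by_cases hx : x ∈ Set.range (blockEmb p m N h)
  · obtain ⟨j, rfl⟩ := hx
    rw [Equiv.Perm.viaEmbedding_apply]
    by_cases h1 : (j : ℕ) = k
    · have e1 : j = ⟨k, by omega⟩ := Fin.ext h1
      rw [e1, adjSwap_left hk]
      exact (adjSwap_left (N := N) (i := p + k) (by omega)).symm
    · by_cases h2 : (j : ℕ) = k + 1
      · have e1 : j = ⟨k + 1, hk⟩ := Fin.ext h2
        rw [e1, adjSwap_right hk]
        exact (adjSwap_right (N := N) (i := p + k) (by omega)).symm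
      · rw [adjSwap_apply_of_ne h1 h2, adjSwap_apply_of_ne]
        · rw [blockEmb_val]; omega
        · rw [blockEmb_val]; omega
  · rw [Equiv.Perm.viaEmbedding_apply_of_notMem _ _ _ hx, adjSwap_apply_of_ne]
    · intro h'
      exact hx ⟨⟨k, by omega⟩, Fin.ext h'.symm⟩
    · intro h'
      exact hx ⟨⟨k + 1, by omega⟩, Fin.ext h'.symm⟩

/-- The product of the antisymmetrizers in two groups of tensor factors. -/
def blockAntisymmetrizer (n p m q s N : ℕ) (h : p + m ≤ N) (h' : q + s ≤ N) :
    Matrix (Fin N → Fin n) (Fin N → Fin n) S :=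
  partialAntisymmetrizer S n (blockEmb p m N h) * partialAntisymmetrizer S n (blockEmb q s N h')

lemma partialAntisymmetrizer_mul_flipOp {p k : ℕ} (h : p + m ≤ N) (hk : k + 1 < m) :
    partialAntisymmetrizer S n (blockEmb p m N h) * flipOp S n N (p + k)
      = - partialAntisymmetrizer S n (blockEmb p m N h) := by
  rw [flipOp_eq_permOp, ← viaEmbedding_adjSwap h hk, partialAntisymmetrizer_mul_permOp, adjSwap,
    dif_pos hk, Equiv.Perm.sign_swap (by simp [Fin.ext_iff])]
  simp

lemma partialAntisymmetrizer_commute {e : Fin m ↪ Fin N} {e' : Fin s ↪ Fin N}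
    (h : ∀ i j, e i ≠ e' j) :
    Commute (partialAntisymmetrizer S n e) (partialAntisymmetrizer S n e') := by
  have key : ∀ σ : Equiv.Perm (Fin m),
      Commute (permOp S n (σ.viaEmbedding e)) (partialAntisymmetrizer S n e') := fun σ => by
    have : e'.trans (σ.viaEmbedding e).toEmbedding = e' := by
      ext j
      refine congrArg Fin.val (Equiv.Perm.viaEmbedding_apply_of_notMem σ e (e' j) ?_)
      rintro ⟨i, hi⟩
      exact h i j hi
    have h2 := permOp_mul_partialAntisymmetrizer S (n := n) e' (σ.viaEmbedding e)
    rw [this] at h2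
    exact h2
  rw [partialAntisymmetrizer]
  exact (Commute.sum_left _ _ _ fun σ _ => (key σ).smul_left _).smul_left _

lemma blockAntisymmetrizer_comm {p q : ℕ} (h : p + m ≤ N) (h' : q + s ≤ N)
    (hd : p + m ≤ q ∨ q + s ≤ p) :
    blockAntisymmetrizer S n p m q s N h h' = blockAntisymmetrizer S n q s p m N h' h :=
  (partialAntisymmetrizer_commute S fun i j hij => by
    have := congrArg Fin.val hij
    rw [blockEmb_val, blockEmb_val] at this
    omega).eq

lemma isZeroWeight_blockAntisymmetrizer {p q : ℕ} (h : p + m ≤ N) (h' : q + s ≤ N) :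
    IsZeroWeight (blockAntisymmetrizer S n p m q s N h h') :=
  (isZeroWeight_partialAntisymmetrizer S _).mul (isZeroWeight_partialAntisymmetrizer S _)

lemma blockAntisymmetrizer_mul_flipOp_right {p q k : ℕ} (h : p + m ≤ N) (h' : q + s ≤ N)
    (hk : k + 1 < s) :
    blockAntisymmetrizer S n p m q s N h h' * flipOp S n N (q + k)
      = - blockAntisymmetrizer S n p m q s N h h' := by
  rw [blockAntisymmetrizer, mul_assoc, partialAntisymmetrizer_mul_flipOp S h' hk, mul_neg]

lemma blockAntisymmetrizer_mul_flipOp_left {p q k : ℕ} (h : p + m ≤ N) (h' : q + s ≤ N)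
    (hd : p + m ≤ q ∨ q + s ≤ p) (hk : k + 1 < m) :
    blockAntisymmetrizer S n p m q s N h h' * flipOp S n N (p + k)
      = - blockAntisymmetrizer S n p m q s N h h' := by
  rw [blockAntisymmetrizer_comm S h h' hd, blockAntisymmetrizer_mul_flipOp_right S h' h hk]

variable {S} in
lemma mul_map_blockAntisymmetrizer {E : Type*} [Ring E]
    (φ : Matrix (Fin N → Fin n) (Fin N → Fin n) S →+* E) {X : E} {p q : ℕ} (h : p + m ≤ N)
    (h' : q + s ≤ N) (h₁ : ∀ k, k + 1 < m → X * φ (flipOp S n N (p + k)) = -X)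
    (h₂ : ∀ k, k + 1 < s → X * φ (flipOp S n N (q + k)) = -X) :
    X * φ (blockAntisymmetrizer S n p m q s N h h') = X := by
  have e : X * φ (partialAntisymmetrizer S n (blockEmb p m N h)) = X :=
    mul_map_partialAntisymmetrizer S _ φ fun k hk => by
      rw [viaEmbedding_adjSwap h hk, ← flipOp_eq_permOp, h₁ k hk]
  rw [blockAntisymmetrizer, map_mul, ← mul_assoc, e]
  exact mul_map_partialAntisymmetrizer S _ φ fun k hk => by
    rw [viaEmbedding_adjSwap h' hk, ← flipOp_eq_permOp, h₂ k hk]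

lemma blockAntisymmetrizer_mul_self {p q : ℕ} (h : p + m ≤ N) (h' : q + s ≤ N)
    (hd : p + m ≤ q ∨ q + s ≤ p) :
    blockAntisymmetrizer S n p m q s N h h' * blockAntisymmetrizer S n p m q s N h h'
      = blockAntisymmetrizer S n p m q s N h h' :=
  mul_map_blockAntisymmetrizer (RingHom.id (Matrix (Fin N → Fin n) (Fin N → Fin n) S)) h h'
    (fun _ hk => blockAntisymmetrizer_mul_flipOp_left S h h' hd hk)
    (fun _ hk => blockAntisymmetrizer_mul_flipOp_right S h h' hk)

/-- The permutation that exchanges the first `m` factors with the last `s` ones. -/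
def blockSwap (h : N = m + s) : Equiv.Perm (Fin N) where
  toFun k := if h' : (k : ℕ) < m then ⟨s + k, by omega⟩ else ⟨k - m, by omega⟩
  invFun k := if h' : (k : ℕ) < s then ⟨m + k, by omega⟩ else ⟨k - s, by omega⟩
  left_inv k := by
    by_cases h' : (k : ℕ) < m
    · simp [h']
    · have : (k : ℕ) - m < s := by omega
      simp only [h', dite_false, this, dite_true]
      exact Fin.ext (by simp only; omega)
  right_inv k := by
    by_cases h' : (k : ℕ) < s
    · simp [h']
    · have : (k : ℕ) - s < m := by omega
      simp only [h', dite_false, this, dite_true]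
      exact Fin.ext (by simp only; omega)

/-- The antisymmetrizers for the block sizes (m, s) and (s, m) are conjugate. This supplies the
matrices `P` and `Pi` required by `corner_inverse`. -/
lemma permOp_blockSwap_mul (h : N = m + s) :
    permOp S n (blockSwap h) * blockAntisymmetrizer S n 0 m m s N (by omega) (by omega)
      = blockAntisymmetrizer S n 0 s s m N (by omega) (by omega) * permOp S n (blockSwap h) := by
  rw [blockAntisymmetrizer_comm S (p := 0) (q := s) _ _ (Or.inl (by omega)), blockAntisymmetrizer,
    ← mul_assoc, permOp_mul_partialAntisymmetrizer, mul_assoc, permOp_mul_partialAntisymmetrizer,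
    ← mul_assoc, blockAntisymmetrizer]
  congr 3
  · ext j
    simp [blockSwap, blockEmb_val]
  · ext j
    simp [blockSwap, blockEmb_val]

end Blocks

/-! ### Linear algebra of conjugate idempotents -/

section Corner
variable {ι S : Type*} [Fintype ι] [DecidableEq ι] [CommRing S]

/-- If an invertible matrix maps the kernel of one idempotent to the kernel of a conjugate one,
then so does its inverse in the other direction. -/
lemma corner_inverse {A A' G Gi P Pi : Matrix ι ι S} (hG : G * Gi = 1)
    (hP : P * Pi = 1) (hP' : Pi * P = 1) (hA' : A' * A' = A')
    (hPA : P * A = A' * P) (hAG : A' * G * A = A' * G) : A * Gi * A' = A * Gi := by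
  have hPA' : A * Pi = Pi * A' := by
    calc A * Pi = Pi * (P * A) * Pi := by rw [← mul_assoc, hP', one_mul]
      _ = Pi * A' * (P * Pi) := by rw [hPA]; simp only [mul_assoc]
      _ = Pi * A' := by rw [hP, mul_one]
  have h1 : A' * (G * Pi) * A' = A' * (G * Pi) := by
    rw [← mul_assoc, mul_assoc _ Pi, ← hPA', ← mul_assoc, hAG]
  have h2 : (G * Pi) * (P * Gi) = 1 := by
    rw [mul_assoc, ← mul_assoc Pi, hP', one_mul, hG]
  -- Conjugation by `P` leaves the single idempotent `A'`. With respect to it `Q` is block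
  -- triangular, which is what `h1` says.
  set Q := G * Pi
  set Q' := P * Gi with hQ'
  have hf : A' * (1 - A') = 0 := by rw [mul_sub, mul_one, hA', sub_self]
  have hf' : (1 - A') * A' = 0 := by rw [sub_mul, one_mul, hA', sub_self]
  have hff : (1 - A') * (1 - A') = 1 - A' := by rw [mul_sub, mul_one, hf', sub_zero]
  have h3 : A' * Q * Q' = A' := by rw [mul_assoc, h2, mul_one]
  -- The corners of `Q` and `Q'` are completed by `1 - A'` to square matrices over a commutative
  -- ring, where a one-sided inverse is two-sided.
  have h4 : (A' * Q * A' + (1 - A')) * (A' * Q' * A' + (1 - A')) = 1 := by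
    have e1 : A' * Q * A' * (A' * Q' * A') = A' := by
      calc A' * Q * A' * (A' * Q' * A') = A' * Q * (A' * A') * Q' * A' := by simp only [mul_assoc]
        _ = A' * Q * A' * Q' * A' := by rw [hA']
        _ = A' := by rw [h1, h3, hA']
    have e2 : A' * Q * A' * (1 - A') = 0 := by rw [mul_assoc, hf, mul_zero]
    have e3 : (1 - A') * (A' * Q' * A') = 0 := by
      rw [← mul_assoc, ← mul_assoc, hf', zero_mul, zero_mul]
    rw [add_mul, mul_add, mul_add, e1, e2, e3, hff]
    simp
  have h5 := _root_.mul_eq_one_comm.1 h4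
  -- The remaining block of `Q'` is annihilated by the corner of `Q`. That corner is invertible by
  -- `h5`, so the block vanishes.
  have h6 : (A' * Q * A' + (1 - A')) * (A' * Q' * (1 - A')) = 0 := by
    have e1 : A' * Q * A' * (A' * Q' * (1 - A')) = 0 := by
      calc A' * Q * A' * (A' * Q' * (1 - A'))
          = A' * Q * (A' * A') * Q' * (1 - A') := by simp only [mul_assoc]
        _ = A' * Q * Q' * (1 - A') := by rw [hA', h1]
        _ = 0 := by rw [h3, hf]
    rw [add_mul, e1, ← mul_assoc, ← mul_assoc, hf', zero_mul, zero_mul, add_zero]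
  have h7 : A' * Q' * (1 - A') = 0 := by
    have := congrArg ((A' * Q' * A' + (1 - A')) * ·) h6
    simpa only [← mul_assoc (A' * Q' * A' + (1 - A')), h5, one_mul, mul_zero] using this
  have h8 : A' * Q' * A' = A' * Q' := by
    rw [mul_sub, mul_one, sub_eq_zero] at h7
    exact h7.symm
  have h9 : P * (A * Gi * A') = P * (A * Gi) := by
    calc P * (A * Gi * A') = (P * A) * Gi * A' := by simp only [mul_assoc]
      _ = A' * Q' * A' := by rw [hPA, hQ']; simp only [mul_assoc]
      _ = A' * P * Gi := by rw [h8, hQ', mul_assoc]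
      _ = P * (A * Gi) := by rw [← hPA, mul_assoc]
  calc A * Gi * A' = Pi * (P * (A * Gi * A')) := by rw [← mul_assoc Pi, hP', one_mul]
    _ = A * Gi := by rw [h9, ← mul_assoc, hP', one_mul]

end Corner

end DynamicalElliptic
end

noncomputable section
namespace DynamicalElliptic
open Matrix PowerSeries

/-! ### Words in dynamical `L`-operators -/

/-- A commutative ring `S` of scalar functions of `λ`, mapped to a ring `T` of functions by a
central homomorphism `ι` and by a second homomorphism `c : F ↦ F(λ + ℏh)`, compatibly with the
translations. -/
structure DynamicalPair (n : ℕ) (S T : Type*) [CommRing S] [Ring T] where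
  shS : Translations n S
  shT : Translations n T
  ι : S →+* T
  c : S →+* T
  ι_comm : ∀ s t, ι s * t = t * ι s
  shT_ι : ∀ μ s, shT.map μ (ι s) = ι (shS.map μ s)
  shT_c : ∀ μ s, shT.map μ (c s) = c (shS.map μ s)

lemma Translations.map_map {n : ℕ} {S : Type*} [Ring S] (sh : Translations n S) (μ ν : Fin n → ℤ)
    (s : S) : sh.map μ (sh.map ν s) = sh.map (μ + ν) s := by
  rw [sh.map_add]
  rfl

section Words
variable {n : ℕ} {S T : Type*} [CommRing S] [Ring T]

/-- The matrix `x₀⁽¹⁾(λ + ℏ(E⁽²⁾ + ⋯)) x₁⁽²⁾(λ + ℏ(E⁽³⁾ + ⋯)) ⋯` on `(ℂⁿ)^{⊗N}`. -/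
def wordMatrix (sh : Translations n T) : (N : ℕ) → (ℕ → Matrix (Fin n) (Fin n) T) →
    Matrix (Fin N → Fin n) (Fin N → Fin n) T
  | 0, _ => Matrix.of fun _ _ => 1
  | N + 1, x => Matrix.of fun a b => sh.map (weight (Fin.tail a)) (x 0 (a 0) (b 0))
      * wordMatrix sh N (fun k => x (k + 1)) (Fin.tail a) (Fin.tail b)

lemma wordMatrix_succ (sh : Translations n T) (N : ℕ) (x : ℕ → Matrix (Fin n) (Fin n) T)
    (a b : Fin (N + 1) → Fin n) :
    wordMatrix sh (N + 1) x a b = sh.map (weight (Fin.tail a)) (x 0 (a 0) (b 0))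
      * wordMatrix sh N (fun k => x (k + 1)) (Fin.tail a) (Fin.tail b) := rfl

lemma wordMatrix_congr (sh : Translations n T) {N : ℕ} {x y : ℕ → Matrix (Fin n) (Fin n) T}
    (h : ∀ k < N, x k = y k) : wordMatrix sh N x = wordMatrix sh N y := by
  induction N generalizing x y with
  | zero => rfl
  | succ N ih =>
    ext a b
    rw [wordMatrix_succ, wordMatrix_succ, h 0 (by omega), ih fun k hk => h (k + 1) (by omega)]

lemma weight_succ {N : ℕ} (a : Fin (N + 1) → Fin n) :
    weight a = unitWeight (a 0) + weight (Fin.tail a) := by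
  rw [weight, Fin.sum_univ_succ]
  rfl

lemma tail_comp_adjSwap {N i : ℕ} (a : Fin (N + 1) → Fin n) :
    Fin.tail (a ∘ adjSwap (N + 1) (i + 1)) = Fin.tail a ∘ adjSwap N i := by
  funext k
  simp only [Fin.tail, Function.comp]
  congr 1
  by_cases h : i + 1 < N
  · by_cases h1 : (k : ℕ) = i
    · have e1 : k = ⟨i, by omega⟩ := Fin.ext h1
      rw [e1, adjSwap_left h]
      exact adjSwap_left (N := N + 1) (i := i + 1) (by omega)
    · by_cases h2 : (k : ℕ) = i + 1
      · have e1 : k = ⟨i + 1, h⟩ := Fin.ext h2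
        rw [e1, adjSwap_right h]
        exact adjSwap_right (N := N + 1) (i := i + 1) (by omega)
      · rw [adjSwap_apply_of_ne h1 h2, adjSwap_apply_of_ne]
        · simpa using h1
        · simpa using h2
  · rw [adjSwap, adjSwap, dif_neg (by omega), dif_neg h]
    rfl

lemma weightAbove_zero {N : ℕ} (a : Fin (N + 1) → Fin n) :
    weightAbove 0 a = weight (Fin.tail a) := by
  rw [weightAbove, Fin.sum_univ_succ]
  simp [weight, Fin.tail]

lemma weightAbove_succ {N k : ℕ} (a : Fin (N + 1) → Fin n) :
    weightAbove (k + 1) a = weightAbove k (Fin.tail a) := by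
  rw [weightAbove, Fin.sum_univ_succ]
  simp [weightAbove, Fin.tail]

lemma localCoeff_succ (sh : Translations n S) {N i : ℕ} (α : Fin n → Fin n → S)
    (a : Fin (N + 1) → Fin n) :
    localCoeff sh (i + 1) α a = localCoeff sh i α (Fin.tail a) := by
  by_cases h : i + 1 < N
  · rw [localCoeff_of_lt sh (by omega : i + 1 + 1 < N + 1), localCoeff_of_lt sh h,
      weightAbove_succ]
    rfl
  · rw [localCoeff, localCoeff, dif_neg (by omega), dif_neg h]

lemma localCoeff_zero (sh : Translations n S) {N : ℕ} (α : Fin n → Fin n → S)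
    (a : Fin (N + 2) → Fin n) :
    localCoeff sh 0 α a = sh.map (weight (Fin.tail (Fin.tail a))) (α (a 0) (a 1)) := by
  rw [localCoeff_of_lt sh (by omega), weightAbove_succ, weightAbove_zero]
  rfl

variable {P : DynamicalPair n S T}

/-- The weight condition `F(λ + ℏ(E + h)) M = M F(λ + ℏ(E + h))` of a matrix. -/
def DynamicalPair.IsWeighted (P : DynamicalPair n S T) (M : Matrix (Fin n) (Fin n) T) : Prop :=
  ∀ a b s, P.c s * M a b = M a b * P.c (P.shS.map (unitWeight b - unitWeight a) s)

/-- The dynamical exchange relation between two matrices, with coefficients `α` and `β`. -/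
def DynamicalPair.Exchange (P : DynamicalPair n S T) (X Y : Matrix (Fin n) (Fin n) T)
    (α β : Fin n → Fin n → S) : Prop :=
  ∀ i j k l, P.ι (α j i) * (P.shT.map (unitWeight i) (X j k) * Y i l)
      + P.ι (β i j) * (P.shT.map (unitWeight j) (X i k) * Y j l)
    = P.shT.map (unitWeight j) (Y i l) * X j k * P.c (α k l)
      + P.shT.map (unitWeight j) (Y i k) * X j l * P.c (β k l)

/-- The relation saying that the antisymmetrizer can be moved through the product of two
matrices. -/
def DynamicalPair.Fused (P : DynamicalPair n S T) (X Y : Matrix (Fin n) (Fin n) T) : Prop :=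
  ∀ i j k l, P.shT.map (unitWeight i) (X j k) * Y i l + P.shT.map (unitWeight i) (X j l) * Y i k
    = P.shT.map (unitWeight j) (X i k) * Y j l + P.shT.map (unitWeight j) (X i l) * Y j k

/-- The weight differences of the letters add up along the word. Since the first letter is
translated by the weight of its tail, the element `P.c s` is first rewritten as a translate, so that
the weight condition of the untranslated letter applies. -/
lemma wordMatrix_weight {N : ℕ} {x : ℕ → Matrix (Fin n) (Fin n) T}
    (hx : ∀ k < N, P.IsWeighted (x k)) (a b : Fin N → Fin n) (s : S) :
    P.c s * wordMatrix P.shT N x a b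
      = wordMatrix P.shT N x a b * P.c (P.shS.map (weight b - weight a) s) := by
  induction N generalizing x s with
  | zero => simp [wordMatrix, weight, P.shS.map_zero]
  | succ N ih =>
    rw [wordMatrix_succ]
    set w := weight (Fin.tail a)
    have h1 : P.c s = P.shT.map w (P.c (P.shS.map (-w) s)) := by
      rw [P.shT_c, Translations.map_map, add_neg_cancel, P.shS.map_zero]
      rfl
    have h2 : P.c s * P.shT.map w (x 0 (a 0) (b 0))
        = P.shT.map w (x 0 (a 0) (b 0))
          * P.c (P.shS.map (unitWeight (b 0) - unitWeight (a 0)) s) := by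
      rw [h1, ← map_mul, hx 0 (by omega), map_mul, P.shT_c, Translations.map_map,
        Translations.map_map]
      congr 4
      abel
    rw [← mul_assoc, h2, mul_assoc, ih fun k hk => hx (k + 1) (by omega), Translations.map_map,
      ← mul_assoc]
    congr 4
    rw [weight_succ a, weight_succ b]
    abel

lemma exchangeOp_map_mul {N i : ℕ} (h : i + 1 < N) (f : S →+* T) (α β : Fin n → Fin n → S)
    (W : Matrix (Fin N → Fin n) (Fin N → Fin n) T) (a b : Fin N → Fin n) :
    ((exchangeOp P.shS N i α β).map f * W) a b
      = f (localCoeff P.shS i α (a ∘ adjSwap N i)) * W (a ∘ adjSwap N i) b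
        + f (localCoeff P.shS i β a) * W a b := by
  rw [mul_apply]
  have e : ∀ d, ((exchangeOp P.shS N i α β).map f) a d * W d b
      = (if d = a ∘ adjSwap N i then f (localCoeff P.shS i α d) * W d b else 0)
        + (if d = a then f (localCoeff P.shS i β d) * W d b else 0) := fun d => by
    have h1 : a = d ∘ adjSwap N i ↔ d = a ∘ adjSwap N i := by
      constructor
      · rintro rfl; exact (comp_adjSwap_adjSwap i d).symm
      · rintro rfl; exact (comp_adjSwap_adjSwap i a).symm
    simp only [exchangeOp, if_pos h, map_apply, of_apply, h1, eq_comm (a := a) (b := d), map_add,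
      add_mul]
    congr 1 <;> split_ifs <;> simp
  simp only [e, Finset.sum_add_distrib, Finset.sum_ite_eq', Finset.mem_univ, if_true]

lemma mul_exchangeOp_map {N i : ℕ} (h : i + 1 < N) (f : S →+* T) (α β : Fin n → Fin n → S)
    (W : Matrix (Fin N → Fin n) (Fin N → Fin n) T) (a b : Fin N → Fin n) :
    (W * (exchangeOp P.shS N i α β).map f) a b
      = W a (b ∘ adjSwap N i) * f (localCoeff P.shS i α b)
        + W a b * f (localCoeff P.shS i β b) := by
  rw [mul_apply]
  have e : ∀ d, W a d * ((exchangeOp P.shS N i α β).map f) d b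
      = (if d = b ∘ adjSwap N i then W a d * f (localCoeff P.shS i α b) else 0)
        + (if d = b then W a d * f (localCoeff P.shS i β b) else 0) := fun d => by
    simp only [exchangeOp, if_pos h, map_apply, of_apply, map_add, mul_add]
    congr 1 <;> split_ifs <;> simp
  simp only [e, Finset.sum_add_distrib, Finset.sum_ite_eq', Finset.mem_univ, if_true]

lemma comp_adjSwap_succ_zero {N i : ℕ} (a : Fin (N + 1) → Fin n) :
    (a ∘ adjSwap (N + 1) (i + 1)) 0 = a 0 := by
  simp only [Function.comp]
  rw [adjSwap_apply_of_ne (by simp) (by simp)]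

lemma comp_adjSwap_zero {N : ℕ} (a : Fin (N + 2) → Fin n) :
    (a ∘ adjSwap (N + 2) 0) 0 = a 1 ∧ (a ∘ adjSwap (N + 2) 0) 1 = a 0
      ∧ Fin.tail (Fin.tail (a ∘ adjSwap (N + 2) 0)) = Fin.tail (Fin.tail a) := by
  refine ⟨comp_adjSwap_apply₀ (i := 0) (by omega) a, comp_adjSwap_apply₁ (i := 0) (by omega) a,
    funext fun k => ?_⟩
  simp only [Fin.tail, Function.comp]
  rw [adjSwap_apply_of_ne (by simp) (by simp [Fin.val_succ])]

lemma wordMatrix_two (sh : Translations n T) (N : ℕ) (x : ℕ → Matrix (Fin n) (Fin n) T)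
    (a b : Fin (N + 2) → Fin n) :
    wordMatrix sh (N + 2) x a b
      = sh.map (weight (Fin.tail (Fin.tail a))) (sh.map (unitWeight (a 1)) (x 0 (a 0) (b 0))
          * x 1 (a 1) (b 1))
        * wordMatrix sh N (fun k => x (k + 2)) (Fin.tail (Fin.tail a)) (Fin.tail (Fin.tail b)) := by
  rw [wordMatrix_succ, wordMatrix_succ, weight_succ, map_mul, Translations.map_map, mul_assoc,
    add_comm]
  rfl

/-- Letters in front of position `i` are peeled off: scalars under ι are central, and such a letter
depends on the later indices only through their total weight, which a swap preserves. At `i = 0` the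
two-letter relation is translated by the weight of the remaining row indices. The coefficient under
`P.c` must then cross the remaining letters. The weight condition replaces the row weight in its
shift by the column weight, as multiplication by the exchange operator on the right demands. -/
theorem exchangeOp_wordMatrix {N i : ℕ} (hi : i + 1 < N) {x y : ℕ → Matrix (Fin n) (Fin n) T}
    (h₀ : y i = x (i + 1)) (h₁ : y (i + 1) = x i) (h₂ : ∀ k, k ≠ i → k ≠ i + 1 → y k = x k)
    {α β : Fin n → Fin n → S} (h : P.Exchange (x i) (x (i + 1)) α β)
    (hx : ∀ k < N, P.IsWeighted (x k)) :
    (exchangeOp P.shS N i α β).map P.ι * wordMatrix P.shT N x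
      = wordMatrix P.shT N y * (exchangeOp P.shS N i α β).map P.c := by
  ext a b
  rw [exchangeOp_map_mul hi, mul_exchangeOp_map hi]
  induction N generalizing i x y with
  | zero => omega
  | succ N ih =>
    obtain _ | i := i
    · obtain _ | N := N
      · omega
      have hw := wordMatrix_weight (P := P) (N := N) (x := fun k => x (k + 2))
        (fun k hk => hx (k + 2) (by omega)) (Fin.tail (Fin.tail a)) (Fin.tail (Fin.tail b))
      have hy : (fun k => y (k + 2)) = fun k => x (k + 2) :=
        funext fun k => h₂ (k + 2) (by omega) (by omega)
      have := congrArg (fun t => P.shT.map (weight (Fin.tail (Fin.tail a))) t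
        * wordMatrix P.shT N (fun k => x (k + 2)) (Fin.tail (Fin.tail a)) (Fin.tail (Fin.tail b)))
        (h (a 0) (a 1) (b 0) (b 1))
      obtain ⟨ha0, ha1, hat⟩ := comp_adjSwap_zero a
      obtain ⟨hb0, hb1, hbt⟩ := comp_adjSwap_zero b
      simp only [wordMatrix_two, localCoeff_zero, ha0, ha1, hat, hb0, hb1, hbt, hy,
        show y 0 = x 1 from h₀, show y 1 = x 0 from h₁]
      simp only [map_add, add_mul, map_mul, P.shT_ι, P.shT_c, zero_add] at this ⊢
      simp only [mul_assoc, hw, Translations.map_map] at this ⊢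
      simpa only [sub_add_cancel] using this
    · have := ih (i := i) (x := fun k => x (k + 1)) (y := fun k => y (k + 1)) (by omega) h₀ h₁
        (fun k h h' => h₂ (k + 1) (by omega) (by omega)) h (fun k hk => hx (k + 1) (by omega))
        (Fin.tail a) (Fin.tail b)
      simp only [localCoeff_succ, wordMatrix_succ, tail_comp_adjSwap, comp_adjSwap_succ_zero,
        weight_comp, h₂ 0 (by omega) (by omega)]
      simp only [← mul_assoc, P.ι_comm _ (P.shT.map _ _)]
      simp only [mul_assoc, ← mul_add, this]

/-- The same peeling; no coefficients have to cross the remaining letters, so no weight condition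
enters. -/
theorem fused_wordMatrix {N i : ℕ} (hi : i + 1 < N) {x : ℕ → Matrix (Fin n) (Fin n) T}
    (h : P.Fused (x i) (x (i + 1))) (a b : Fin N → Fin n) :
    wordMatrix P.shT N x (a ∘ adjSwap N i) b
        + wordMatrix P.shT N x (a ∘ adjSwap N i) (b ∘ adjSwap N i)
      = wordMatrix P.shT N x a b + wordMatrix P.shT N x a (b ∘ adjSwap N i) := by
  induction N generalizing i x with
  | zero => omega
  | succ N ih =>
    obtain _ | i := i
    · obtain _ | N := N
      · omega
      have := congrArg (fun t => P.shT.map (weight (Fin.tail (Fin.tail a))) t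
        * wordMatrix P.shT N (fun k => x (k + 2)) (Fin.tail (Fin.tail a)) (Fin.tail (Fin.tail b)))
        (h (a 0) (a 1) (b 0) (b 1))
      obtain ⟨ha0, ha1, hat⟩ := comp_adjSwap_zero a
      obtain ⟨hb0, hb1, hbt⟩ := comp_adjSwap_zero b
      simp only [wordMatrix_two, ha0, ha1, hat, hb0, hb1, hbt]
      simpa only [map_add, add_mul, zero_add] using this
    · have := ih (i := i) (x := fun k => x (k + 1)) (by omega) h (Fin.tail a) (Fin.tail b)
      simp only [wordMatrix_succ, tail_comp_adjSwap, comp_adjSwap_succ_zero, weight_comp, ← mul_add,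
        this]

end Words

end DynamicalElliptic
end

noncomputable section
namespace DynamicalElliptic
open Matrix PowerSeries

/-! ### Commutation of traces of antisymmetrized words -/

lemma isUnit_braidOp {n N : ℕ} {S : Type*} [CommRing S] (sh : Translations n S)
    {α β : ℕ → ℕ → Fin n → Fin n → S}
    (hu : ∀ i r p, IsUnit (exchangeOp sh N i (α r p) (β r p)))
    (m p : ℕ) : IsUnit (braidOp sh α β N m p) := by
  have h : ∀ p r, IsUnit (moveOp sh α β N p r) := fun p r => by
    induction r with
    | zero => exact isUnit_one
    | succ r ih => exact ih.mul (hu _ _ _)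
  induction p with
  | zero => exact isUnit_one
  | succ p ih => exact (h _ _).mul ih

section Trace
variable {n N : ℕ} {S T : Type*} [CommRing S] [Ring T] {P : DynamicalPair n S T}

/-- The trace over the basis vectors of weight `μ`. -/
def weightTrace (μ : Fin n → ℤ) (M : Matrix (Fin N → Fin n) (Fin N → Fin n) T) : T :=
  ∑ b, if weight b = μ then M b b else 0

/-- The entries of `M` do not commute, but those of `Z` become central under ι. Zero weight of `Z`
keeps the summation inside a single weight space. -/
lemma weightTrace_mul_comm (P : DynamicalPair n S T) (μ : Fin n → ℤ)
    {Z : Matrix (Fin N → Fin n) (Fin N → Fin n) S}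
    (hZ : IsZeroWeight Z) (M : Matrix (Fin N → Fin n) (Fin N → Fin n) T) :
    weightTrace μ (Z.map P.ι * M) = weightTrace μ (M * Z.map P.ι) := by
  have e₁ : ∀ b, (if weight b = μ then (Z.map P.ι * M) b b else 0)
      = ∑ a, if weight b = μ then P.ι (Z b a) * M a b else 0 := fun b => by
    split_ifs
    · rfl
    · simp
  have e₂ : ∀ b, (if weight b = μ then (M * Z.map P.ι) b b else 0)
      = ∑ a, if weight b = μ then M b a * P.ι (Z a b) else 0 := fun b => by
    split_ifs
    · rfl
    · simp
  simp only [weightTrace, e₁, e₂]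
  rw [Finset.sum_comm]
  refine Finset.sum_congr rfl fun a _ => Finset.sum_congr rfl fun b _ => ?_
  by_cases h : weight b = weight a
  · rw [h, P.ι_comm]
  · simp [hZ b a h]

/-- The altered factor stands on the right, so a left ideal `J` suffices. -/
lemma weightTrace_mul_sub_mem {J : Ideal T} (hJ : ∀ s, P.c s - P.ι s ∈ J) (μ : Fin n → ℤ)
    (Z : Matrix (Fin N → Fin n) (Fin N → Fin n) S)
    (M : Matrix (Fin N → Fin n) (Fin N → Fin n) T) :
    weightTrace μ (M * Z.map P.c) - weightTrace μ (M * Z.map P.ι) ∈ J := by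
  rw [weightTrace, weightTrace, ← Finset.sum_sub_distrib]
  refine sum_mem fun b _ => ?_
  split_ifs
  · rw [mul_apply, mul_apply, ← Finset.sum_sub_distrib]
    refine sum_mem fun a _ => ?_
    rw [← mul_sub]
    exact J.mul_mem_left _ (hJ _)
  · simp

/-- The word `V 0, …, V (p-1), U 0, …, U (r-1), V p, U r, …, U (m-1), V (p+1), …`. -/
def interleave {X : Type*} (m p r : ℕ) (U V : ℕ → X) (k : ℕ) : X :=
  if k < p then V k else if k < p + r then U (k - p) else if k = p + r then V p
  else if k ≤ p + m then U (k - p - 1) else V (k - m)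

/-- The word `U 0, …, U (m-1), V 0, V 1, …`. -/
def concat {X : Type*} (m : ℕ) (U V : ℕ → X) (k : ℕ) : X := if k < m then U k else V (k - m)

lemma concat_of_lt {X : Type*} {m k : ℕ} (U V : ℕ → X) (h : k < m) : concat m U V k = U k :=
  if_pos h

lemma concat_add {X : Type*} (m k : ℕ) (U V : ℕ → X) : concat m U V (m + k) = V k := by
  rw [concat, if_neg (by omega), Nat.add_sub_cancel_left]

lemma interleave_zero_eq {X : Type*} (m p : ℕ) (U V : ℕ → X) :
    interleave m p 0 U V = interleave m (p + 1) m U V := by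
  funext k
  simp only [interleave]
  split_ifs <;> first | rfl | omega | (congr 1; omega)

lemma interleave_zero_left {X : Type*} (m : ℕ) (U V : ℕ → X) :
    interleave m 0 m U V = concat m U V := by
  funext k
  simp only [interleave, concat]
  split_ifs <;> first | rfl | omega | (congr 1; omega)

lemma interleave_eq_concat {X : Type*} (m s : ℕ) (U V : ℕ → X) {k : ℕ} (h : k < s + m) :
    interleave m s m U V k = concat s V U k := by
  simp only [interleave, concat]
  split_ifs <;> try omega
  all_goals rfl

variable {U V : ℕ → Matrix (Fin n) (Fin n) T} {α β : ℕ → ℕ → Fin n → Fin n → S}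

lemma interleave_isWeighted (hU : ∀ r, P.IsWeighted (U r)) (hV : ∀ p, P.IsWeighted (V p))
    (m p r k : ℕ) : P.IsWeighted (interleave m p r U V k) := by
  simp only [interleave]
  split_ifs <;> first | exact hU _ | exact hV _

lemma moveOp_wordMatrix (hE : ∀ r p, P.Exchange (U r) (V p) (α r p) (β r p))
    (hU : ∀ r, P.IsWeighted (U r)) (hV : ∀ p, P.IsWeighted (V p)) {m p r : ℕ} (hr : r ≤ m)
    (h : p + r < N) :
    (moveOp P.shS α β N p r).map P.ι * wordMatrix P.shT N (interleave m p r U V)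
      = wordMatrix P.shT N (interleave m p 0 U V) * (moveOp P.shS α β N p r).map P.c := by
  induction r with
  | zero => rw [moveOp, Matrix.map_one _ (map_zero _) (map_one _),
      Matrix.map_one _ (map_zero _) (map_one _), one_mul, mul_one]
  | succ r ih =>
    have e₁ : interleave m p (r + 1) U V (p + r) = U r := by
      rw [interleave, if_neg (by omega), if_pos (by omega), Nat.add_sub_cancel_left]
    have e₂ : interleave m p (r + 1) U V (p + r + 1) = V p := by
      rw [interleave, if_neg (by omega), if_neg (by omega), if_pos (by omega)]
    have := exchangeOp_wordMatrix (P := P) (N := N) (i := p + r) (by omega)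
      (x := interleave m p (r + 1) U V) (y := interleave m p r U V) (α := α r p) (β := β r p)
      (by rw [e₂, interleave, if_neg (by omega), if_neg (by omega), if_pos rfl])
      (by rw [e₁, interleave, if_neg (by omega), if_neg (by omega), if_neg (by omega),
            if_pos (by omega)]
          congr 1; omega)
      (fun k _ _ => by
        simp only [interleave]
        split_ifs <;> first | rfl | omega)
      (by rw [e₁, e₂]; exact hE r p) (fun k _ => interleave_isWeighted hU hV _ _ _ k)
    rw [moveOp, Matrix.map_mul, Matrix.map_mul, mul_assoc, this, ← mul_assoc,
      ih (by omega) (by omega), mul_assoc]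

lemma braidOp_wordMatrix (hE : ∀ r p, P.Exchange (U r) (V p) (α r p) (β r p))
    (hU : ∀ r, P.IsWeighted (U r)) (hV : ∀ p, P.IsWeighted (V p)) {m p : ℕ} (h : m + p ≤ N) :
    (braidOp P.shS α β N m p).map P.ι * wordMatrix P.shT N (concat m U V)
      = wordMatrix P.shT N (interleave m p m U V) * (braidOp P.shS α β N m p).map P.c := by
  induction p with
  | zero => rw [braidOp, Matrix.map_one _ (map_zero _) (map_one _),
      Matrix.map_one _ (map_zero _) (map_one _), one_mul, mul_one, interleave_zero_left]
  | succ p ih =>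
    rw [braidOp, Matrix.map_mul, Matrix.map_mul, mul_assoc, ih (by omega), ← mul_assoc,
      moveOp_wordMatrix hE hU hV le_rfl (by omega), mul_assoc, interleave_zero_eq]

variable [Algebra ℂ S]

/-- Absorbs a factor `1 - P` into an antisymmetrizer, so that relations of the form (1 - P) X (1 +
P) = 0 can be applied behind it. -/
lemma mul_one_sub_flipOp {A : Matrix (Fin N → Fin n) (Fin N → Fin n) S} {i : ℕ}
    (h : A * flipOp S n N i = -A) : ((2⁻¹ : ℂ) • A) * (1 - flipOp S n N i) = A := by
  rw [mul_sub, mul_one, smul_mul_assoc, h, smul_neg, sub_neg_eq_add, ← add_smul]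
  norm_num

/-- Antisymmetrization is preserved by words with the fusion property. -/
lemma antisymmetrizer_word {m s : ℕ} (hN : N = m + s)
    (hFU : ∀ r, P.Fused (U r) (U (r + 1))) (hFV : ∀ p, P.Fused (V p) (V (p + 1))) :
    (blockAntisymmetrizer S n 0 m m s N (by omega) (by omega)).map P.ι
          * wordMatrix P.shT N (concat m U V)
        * (blockAntisymmetrizer S n 0 m m s N (by omega) (by omega)).map P.ι
      = (blockAntisymmetrizer S n 0 m m s N (by omega) (by omega)).map P.ι
          * wordMatrix P.shT N (concat m U V) := by
  set A := blockAntisymmetrizer S n 0 m m s N (by omega) (by omega) with hA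
  have key : ∀ i, i + 1 < N → P.Fused (concat m U V i) (concat m U V (i + 1)) →
      A * flipOp S n N i = -A →
      A.map P.ι * wordMatrix P.shT N (concat m U V) * (flipOp S n N i).map P.ι
        = -(A.map P.ι * wordMatrix P.shT N (concat m U V)) := fun i hi hf hAi => by
    have h1 := fused_wordMatrix (P := P) hi hf
    have h2 : (1 - flipOp S n N i : Matrix _ _ S).map P.ι * (wordMatrix P.shT N (concat m U V)
        * (1 + flipOp S n N i : Matrix _ _ S).map P.ι) = 0 := by
      have e₁ : (1 - flipOp S n N i : Matrix _ _ S).map P.ι = 1 - (flipOp S n N i).map P.ι := by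
        rw [Matrix.map_sub _ (map_sub P.ι), Matrix.map_one _ (map_zero _) (map_one _)]
      have e₂ : (1 + flipOp S n N i : Matrix _ _ S).map P.ι = 1 + (flipOp S n N i).map P.ι := by
        rw [Matrix.map_add _ (map_add P.ι), Matrix.map_one _ (map_zero _) (map_one _)]
      have f₁ : ∀ (M : Matrix (Fin N → Fin n) (Fin N → Fin n) T) a b,
          ((flipOp S n N i).map P.ι * M) a b = M (a ∘ adjSwap N i) b := fun M a b => by
        rw [flipOp_eq_exchangeOp P.shS hi, exchangeOp_map_mul hi, localCoeff_of_lt _ hi,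
          localCoeff_of_lt _ hi]
        simp
      have f₂ : ∀ (M : Matrix (Fin N → Fin n) (Fin N → Fin n) T) a b,
          (M * (flipOp S n N i).map P.ι) a b = M a (b ∘ adjSwap N i) := fun M a b => by
        rw [flipOp_eq_exchangeOp P.shS hi, mul_exchangeOp_map hi, localCoeff_of_lt _ hi,
          localCoeff_of_lt _ hi]
        simp
      ext a b
      rw [e₁, e₂, mul_add, mul_one, mul_add, sub_mul, sub_mul, one_mul, one_mul]
      simp only [Matrix.add_apply, Matrix.sub_apply, Matrix.zero_apply, f₁, f₂]
      have := h1 a b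
      linear_combination (norm := abel) -this
    have h3 : A.map P.ι * (wordMatrix P.shT N (concat m U V)
        * (1 + flipOp S n N i : Matrix _ _ S).map P.ι) = 0 := by
      rw [← mul_one_sub_flipOp hAi, Matrix.map_mul, mul_assoc, h2, mul_zero]
    rw [Matrix.map_add _ (map_add P.ι), Matrix.map_one _ (map_zero _) (map_one _), mul_add,
      mul_one, mul_add, ← mul_assoc] at h3
    exact (neg_eq_of_add_eq_zero_right h3).symm
  refine mul_map_blockAntisymmetrizer P.ι.mapMatrix _ _ (fun k hk => ?_) fun k hk => ?_
  · refine key _ (by omega) ?_ (blockAntisymmetrizer_mul_flipOp_left S _ _ (by omega) hk)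
    rw [zero_add, concat_of_lt _ _ (by omega), concat_of_lt _ _ hk]
    exact hFU k
  · refine key _ (by omega) ?_ (blockAntisymmetrizer_mul_flipOp_right S _ _ hk)
    rw [add_assoc, concat_add, concat_add]
    exact hFV k

/-- The traces of antisymmetrized words commute modulo a left ideal containing
`F(λ + ℏh) - F(λ)`. -/
theorem weightTrace_concat_sub_mem {m s : ℕ} (hN : N = m + s) {J : Ideal T}
    (hJ : ∀ s, P.c s - P.ι s ∈ J)
    (hE : ∀ r p, P.Exchange (U r) (V p) (α r p) (β r p))
    (hu : ∀ i r p, IsUnit (exchangeOp P.shS N i (α r p) (β r p)))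
    (hL : ∀ r p, LeftFusion P.shS (α r p) (β r p) (α (r + 1) p) (β (r + 1) p))
    (hR : ∀ r p, RightFusion P.shS (α r p) (β r p) (α r (p + 1)) (β r (p + 1)))
    (hU : ∀ r, P.IsWeighted (U r)) (hV : ∀ p, P.IsWeighted (V p))
    (hFU : ∀ r, P.Fused (U r) (U (r + 1))) (hFV : ∀ p, P.Fused (V p) (V (p + 1)))
    (μ : Fin n → ℤ) :
    weightTrace μ ((blockAntisymmetrizer S n 0 m m s N (by omega) (by omega)).map P.ι
          * wordMatrix P.shT N (concat m U V))
      - weightTrace μ ((blockAntisymmetrizer S n 0 s s m N (by omega) (by omega)).map P.ι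
          * wordMatrix P.shT N (concat s V U)) ∈ J := by
  have hS := antisymmetrizer_word hN hFU hFV
  set A := blockAntisymmetrizer S n 0 m m s N (by omega) (by omega) with hA
  set A' := blockAntisymmetrizer S n 0 s s m N (by omega) (by omega) with hA'
  set x := wordMatrix P.shT N (concat m U V) with hx
  set y := wordMatrix P.shT N (concat s V U) with hy
  set G := braidOp P.shS α β N m s with hG
  obtain ⟨Gi, hGi⟩ := (isUnit_braidOp (N := N) P.shS hu m s).exists_right_inv
  have hGi' : Gi * G = 1 := _root_.mul_eq_one_comm.1 hGi
  have hGx : G.map P.ι * x = y * G.map P.c := by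
    rw [hG, hx, braidOp_wordMatrix hE hU hV (by omega), hy]
    congr 1
    exact wordMatrix_congr _ fun k hk => interleave_eq_concat m s U V (by omega)
  have hyx : y = G.map P.ι * x * Gi.map P.c := by
    rw [hGx, mul_assoc, ← Matrix.map_mul, hGi, Matrix.map_one _ (map_zero _) (map_one _), mul_one]
  have hGz : IsZeroWeight G := isZeroWeight_braidOp P.shS α β m s
  have hGiz : IsZeroWeight Gi := hGz.of_mul_eq_one hGi hGi'
  have hAz : IsZeroWeight A := isZeroWeight_blockAntisymmetrizer S _ _
  have hA'G : ∀ i j, A' * flipOp S n N j = -A' →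
      (1 - flipOp S n N j) * G * (1 + flipOp S n N i) = 0 →
      A' * G * flipOp S n N i = -(A' * G) := fun i j hj h => by
    have : A' * G * (1 + flipOp S n N i) = 0 := by
      rw [← mul_one_sub_flipOp hj, mul_assoc, mul_assoc, ← mul_assoc (1 - _), h, mul_zero]
    rw [mul_add, mul_one] at this
    exact (neg_eq_of_add_eq_zero_right this).symm
  -- The braid operator carries tensors symmetric in a neighbouring pair of one block to tensors
  -- symmetric in the corresponding pair, which `A'` kills.
  have hAG : A' * G * A = A' * G := by
    refine mul_map_blockAntisymmetrizer (RingHom.id (Matrix (Fin N → Fin n) (Fin N → Fin n) S)) _ _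
      (fun k hk => ?_) fun k hk => ?_
    · refine hA'G _ (s + k) (blockAntisymmetrizer_mul_flipOp_right S _ _ hk) ?_
      rw [zero_add]
      exact one_sub_flipOp_mul_braidOp P.shS hL hk (by omega)
    · refine hA'G _ (0 + k) (blockAntisymmetrizer_mul_flipOp_left S _ _ (by omega) hk) ?_
      rw [zero_add]
      exact one_sub_flipOp_mul_braidOp' P.shS hR hk (by omega)
  have hP : permOp S n (blockSwap hN) * permOp S n (blockSwap hN)⁻¹ = 1 := by
    rw [← permOp_mul, mul_inv_cancel, permOp_one]
  have hP' : permOp S n (blockSwap hN)⁻¹ * permOp S n (blockSwap hN) = 1 := by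
    rw [← permOp_mul, inv_mul_cancel, permOp_one]
  have hcor : A * Gi * A' = A * Gi := corner_inverse hGi hP hP'
    (blockAntisymmetrizer_mul_self S _ _ (by omega)) (permOp_blockSwap_mul S hN) hAG
  -- The operator `G` need not intertwine the antisymmetrizers, so `B` may differ from `A`. The
  -- relations `hBA` and `hAB` say that the two idempotents have the same kernel, and this is enough
  -- for the traces.
  set B := Gi * A' * G with hB
  have hBA : B * A = B := by rw [hB, mul_assoc Gi, mul_assoc Gi, hAG]
  have hAB : A * B = A := by rw [hB, ← mul_assoc, ← mul_assoc, hcor, mul_assoc, hGi', mul_one]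
  have h1 : weightTrace μ (A.map P.ι * x) = weightTrace μ ((A' * G).map P.ι * x * Gi.map P.ι) := by
    rw [← weightTrace_mul_comm P μ hGiz, ← mul_assoc, ← Matrix.map_mul, ← mul_assoc, ← hB]
    calc weightTrace μ (A.map P.ι * x) = weightTrace μ (A.map P.ι * (B.map P.ι * x)) := by
          rw [← mul_assoc, ← Matrix.map_mul, hAB]
      _ = weightTrace μ (B.map P.ι * x * A.map P.ι) := weightTrace_mul_comm P μ hAz _
      _ = weightTrace μ (B.map P.ι * (A.map P.ι * x * A.map P.ι)) := by
          rw [← mul_assoc, ← mul_assoc, ← Matrix.map_mul, hBA]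
      _ = weightTrace μ (B.map P.ι * x) := by rw [hS, ← mul_assoc, ← Matrix.map_mul, hBA]
  -- The two traces now differ only in the last factor, which is `Gi` under ι in one and under `P.c`
  -- in the other.
  rw [h1, hyx, ← mul_assoc, ← mul_assoc, ← Matrix.map_mul, ← neg_sub]
  exact neg_mem (weightTrace_mul_sub_mem hJ μ Gi _)

end Trace

end DynamicalElliptic
end

noncomputable section
namespace DynamicalElliptic
open Matrix PowerSeries TensorProduct
open Finset.HasAntidiagonal (antidiagonal mem_antidiagonal)

/-! ### Linear functoriality of completed tensor products -/

section Level
variable (R : Type*) [Ring R] [Algebra ℂ⟦X⟧ R] (N : ℕ)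

/-- The quotient `R / ℏᴺ R`, as a complex vector space. -/
def Level : Type _ := R ⧸ hbarIdeal R N

instance : AddCommGroup (Level R N) := inferInstanceAs (AddCommGroup (R ⧸ hbarIdeal R N))

instance : Module ℂ⟦X⟧ (Level R N) := inferInstanceAs (Module ℂ⟦X⟧ (R ⧸ hbarIdeal R N))

instance : Module ℂ (Level R N) := Module.compHom _ (PowerSeries.C : ℂ →+* ℂ⟦X⟧)

/-- The projection to `R / ℏᴺ R`. -/
def toLevel : R →ₗ[ℂ⟦X⟧] Level R N := (hbarIdeal R N).mkQ.restrictScalars ℂ⟦X⟧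

variable {R N}

lemma complex_smul_level (z : ℂ) (x : Level R N) : z • x = (PowerSeries.C z : ℂ⟦X⟧) • x := by
  with_reducible_and_instances rfl

lemma toLevel_surjective : Function.Surjective (toLevel R N) := fun y =>
  Submodule.Quotient.mk_surjective (hbarIdeal R N) y

lemma toLevel_X_pow_smul {m : ℕ} (h : N ≤ m) (r : R) :
    toLevel R N ((PowerSeries.X : ℂ⟦X⟧) ^ m • r) = 0 :=
  (Submodule.Quotient.mk_eq_zero _).2 (hbarIdeal_anti R h (mem_hbarIdeal.2 ⟨r, rfl⟩))

/-- The coefficients of `c` from degree `N - b` on contribute multiples of ℏᴺ, which vanish at level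
`N`. -/
lemma toLevel_X_pow_smul_smul (c : ℂ⟦X⟧) {b : ℕ} (hb : b < N) (r : R) :
    toLevel R N ((PowerSeries.X : ℂ⟦X⟧) ^ b • c • r)
      = ∑ a ∈ Finset.range (N - b),
        PowerSeries.coeff a c • toLevel R N ((PowerSeries.X : ℂ⟦X⟧) ^ (a + b) • r) := by
  have h : c = ∑ a ∈ Finset.range (N - b), PowerSeries.C (PowerSeries.coeff a c) * PowerSeries.X ^ a
      + PowerSeries.X ^ (N - b) * PowerSeries.mk fun i => PowerSeries.coeff (i + (N - b)) c := by
    ext m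
    rw [map_add, map_sum, PowerSeries.coeff_X_pow_mul']
    simp only [PowerSeries.coeff_C_mul_X_pow, PowerSeries.coeff_mk]
    rw [Finset.sum_ite_eq]
    by_cases hm : m < N - b
    · rw [if_pos (Finset.mem_range.2 hm), if_neg (by omega), add_zero]
    · rw [if_neg (by simpa using hm), if_pos (by omega), zero_add, Nat.sub_add_cancel (by omega)]
  conv_lhs => rw [h, add_smul, smul_add, map_add, mul_smul, smul_smul _ (PowerSeries.X ^ (N - b)),
    ← pow_add, toLevel_X_pow_smul (m := b + (N - b)) (by omega), add_zero, Finset.sum_smul, Finset.smul_sum, map_sum]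
  refine Finset.sum_congr rfl fun a _ => ?_
  rw [complex_smul_level, ← map_smul, smul_smul, smul_smul, pow_add]
  congr 2
  ring

variable (K : Type*) [CommRing K] [Algebra ℂ K] (N)

/-- The map `K⟦ℏ⟧ ⊗ R → K ⊗_ℂ (R / ℏᴺ R)`. -/
def levelHom : K⟦X⟧ ⊗[ℂ⟦X⟧] R →+ K ⊗[ℂ] Level R N :=
  TensorProduct.liftAddHom
    (AddMonoidHom.mk' (fun f => AddMonoidHom.mk'
        (fun r => ∑ i ∈ Finset.range N,
          PowerSeries.coeff i f ⊗ₜ[ℂ] toLevel R N ((PowerSeries.X : ℂ⟦X⟧) ^ i • r))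
        fun r r' => by simp only [smul_add, map_add, tmul_add, Finset.sum_add_distrib])
      fun f f' => by
        ext r
        simp [map_add, add_tmul, Finset.sum_add_distrib])
    fun c f r => by
      simp only [AddMonoidHom.mk'_apply]
      -- To see that the map is balanced over ℂ⟦ℏ⟧, expand both sides as the sum over a + b < N of
      -- c_a f_b ⊗ ℏ^{a+b} r.
      have e₁ : ∀ i, PowerSeries.coeff i (c • f) = ∑ p ∈ antidiagonal i,
          PowerSeries.coeff p.1 c • PowerSeries.coeff p.2 f := fun i => by
        rw [Algebra.smul_def, PowerSeries.coeff_mul]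
        simp [PowerSeries.algebraMap_apply'', Algebra.smul_def]
      have e₂ : ∀ b ∈ Finset.range N, PowerSeries.coeff b f
            ⊗ₜ[ℂ] toLevel R N ((PowerSeries.X : ℂ⟦X⟧) ^ b • c • r)
          = ∑ a ∈ Finset.range (N - b), (PowerSeries.coeff a c • PowerSeries.coeff b f)
            ⊗ₜ[ℂ] toLevel R N ((PowerSeries.X : ℂ⟦X⟧) ^ (a + b) • r) := fun b hb => by
        rw [toLevel_X_pow_smul_smul c (Finset.mem_range.1 hb), tmul_sum]
        simp only [tmul_smul, smul_tmul']
      simp only [e₁, sum_tmul]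
      rw [Finset.sum_congr rfl e₂, Finset.sum_sigma', Finset.sum_sigma']
      refine Finset.sum_bij' (fun x _ => ⟨x.2.2, x.2.1⟩) (fun x _ => ⟨x.2 + x.1, (x.2, x.1)⟩)
        ?_ ?_ ?_ ?_ ?_
      · rintro ⟨i, a, b⟩ hx
        simp only [Finset.mem_sigma, Finset.mem_range, mem_antidiagonal] at hx ⊢
        omega
      · rintro ⟨b, a⟩ hx
        simp only [Finset.mem_sigma, Finset.mem_range, mem_antidiagonal, and_true] at hx ⊢
        omega
      · rintro ⟨i, a, b⟩ hx
        simp only [Finset.mem_sigma, Finset.mem_range, mem_antidiagonal] at hx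
        obtain ⟨-, rfl⟩ := hx
        rfl
      · rintro ⟨b, a⟩ hx
        rfl
      · rintro ⟨i, a, b⟩ hx
        simp only [Finset.mem_sigma, Finset.mem_range, mem_antidiagonal] at hx
        obtain ⟨-, rfl⟩ := hx
        rfl

variable {K N}

lemma levelHom_tmul (f : K⟦X⟧) (r : R) :
    levelHom N K (f ⊗ₜ[ℂ⟦X⟧] r) = ∑ i ∈ Finset.range N,
      PowerSeries.coeff i f ⊗ₜ[ℂ] toLevel R N ((PowerSeries.X : ℂ⟦X⟧) ^ i • r) := rfl

lemma levelHom_X_pow_smul (x : K⟦X⟧ ⊗[ℂ⟦X⟧] R) :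
    levelHom N K ((PowerSeries.X : ℂ⟦X⟧) ^ N • x) = 0 := by
  induction x with
  | zero => rw [smul_zero, map_zero]
  | add x y hx hy => rw [smul_add, map_add, hx, hy, add_zero]
  | tmul f r =>
    rw [← tmul_smul, levelHom_tmul]
    refine Finset.sum_eq_zero fun i _ => ?_
    rw [smul_smul, ← pow_add, toLevel_X_pow_smul (Nat.le_add_left _ _), tmul_zero]

lemma levelHom_C (k : K) (r : R) :
    levelHom N K ((PowerSeries.C k) ⊗ₜ[ℂ⟦X⟧] r) = k ⊗ₜ[ℂ] toLevel R N r := by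
  rw [levelHom_tmul]
  obtain _ | N := N
  -- For `N = 0` the sum has no term for the constant coefficient, but R/ℏ⁰R is zero.
  · rw [Finset.range_zero, Finset.sum_empty, ← one_smul ℂ⟦X⟧ r,
      ← pow_zero (PowerSeries.X : ℂ⟦X⟧), toLevel_X_pow_smul le_rfl, tmul_zero]
  · rw [Finset.sum_range_succ', Finset.sum_eq_zero fun i _ => by
      rw [PowerSeries.coeff_C, if_neg (Nat.succ_ne_zero i), zero_tmul]]
    simp

/-- Additive maps from `T / ℏᴺ T`, `T = K⟦ℏ⟧ ⊗ R`, are determined by the classes of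
`k ⊗ r` with `k ∈ K`. -/
lemma mk_C_tmul_induction {p : (K⟦X⟧ ⊗[ℂ⟦X⟧] R) ⧸ hbarIdeal (K⟦X⟧ ⊗[ℂ⟦X⟧] R) N → Prop}
    (hC : ∀ (k : K) (r : R), p (Ideal.Quotient.mk _ ((PowerSeries.C k) ⊗ₜ[ℂ⟦X⟧] r)))
    (hadd : ∀ x y, p x → p y → p (x + y)) (x) : p x := by
  obtain ⟨x, rfl⟩ := Ideal.Quotient.mk_surjective x
  have h0 : p 0 := by simpa using hC 0 0
  induction x with
  | zero => exact h0
  | add x y hx hy => rw [map_add]; exact hadd _ _ hx hy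
  | tmul f r =>
    -- Modulo ℏᴺ only finitely many coefficients of `f` survive, and their powers of ℏ can be moved
    -- into the factor `R`.
    have h : f = ∑ i ∈ Finset.range N, ((PowerSeries.X : ℂ⟦X⟧) ^ i) • PowerSeries.C (PowerSeries.coeff i f)
        + ((PowerSeries.X : ℂ⟦X⟧) ^ N) • PowerSeries.mk fun i => PowerSeries.coeff (i + N) f := by
      ext m
      simp only [Algebra.smul_def, map_pow, PowerSeries.algebraMap_apply'', PowerSeries.map_X]
      rw [map_add, map_sum, PowerSeries.coeff_X_pow_mul']
      simp only [mul_comm (PowerSeries.X ^ _) (PowerSeries.C _), PowerSeries.coeff_C_mul_X_pow,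
        PowerSeries.coeff_mk]
      rw [Finset.sum_ite_eq]
      by_cases hm : m < N
      · rw [if_pos (Finset.mem_range.2 hm), if_neg (by omega), add_zero]
      · rw [if_neg (by simpa using hm), if_pos (by omega), zero_add, Nat.sub_add_cancel (by omega)]
    have h' : Ideal.Quotient.mk (hbarIdeal (K⟦X⟧ ⊗[ℂ⟦X⟧] R) N) (f ⊗ₜ[ℂ⟦X⟧] r)
        = ∑ i ∈ Finset.range N, Ideal.Quotient.mk _
          ((PowerSeries.C (PowerSeries.coeff i f)) ⊗ₜ[ℂ⟦X⟧] ((PowerSeries.X : ℂ⟦X⟧) ^ i • r)) := by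
      conv_lhs => rw [h]
      rw [add_tmul, ← smul_tmul', map_add, sum_tmul, map_sum,
        Ideal.Quotient.eq_zero_iff_mem.2 (mem_hbarIdeal.2 ⟨_, rfl⟩), add_zero]
      simp only [smul_tmul]
    rw [h']
    clear h'
    induction Finset.range N using Finset.induction_on with
    | empty => simpa using h0
    | insert a s ha ih => rw [Finset.sum_insert ha]; exact hadd _ _ (hC _ _) ih

variable (N) in
/-- The class of `k ⊗ r` in `T / ℏᴺ T`, `T = K⟦ℏ⟧ ⊗ R`. -/
def classHom (k : K) : R →+ (K⟦X⟧ ⊗[ℂ⟦X⟧] R) ⧸ hbarIdeal (K⟦X⟧ ⊗[ℂ⟦X⟧] R) N where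
  toFun r := Ideal.Quotient.mk _ ((PowerSeries.C k) ⊗ₜ[ℂ⟦X⟧] r)
  map_zero' := by rw [tmul_zero, map_zero]
  map_add' r r' := by rw [tmul_add, map_add]

lemma classHom_add (k k' : K) (r : R) :
    classHom N (k + k') r = classHom N k r + classHom N k' r := by
  simp only [classHom, AddMonoidHom.coe_mk, ZeroHom.coe_mk]
  rw [map_add, add_tmul, map_add]

lemma classHom_smul (c : ℂ) (k : K) (r : R) :
    classHom N (c • k) r = classHom N k ((PowerSeries.C c : ℂ⟦X⟧) • r) := by
  simp only [classHom, AddMonoidHom.coe_mk, ZeroHom.coe_mk]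
  rw [← smul_tmul]
  congr 2
  rw [Algebra.smul_def, map_mul, Algebra.smul_def, PowerSeries.algebraMap_apply'',
    PowerSeries.map_C]

lemma quotient_addHom_ext {M : Type*} [AddCommGroup M]
    {f g : (K⟦X⟧ ⊗[ℂ⟦X⟧] R) ⧸ hbarIdeal (K⟦X⟧ ⊗[ℂ⟦X⟧] R) N →+ M}
    (h : ∀ (k : K) (r : R), f (classHom N k r) = g (classHom N k r)) (x) : f x = g x := by
  induction x using mk_C_tmul_induction with
  | hC k r => exact h k r
  | hadd x y hx hy => rw [map_add, map_add, hx, hy]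

variable (R N K) in
/-- The isomorphism from `T / ℏᴺ T`, `T = K⟦ℏ⟧ ⊗ R`, to `K ⊗_ℂ (R / ℏᴺ R)`. -/
def quotLevelHom : (K⟦X⟧ ⊗[ℂ⟦X⟧] R) ⧸ hbarIdeal (K⟦X⟧ ⊗[ℂ⟦X⟧] R) N →+ K ⊗[ℂ] Level R N :=
  QuotientAddGroup.lift (Submodule.toAddSubgroup (hbarIdeal (K⟦X⟧ ⊗[ℂ⟦X⟧] R) N)) (levelHom N K)
    fun x hx => by
      obtain ⟨y, rfl⟩ := mem_hbarIdeal.1 hx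
      exact levelHom_X_pow_smul y

lemma quotLevelHom_mk_C (k : K) (r : R) :
    quotLevelHom R N K (classHom N k r)
      = k ⊗ₜ[ℂ] toLevel R N r :=
  levelHom_C k r

variable (R N K) in
/-- The inverse of `quotLevelHom`. -/
def levelInv : K ⊗[ℂ] Level R N →+ (K⟦X⟧ ⊗[ℂ⟦X⟧] R) ⧸ hbarIdeal (K⟦X⟧ ⊗[ℂ⟦X⟧] R) N :=
  TensorProduct.liftAddHom
    (AddMonoidHom.mk' (fun k =>
        (QuotientAddGroup.lift (Submodule.toAddSubgroup (hbarIdeal R N)) (classHom N k)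
          fun r hr => by
            obtain ⟨y, rfl⟩ := mem_hbarIdeal.1 hr
            exact Ideal.Quotient.eq_zero_iff_mem.2 (mem_hbarIdeal.2
              ⟨(PowerSeries.C k) ⊗ₜ y, (tmul_smul _ _ _).symm⟩) :
          Level R N →+ (K⟦X⟧ ⊗[ℂ⟦X⟧] R) ⧸ hbarIdeal (K⟦X⟧ ⊗[ℂ⟦X⟧] R) N))
      fun k k' => by
        ext r
        obtain ⟨r, rfl⟩ := toLevel_surjective r
        exact classHom_add k k' r)
    fun c k r => by
      obtain ⟨r, rfl⟩ := toLevel_surjective r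
      rw [complex_smul_level, ← map_smul]
      exact classHom_smul c k r

lemma levelInv_tmul (k : K) (r : R) :
    levelInv R N K (k ⊗ₜ[ℂ] toLevel R N r)
      = classHom N k r := rfl

lemma levelInv_quotLevelHom (x) : levelInv R N K (quotLevelHom R N K x) = x :=
  quotient_addHom_ext (f := (levelInv R N K).comp (quotLevelHom R N K)) (g := AddMonoidHom.id _)
    (fun k r => by
      rw [AddMonoidHom.comp_apply, quotLevelHom_mk_C, levelInv_tmul, AddMonoidHom.id_apply]) x

lemma quotLevelHom_levelInv (y) : quotLevelHom R N K (levelInv R N K y) = y := by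
  induction y with
  | zero => rw [map_zero, map_zero]
  | add x y hx hy => rw [map_add, map_add, hx, hy]
  | tmul k r =>
    obtain ⟨r, rfl⟩ := toLevel_surjective r
    rw [levelInv_tmul, quotLevelHom_mk_C]

end Level

/-! ### Linear maps of functions acting on functions with values in `R` -/

section LinMap
variable {R : Type*} [Ring R] [Algebra ℂ⟦X⟧ R] {K : Type*} [CommRing K] [Algebra ℂ K]
  {K' : Type*} [CommRing K'] [Algebra ℂ K'] {K'' : Type*} [CommRing K''] [Algebra ℂ K'']

/-- The map induced by a linear map of functions on functions with values in `R / ℏᴺ R`. -/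
def levelMap (φ : K →ₗ[ℂ] K') (N : ℕ) :
    (K⟦X⟧ ⊗[ℂ⟦X⟧] R) ⧸ hbarIdeal (K⟦X⟧ ⊗[ℂ⟦X⟧] R) N →+
      (K'⟦X⟧ ⊗[ℂ⟦X⟧] R) ⧸ hbarIdeal (K'⟦X⟧ ⊗[ℂ⟦X⟧] R) N :=
  ((levelInv R N K').comp (φ.rTensor (Level R N)).toAddMonoidHom).comp (quotLevelHom R N K)

lemma levelMap_mk_C (φ : K →ₗ[ℂ] K') (N : ℕ) (k : K) (r : R) :
    levelMap φ N (classHom N k r)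
      = classHom N (φ k) r := by
  change levelInv R N K' (φ.rTensor (Level R N) (quotLevelHom R N K _)) = _
  rw [quotLevelHom_mk_C, LinearMap.rTensor_tmul, levelInv_tmul]

/-- The projection of a function with values in `R` to `T / ℏᴺ T`. -/
def levelProj (N : ℕ) :
    CompletedTensor K R →+* (K⟦X⟧ ⊗[ℂ⟦X⟧] R) ⧸ hbarIdeal (K⟦X⟧ ⊗[ℂ⟦X⟧] R) N :=
  (Pi.evalRingHom _ N).comp (hbarFamilies (K⟦X⟧ ⊗[ℂ⟦X⟧] R)).subtype

lemma completedTensor_ext {x y : CompletedTensor K R} (h : ∀ N, levelProj N x = levelProj N y) :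
    x = y :=
  Subtype.ext (funext h)

lemma levelProj_ofFun_C (N : ℕ) (k : K) :
    levelProj N (ofFun (R := R) (PowerSeries.C k)) = classHom N k 1 := rfl

lemma levelProj_ofAlg (N : ℕ) (r : R) :
    levelProj N (ofAlg (K := K) r) = classHom N 1 r := by
  rw [classHom, AddMonoidHom.coe_mk, ZeroHom.coe_mk, map_one]
  rfl

lemma classHom_mul (N : ℕ) (k k' : K) (r r' : R) :
    classHom N k r * classHom N k' r' = classHom N (k * k') (r * r') := by
  simp only [classHom, AddMonoidHom.coe_mk, ZeroHom.coe_mk]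
  rw [← map_mul, Algebra.TensorProduct.tmul_mul_tmul, ← map_mul]

/-- A linear map of functions, applied to functions with values in `R`. -/
def linMap (φ : K →ₗ[ℂ] K') : CompletedTensor K R →+ CompletedTensor K' R where
  toFun x := ⟨fun N => levelMap φ N (levelProj N x), fun M N h => by
    have e : levelProj M x = Ideal.Quotient.factor (hbarIdeal_anti _ h) (levelProj N x) :=
      (x.2 M N h).symm
    refine Eq.trans ?_ (congrArg (levelMap φ M) e).symm
    exact quotient_addHom_ext
      (f := (Ideal.Quotient.factor (hbarIdeal_anti _ h)).toAddMonoidHom.comp (levelMap φ N))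
      (g := (levelMap φ M).comp (Ideal.Quotient.factor (hbarIdeal_anti _ h)).toAddMonoidHom)
      (fun k r => by
        rw [AddMonoidHom.comp_apply, AddMonoidHom.comp_apply, levelMap_mk_C]
        exact (levelMap_mk_C φ M k r).symm) _⟩
  map_zero' := completedTensor_ext fun N => map_zero (levelMap φ N)
  map_add' x y := completedTensor_ext fun N => map_add (levelMap φ N) _ _

lemma levelProj_linMap (φ : K →ₗ[ℂ] K') (x : CompletedTensor K R) (N : ℕ) :
    levelProj N (linMap φ x) = levelMap φ N (levelProj N x) := rfl

lemma linMap_comp (ψ : K' →ₗ[ℂ] K'') (φ : K →ₗ[ℂ] K') (x : CompletedTensor K R) :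
    linMap (ψ ∘ₗ φ) x = linMap ψ (linMap φ x) :=
  completedTensor_ext fun N => quotient_addHom_ext (f := levelMap (ψ ∘ₗ φ) N)
    (g := (levelMap ψ N).comp (levelMap φ N))
    (fun k r => by
      rw [AddMonoidHom.comp_apply, levelMap_mk_C, levelMap_mk_C, levelMap_mk_C]; rfl) _

lemma linMap_add (φ ψ : K →ₗ[ℂ] K') (x : CompletedTensor K R) :
    linMap (φ + ψ) x = linMap φ x + linMap ψ x :=
  completedTensor_ext fun N => quotient_addHom_ext (f := levelMap (φ + ψ) N)
    (g := levelMap φ N + levelMap ψ N)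
    (fun k r => by
      rw [AddMonoidHom.add_apply, levelMap_mk_C, levelMap_mk_C, levelMap_mk_C,
        LinearMap.add_apply, classHom_add]) _

lemma linMap_id (x : CompletedTensor K R) : linMap LinearMap.id x = x :=
  completedTensor_ext fun N => quotient_addHom_ext (f := levelMap LinearMap.id N)
    (g := AddMonoidHom.id _) (fun k r => levelMap_mk_C _ N k r) _

lemma linMap_algHom (φ : K →ₐ[ℂ] K') (x : CompletedTensor K R) :
    linMap φ.toLinearMap x = tensorMap (mapHbar φ) x :=
  completedTensor_ext fun N => quotient_addHom_ext (f := levelMap φ.toLinearMap N)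
    (g := (Ideal.quotientMap (hbarIdeal (K'⟦X⟧ ⊗[ℂ⟦X⟧] R) N) _
      (hbarIdeal_le_comap (Algebra.TensorProduct.map (mapHbar φ) (AlgHom.id ℂ⟦X⟧ R)) N)).toAddMonoidHom)
    (fun k r => by
      rw [levelMap_mk_C]
      change Ideal.Quotient.mk _ _ = Ideal.Quotient.mk _
        ((PowerSeries.map (φ : K →+* K') (PowerSeries.C k)) ⊗ₜ[ℂ⟦X⟧] r)
      rw [PowerSeries.map_C]
      rfl) _

lemma linMap_mulLeft (k : K) (x : CompletedTensor K R) :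
    linMap (LinearMap.mulLeft ℂ k) x = ofFun (PowerSeries.C k) * x :=
  completedTensor_ext fun N => by
    rw [map_mul, levelProj_ofFun_C]
    exact quotient_addHom_ext (f := levelMap (LinearMap.mulLeft ℂ k) N)
      (g := AddMonoidHom.mulLeft (classHom N k 1))
      (fun k' r => by
        rw [levelMap_mk_C, AddMonoidHom.coe_mulLeft, classHom_mul, one_mul]; rfl) _

/-- A map of the function factor commutes with right multiplication by `R`. Hence a merely linear
left inverse of a restriction map can transport membership in a left ideal generated by elements of
`R`. -/
lemma linMap_mul_ofAlg (φ : K →ₗ[ℂ] K') (x : CompletedTensor K R) (r : R) :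
    linMap φ (x * ofAlg r) = linMap φ x * ofAlg r :=
  completedTensor_ext fun N => by
    rw [levelProj_linMap, RingHom.map_mul, RingHom.map_mul, levelProj_linMap,
      levelProj_ofAlg, levelProj_ofAlg]
    exact quotient_addHom_ext (f := (levelMap φ N).comp (AddMonoidHom.mulRight (classHom N 1 r)))
      (g := (AddMonoidHom.mulRight (classHom N 1 r)).comp (levelMap φ N))
      (fun k' r' => by
        rw [AddMonoidHom.comp_apply, AddMonoidHom.comp_apply, AddMonoidHom.mulRight_apply,
          AddMonoidHom.mulRight_apply, classHom_mul, levelMap_mk_C, levelMap_mk_C, classHom_mul,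
          mul_one, mul_one]) _

/-- Jointly injective linear maps of functions are jointly injective on functions with values
in `R`. -/
theorem eq_zero_of_linMap {ι : Type*} (φ : ι → K →ₗ[ℂ] K') (hφ : ∀ k, (∀ i, φ i k = 0) → k = 0)
    {x : CompletedTensor K R} (hx : ∀ i, linMap (φ i) x = 0) : x = 0 := by
  classical
  refine completedTensor_ext fun N => ?_
  suffices h : quotLevelHom R N K (levelProj N x) = 0 by
    rw [← levelInv_quotLevelHom (levelProj N x), h, map_zero, map_zero]
  have h₁ : ∀ i, (φ i).rTensor (Level R N) (quotLevelHom R N K (levelProj N x)) = 0 := fun i => by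
    have : levelInv R N K' ((φ i).rTensor (Level R N) (quotLevelHom R N K (levelProj N x))) = 0 :=
      (congrArg (levelProj N) (hx i)).trans (map_zero _)
    rw [← quotLevelHom_levelInv ((φ i).rTensor (Level R N) _), this, map_zero]
  generalize quotLevelHom R N K (levelProj N x) = y at h₁
  -- Coordinates in a basis of R/ℏᴺR reduce the claim to scalar functions. The index family may be
  -- infinite, so the argument is made coordinate by coordinate with all the maps at once.
  let b := Module.Basis.ofVectorSpace ℂ (Level R N)
  have h₂ : ∀ i j (y : K ⊗[ℂ] Level R N), TensorProduct.equivFinsuppOfBasisRight b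
      ((φ i).rTensor (Level R N) y) j = φ i (TensorProduct.equivFinsuppOfBasisRight b y j) :=
    fun i j y => by
      induction y with
      | zero => simp
      | add x y hx hy => simp only [map_add, Finsupp.add_apply, hx, hy]
      | tmul k r => simp
  refine (TensorProduct.equivFinsuppOfBasisRight b).injective (Finsupp.ext fun j => ?_)
  rw [map_zero, Finsupp.zero_apply]
  refine hφ _ fun i => ?_
  rw [← h₂, h₁ i, map_zero, Finsupp.zero_apply]

/-- Jointly injective homomorphisms of functions are jointly injective on functions with values
in `R`. -/
theorem eq_of_tensorMap {ι : Type*} (φ : ι → K →ₐ[ℂ] K') (hφ : ∀ k, (∀ i, φ i k = 0) → k = 0)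
    {x y : CompletedTensor K R} (h : ∀ i, tensorMap (mapHbar (φ i)) x = tensorMap (mapHbar (φ i)) y) :
    x = y := by
  refine sub_eq_zero.1 (eq_zero_of_linMap (fun i => (φ i).toLinearMap) hφ fun i => ?_)
  rw [linMap_algHom, map_sub, h, sub_self]

end LinMap

end DynamicalElliptic
end

noncomputable section
namespace DynamicalElliptic
open Matrix PowerSeries TensorProduct
open Finset.HasAntidiagonal (antidiagonal mem_antidiagonal)

/-! ### Naturality of translations -/

section Naturality
variable {K : Type*} [CommRing K] [Algebra ℂ K] {K' : Type*} [CommRing K'] [Algebra ℂ K']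
  {K'' : Type*} [CommRing K''] [Algebra ℂ K'']

lemma map_divPow {D : Derivation ℂ K K} {D' : Derivation ℂ K' K'} (φ : K →ₐ[ℂ] K')
    (h : ∀ x, φ (D x) = D' (φ x)) (i : ℕ) (x : K) : φ (divPow D i x) = divPow D' i (φ x) := by
  simp only [divPow, LinearMap.smul_apply, map_smul]
  congr 1
  induction i generalizing x with
  | zero => rfl
  | succ i ih => rw [pow_succ, pow_succ, Module.End.mul_apply, Module.End.mul_apply, ih]
                 exact congrArg _ (h x)

lemma coeff_mapHbar (φ : K →ₐ[ℂ] K') (f : K⟦X⟧) (m : ℕ) :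
    PowerSeries.coeff m (mapHbar φ f) = φ (PowerSeries.coeff m f) :=
  PowerSeries.coeff_map _ _ _

lemma mapHbar_C (φ : K →ₐ[ℂ] K') (k : K) :
    mapHbar φ (PowerSeries.C k) = PowerSeries.C (φ k) :=
  PowerSeries.map_C _ _

lemma mapHbar_comp (ψ : K' →ₐ[ℂ] K'') (φ : K →ₐ[ℂ] K') (f : K⟦X⟧) :
    mapHbar (ψ.comp φ) f = mapHbar ψ (mapHbar φ f) := by
  ext m
  rw [coeff_mapHbar, coeff_mapHbar, coeff_mapHbar]
  rfl

lemma mapHbar_expShift {D : Derivation ℂ K K} {D' : Derivation ℂ K' K'} (φ : K →ₐ[ℂ] K')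
    (h : ∀ x, φ (D x) = D' (φ x)) (f : K⟦X⟧) :
    mapHbar φ (expShift D f) = expShift D' (mapHbar φ f) := by
  ext m
  rw [coeff_mapHbar, coeff_expShift, coeff_expShift, map_sum]
  simp only [map_divPow φ h, coeff_mapHbar]

lemma expShift_comm {D D' : Derivation ℂ K K} (h : ∀ x, D (D' x) = D' (D x)) (f : K⟦X⟧) :
    expShift D (expShift D' f) = expShift D' (expShift D f) := by
  have h₁ : Commute (D : K →ₗ[ℂ] K) D' := LinearMap.ext h
  have := expShift_add h₁
  rw [add_comm, expShift_add h₁.symm] at this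
  exact (congrArg (fun ψ => ψ f) this).symm

variable {R : Type*} [Ring R] [Algebra ℂ⟦X⟧ R]

lemma tensorMap_comp (ψ : K'⟦X⟧ →ₐ[ℂ⟦X⟧] K''⟦X⟧) (φ : K⟦X⟧ →ₐ[ℂ⟦X⟧] K'⟦X⟧)
    (x : CompletedTensor K R) : tensorMap (ψ.comp φ) x = tensorMap ψ (tensorMap φ x) := by
  have : Algebra.TensorProduct.map (ψ.comp φ) (AlgHom.id ℂ⟦X⟧ R)
      = (Algebra.TensorProduct.map ψ (AlgHom.id ℂ⟦X⟧ R)).comp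
        (Algebra.TensorProduct.map φ (AlgHom.id ℂ⟦X⟧ R)) := by
    rw [← Algebra.TensorProduct.map_comp, AlgHom.id_comp]
  rw [tensorMap, this, hbarMap_comp]
  rfl

lemma tensorMap_id (x : CompletedTensor K R) : tensorMap (AlgHom.id ℂ⟦X⟧ K⟦X⟧) x = x := by
  rw [tensorMap, Algebra.TensorProduct.map_id, hbarMap_id]
  rfl

lemma tensorMap_ofFun (φ : K⟦X⟧ →ₐ[ℂ⟦X⟧] K'⟦X⟧) (f : K⟦X⟧) :
    tensorMap (R := R) φ (ofFun f) = ofFun (φ f) :=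
  completedTensor_ext fun _ => congrArg (Ideal.Quotient.mk _)
    (Algebra.TensorProduct.map_tmul φ (AlgHom.id ℂ⟦X⟧ R) f 1)

lemma tensorMap_ofAlg (φ : K⟦X⟧ →ₐ[ℂ⟦X⟧] K'⟦X⟧) (r : R) :
    tensorMap φ (ofAlg r) = ofAlg r :=
  completedTensor_ext fun _ => by
    change Ideal.Quotient.mk _ (φ 1 ⊗ₜ[ℂ⟦X⟧] r) = Ideal.Quotient.mk _ (1 ⊗ₜ[ℂ⟦X⟧] r)
    rw [map_one]

variable (K R) in
/-- The canonical map from the tensor product to its completion. -/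
def ofTensor : K⟦X⟧ ⊗[ℂ⟦X⟧] R →+* CompletedTensor K R := toHbar

lemma ofTensor_tmul (f : K⟦X⟧) (r : R) :
    ofTensor K R (f ⊗ₜ[ℂ⟦X⟧] r) = ofFun f * ofAlg r := by
  have : f ⊗ₜ[ℂ⟦X⟧] r = (f ⊗ₜ[ℂ⟦X⟧] 1) * (1 ⊗ₜ[ℂ⟦X⟧] r) := by
    rw [Algebra.TensorProduct.tmul_mul_tmul, one_mul, mul_one]
  rw [this, map_mul]
  rfl

lemma ofFun_mul_comm (f : K⟦X⟧) (x : CompletedTensor K R) : ofFun f * x = x * ofFun f := by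
  refine completedTensor_ext fun N => ?_
  rw [RingHom.map_mul, RingHom.map_mul]
  obtain ⟨y, hy⟩ := Ideal.Quotient.mk_surjective (levelProj N x)
  rw [← hy]
  clear hy
  change Ideal.Quotient.mk _ (f ⊗ₜ[ℂ⟦X⟧] 1) * _ = _ * Ideal.Quotient.mk _ (f ⊗ₜ[ℂ⟦X⟧] 1)
  rw [← map_mul, ← map_mul]
  congr 1
  induction y with
  | zero => rw [mul_zero, zero_mul]
  | add a b ha hb => rw [mul_add, add_mul, ha, hb]
  | tmul g r => rw [Algebra.TensorProduct.tmul_mul_tmul, Algebra.TensorProduct.tmul_mul_tmul,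
      one_mul, mul_one, mul_comm]

end Naturality

/-! ### Families of commuting derivations -/

/-- Commuting derivations `∂/∂λ₁, …, ∂/∂λₙ` of an algebra of functions. -/
structure PartialDerivatives (n : ℕ) (K : Type*) [CommRing K] [Algebra ℂ K] where
  d : Fin n → Derivation ℂ K K
  comm : ∀ k l x, d k (d l x) = d l (d k x)

namespace PartialDerivatives
variable {n : ℕ} {K : Type*} [CommRing K] [Algebra ℂ K] (D : PartialDerivatives n K)
  {K' : Type*} [CommRing K'] [Algebra ℂ K'] (D' : PartialDerivatives n K')

/-- The directional derivative. -/
def dir (μ : Fin n → ℤ) : Derivation ℂ K K := ∑ k, μ k • D.d k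

lemma sum_der_apply {σ : Type*} (s : Finset σ) (E : σ → Derivation ℂ K K) (x : K) :
    (∑ k ∈ s, E k) x = ∑ k ∈ s, E k x := by
  change (Derivation.coeFnAddMonoidHom (∑ k ∈ s, E k)) x = _
  rw [map_sum, Finset.sum_apply]
  rfl

lemma dir_apply (μ : Fin n → ℤ) (x : K) : D.dir μ x = ∑ k, μ k • D.d k x :=
  sum_der_apply _ _ x

lemma dir_zero : D.dir 0 = 0 := by simp [dir]

lemma dir_add (μ ν : Fin n → ℤ) : D.dir (μ + ν) = D.dir μ + D.dir ν := by
  simp [dir, add_smul, Finset.sum_add_distrib]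

lemma dir_comm (μ ν : Fin n → ℤ) (x : K) : D.dir μ (D.dir ν x) = D.dir ν (D.dir μ x) := by
  simp only [dir_apply, map_sum, map_zsmul, Finset.smul_sum]
  rw [Finset.sum_comm]
  refine Finset.sum_congr rfl fun k _ => Finset.sum_congr rfl fun l _ => ?_
  rw [D.comm, smul_comm]

/-- Translations of scalar functions. -/
def shS : Translations n K⟦X⟧ where
  map μ := (expShift (D.dir μ) : K⟦X⟧ →+* K⟦X⟧)
  map_zero := by rw [dir_zero, expShift_zero]; rfl
  map_add μ ν := by
    rw [dir_add, expShift_add (LinearMap.ext (D.dir_comm μ ν))]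
    rfl

variable (R : Type*) [Ring R] [Algebra ℂ⟦X⟧ R]

/-- Translations of functions with values in `R`. -/
def shT : Translations n (CompletedTensor K R) where
  map μ := tensorMap (expShift (D.dir μ))
  map_zero := RingHom.ext fun x => by rw [dir_zero, expShift_zero, tensorMap_id]; rfl
  map_add μ ν := RingHom.ext fun x => by
    rw [dir_add, expShift_add (LinearMap.ext (D.dir_comm μ ν)), tensorMap_comp]
    rfl

end PartialDerivatives

/-! ### Shifts by Cartan elements -/

section Truncation
variable {B Q : Type*} [CommRing B] [Ring Q]

/-- A polynomial and its truncation differ by a multiple of Xᴺ, which `φ` kills. This makes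
evaluation of power series modulo ℏᴺ well defined by truncation. -/
lemma map_trunc_coe {N : ℕ} (φ : Polynomial B →+* Q) (h : φ Polynomial.X ^ N = 0)
    (p : Polynomial B) : φ (PowerSeries.trunc N (p : B⟦X⟧)) = φ p := by
  have hd : Polynomial.X ^ N ∣ p - PowerSeries.trunc N (p : B⟦X⟧) :=
    Polynomial.X_pow_dvd_iff.2 fun d hd => by
      rw [Polynomial.coeff_sub, PowerSeries.coeff_trunc, if_pos hd, Polynomial.coeff_coe, sub_self]
  obtain ⟨q, hq⟩ := hd
  have := congrArg φ hq
  rw [map_mul, map_pow, h, zero_mul, map_sub, sub_eq_zero] at this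
  exact this.symm

/-- Evaluation of power series at a nilpotent element is multiplicative. -/
lemma map_trunc_mul {N : ℕ} (φ : Polynomial B →+* Q) (h : φ Polynomial.X ^ N = 0) (F G : B⟦X⟧) :
    φ (PowerSeries.trunc N (F * G)) = φ (PowerSeries.trunc N F) * φ (PowerSeries.trunc N G) := by
  rw [← PowerSeries.trunc_trunc_mul_trunc, ← Polynomial.coe_mul, map_trunc_coe _ h, map_mul]

end Truncation

/-! ### Derivations of polynomial rings and the generating operator ∑ yₖ ∂/∂λₖ -/

section PolynomialDerivation
variable {n : ℕ} {K : Type*} [CommRing K] [Algebra ℂ K]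

/-- The homomorphism `p ↦ p + D(p) ε`, for `D` acting on the coefficients of polynomials. -/
def polyDualHom (D : Derivation ℂ K K) :
    MvPolynomial (Fin n) K →+* TrivSqZeroExt (MvPolynomial (Fin n) K) (MvPolynomial (Fin n) K) :=
  MvPolynomial.eval₂Hom (dualHom (MvPolynomial (Fin n) K) D)
    fun k => TrivSqZeroExt.inl (MvPolynomial.X k)

lemma polyDualHom_C (D : Derivation ℂ K K) (a : K) :
    polyDualHom D (MvPolynomial.C a : MvPolynomial (Fin n) K)
      = dualHom (MvPolynomial (Fin n) K) D a :=
  MvPolynomial.eval₂Hom_C _ _ _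

lemma polyDualHom_X (D : Derivation ℂ K K) (k : Fin n) :
    polyDualHom D (MvPolynomial.X k) = TrivSqZeroExt.inl (MvPolynomial.X k) :=
  MvPolynomial.eval₂Hom_X' _ _ _

lemma fst_polyDualHom (D : Derivation ℂ K K) (p : MvPolynomial (Fin n) K) :
    (polyDualHom D p).fst = p := by
  induction p using MvPolynomial.induction_on with
  | C a => simp [polyDualHom_C, dualHom]
  | add p q hp hq => rw [map_add, TrivSqZeroExt.fst_add, hp, hq]
  | mul_X p k hp => rw [map_mul, polyDualHom_X, TrivSqZeroExt.fst_mul, hp, TrivSqZeroExt.fst_inl]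

/-- A derivation acting on the coefficients of polynomials. -/
def polyDer (D : Derivation ℂ K K) :
    Derivation ℂ (MvPolynomial (Fin n) K) (MvPolynomial (Fin n) K) :=
  Derivation.mk'
    { toFun := fun p => (polyDualHom D p).snd
      map_add' := fun x y => by rw [map_add, TrivSqZeroExt.snd_add]
      map_smul' := fun c x => by
        rw [Algebra.smul_def, IsScalarTower.algebraMap_apply ℂ K (MvPolynomial (Fin n) K), map_mul,
          MvPolynomial.algebraMap_eq, polyDualHom_C]
        simp [dualHom, fst_polyDualHom, Algebra.smul_def,
          IsScalarTower.algebraMap_apply ℂ K (MvPolynomial (Fin n) K)] }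
    (fun x y => by
      change (polyDualHom D (x * y)).snd
        = x * (polyDualHom D y).snd + y * (polyDualHom D x).snd
      rw [map_mul, TrivSqZeroExt.snd_mul, fst_polyDualHom, fst_polyDualHom]
      simp only [smul_eq_mul, MulOpposite.smul_eq_mul_unop, MulOpposite.unop_op]
      ring)

lemma polyDer_C (D : Derivation ℂ K K) (a : K) :
    polyDer (n := n) D (MvPolynomial.C a) = MvPolynomial.C (D a) := by
  change (polyDualHom D (MvPolynomial.C a)).snd = _
  simp [polyDualHom_C, dualHom]

lemma polyDer_X (D : Derivation ℂ K K) (k : Fin n) : polyDer D (MvPolynomial.X k) = 0 := by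
  change (polyDualHom D (MvPolynomial.X k)).snd = _
  rw [polyDualHom_X, TrivSqZeroExt.snd_inl]

lemma polyDer_mul_X (D : Derivation ℂ K K) (p : MvPolynomial (Fin n) K) (k : Fin n) :
    polyDer D (p * MvPolynomial.X k) = polyDer D p * MvPolynomial.X k := by
  rw [Derivation.leibniz, polyDer_X, smul_zero, zero_add, smul_eq_mul, mul_comm]

lemma polyDer_comm {D D' : Derivation ℂ K K} (h : ∀ x, D (D' x) = D' (D x))
    (p : MvPolynomial (Fin n) K) : polyDer D (polyDer D' p) = polyDer D' (polyDer D p) := by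
  induction p using MvPolynomial.induction_on with
  | C a => rw [polyDer_C, polyDer_C, polyDer_C, polyDer_C, h]
  | add p q hp hq => simp only [map_add, hp, hq]
  | mul_X p k hp => simp only [polyDer_mul_X, hp]

/-- The derivation `∑ yₖ ∂/∂λₖ` on polynomials in `y₁, …, yₙ`. -/
def PartialDerivatives.poly (D : PartialDerivatives n K) :
    Derivation ℂ (MvPolynomial (Fin n) K) (MvPolynomial (Fin n) K) :=
  ∑ k, (MvPolynomial.X k : MvPolynomial (Fin n) K) • polyDer (D.d k)

lemma PartialDerivatives.poly_apply (D : PartialDerivatives n K) (p : MvPolynomial (Fin n) K) :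
    D.poly p = ∑ k, MvPolynomial.X k * polyDer (D.d k) p :=
  sum_der_apply _ _ p

lemma PartialDerivatives.poly_comm (D : PartialDerivatives n K) {E : Derivation ℂ K K}
    (h : ∀ k x, E (D.d k x) = D.d k (E x)) (p : MvPolynomial (Fin n) K) :
    D.poly (polyDer E p) = polyDer E (D.poly p) := by
  rw [poly_apply, poly_apply, map_sum]
  refine Finset.sum_congr rfl fun k _ => ?_
  rw [mul_comm (MvPolynomial.X k) (polyDer (D.d k) p), polyDer_mul_X, polyDer_comm (h k), mul_comm]

end PolynomialDerivation

end DynamicalElliptic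
end

/-! ### Evaluation of the auxiliary variables yₖ at the Cartan elements -/

noncomputable section
namespace DynamicalElliptic
open Matrix PowerSeries TensorProduct
open Finset.HasAntidiagonal (antidiagonal mem_antidiagonal)

section Monomials
variable {n : ℕ} {R : Type*} [Ring R]

lemma prod_ofFn_mul {M : Type*} [Monoid M] {n : ℕ} {a b : Fin n → M}
    (h : ∀ i j, Commute (b i) (a j)) :
    (List.ofFn fun k => a k * b k).prod = (List.ofFn a).prod * (List.ofFn b).prod := by
  induction n with
  | zero => simp
  | succ n ih =>
    have hc : Commute (b 0) (List.ofFn fun i : Fin n => a i.succ).prod := by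
      refine Commute.list_prod_right _ _ fun y hy => ?_
      obtain ⟨i, rfl⟩ := (List.mem_ofFn' _ _).1 hy
      exact h _ _
    rw [List.ofFn_succ, List.ofFn_succ, List.ofFn_succ, List.prod_cons, List.prod_cons,
      List.prod_cons, ih fun i j => h _ _, mul_assoc, mul_assoc, ← mul_assoc (b 0), hc.eq,
      mul_assoc]

variable {h : Fin n → R} (hh : ∀ i j, Commute (h i) (h j))

/-- The monomials in commuting elements. -/
def monomialHom : Multiplicative (Fin n →₀ ℕ) →* R where
  toFun α := (List.ofFn fun k => h k ^ α.toAdd k).prod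
  map_one' := by
    rw [List.prod_eq_one]
    intro x hx
    obtain ⟨i, rfl⟩ := (List.mem_ofFn' _ _).1 hx
    simp
  map_mul' α β := by
    rw [← prod_ofFn_mul fun i j => (hh i j).pow_pow _ _]
    simp only [toAdd_mul, Finsupp.add_apply, pow_add]

lemma monomialHom_single (k : Fin n) :
    monomialHom hh (Multiplicative.ofAdd (Finsupp.single k 1)) = h k := by
  have : ∀ (n : ℕ) (k : Fin n) (x : R),
      (List.ofFn fun j => if j = k then x else 1).prod = x := fun n => by
    induction n with
    | zero => exact fun k => k.elim0
    | succ n ih =>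
      intro k x
      rw [List.ofFn_succ, List.prod_cons]
      refine Fin.cases ?_ (fun k => ?_) k
      · rw [if_pos rfl, List.prod_eq_one, mul_one]
        intro y hy
        obtain ⟨i, rfl⟩ := (List.mem_ofFn' _ _).1 hy
        simp [Fin.succ_ne_zero]
      · rw [if_neg (Fin.succ_ne_zero k).symm, one_mul]
        simpa only [Fin.succ_inj] using ih k x
  refine Eq.trans (congrArg (fun f => (List.ofFn f).prod) (funext fun j => ?_)) (this n k (h k))
  by_cases hj : j = k
  · subst hj; simp
  · simp [hj]

end Monomials

section CartanShift
variable {n : ℕ} {K : Type*} [CommRing K] [Algebra ℂ K] {R : Type*} [Ring R] [Algebra ℂ⟦X⟧ R]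

lemma levelProj_ofFun_X_pow (N : ℕ) :
    levelProj N (ofFun (PowerSeries.X : K⟦X⟧) : CompletedTensor K R) ^ N = 0 := by
  rw [← map_pow, ← map_pow]
  refine Ideal.Quotient.eq_zero_iff_mem.2 (mem_hbarIdeal.2 ⟨1, ?_⟩)
  rw [Algebra.smul_def, mul_one, Algebra.TensorProduct.algebraMap_apply, map_pow,
    PowerSeries.algebraMap_apply'', PowerSeries.map_X]
  rfl

/-- An `ℏ`-linear map from power series is determined by the images of the constants. -/
lemma addHom_ext_of_C {B : Type*} [CommRing B] {f g : B⟦X⟧ → CompletedTensor K R}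
    (hfa : ∀ F G, f (F + G) = f F + f G) (hga : ∀ F G, g (F + G) = g F + g G)
    (hf : ∀ G, f (PowerSeries.X * G) = ofFun PowerSeries.X * f G)
    (hg : ∀ G, g (PowerSeries.X * G) = ofFun PowerSeries.X * g G)
    (h : ∀ b, f (PowerSeries.C b) = g (PowerSeries.C b)) (G : B⟦X⟧) : f G = g G := by
  -- Splitting off the constant term `N` times shows that the difference is divisible by ℏᴺ for
  -- every `N`. It then vanishes at every level, hence in the completion.
  have key : ∀ N G, ∃ G', f G - g G = ofFun PowerSeries.X ^ N * (f G' - g G') := fun N => by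
    induction N with
    | zero => exact fun G => ⟨G, by rw [pow_zero, one_mul]⟩
    | succ N ih =>
      intro G
      obtain ⟨G', hG'⟩ := ih (PowerSeries.mk fun m => PowerSeries.coeff (m + 1) G)
      refine ⟨G', ?_⟩
      conv_lhs => rw [PowerSeries.eq_X_mul_shift_add_const G]
      rw [hfa, hga, h, add_sub_add_right_eq_sub, hf, hg, ← mul_sub, hG', pow_succ',
        mul_assoc]
  refine sub_eq_zero.1 (completedTensor_ext fun N => ?_)
  obtain ⟨G', hG'⟩ := key N G
  rw [hG', RingHom.map_mul, RingHom.map_pow, levelProj_ofFun_X_pow, zero_mul, map_zero]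

variable {h : Fin n → R} (hh : ∀ i j, Commute (h i) (h j))

variable (K) in
/-- The homomorphism from polynomials that sends the variables to the Cartan elements. -/
def cartanPolyHom : MvPolynomial (Fin n) K →+* K⟦X⟧ ⊗[ℂ⟦X⟧] R :=
  AddMonoidAlgebra.liftNCRingHom
    ((Algebra.TensorProduct.includeLeft : K⟦X⟧ →ₐ[ℂ⟦X⟧] K⟦X⟧ ⊗[ℂ⟦X⟧] R).toRingHom.comp
      PowerSeries.C)
    (((Algebra.TensorProduct.includeRight : R →ₐ[ℂ⟦X⟧] K⟦X⟧ ⊗[ℂ⟦X⟧] R) : R →* _).comp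
      (monomialHom hh))
    (fun k α => by
      refine (Algebra.TensorProduct.tmul_mul_tmul _ _ _ _).trans
        (Eq.trans ?_ (Algebra.TensorProduct.tmul_mul_tmul _ _ _ _).symm)
      rw [one_mul, mul_one, one_mul, mul_one])

lemma cartanPolyHom_monomial (α : Fin n →₀ ℕ) (a : K) :
    cartanPolyHom K hh (MvPolynomial.monomial α a)
      = (PowerSeries.C a) ⊗ₜ[ℂ⟦X⟧] (List.ofFn fun k => h k ^ α k).prod := by
  refine (AddMonoidAlgebra.liftNC_single _ _ _ _).trans
    ((Algebra.TensorProduct.tmul_mul_tmul _ _ _ _).trans ?_)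
  rw [one_mul, mul_one]
  rfl

lemma cartanPolyHom_C (a : K) :
    cartanPolyHom K hh (MvPolynomial.C a) = (PowerSeries.C a) ⊗ₜ[ℂ⟦X⟧] 1 := by
  rw [MvPolynomial.C_apply, cartanPolyHom_monomial]
  congr 1
  exact (monomialHom hh).map_one

lemma cartanPolyHom_X (k : Fin n) :
    cartanPolyHom K hh (MvPolynomial.X k) = 1 ⊗ₜ[ℂ⟦X⟧] h k := by
  rw [MvPolynomial.X, cartanPolyHom_monomial, map_one]
  congr 1
  exact monomialHom_single hh k

variable (K) in
/-- Evaluation of polynomials in `ℏ` modulo `ℏᴺ`. -/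
def cartanLevelHom (N : ℕ) : Polynomial (MvPolynomial (Fin n) K) →+*
    (K⟦X⟧ ⊗[ℂ⟦X⟧] R) ⧸ hbarIdeal (K⟦X⟧ ⊗[ℂ⟦X⟧] R) N :=
  Polynomial.eval₂RingHom' ((Ideal.Quotient.mk _).comp (cartanPolyHom K hh))
    (levelProj N (ofFun PowerSeries.X)) fun a => by
      have := congrArg (levelProj N) (ofFun_mul_comm (PowerSeries.X : K⟦X⟧)
        (ofTensor K R (cartanPolyHom K hh a)))
      rw [RingHom.map_mul, RingHom.map_mul] at this
      exact this.symm

lemma cartanLevelHom_C (N : ℕ) (p : MvPolynomial (Fin n) K) :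
    cartanLevelHom K hh N (Polynomial.C p) = Ideal.Quotient.mk _ (cartanPolyHom K hh p) :=
  Polynomial.eval₂_C _ _

lemma cartanLevelHom_X (N : ℕ) :
    cartanLevelHom K hh N Polynomial.X = levelProj N (ofFun PowerSeries.X) :=
  Polynomial.eval₂_X _ _

lemma cartanLevelHom_X_pow (N : ℕ) : cartanLevelHom K hh N Polynomial.X ^ N = 0 := by
  rw [cartanLevelHom_X, levelProj_ofFun_X_pow]

/-- The power series in `ℏ` with polynomial coefficients, evaluated at the Cartan elements. -/
def cartanEval : (MvPolynomial (Fin n) K)⟦X⟧ →+* CompletedTensor K R where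
  toFun G := ⟨fun N => cartanLevelHom K hh N (PowerSeries.trunc N G), fun M N hMN => by
    have e : ∀ p, Ideal.Quotient.factor (hbarIdeal_anti _ hMN) (cartanLevelHom K hh N p)
        = cartanLevelHom K hh M p := fun p => by
      refine congrArg (fun f => f p) (Polynomial.ringHom_ext' (f :=
        (Ideal.Quotient.factor (hbarIdeal_anti _ hMN)).comp (cartanLevelHom K hh N))
        (RingHom.ext fun p => ?_) ?_)
      · rw [RingHom.comp_apply, RingHom.comp_apply, RingHom.comp_apply, cartanLevelHom_C,
          cartanLevelHom_C, Ideal.Quotient.factor_mk]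
      · rw [RingHom.comp_apply, cartanLevelHom_X, cartanLevelHom_X]
        rfl
    rw [e, ← map_trunc_coe (cartanLevelHom K hh M) (cartanLevelHom_X_pow hh M)]
    congr 1
    ext d
    simp only [PowerSeries.coeff_trunc, Polynomial.coeff_coe]
    by_cases hd : d < M
    · rw [if_pos hd, if_pos hd, if_pos (by omega)]
    · rw [if_neg hd, if_neg hd]⟩
  map_one' := completedTensor_ext fun N => by
    have := map_trunc_coe (cartanLevelHom K hh N) (cartanLevelHom_X_pow hh N) 1
    rw [Polynomial.coe_one] at this
    exact this.trans (map_one _)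
  map_zero' := completedTensor_ext fun N => by
    refine Eq.trans ?_ (map_zero (cartanLevelHom K hh N))
    exact map_trunc_coe (cartanLevelHom K hh N) (cartanLevelHom_X_pow hh N) 0
  map_mul' F G := completedTensor_ext fun N =>
    map_trunc_mul (cartanLevelHom K hh N) (cartanLevelHom_X_pow hh N) F G
  map_add' F G := completedTensor_ext fun N => by
    refine Eq.trans ?_ (map_add (cartanLevelHom K hh N) _ _)
    exact congrArg _ (map_add _ _ _)

lemma levelProj_cartanEval (N : ℕ) (G : (MvPolynomial (Fin n) K)⟦X⟧) :
    levelProj N (cartanEval hh G) = cartanLevelHom K hh N (PowerSeries.trunc N G) := rfl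

lemma cartanEval_coe (p : Polynomial (MvPolynomial (Fin n) K)) (N : ℕ) :
    levelProj N (cartanEval hh (p : (MvPolynomial (Fin n) K)⟦X⟧)) = cartanLevelHom K hh N p :=
  map_trunc_coe _ (cartanLevelHom_X_pow hh N) p

lemma cartanEval_C (p : MvPolynomial (Fin n) K) :
    cartanEval hh (PowerSeries.C p) = ofTensor K R (cartanPolyHom K hh p) :=
  completedTensor_ext fun N => by
    rw [← Polynomial.coe_C, cartanEval_coe]
    exact cartanLevelHom_C hh N p

lemma cartanEval_X :
    cartanEval hh (PowerSeries.X : (MvPolynomial (Fin n) K)⟦X⟧) = ofFun PowerSeries.X :=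
  completedTensor_ext fun N => by
    rw [← Polynomial.coe_X, cartanEval_coe]
    exact cartanLevelHom_X hh N

variable (n K) in
/-- The inclusion of functions into polynomials with functions as coefficients. -/
def constPoly : K →ₐ[ℂ] MvPolynomial (Fin n) K :=
  IsScalarTower.toAlgHom ℂ K (MvPolynomial (Fin n) K)

lemma constPoly_apply (a : K) : constPoly n K a = MvPolynomial.C a := rfl

lemma algHom_X {B B' : Type*} [CommRing B] [CommRing B'] [Algebra ℂ B] [Algebra ℂ B']
    (φ : B⟦X⟧ →ₐ[ℂ⟦X⟧] B'⟦X⟧) : φ PowerSeries.X = PowerSeries.X := by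
  have := φ.commutes PowerSeries.X
  rwa [PowerSeries.algebraMap_apply'', PowerSeries.algebraMap_apply'', PowerSeries.map_X,
    PowerSeries.map_X] at this

lemma cartanEval_mapHbar (f : K⟦X⟧) : cartanEval hh (mapHbar (constPoly n K) f) = ofFun f :=
  addHom_ext_of_C (f := fun f => cartanEval hh (mapHbar (constPoly n K) f)) (g := ofFun)
    (fun F G => by simp only [map_add]) (fun F G => map_add _ _ _)
    (fun G => by
      rw [map_mul, map_mul, algHom_X, cartanEval_X])
    (fun G => map_mul _ _ _)
    (fun b => by
      rw [mapHbar_C, cartanEval_C, constPoly_apply, cartanPolyHom_C]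
      rfl) f

variable (D : PartialDerivatives n K)

/-- The shift `F(λ) ↦ F(λ + ℏh)` by commuting elements. -/
def cartanHom : K⟦X⟧ →+* CompletedTensor K R :=
  ((cartanEval hh).comp (expShift D.poly).toRingHom).comp (mapHbar (constPoly n K)).toRingHom

lemma cartanHom_apply (f : K⟦X⟧) :
    cartanHom hh D f = cartanEval hh (expShift D.poly (mapHbar (constPoly n K) f)) := rfl

lemma cartanHom_algebraMap (c : ℂ⟦X⟧) :
    cartanHom hh D (algebraMap ℂ⟦X⟧ K⟦X⟧ c) = ofFun (algebraMap ℂ⟦X⟧ K⟦X⟧ c) := by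
  rw [cartanHom_apply, AlgHom.commutes, AlgHom.commutes, ← AlgHom.commutes (mapHbar (constPoly n K)),
    cartanEval_mapHbar]

/-- `Ψ` lifts `ψ` to polynomials, fixes the variables yₖ and respects the exponential, so naturality
is reduced to that of the evaluation yₖ ↦ hₖ. The latter is checked on constants in ℏ and extended
by ℏ-linearity. In this form the lemma covers both coefficientwise homomorphisms and exponentials of
derivations. -/
lemma cartanHom_natural {K' : Type*} [CommRing K'] [Algebra ℂ K'] {D' : PartialDerivatives n K'}
    (ψ : K⟦X⟧ →ₐ[ℂ⟦X⟧] K'⟦X⟧)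
    (Ψ : (MvPolynomial (Fin n) K)⟦X⟧ →ₐ[ℂ⟦X⟧] (MvPolynomial (Fin n) K')⟦X⟧)
    (h₁ : ∀ f, Ψ (mapHbar (constPoly n K) f) = mapHbar (constPoly n K') (ψ f))
    (h₂ : ∀ k, Ψ (PowerSeries.C (MvPolynomial.X k)) = PowerSeries.C (MvPolynomial.X k))
    (h₃ : ∀ G, Ψ (expShift D.poly G) = expShift D'.poly (Ψ G)) (f : K⟦X⟧) :
    tensorMap ψ (cartanHom hh D f) = cartanHom hh D' (ψ f) := by
  have key : ∀ G, tensorMap ψ (cartanEval hh G) = cartanEval hh (Ψ G) :=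
    addHom_ext_of_C (f := fun G => tensorMap ψ (cartanEval hh G))
      (g := fun G => cartanEval hh (Ψ G))
      (fun F G => by simp only [map_add]) (fun F G => by simp only [map_add])
      (fun G => by
          rw [map_mul, map_mul, cartanEval_X, tensorMap_ofFun, algHom_X])
      (fun G => by
          rw [map_mul, map_mul, algHom_X, cartanEval_X])
      (fun p => by
          induction p using MvPolynomial.induction_on with
        | C a =>
          rw [← constPoly_apply, ← mapHbar_C, h₁, cartanEval_mapHbar, cartanEval_mapHbar,
            tensorMap_ofFun]
        | add p q hp hq => simp only [map_add, hp, hq]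
        | mul_X p k hp =>
          rw [map_mul, map_mul, map_mul, map_mul, map_mul, hp, h₂, cartanEval_C, cartanEval_C,
            cartanPolyHom_X, cartanPolyHom_X, ofTensor_tmul, ofTensor_tmul, map_one, map_one,
            one_mul, one_mul, tensorMap_ofAlg])
  rw [cartanHom_apply, cartanHom_apply, key, h₃, h₁]

end CartanShift

end DynamicalElliptic
end

noncomputable section
namespace DynamicalElliptic
open Matrix PowerSeries TensorProduct
open Finset.HasAntidiagonal (antidiagonal mem_antidiagonal)

/-! ### The shift by Cartan elements: naturality, commutation and reduction modulo the ideal -/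

section CartanHom
variable {n : ℕ} {K : Type*} [CommRing K] [Algebra ℂ K] {R : Type*} [Ring R] [Algebra ℂ⟦X⟧ R]
  {h : Fin n → R} (hh : ∀ i j, Commute (h i) (h j)) (D : PartialDerivatives n K)
  {K' : Type*} [CommRing K'] [Algebra ℂ K']

variable (n) in
/-- A homomorphism acting on the coefficients of polynomials. -/
def mapPoly (φ : K →ₐ[ℂ] K') : MvPolynomial (Fin n) K →ₐ[ℂ] MvPolynomial (Fin n) K' :=
  MvPolynomial.mapAlgHom φ

lemma mapPoly_C (φ : K →ₐ[ℂ] K') (a : K) :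
    mapPoly n φ (MvPolynomial.C a) = MvPolynomial.C (φ a) :=
  MvPolynomial.map_C _ _

lemma mapPoly_X (φ : K →ₐ[ℂ] K') (k : Fin n) :
    mapPoly n φ (MvPolynomial.X k) = MvPolynomial.X k :=
  MvPolynomial.map_X _ _

lemma mapPoly_polyDer {E : Derivation ℂ K K} {E' : Derivation ℂ K' K'} (φ : K →ₐ[ℂ] K')
    (hφ : ∀ x, φ (E x) = E' (φ x)) (p : MvPolynomial (Fin n) K) :
    mapPoly n φ (polyDer E p) = polyDer E' (mapPoly n φ p) := by
  induction p using MvPolynomial.induction_on with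
  | C a => rw [polyDer_C, mapPoly_C, mapPoly_C, polyDer_C, hφ]
  | add p q hp hq => simp only [map_add, hp, hq]
  | mul_X p k hp => rw [polyDer_mul_X, map_mul, map_mul, mapPoly_X, polyDer_mul_X, hp]

theorem cartanHom_mapHbar {D' : PartialDerivatives n K'} (φ : K →ₐ[ℂ] K')
    (hφ : ∀ k x, φ (D.d k x) = D'.d k (φ x)) (f : K⟦X⟧) :
    tensorMap (mapHbar φ) (cartanHom hh D f) = cartanHom hh D' (mapHbar φ f) := by
  refine cartanHom_natural hh D (mapHbar φ) (mapHbar (mapPoly n φ)) (fun f => ?_) (fun k => ?_)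
    (fun G => mapHbar_expShift _ (fun p => ?_) G) f
  · ext m : 1
    simp only [coeff_mapHbar, constPoly_apply, mapPoly_C]
  · rw [mapHbar_C, mapPoly_X]
  · rw [D.poly_apply, D'.poly_apply, map_sum]
    refine Finset.sum_congr rfl fun k _ => ?_
    rw [map_mul, mapPoly_X, mapPoly_polyDer φ (hφ k)]

theorem cartanHom_expShift (E : Derivation ℂ K K) (hE : ∀ k x, E (D.d k x) = D.d k (E x))
    (f : K⟦X⟧) : tensorMap (expShift E) (cartanHom hh D f) = cartanHom hh D (expShift E f) := by
  refine cartanHom_natural hh D (expShift E) (expShift (polyDer E)) (fun f => ?_) (fun k => ?_)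
    (fun G => ?_) f
  · exact (mapHbar_expShift (constPoly n K) (fun x => (polyDer_C E x).symm) f).symm
  · ext m : 1
    rw [coeff_expShift, Finset.sum_eq_single (0, m)]
    · rw [divPow_zero]; rfl
    · rintro ⟨i, j⟩ hij hne
      obtain _ | i := i
      · exact absurd (by simpa using hij) hne
      · rw [PowerSeries.coeff_C]
        split_ifs
        · rw [divPow, LinearMap.smul_apply, pow_succ, Module.End.mul_apply]
          rw [Derivation.coeFn_coe, polyDer_X, map_zero, smul_zero]
        · rw [map_zero]
    · simp
  · exact expShift_comm (fun p => (D.poly_comm hE p).symm) G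

/-- The dynamical pair of scalar functions and of functions with values in `R`. -/
def dynamicalPair : DynamicalPair n K⟦X⟧ (CompletedTensor K R) where
  shS := D.shS
  shT := D.shT R
  ι := ofFun
  c := cartanHom hh D
  ι_comm := ofFun_mul_comm
  shT_ι _ _ := tensorMap_ofFun _ _
  shT_c μ f := cartanHom_expShift hh D (D.dir μ) (fun k x => by
    simp only [D.dir_apply, map_sum, map_zsmul, D.comm k]) f

/-- The substitution `yₖ ↦ yₖ + εₖ`. -/
def shiftPoly (ε : Fin n → ℤ) : MvPolynomial (Fin n) K →ₐ[ℂ] MvPolynomial (Fin n) K :=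
  (MvPolynomial.aeval fun k => MvPolynomial.X k + ((ε k : ℤ) : MvPolynomial (Fin n) K)).restrictScalars
    ℂ

lemma shiftPoly_C (ε : Fin n → ℤ) (a : K) :
    shiftPoly ε (MvPolynomial.C a) = MvPolynomial.C a :=
  MvPolynomial.aeval_C _ _

lemma shiftPoly_X (ε : Fin n → ℤ) (k : Fin n) :
    shiftPoly (K := K) ε (MvPolynomial.X k) = MvPolynomial.X k + ((ε k : ℤ) : MvPolynomial (Fin n) K) :=
  MvPolynomial.aeval_X _ _

lemma shiftPoly_polyDer (ε : Fin n → ℤ) (E : Derivation ℂ K K) (p : MvPolynomial (Fin n) K) :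
    shiftPoly ε (polyDer E p) = polyDer E (shiftPoly ε p) := by
  induction p using MvPolynomial.induction_on with
  | C a => rw [polyDer_C, shiftPoly_C, shiftPoly_C, polyDer_C]
  | add p q hp hq => simp only [map_add, hp, hq]
  | mul_X p k hp =>
    rw [polyDer_mul_X, map_mul, map_mul, shiftPoly_X, hp, Derivation.leibniz, map_add, polyDer_X,
      Derivation.map_intCast, add_zero, smul_zero, zero_add, smul_eq_mul, mul_comm]

lemma cartanEval_mul {ε : Fin n → ℤ} {x : CompletedTensor K R}
    (hx : ∀ k, ofAlg (h k) * x = x * (ofAlg (h k) + ((ε k : ℤ) : CompletedTensor K R)))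
    (G : (MvPolynomial (Fin n) K)⟦X⟧) :
    cartanEval hh G * x = x * cartanEval hh (mapHbar (shiftPoly ε) G) := by
  refine addHom_ext_of_C (f := fun G => cartanEval hh G * x)
    (g := fun G => x * cartanEval hh (mapHbar (shiftPoly ε) G))
    (fun F G => by simp only [map_add, add_mul]) (fun F G => by simp only [map_add, mul_add])
    (fun G => ?_) (fun G => ?_) (fun p => ?_) G
  · rw [map_mul, cartanEval_X, mul_assoc]
  · rw [map_mul, map_mul, algHom_X, cartanEval_X, ← mul_assoc, ← ofFun_mul_comm, mul_assoc]
  · induction p using MvPolynomial.induction_on with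
    | C a =>
      rw [mapHbar_C, shiftPoly_C, cartanEval_C, cartanPolyHom_C, ofTensor_tmul, map_one, mul_one,
        ofFun_mul_comm]
    | add p q hp hq => simp only [map_add, add_mul, mul_add, hp, hq]
    | mul_X p k hp =>
      have e : cartanEval hh (PowerSeries.C (MvPolynomial.X k : MvPolynomial (Fin n) K))
          = ofAlg (h k) := by
        rw [cartanEval_C, cartanPolyHom_X, ofTensor_tmul, map_one, one_mul]
      rw [map_mul, map_mul, map_mul, map_mul, e, mul_assoc, hx, ← mul_assoc, hp, mul_assoc]
      congr 2
      rw [mapHbar_C, shiftPoly_X, map_add, map_add, e, map_intCast, map_intCast]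

/-- Moving `x` to the left substitutes yₖ + εₖ for yₖ. In the generator this adds the derivation ∑
εₖ ∂/∂λₖ, which commutes with ∑ yₖ ∂/∂λₖ. The exponential therefore factors, and its second factor
is the translation by `ε`. -/
theorem cartanHom_mul {ε : Fin n → ℤ} {x : CompletedTensor K R}
    (hx : ∀ k, ofAlg (h k) * x = x * (ofAlg (h k) + ((ε k : ℤ) : CompletedTensor K R)))
    (f : K⟦X⟧) : cartanHom hh D f * x = x * cartanHom hh D (D.shS.map ε f) := by
  rw [cartanHom_apply, cartanEval_mul hh hx, cartanHom_apply]
  congr 2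
  set E : Derivation ℂ (MvPolynomial (Fin n) K) (MvPolynomial (Fin n) K) :=
    ∑ k, ε k • polyDer (D.d k) with hE
  have hE' : ∀ p, E p = ∑ k, ε k • polyDer (D.d k) p := PartialDerivatives.sum_der_apply _ _
  have h₁ : ∀ p, shiftPoly ε (D.poly p) = (D.poly + E) (shiftPoly ε p) := fun p => by
    rw [Derivation.add_apply, hE', D.poly_apply, D.poly_apply, map_sum, ← Finset.sum_add_distrib]
    refine Finset.sum_congr rfl fun k _ => ?_
    rw [map_mul, shiftPoly_X, shiftPoly_polyDer, add_mul, zsmul_eq_mul]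
  have h₂ : ∀ p, D.poly (E p) = E (D.poly p) := fun p => by
    rw [hE', hE', map_sum]
    refine Finset.sum_congr rfl fun k _ => ?_
    rw [map_zsmul, D.poly_comm (D.comm k)]
  rw [mapHbar_expShift _ h₁, expShift_add (LinearMap.ext h₂), AlgHom.comp_apply]
  congr 1
  change _ = mapHbar _ (expShift (D.dir ε) f)
  rw [mapHbar_expShift (D' := E) (constPoly n K) (fun x => by
    rw [hE', D.dir_apply, map_sum]
    refine Finset.sum_congr rfl fun k _ => ?_
    rw [map_zsmul, constPoly_apply, constPoly_apply, polyDer_C])]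
  congr 1
  ext m : 1
  rw [coeff_mapHbar, coeff_mapHbar, constPoly_apply, shiftPoly_C]

lemma divPow_poly_succ (i : ℕ) (p : MvPolynomial (Fin n) K) :
    divPow D.poly (i + 1) p = ∑ k, MvPolynomial.X k
      * polyDer (D.d k) ((((i + 1 : ℕ) : ℂ)⁻¹) • divPow D.poly i p) := by
  rw [← D.poly_apply, Derivation.map_smul, ← divPow_succ, smul_smul, inv_mul_cancel₀, one_smul]
  exact_mod_cast Nat.succ_ne_zero i

/-- `F(λ + ℏh) - F(λ)` lies in the left ideal generated by the Cartan elements. -/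
theorem cartanHom_sub_ofFun (f : K⟦X⟧) :
    ∃ A : Fin n → CompletedTensor K R,
      cartanHom hh D f - ofFun f = ∑ k, A k * ofAlg (h k) := by
  set F := mapHbar (constPoly n K) f
  -- With ∇ = ∑ yₖ ∂/∂λₖ, this is the coefficient of ℏᵐ in ∇⁻¹(exp(ℏ∇) - 1)F: the term ∇ⁱ/i!
  -- contributes 1/i times the divided power of order i - 1.
  let Q : ℕ → MvPolynomial (Fin n) K := fun m => ∑ p ∈ antidiagonal m,
    if p.1 = 0 then 0 else ((p.1 : ℂ)⁻¹) • divPow D.poly (p.1 - 1) (PowerSeries.coeff p.2 F)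
  have h₁ : expShift D.poly F = F + ∑ k, PowerSeries.C (MvPolynomial.X k)
      * PowerSeries.mk fun m => polyDer (D.d k) (Q m) := by
    ext m : 1
    rw [map_add, map_sum, coeff_expShift]
    simp only [PowerSeries.coeff_C_mul, PowerSeries.coeff_mk]
    have h₂ : ∀ p ∈ antidiagonal m, divPow D.poly p.1 (PowerSeries.coeff p.2 F)
        = (if p = (0, m) then PowerSeries.coeff m F else 0) + ∑ k, MvPolynomial.X k
          * polyDer (D.d k) (if p.1 = 0 then 0 else
            ((p.1 : ℂ)⁻¹) • divPow D.poly (p.1 - 1) (PowerSeries.coeff p.2 F)) := by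
      rintro ⟨i, j⟩ hij
      obtain rfl : i + j = m := mem_antidiagonal.1 hij
      obtain _ | i := i
      · simp [divPow_zero]
      · rw [divPow_poly_succ, if_neg (by simp), zero_add]
        simp
    rw [Finset.sum_congr rfl h₂, Finset.sum_add_distrib, Finset.sum_ite_eq',
      if_pos (mem_antidiagonal.2 (zero_add m)), Finset.sum_comm]
    congr 1
    refine Finset.sum_congr rfl fun k _ => ?_
    rw [← Finset.mul_sum, ← map_sum]
  refine ⟨fun k => cartanEval hh (PowerSeries.mk fun m => polyDer (D.d k) (Q m)), ?_⟩
  rw [cartanHom_apply, h₁, map_add, cartanEval_mapHbar, add_sub_cancel_left, map_sum]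
  refine Finset.sum_congr rfl fun k _ => ?_
  -- The variable yₖ is put last while still in a commutative ring. So hₖ ends up as the right
  -- factor, which places the sum in the left ideal.
  rw [mul_comm, map_mul, cartanEval_C, cartanPolyHom_X, ofTensor_tmul, map_one, one_mul]

end CartanHom

end DynamicalElliptic
end

noncomputable section
namespace DynamicalElliptic
open Matrix PowerSeries TensorProduct
open Finset.HasAntidiagonal (antidiagonal mem_antidiagonal)

/-! ### Multinomial expansion of F(λ + ℏh) -/

section CartanShiftExpansion
variable {n : ℕ} {K : Type*} [CommRing K] [Algebra ℂ K]

lemma list_prod_divPow (D : Fin n → Derivation ℂ K K) (α : Fin n → ℕ) (l : List (Fin n)) (f : K) :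
    (l.map fun k => divPow (D k) (α k)).prod f
      = (l.map fun k => ((α k).factorial : ℂ)⁻¹).prod
        • (l.map fun k => (D k : K →ₗ[ℂ] K) ^ α k).prod f := by
  induction l generalizing f with
  | nil => simp
  | cons k l ih =>
    simp only [List.map_cons, List.prod_cons, Module.End.mul_apply, ih, map_smul]
    rw [divPow, LinearMap.smul_apply, smul_smul, mul_comm]

/-- The operator `yₖ ∂/∂λₖ`. -/
def polyTerm (D : PartialDerivatives n K) (k : Fin n) : Module.End ℂ (MvPolynomial (Fin n) K) :=
  (LinearMap.mulLeft ℂ (MvPolynomial.X k)) ∘ₗ (polyDer (D.d k) : Derivation ℂ (MvPolynomial (Fin n) K) (MvPolynomial (Fin n) K)).toLinearMap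

lemma polyTerm_apply (D : PartialDerivatives n K) (k : Fin n) (p : MvPolynomial (Fin n) K) :
    polyTerm D k p = MvPolynomial.X k * polyDer (D.d k) p := rfl

lemma polyDer_X_pow_mul (E : Derivation ℂ K K) (k : Fin n) (i : ℕ) (p : MvPolynomial (Fin n) K) :
    polyDer E (MvPolynomial.X k ^ i * p) = MvPolynomial.X k ^ i * polyDer E p := by
  rw [Derivation.leibniz, Derivation.leibniz_pow, polyDer_X, smul_zero, smul_zero, smul_zero,
    add_zero, smul_eq_mul]

lemma polyTerm_commute (D : PartialDerivatives n K) (k l : Fin n) :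
    Commute (polyTerm D k) (polyTerm D l) := LinearMap.ext fun p => by
  have h : ∀ k l : Fin n, polyTerm D k (polyTerm D l p)
      = MvPolynomial.X k * (MvPolynomial.X l * polyDer (D.d k) (polyDer (D.d l) p)) := fun k l => by
    rw [polyTerm_apply, polyTerm_apply]
    have := polyDer_X_pow_mul (D.d k) l 1 (polyDer (D.d l) p)
    rw [pow_one] at this
    rw [this]
  rw [Module.End.mul_apply, Module.End.mul_apply, h, h, polyDer_comm (D.comm k l)]
  ring

lemma list_prod_polyTerm (D : PartialDerivatives n K) (α : Fin n → ℕ) (l : List (Fin n)) (f : K) :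
    (l.map fun k => polyTerm D k ^ α k).prod (MvPolynomial.C f)
      = (l.map fun k => (MvPolynomial.X k : MvPolynomial (Fin n) K) ^ α k).prod
        * MvPolynomial.C ((l.map fun k => (D.d k : K →ₗ[ℂ] K) ^ α k).prod f) := by
  induction l generalizing f with
  | nil => simp
  | cons k l ih =>
    have h₁ : ∀ (E : Derivation ℂ K K) (l : List (Fin n)) (p : MvPolynomial (Fin n) K),
        polyDer E ((l.map fun k => (MvPolynomial.X k : MvPolynomial (Fin n) K) ^ α k).prod * p)
        = (l.map fun k => (MvPolynomial.X k : MvPolynomial (Fin n) K) ^ α k).prod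
          * polyDer E p := fun E l p => by
      induction l with
      | nil => simp
      | cons k l ih =>
        rw [List.map_cons, List.prod_cons, mul_assoc, polyDer_X_pow_mul, ih, mul_assoc]
    have h₂ : ∀ (i : ℕ) (g : K), (polyTerm D k ^ i)
        ((l.map fun k => (MvPolynomial.X k : MvPolynomial (Fin n) K) ^ α k).prod
          * MvPolynomial.C g)
        = MvPolynomial.X k ^ i * ((l.map fun k => (MvPolynomial.X k : MvPolynomial (Fin n) K) ^ α k).prod
          * MvPolynomial.C (((D.d k : K →ₗ[ℂ] K) ^ i) g)) := fun i g => by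
      induction i with
      | zero => simp
      | succ i ih =>
        rw [pow_succ', Module.End.mul_apply, ih, polyTerm_apply, polyDer_X_pow_mul, h₁, polyDer_C,
          pow_succ', pow_succ', Module.End.mul_apply, mul_assoc]
        rfl
    rw [List.map_cons, List.prod_cons, Module.End.mul_apply, ih, h₂, List.map_cons, List.prod_cons,
      List.map_cons, List.prod_cons, Module.End.mul_apply, mul_assoc]

/-- Multinomial theorem for the commuting operators yₖ ∂/∂λₖ. The derivatives do not act on the
variables, so the yₖ collect into a monomial, and the multinomial coefficient divided by d! is ∏
1/αₖ!. -/
lemma divPow_poly_C (D : PartialDerivatives n K) (d : ℕ) (f : K) :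
    divPow D.poly d (MvPolynomial.C f) = ∑ α ∈ Finset.piAntidiag Finset.univ d,
      MvPolynomial.monomial (Finsupp.equivFunOnFinite.symm α)
        ((List.ofFn fun k => divPow (D.d k) (α k)).prod f) := by
  have h : (D.poly : MvPolynomial (Fin n) K →ₗ[ℂ] _) = ∑ k, polyTerm D k := LinearMap.ext fun p => by
    rw [LinearMap.sum_apply]
    exact D.poly_apply p
  rw [divPow, h, Finset.sum_pow_eq_sum_piAntidiag_of_commute _ _ (fun k _ l _ _ => polyTerm_commute D k l),
    LinearMap.smul_apply, LinearMap.sum_apply, Finset.smul_sum]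
  refine Finset.sum_congr rfl fun α hα => ?_
  have e : ∀ hc, Finset.univ.noncommProd (fun k => polyTerm D k ^ α k) hc
      = ((List.finRange n).map fun k => polyTerm D k ^ α k).prod := fun hc =>
    (Multiset.noncommProd_coe _ _)
  rw [e, Module.End.mul_apply, list_prod_polyTerm, List.ofFn_eq_map, list_prod_divPow,
    Module.End.natCast_apply]
  have hs : ∑ k, α k = d := (Finset.mem_piAntidiag.1 hα).1
  have hf : (d.factorial : ℂ)⁻¹ * (Nat.multinomial Finset.univ α : ℂ)
      = ((List.finRange n).map fun k => ((α k).factorial : ℂ)⁻¹).prod := by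
    rw [← List.ofFn_eq_map, List.prod_ofFn, Finset.prod_inv_distrib, ← hs,
      ← Nat.multinomial_spec, Nat.cast_mul, Nat.cast_prod, mul_inv, mul_assoc, inv_mul_cancel₀,
      mul_one]
    exact_mod_cast (Nat.multinomial_pos _ _).ne'
  have hX : ((List.finRange n).map fun k => (MvPolynomial.X k : MvPolynomial (Fin n) K) ^ α k).prod
      = MvPolynomial.monomial (Finsupp.equivFunOnFinite.symm α) 1 := by
    rw [← List.ofFn_eq_map, List.prod_ofFn, MvPolynomial.monomial_eq, map_one, one_mul,
      Finsupp.prod_fintype _ _ fun _ => pow_zero _]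
    rfl
  rw [hX, mul_comm, MvPolynomial.C_mul_monomial, mul_one, ← Nat.cast_smul_eq_nsmul ℂ, smul_smul, hf,
    MvPolynomial.smul_monomial]

variable {R : Type*} [Ring R] [Algebra ℂ⟦X⟧ R] {h : Fin n → R}

/-- The partial derivatives on `𝔸ₙ`. -/
def lambdaDerivatives (n : ℕ) : PartialDerivatives n (LambdaField n) := ⟨dLambda, dLambda_commute⟩

lemma translate_eq (μ : Fin n → ℤ) :
    translate (R := R) μ = ((lambdaDerivatives n).shT R).map μ := rfl

lemma levelProj_hbarSum (N : ℕ) (a : ℕ → K⟦X⟧ ⊗[ℂ⟦X⟧] R) (ha) :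
    levelProj (K := K) (R := R) N (hbarSum a ha)
      = Ideal.Quotient.mk _ (∑ d ∈ Finset.range N, a d) := rfl

lemma levelProj_ofFun_eq (N : ℕ) (f : K⟦X⟧) :
    levelProj (K := K) (R := R) N (ofFun f) = Ideal.Quotient.mk _ (f ⊗ₜ[ℂ⟦X⟧] 1) := rfl

lemma cartanLevelHom_monomial (hh : ∀ i j, Commute (h i) (h j)) (N d : ℕ)
    (p : MvPolynomial (Fin n) K) :
    cartanLevelHom K hh N (Polynomial.monomial d p) = Ideal.Quotient.mk _
      (cartanPolyHom K hh p * (PowerSeries.X ^ d : K⟦X⟧) ⊗ₜ[ℂ⟦X⟧] 1) := by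
  rw [← Polynomial.C_mul_X_pow_eq_monomial, map_mul, map_pow, cartanLevelHom_C, cartanLevelHom_X,
    map_mul]
  congr 1
  rw [← map_pow, ← map_pow]
  rfl

/-- The shift `F(λ) ↦ F(λ + ℏh)` as a homomorphism. -/
theorem cartanShift_eq (hh : ∀ i j, Commute (h i) (h j)) (F : (LambdaField n)⟦X⟧) :
    cartanShift h F = cartanHom hh (lambdaDerivatives n) F := by
  refine addHom_ext_of_C (f := cartanShift h) (g := cartanHom hh (lambdaDerivatives n)) (fun F G => ?_)
    (fun F G => map_add _ _ _) (fun G => ?_) (fun G => ?_) (fun f => ?_) F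
  · refine completedTensor_ext fun N => ?_
    rw [map_add]
    simp only [cartanShift, levelProj_hbarSum, ← map_add, ← Finset.sum_add_distrib,
      ← TensorProduct.add_tmul]
    congr! 7
    ext m
    simp
  · refine completedTensor_ext fun N => ?_
    rw [RingHom.map_mul, levelProj_ofFun_eq]
    simp only [cartanShift, levelProj_hbarSum]
    rw [← map_mul, Finset.mul_sum]
    congr 1
    refine Finset.sum_congr rfl fun d _ => ?_
    rw [Finset.mul_sum]
    refine Finset.sum_congr rfl fun α _ => ?_
    rw [Algebra.TensorProduct.tmul_mul_tmul, one_mul]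
    congr 1
    ext m
    obtain _ | m := m
    · rw [PowerSeries.coeff_zero_X_mul, PowerSeries.coeff_mk, PowerSeries.coeff_zero_X_mul, map_zero]
    · rw [PowerSeries.coeff_succ_X_mul, PowerSeries.coeff_mk, PowerSeries.coeff_mk,
        PowerSeries.coeff_succ_X_mul]
  · have e : (PowerSeries.X : (LambdaField n)⟦X⟧) = algebraMap ℂ⟦X⟧ _ PowerSeries.X := by
      rw [PowerSeries.algebraMap_apply'', PowerSeries.map_X]
    rw [map_mul, e, cartanHom_algebraMap]
  · refine completedTensor_ext fun N => ?_
    have ht : ∀ G : (MvPolynomial (Fin n) (LambdaField n))⟦X⟧, PowerSeries.trunc N G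
        = ∑ d ∈ Finset.range N, Polynomial.monomial d (PowerSeries.coeff d G) := fun G => by
      ext d
      rw [PowerSeries.coeff_trunc, Polynomial.finsetSum_coeff]
      simp [Polynomial.coeff_monomial]
    rw [cartanShift, levelProj_hbarSum, cartanHom_apply, levelProj_cartanEval, mapHbar_C, ht,
      map_sum, map_sum]
    refine Finset.sum_congr rfl fun d _ => ?_
    have hd : PowerSeries.coeff d (expShift (lambdaDerivatives n).poly
        (PowerSeries.C (constPoly n (LambdaField n) f)))
        = divPow (lambdaDerivatives n).poly d (MvPolynomial.C f) := by
      rw [coeff_expShift, Finset.sum_eq_single (d, 0)]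
      · rw [PowerSeries.coeff_zero_C, constPoly_apply]
      · rintro ⟨i, j⟩ hij hne
        have hj : j ≠ 0 := by
          rintro rfl
          exact hne (by simpa using hij)
        rw [PowerSeries.coeff_C, if_neg hj, map_zero]
      · simp
    rw [hd, cartanLevelHom_monomial, divPow_poly_C]
    congr 1
    rw [map_sum, Finset.sum_mul]
    refine Finset.sum_congr rfl fun α _ => ?_
    have hC : (PowerSeries.mk fun m => (List.ofFn fun k => divPow (dLambda k) (α k)).prod
        (PowerSeries.coeff m (PowerSeries.C f)))
        = PowerSeries.C ((List.ofFn fun k => divPow (dLambda k) (α k)).prod f) := by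
      ext m
      rw [PowerSeries.coeff_mk, PowerSeries.coeff_C, PowerSeries.coeff_C]
      split_ifs
      · rfl
      · rw [map_zero]
    have hX : (PowerSeries.X ^ d : (LambdaField n)⟦X⟧)
        = (PowerSeries.X ^ d : ℂ⟦X⟧) • 1 := by
      rw [Algebra.smul_def, mul_one, PowerSeries.algebraMap_apply'', map_pow, PowerSeries.map_X]
    rw [hC, cartanPolyHom_monomial, Algebra.TensorProduct.tmul_mul_tmul, mul_one, hX,
      mul_smul_comm, mul_one, TensorProduct.smul_tmul]
    rfl

end CartanShiftExpansion

end DynamicalElliptic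
end

noncomputable section
namespace DynamicalElliptic
open Matrix PowerSeries TensorProduct
open Finset.HasAntidiagonal (antidiagonal mem_antidiagonal)

/-! ### Identities for the theta function -/

section ThetaAnalysis
variable {τ : ℂ}

lemma differentiable_jacobiTheta₂ (hτ : 0 < τ.im) : Differentiable ℂ fun z => jacobiTheta₂ z τ :=
  fun z => differentiableAt_jacobiTheta₂_fst z hτ

/-- The part of the theta series of `2τ` with even exponents. -/
def evenTheta (τ x : ℂ) : ℂ := jacobiTheta₂ (2 * x) (2 * τ)

/-- The part of the theta series of `2τ` with odd exponents. -/
def oddTheta (τ x : ℂ) : ℂ :=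
  Complex.exp (2 * Real.pi * Complex.I * x) * jacobiTheta₂ (2 * x + τ) (2 * τ)

lemma two_mul_im_pos (hτ : 0 < τ.im) : 0 < (2 * τ).im := by
  simpa using hτ

lemma differentiable_evenTheta (hτ : 0 < τ.im) : Differentiable ℂ (evenTheta τ) :=
  (differentiable_jacobiTheta₂ (two_mul_im_pos hτ)).comp
    (differentiable_id.const_mul 2)

lemma differentiable_oddTheta (hτ : 0 < τ.im) : Differentiable ℂ (oddTheta τ) :=
  (Complex.differentiable_exp.comp (differentiable_id.const_mul _)).mul
    ((differentiable_jacobiTheta₂ (two_mul_im_pos hτ)).comp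
      ((differentiable_id.const_mul 2).add_const τ))

lemma differentiable_thetaOne (hτ : 0 < τ.im) : Differentiable ℂ (thetaOne τ) :=
  (Complex.differentiable_exp.comp (differentiable_id.const_mul _)).mul
    ((differentiable_jacobiTheta₂ hτ).comp (differentiable_id.add_const _))

lemma exp_eq_exp_of_int {a b : ℂ} (k : ℤ) (h : a = b + k * (2 * Real.pi * Complex.I)) :
    Complex.exp a = Complex.exp b := by
  rw [h, Complex.exp_add, Complex.exp_int_mul_two_pi_mul_I, mul_one]

lemma hasSum_jacobiTheta₂_term_mul (hτ : 0 < τ.im) (z w : ℂ) :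
    HasSum (fun p : ℤ × ℤ => jacobiTheta₂_term p.1 z τ * jacobiTheta₂_term p.2 w τ)
      (jacobiTheta₂ z τ * jacobiTheta₂ w τ) := by
  have hz := hasSum_jacobiTheta₂_term z hτ
  have hw := hasSum_jacobiTheta₂_term w hτ
  exact HasSum.mul (f := fun k => jacobiTheta₂_term k z τ) (g := fun k => jacobiTheta₂_term k w τ)
    hz hw (summable_mul_of_summable_norm (f := fun k => jacobiTheta₂_term k z τ)
      (g := fun k => jacobiTheta₂_term k w τ) hz.summable.norm hw.summable.norm)

lemma hasSum_thetaOne_mul (hτ : 0 < τ.im) (x y : ℂ) :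
    HasSum (fun p : ℤ × ℤ => Complex.exp (2 * Real.pi * Complex.I * x)
        * (jacobiTheta₂_term p.1 (x + y + (1 + τ) / 2) τ * jacobiTheta₂_term p.2 (x - y + (1 + τ) / 2) τ))
      (thetaOne τ (x + y) * thetaOne τ (x - y)) := by
  have e : thetaOne τ (x + y) * thetaOne τ (x - y) = Complex.exp (2 * Real.pi * Complex.I * x)
      * (jacobiTheta₂ (x + y + (1 + τ) / 2) τ * jacobiTheta₂ (x - y + (1 + τ) / 2) τ) := by
    have h : Complex.exp (2 * Real.pi * Complex.I * x) = Complex.exp (Real.pi * Complex.I * (x + y))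
        * Complex.exp (Real.pi * Complex.I * (x - y)) := by
      rw [← Complex.exp_add]
      congr 1
      ring
    rw [h, thetaOne, thetaOne]
    ring
  rw [e]
  exact (hasSum_jacobiTheta₂_term_mul hτ _ _).mul_left _

lemma hasSum_odd_mul_even (hτ : 0 < τ.im) (x y : ℂ) :
    HasSum (fun p : ℤ × ℤ => Complex.exp (2 * Real.pi * Complex.I * x)
        * (jacobiTheta₂_term p.1 (2 * x + τ) (2 * τ) * jacobiTheta₂_term p.2 (2 * y) (2 * τ)))
      (oddTheta τ x * evenTheta τ y) := by
  rw [oddTheta, evenTheta, mul_assoc (Complex.exp _)]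
  exact (hasSum_jacobiTheta₂_term_mul (two_mul_im_pos hτ) _ _).mul_left _

/-- The two families of pairs exhaust ℤ² according to the parity of the sum of the coordinates. -/
lemma hasSum_int_prod {f : ℤ × ℤ → ℂ} {a b : ℂ}
    (ha : HasSum (fun p : ℤ × ℤ => f (p.1 + p.2, p.1 - p.2)) a)
    (hb : HasSum (fun p : ℤ × ℤ => f (p.1 + p.2, p.1 - p.2 - 1)) b) : HasSum f (a + b) := by
  have hi : Function.Injective fun p : ℤ × ℤ => (p.1 + p.2, p.1 - p.2) := fun p q h => by
    simp only [Prod.mk.injEq] at h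
    exact Prod.ext (by omega) (by omega)
  have hj : Function.Injective fun p : ℤ × ℤ => (p.1 + p.2, p.1 - p.2 - 1) := fun p q h => by
    simp only [Prod.mk.injEq] at h
    exact Prod.ext (by omega) (by omega)
  refine (hi.hasSum_range_iff.2 ha).add_isCompl ?_ (hj.hasSum_range_iff.2 hb)
  refine ⟨Set.disjoint_left.2 ?_, codisjoint_iff_le_sup.2 fun p _ => ?_⟩
  · rintro _ ⟨p, rfl⟩ ⟨q, hq⟩
    simp only [Prod.mk.injEq] at hq
    omega
  · obtain ⟨k, l⟩ := p
    rcases Int.even_or_odd (k + l) with ⟨i, hi⟩ | ⟨i, hi⟩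
    · exact Or.inl ⟨(i, k - i), by simp only [Prod.mk.injEq]; omega⟩
    · exact Or.inr ⟨(i + 1, k - i - 1), by simp only [Prod.mk.injEq]; omega⟩

/-- Multiply the two series and put k = i + j, l = i - j when k + l is even. Since k² + l² = 2(i² +
j²), the double series splits into a product of theta series of 2τ. When k + l is odd, put l = i - j
- 1. The half-period (1 + τ)/2 contributes the sign (-1)^{k+l}, which gives the minus of the second
product. -/
theorem thetaOne_mul (hτ : 0 < τ.im) (x y : ℂ) : thetaOne τ (x + y) * thetaOne τ (x - y)
    = oddTheta τ x * evenTheta τ y - evenTheta τ x * oddTheta τ y := by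
  refine (hasSum_thetaOne_mul hτ x y).unique ?_
  refine (hasSum_int_prod (a := oddTheta τ x * evenTheta τ y)
    (b := -(evenTheta τ x * oddTheta τ y)) ?_ ?_)
  · convert hasSum_odd_mul_even hτ x y using 2 with p
    simp only [jacobiTheta₂_term, ← Complex.exp_add]
    refine exp_eq_exp_of_int p.1 ?_
    push_cast
    ring
  · have := (hasSum_odd_mul_even hτ y x).neg
    rw [← (Equiv.prodComm ℤ ℤ).hasSum_iff] at this
    rw [mul_comm (evenTheta τ x)]
    refine (congrArg (fun f => HasSum f _) (funext fun p => ?_)).mp this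
    refine Eq.symm ?_
    simp only [jacobiTheta₂_term, ← Complex.exp_add, Function.comp, Equiv.prodComm_apply,
      Prod.fst_swap, Prod.snd_swap]
    rw [← neg_one_mul, ← Complex.exp_pi_mul_I, ← Complex.exp_add]
    refine exp_eq_exp_of_int (p.1 - 1) ?_
    push_cast
    ring

lemma thetaOne_neg (x : ℂ) : thetaOne τ (-x) = -thetaOne τ x := by
  rw [thetaOne, thetaOne]
  have h₁ : -x + (1 + τ) / 2 = -(x + (1 + τ) / 2 - τ - 1) := by ring
  set w := x + (1 + τ) / 2 - τ - 1 with hw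
  have h₂ : x + (1 + τ) / 2 = w + τ + 1 := by ring
  rw [h₁, jacobiTheta₂_neg_left, h₂, jacobiTheta₂_add_left, jacobiTheta₂_add_left', ← mul_assoc,
    ← Complex.exp_add, ← neg_mul]
  congr 1
  have h₃ : Real.pi * Complex.I * x + -Real.pi * Complex.I * (τ + 2 * w)
      = Real.pi * Complex.I * -x + Real.pi * Complex.I := by
    rw [hw]
    ring
  rw [h₃, Complex.exp_add, Complex.exp_pi_mul_I, mul_neg_one, neg_neg]

lemma theta_neg (x : ℂ) : theta τ (-x) = -theta τ x := by
  rw [theta, theta, thetaOne_neg, neg_div]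

lemma thetaOne_zero : thetaOne τ 0 = 0 := by
  have := thetaOne_neg (τ := τ) 0
  rw [neg_zero] at this
  exact self_eq_neg.1 this

lemma theta_zero : theta τ 0 = 0 := by
  rw [theta, thetaOne_zero, zero_div]

/-- The three-term relation of a function on an abelian group. -/
def ThreeTerm {G S : Type*} [AddCommGroup G] [CommRing S] (f : G → S) : Prop :=
  ∀ t a b c, f (t + a + b) * f (a - b) * (f (t + c) * f c)
    + f (t + b + c) * f (b - c) * (f (t + a) * f a)
    + f (t + c + a) * f (c - a) * (f (t + b) * f b) = 0

/-- By the addition formula, θ(t+x+y) θ(x-y) is up to normalization the 2×2 determinant of the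
vectors (odd, even) at t/2 + x and t/2 + y. The claim is the Plücker relation for the four points a,
b, c, 0. -/
theorem threeTerm_theta (hτ : 0 < τ.im) : ThreeTerm (theta τ) := fun t a b c => by
  have key : ∀ x y, thetaOne τ (t + x + y) * thetaOne τ (x - y)
      = oddTheta τ (t / 2 + x) * evenTheta τ (t / 2 + y)
        - evenTheta τ (t / 2 + x) * oddTheta τ (t / 2 + y) := fun x y => by
    rw [← thetaOne_mul hτ]
    congr 2 <;> ring
  have key' : ∀ x, thetaOne τ (t + x) * thetaOne τ x
      = oddTheta τ (t / 2 + x) * evenTheta τ (t / 2)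
        - evenTheta τ (t / 2 + x) * oddTheta τ (t / 2) := fun x => by
    have := key x 0
    rwa [add_zero, add_zero, sub_zero] at this
  simp only [theta]
  generalize deriv (thetaOne τ) 0 = d
  have h : (thetaOne τ (t + a + b) * thetaOne τ (a - b) * (thetaOne τ (t + c) * thetaOne τ c)
    + thetaOne τ (t + b + c) * thetaOne τ (b - c) * (thetaOne τ (t + a) * thetaOne τ a)
    + thetaOne τ (t + c + a) * thetaOne τ (c - a) * (thetaOne τ (t + b) * thetaOne τ b)) / d ^ 4
      = 0 := by
    simp only [key, key']
    ring
  rw [← h]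
  ring

lemma integral_jacobiTheta₂_term (k : ℤ) (hk : k ≠ 0) :
    ∫ x : ℝ in (0 : ℝ)..1, jacobiTheta₂_term k x τ = 0 := by
  have hc : (2 * Real.pi * Complex.I * k : ℂ) ≠ 0 :=
    mul_ne_zero Complex.two_pi_I_ne_zero (Int.cast_ne_zero.2 hk)
  have e : ∀ x : ℝ, jacobiTheta₂_term k x τ
      = Complex.exp (Real.pi * Complex.I * k ^ 2 * τ) * Complex.exp (2 * Real.pi * Complex.I * k * x) :=
    fun x => by
      rw [jacobiTheta₂_term, ← Complex.exp_add, add_comm]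
  simp only [e]
  rw [intervalIntegral.integral_const_mul, integral_exp_mul_complex hc]
  have : Complex.exp (2 * Real.pi * Complex.I * k * (1 : ℝ)) = 1 := by
    rw [Complex.ofReal_one, mul_one, mul_comm]
    exact Complex.exp_int_mul_two_pi_mul_I k
  rw [this]
  simp

/-- If the theta function vanished, integrating its series term by term over [0, 1] would give 0,
whereas the zeroth Fourier coefficient is 1. -/
lemma exists_jacobiTheta₂_ne_zero (hτ : 0 < τ.im) : ∃ z, jacobiTheta₂ z τ ≠ 0 := by
  by_contra! h
  have hn : ∀ (k : ℤ) (x : ℝ), ‖jacobiTheta₂_term k x τ‖ = ‖jacobiTheta₂_term k 0 τ‖ :=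
    fun k x => by simp [norm_jacobiTheta₂_term]
  have hc : ∀ k : ℤ, Continuous fun x : ℝ => jacobiTheta₂_term k x τ := fun k => by
    unfold jacobiTheta₂_term
    fun_prop
  have hs := intervalIntegral.hasSum_integral_of_dominated_convergence (μ := MeasureTheory.volume)
    (a := 0) (b := 1) (F := fun (k : ℤ) (x : ℝ) => jacobiTheta₂_term k x τ) (f := fun _ => 0)
    (fun k _ => ‖jacobiTheta₂_term k 0 τ‖)
    (fun k => (hc k).aestronglyMeasurable)
    (fun k => Filter.Eventually.of_forall fun x _ => (hn k x).le)
    (Filter.Eventually.of_forall fun x _ => (hasSum_jacobiTheta₂_term 0 hτ).summable.norm)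
    (by simp)
    (Filter.Eventually.of_forall fun x _ => by
      have := hasSum_jacobiTheta₂_term (x : ℂ) hτ
      rwa [h] at this)
  have h₁ := hasSum_single (f := fun k : ℤ => ∫ x : ℝ in (0 : ℝ)..1, jacobiTheta₂_term k x τ) 0
    fun k hk => integral_jacobiTheta₂_term k hk
  have h₂ := h₁.unique hs
  simp [jacobiTheta₂_term] at h₂

lemma exists_thetaOne_ne_zero (hτ : 0 < τ.im) : ∃ z, thetaOne τ z ≠ 0 := by
  obtain ⟨z, hz⟩ := exists_jacobiTheta₂_ne_zero hτ
  refine ⟨z - (1 + τ) / 2, mul_ne_zero (Complex.exp_ne_zero _) ?_⟩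
  rwa [sub_add_cancel]

lemma eq_zero_of_eventuallyEq {f : ℂ → ℂ} (hf : Differentiable ℂ f) {a : ℂ}
    (h : ∀ᶠ z in nhds a, f z = 0) (z : ℂ) : f z = 0 :=
  congrFun ((hf.differentiableOn.analyticOnNhd isOpen_univ).eq_of_eventuallyEq
    (g := 0) (fun _ _ => analyticAt_const) h) z

lemma thetaOne_eq_zero_of_mul (hτ : 0 < τ.im) {a b : ℂ}
    (h : ∀ᶠ s in nhds a, ∀ᶠ d in nhds b, thetaOne τ s * thetaOne τ d = 0) (z : ℂ) :
    thetaOne τ z = 0 := by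
  by_cases h₁ : ∀ᶠ s in nhds a, thetaOne τ s = 0
  · exact eq_zero_of_eventuallyEq (differentiable_thetaOne hτ) h₁ z
  · obtain ⟨s, hs, hs'⟩ := ((Filter.not_eventually.1 h₁).and_eventually h).exists
    exact eq_zero_of_eventuallyEq (differentiable_thetaOne hτ)
      (hs'.mono fun d hd => (mul_eq_zero.1 hd).resolve_left hs) z

/-- Differentiate the addition formula with respect to y at y = x. On the product side one term
carries θ(0) = 0 and the other θ'(0) = 0. -/
lemma wronskian_eq_zero (hτ : 0 < τ.im) (h : deriv (thetaOne τ) 0 = 0) (x : ℂ) :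
    oddTheta τ x * deriv (evenTheta τ) x - evenTheta τ x * deriv (oddTheta τ) x = 0 := by
  have hθ := differentiable_thetaOne hτ
  have h₁ : HasDerivAt (fun y => thetaOne τ (x + y) * thetaOne τ (x - y)) 0 x := by
    have h₂ : HasDerivAt (fun y => thetaOne τ (x - y)) 0 x := by
      have h₃ : HasDerivAt (thetaOne τ) 0 (x - x) := by
        have := (hθ (x - x)).hasDerivAt
        rwa [show deriv (thetaOne τ) (x - x) = 0 by rw [sub_self, h]] at this
      have := h₃.comp x ((hasDerivAt_id x).const_sub x)
      rw [zero_mul] at this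
      exact this
    have h₄ : HasDerivAt (fun y => thetaOne τ (x + y)) (deriv (thetaOne τ) (x + x)) x :=
      ((hθ (x + x)).hasDerivAt).comp_const_add x x
    have := h₄.mul h₂
    rw [sub_self, thetaOne_zero, mul_zero, mul_zero, add_zero] at this
    exact this
  have h₅ : HasDerivAt (fun y => oddTheta τ x * evenTheta τ y - evenTheta τ x * oddTheta τ y)
      (oddTheta τ x * deriv (evenTheta τ) x - evenTheta τ x * deriv (oddTheta τ) x) x :=
    (((differentiable_evenTheta hτ) x).hasDerivAt.const_mul _).sub
      (((differentiable_oddTheta hτ) x).hasDerivAt.const_mul _)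
  refine h₅.unique ?_
  simpa only [thetaOne_mul hτ] using h₁

/-- Guarantees that the normalization of `theta` does not divide by zero. If θ'(0) were 0, the
Wronskian of the odd and even parts would vanish and their ratio would be constant on a small ball.
The addition formula would then give θ(x+y) θ(x-y) = 0 for x, y in the ball, and the identity
theorem would make θ vanish identically. -/
theorem deriv_thetaOne_ne_zero (hτ : 0 < τ.im) : deriv (thetaOne τ) 0 ≠ 0 := fun h => by
  obtain ⟨z, hz⟩ := exists_thetaOne_ne_zero hτ
  obtain ⟨w, hw⟩ := exists_jacobiTheta₂_ne_zero (two_mul_im_pos hτ)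
  have hE := differentiable_evenTheta hτ
  have hO := differentiable_oddTheta hτ
  have hx : evenTheta τ (w / 2) ≠ 0 := by
    rwa [evenTheta, mul_div_cancel₀ w (two_ne_zero)]
  obtain ⟨r, hr, hball⟩ := Metric.eventually_nhds_iff_ball.1 ((hE.continuous.continuousAt).eventually_ne hx)
  have hd : ∀ x ∈ Metric.ball (w / 2) r,
      HasDerivAt (fun y => oddTheta τ y / evenTheta τ y) 0 x := fun x hx' => by
    have := (hO x).hasDerivAt.div (hE x).hasDerivAt (hball x hx')
    have e := wronskian_eq_zero hτ h x
    have h₀ : (deriv (oddTheta τ) x * evenTheta τ x - oddTheta τ x * deriv (evenTheta τ) x)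
        / evenTheta τ x ^ 2 = 0 := by
      rw [div_eq_zero_iff]
      left
      linear_combination -e
    rw [h₀] at this
    exact this
  have hconst : ∀ x ∈ Metric.ball (w / 2) r, ∀ y ∈ Metric.ball (w / 2) r,
      oddTheta τ x / evenTheta τ x = oddTheta τ y / evenTheta τ y := fun x hx y hy =>
    (convex_ball (w / 2) r).is_const_of_fderivWithin_eq_zero (𝕜 := ℂ)
      (fun x hx => (hd x hx).differentiableAt.differentiableWithinAt)
      (fun x hx => by
        rw [fderivWithin_of_isOpen Metric.isOpen_ball hx]
        ext
        simp [(hd x hx).deriv]) hx hy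
  have hzero : ∀ x ∈ Metric.ball (w / 2) r, ∀ y ∈ Metric.ball (w / 2) r,
      thetaOne τ (x + y) * thetaOne τ (x - y) = 0 := fun x hx y hy => by
    have := hconst x hx y hy
    rw [div_eq_div_iff (hball x hx) (hball y hy)] at this
    rw [thetaOne_mul hτ]
    linear_combination this
  -- The coordinates s = x + y near w and d = x - y near 0 vary independently while x and y stay in
  -- the ball around w/2.
  refine hz (thetaOne_eq_zero_of_mul hτ (a := w) (b := 0) ?_ z)
  filter_upwards [Metric.ball_mem_nhds w hr] with s hs
  filter_upwards [Metric.ball_mem_nhds 0 hr] with d hd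
  rw [Metric.mem_ball, dist_eq_norm] at hs hd
  have hsd : ∀ e : ℂ, ‖e‖ < r → ‖(s + e) / 2 - w / 2‖ < r := fun e he => by
    have : (s + e) / 2 - w / 2 = ((s - w) + e) / 2 := by ring
    rw [this, norm_div, Complex.norm_ofNat]
    have := norm_add_le (s - w) e
    linarith
  rw [sub_zero] at hd
  have := hzero ((s + d) / 2) (by simpa [dist_eq_norm] using hsd d hd)
    ((s + -d) / 2) (by simpa [dist_eq_norm] using hsd (-d) (by rwa [norm_neg]))
  convert this using 2 <;> congr 1 <;> ring

lemma differentiable_theta (hτ : 0 < τ.im) : Differentiable ℂ (theta τ) :=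
  (differentiable_thetaOne hτ).div_const _

lemma deriv_theta_zero (hτ : 0 < τ.im) : deriv (theta τ) 0 = 1 := by
  unfold theta
  rw [deriv_div_const, div_self (deriv_thetaOne_ne_zero hτ)]

end ThetaAnalysis

end DynamicalElliptic
end

noncomputable section
namespace DynamicalElliptic
open Matrix PowerSeries TensorProduct
open Finset.HasAntidiagonal (antidiagonal mem_antidiagonal)

/-! ### Formal Taylor expansions of entire functions -/

/-- The entire functions. -/
abbrev Entire : Type := {f : ℂ → ℂ // Differentiable ℂ f}

/-- The derivative of an entire function. -/
def Entire.der (f : Entire) : Entire := ⟨deriv f.1, f.2.deriv⟩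

lemma Entire.coe_der_iterate (f : Entire) (j : ℕ) :
    (Entire.der^[j] f).1 = iteratedDeriv j f.1 := by
  rw [iteratedDeriv_eq_iterate]
  induction j with
  | zero => rfl
  | succ j ih => rw [Function.iterate_succ_apply', Function.iterate_succ_apply', ← ih]; rfl

section ExpSeries
variable {K : Type*} [CommRing K] [Algebra ℂ K]

/-- The Taylor expansion `∑ⱼ κʲ f⁽ʲ⁾ ℏʲ / j!` of `f(· + κℏ)`, where `E` assigns to a function its
value at `·`. -/
def expSeries (E : Entire → K) (κ : ℂ) (f : Entire) : K⟦X⟧ :=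
  PowerSeries.mk fun j => (κ ^ j / (j.factorial : ℂ)) • E (Entire.der^[j] f)

lemma coeff_expSeries (E : Entire → K) (κ : ℂ) (f : Entire) (j : ℕ) :
    PowerSeries.coeff j (expSeries E κ f) = (κ ^ j / (j.factorial : ℂ)) • E (Entire.der^[j] f) :=
  PowerSeries.coeff_mk _ _

lemma expSeries_zero (E : Entire → K) (f : Entire) : expSeries E 0 f = PowerSeries.C (E f) := by
  ext j
  rw [coeff_expSeries, PowerSeries.coeff_C]
  obtain _ | j := j
  · simp
  · simp

lemma divPow_of_der {D : Derivation ℂ K K} {E : Entire → K} {κ : ℂ}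
    (hD : ∀ f, D (E f) = κ • E f.der) (j : ℕ) (f : Entire) :
    divPow D j (E f) = (κ ^ j / (j.factorial : ℂ)) • E (Entire.der^[j] f) := by
  induction j with
  | zero => simp [divPow_zero]
  | succ j ih =>
    have h : ((j + 1 : ℕ) : ℂ) ≠ 0 := by exact_mod_cast Nat.succ_ne_zero j
    refine smul_right_injective K h ?_
    change ((j + 1 : ℕ) : ℂ) • _ = ((j + 1 : ℕ) : ℂ) • _
    rw [divPow_succ, ih, D.map_smul, hD, smul_smul, smul_smul, Function.iterate_succ_apply',
      Nat.factorial_succ]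
    congr 1
    have h₁ : (j.factorial : ℂ) ≠ 0 := by exact_mod_cast Nat.factorial_ne_zero _
    push_cast at h ⊢
    rw [pow_succ]
    field_simp

lemma add_pow_div_factorial (a b : ℂ) (m : ℕ) : (a + b) ^ m / (m.factorial : ℂ)
    = ∑ p ∈ antidiagonal m, a ^ p.1 / (p.1.factorial : ℂ) * (b ^ p.2 / (p.2.factorial : ℂ)) := by
  rw [(Commute.all a b).add_pow', Finset.sum_div]
  refine Finset.sum_congr rfl fun p hp => ?_
  obtain ⟨i, j⟩ := p
  obtain rfl : i + j = m := mem_antidiagonal.1 hp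
  have := Nat.add_choose_mul_factorial_mul_factorial i j
  have h1 : ((i + j).factorial : ℂ) ≠ 0 := by exact_mod_cast Nat.factorial_ne_zero _
  have h2 : (i.factorial : ℂ) ≠ 0 := by exact_mod_cast Nat.factorial_ne_zero _
  have h3 : (j.factorial : ℂ) ≠ 0 := by exact_mod_cast Nat.factorial_ne_zero _
  rw [nsmul_eq_mul]
  field_simp
  rw [← this, Nat.choose_symm_add]
  push_cast
  ring

/-- The binomial theorem for Taylor coefficients. Nothing is assumed of the valuation `E` except
that it intertwines `D` with κ times differentiation; this uniform form applies to values,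
holomorphic functions and power series alike. -/
theorem expShift_expSeries {D : Derivation ℂ K K} {E : Entire → K} {κ : ℂ}
    (hD : ∀ f, D (E f) = κ • E f.der) (κ' : ℂ) (f : Entire) :
    expShift D (expSeries E κ' f) = expSeries E (κ + κ') f := by
  ext m
  rw [coeff_expShift, coeff_expSeries, add_pow_div_factorial, Finset.sum_smul]
  refine Finset.sum_congr rfl fun p hp => ?_
  rw [coeff_expSeries, map_smul, divPow_of_der hD, ← Function.iterate_add_apply, mem_antidiagonal.1 hp,
    smul_smul, mul_comm]

theorem expShift_C_of_der {D : Derivation ℂ K K} {E : Entire → K} {κ : ℂ}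
    (hD : ∀ f, D (E f) = κ • E f.der) (f : Entire) :
    expShift D (PowerSeries.C (E f)) = expSeries E κ f := by
  rw [← expSeries_zero, expShift_expSeries hD, add_zero]

lemma mapHbar_expSeries {K' : Type*} [CommRing K'] [Algebra ℂ K'] (φ : K →ₐ[ℂ] K') (E : Entire → K)
    (κ : ℂ) (f : Entire) : mapHbar φ (expSeries E κ f) = expSeries (fun f => φ (E f)) κ f := by
  ext m
  rw [coeff_mapHbar, coeff_expSeries, coeff_expSeries, map_smul]

end ExpSeries

section TaylorSeries
variable {n : ℕ} {A : Type*} [CommRing A] [Algebra ℂ A]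

/-- The Taylor expansion of `f(· + ∑ᵢ ℓᵢ λᵢ)` in `λ`, where `E` assigns to a function its value
at `·`. -/
def taylorSeries (E : Entire → A) (l : Fin n → ℂ) (f : Entire) : MvPowerSeries (Fin n) A :=
  fun d => (∏ i, l i ^ d i / ((d i).factorial : ℂ)) • E (Entire.der^[∑ i, d i] f)

lemma coeff_taylorSeries (E : Entire → A) (l : Fin n → ℂ) (f : Entire) (d : Fin n →₀ ℕ) :
    MvPowerSeries.coeff d (taylorSeries E l f)
      = (∏ i, l i ^ d i / ((d i).factorial : ℂ)) • E (Entire.der^[∑ i, d i] f) := rfl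

lemma mapAlgHom_taylorSeries {A' : Type*} [CommRing A'] [Algebra ℂ A'] (φ : A →ₐ[ℂ] A')
    (E : Entire → A) (l : Fin n → ℂ) (f : Entire) :
    MvPowerSeries.mapAlgHom φ (taylorSeries E l f) = taylorSeries (fun f => φ (E f)) l f := by
  ext d
  change φ (MvPowerSeries.coeff d (taylorSeries E l f)) = _
  rw [coeff_taylorSeries, coeff_taylorSeries, map_smul]

lemma coeffDer_taylorSeries {D : Derivation ℂ A A} {E : Entire → A} {κ : ℂ}
    (hD : ∀ f, D (E f) = κ • E f.der) (l : Fin n → ℂ) (f : Entire) :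
    coeffDer D (taylorSeries E l f) = κ • taylorSeries E l f.der := by
  ext d
  change D (MvPowerSeries.coeff d (taylorSeries E l f)) = κ • MvPowerSeries.coeff d (taylorSeries E l f.der)
  rw [coeff_taylorSeries, coeff_taylorSeries, D.map_smul, hD, smul_comm,
    ← Function.iterate_succ_apply, ← Function.iterate_succ_apply' Entire.der]

lemma pderiv_taylorSeries (E : Entire → A) (l : Fin n → ℂ) (f : Entire) (k : Fin n) :
    MvPowerSeries.pderiv A k (taylorSeries E l f) = l k • taylorSeries E l f.der := by
  classical
  ext d
  rw [MvPowerSeries.coeff_pderiv]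
  change _ = l k • MvPowerSeries.coeff d (taylorSeries E l f.der)
  rw [coeff_taylorSeries, coeff_taylorSeries]
  have h₁ : ∑ i, (d + Finsupp.single k 1 : Fin n →₀ ℕ) i = (∑ i, d i) + 1 := by
    simp [Finsupp.add_apply, Finset.sum_add_distrib, Finsupp.single_apply]
  have h₂ : ∏ i, l i ^ (d + Finsupp.single k 1 : Fin n →₀ ℕ) i / (((d + Finsupp.single k 1 : Fin n →₀ ℕ) i).factorial : ℂ)
      = (∏ i, l i ^ d i / ((d i).factorial : ℂ)) * (l k / ((d k : ℂ) + 1)) := by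
    have : l k / ((d k : ℂ) + 1) = ∏ i, if k = i then l k / ((d k : ℂ) + 1) else 1 := by simp
    rw [this, ← Finset.prod_mul_distrib]
    refine Finset.prod_congr rfl fun i _ => ?_
    rw [Finsupp.add_apply, Finsupp.single_apply]
    split_ifs with h
    · subst h
      have h₃ : ((d k : ℂ) + 1) ≠ 0 := by exact_mod_cast Nat.succ_ne_zero (d k)
      have h₄ : ((d k).factorial : ℂ) ≠ 0 := by exact_mod_cast Nat.factorial_ne_zero _
      rw [Nat.factorial_succ, pow_succ]
      push_cast
      field_simp
    · rw [add_zero, mul_one]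
  have h₃ : ((d k : A) + 1) = algebraMap ℂ A ((d k : ℂ) + 1) := by simp
  have h₄ : ((d k : ℂ) + 1) ≠ 0 := by exact_mod_cast Nat.succ_ne_zero (d k)
  rw [h₁, h₂, h₃, mul_comm, ← Algebra.smul_def, smul_smul, smul_smul, Function.iterate_succ_apply]
  congr 1
  field_simp

end TaylorSeries

/-! ### Restriction of power series to lines -/

section Lines
variable {n : ℕ}

lemma hasSubst_line (a : Fin n → ℂ) :
    MvPowerSeries.HasSubst fun k => (a k • PowerSeries.X : ℂ⟦X⟧) :=
  MvPowerSeries.hasSubst_of_constantCoeff_zero fun k => by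
    change MvPowerSeries.constantCoeff (a k • MvPowerSeries.X () : MvPowerSeries Unit ℂ) = 0
    simp

/-- The restriction of a power series to the line spanned by `a`. -/
def lineHom (a : Fin n → ℂ) : MvPowerSeries (Fin n) ℂ →+* ℂ⟦X⟧ :=
  (MvPowerSeries.substAlgHom (R := ℂ) (hasSubst_line a)).toRingHom

lemma lineHom_apply (a : Fin n → ℂ) (f : MvPowerSeries (Fin n) ℂ) :
    lineHom a f = MvPowerSeries.subst (fun k => (a k • PowerSeries.X : ℂ⟦X⟧)) f :=
  MvPowerSeries.substAlgHom_apply _ _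

lemma coeff_lineHom (a : Fin n → ℂ) (f : MvPowerSeries (Fin n) ℂ) (m : ℕ) :
    PowerSeries.coeff m (lineHom a f) = ∑ α ∈ Finset.piAntidiag Finset.univ m,
      MvPowerSeries.coeff (Finsupp.equivFunOnFinite.symm α) f * ∏ k, a k ^ α k := by
  have h : ∀ d : Fin n →₀ ℕ, PowerSeries.coeff m (d.prod fun k e => (a k • PowerSeries.X : ℂ⟦X⟧) ^ e)
      = if ∑ k, d k = m then ∏ k, a k ^ d k else 0 := fun d => by
    rw [Finsupp.prod_fintype _ _ fun _ => pow_zero _]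
    simp only [PowerSeries.smul_eq_C_mul, mul_pow, ← map_pow, Finset.prod_mul_distrib, Finset.prod_pow_eq_pow_sum]
    rw [← map_prod, PowerSeries.coeff_C_mul, PowerSeries.coeff_X_pow]
    split_ifs <;> simp_all
  rw [lineHom_apply, PowerSeries.coeff, MvPowerSeries.coeff_subst (hasSubst_line a)]
  change ∑ᶠ d : Fin n →₀ ℕ, MvPowerSeries.coeff d f
    • PowerSeries.coeff m (d.prod fun k e => (a k • PowerSeries.X : ℂ⟦X⟧) ^ e) = _
  simp only [h]
  rw [finsum_eq_sum_of_support_subset (s := (Finset.piAntidiag Finset.univ m).map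
    Finsupp.equivFunOnFinite.symm.toEmbedding), Finset.sum_map]
  · refine Finset.sum_congr rfl fun α hα => ?_
    have := (Finset.mem_piAntidiag.1 hα).1
    simp [this]
  · intro d hd
    rw [Function.mem_support] at hd
    have hm : ∑ k, d k = m := by
      by_contra hm
      exact hd (by rw [if_neg hm, smul_zero])
    simp only [Finset.coe_map, Set.mem_image, Finset.mem_coe, Finset.mem_piAntidiag]
    exact ⟨Finsupp.equivFunOnFinite d, ⟨hm, by simp⟩, by simp⟩

/-- The coefficient of degree m on the line spanned by `a` is the homogeneous part of degree m
evaluated at `a`. A polynomial vanishing at all points of ℂⁿ is zero. -/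
lemma eq_zero_of_lineHom {f : MvPowerSeries (Fin n) ℂ} (h : ∀ a, lineHom a f = 0) : f = 0 := by
  classical
  ext d
  set m := ∑ k, d k
  have hp : ∑ α ∈ Finset.piAntidiag Finset.univ m, MvPolynomial.monomial
      (Finsupp.equivFunOnFinite.symm α) (MvPowerSeries.coeff (Finsupp.equivFunOnFinite.symm α) f)
      = 0 := by
    refine MvPolynomial.funext fun a => ?_
    have := congrArg (PowerSeries.coeff m) (h a)
    rw [coeff_lineHom, map_zero] at this
    rw [map_zero, ← this, map_sum]
    refine Finset.sum_congr rfl fun α _ => ?_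
    rw [MvPolynomial.eval_monomial, Finsupp.prod_fintype _ _ fun _ => pow_zero _]
    rfl
  have := congrArg (MvPolynomial.coeff d) hp
  rw [MvPolynomial.coeff_sum, Finset.sum_eq_single (Finsupp.equivFunOnFinite d)] at this
  · simpa using this
  · intro α _ hα
    rw [MvPolynomial.coeff_monomial, if_neg]
    rintro rfl
    exact hα (by simp)
  · intro hd
    exact absurd (Finset.mem_piAntidiag.2 ⟨rfl, by simp⟩) hd

lemma eq_of_lineHom {f g : MvPowerSeries (Fin n) ℂ} (h : ∀ a, lineHom a f = lineHom a g) : f = g :=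
  sub_eq_zero.1 (eq_zero_of_lineHom fun a => by rw [map_sub, h, sub_self])

lemma lineHom_taylorSeries (a : Fin n → ℂ) (E : Entire → ℂ) (l : Fin n → ℂ) (f : Entire) :
    lineHom a (taylorSeries E l f) = expSeries E (∑ k, l k * a k) f := by
  ext m
  rw [coeff_lineHom, coeff_expSeries, Finset.sum_pow_eq_sum_piAntidiag, Finset.sum_div,
    Finset.sum_smul]
  refine Finset.sum_congr rfl fun α hα => ?_
  have hs : ∑ k, α k = m := (Finset.mem_piAntidiag.1 hα).1
  rw [coeff_taylorSeries]
  simp only [Finsupp.equivFunOnFinite_symm_apply_apply, smul_eq_mul, hs]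
  have := Nat.multinomial_spec Finset.univ α
  rw [hs] at this
  have h₁ : (∏ k, ((α k).factorial : ℂ)) ≠ 0 :=
    Finset.prod_ne_zero_iff.2 fun k _ => by exact_mod_cast Nat.factorial_ne_zero _
  have h₂ : (m.factorial : ℂ) = (∏ k, ((α k).factorial : ℂ)) * Nat.multinomial Finset.univ α := by
    rw [← this]
    push_cast
    rfl
  have h₃ : (Nat.multinomial Finset.univ α : ℂ) ≠ 0 := by
    exact_mod_cast (Nat.multinomial_pos _ _).ne'
  rw [h₂, Finset.prod_div_distrib]
  simp only [mul_pow, Finset.prod_mul_distrib]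
  field_simp

lemma lineHom_subst (a l : Fin n → ℂ) (f : ℂ⟦X⟧) :
    lineHom a (PowerSeries.subst (∑ k, l k • MvPowerSeries.X k : MvPowerSeries (Fin n) ℂ) f)
      = PowerSeries.rescale (∑ k, l k * a k) f := by
  have h₁ : PowerSeries.HasSubst (∑ k, l k • MvPowerSeries.X k : MvPowerSeries (Fin n) ℂ) :=
    PowerSeries.HasSubst.of_constantCoeff_zero (by simp [map_sum])
  rw [lineHom_apply, PowerSeries.subst_def, MvPowerSeries.subst_comp_subst_apply
    (PowerSeries.HasSubst.const h₁) (hasSubst_line a), PowerSeries.rescale_eq_subst,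
    PowerSeries.subst_def]
  congr 1
  funext _
  rw [← lineHom_apply, map_sum, Finset.sum_smul]
  refine Finset.sum_congr rfl fun k _ => ?_
  rw [lineHom_apply, MvPowerSeries.subst_smul (hasSubst_line a), MvPowerSeries.subst_X (hasSubst_line a),
    smul_smul]

end Lines

end DynamicalElliptic
end

noncomputable section
namespace DynamicalElliptic
open Matrix PowerSeries TensorProduct
open Finset.HasAntidiagonal (antidiagonal mem_antidiagonal)

/-! ### Formal theta functions -/

section ThetaLike
variable {G H S S' : Type*} [AddCommGroup G] [AddCommGroup H] [CommRing S] [CommRing S']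

/-- An odd function on an abelian group that satisfies the three-term relation. -/
structure ThetaLike (f : G → S) : Prop where
  odd : ∀ x, f (-x) = -f x
  threeTerm : ThreeTerm f

lemma ThetaLike.comp {f : G → S} (hf : ThetaLike f) (g : H →+ G) : ThetaLike fun x => f (g x) where
  odd x := by rw [map_neg, hf.odd]
  threeTerm t a b c := by
    simp only [map_add, map_sub]
    exact hf.threeTerm _ _ _ _

lemma ThetaLike.map {f : G → S} (hf : ThetaLike f) (φ : S →+* S') : ThetaLike fun x => φ (f x) where
  odd x := by rw [hf.odd, map_neg]
  threeTerm t a b c := by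
    have := congrArg φ (hf.threeTerm t a b c)
    simpa only [map_add, map_mul, map_zero] using this

/-- Oddness and the three-term relation are polynomial identities, so a jointly injective family of
homomorphisms detects them. In this way the relations pass from numbers to holomorphic functions by
evaluation at points, and to power series in λ by restriction to lines. -/
lemma ThetaLike.of_injective {ι : Type*} {S' : ι → Type*} [∀ i, CommRing (S' i)] {f : G → S}
    (φ : ∀ i, S →+* S' i) (hφ : ∀ x, (∀ i, φ i x = 0) → x = 0)
    (hf : ∀ i, ThetaLike fun x => φ i (f x)) : ThetaLike f where
  odd x := by
    rw [eq_neg_iff_add_eq_zero]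
    refine hφ _ fun i => ?_
    rw [map_add, (hf i).odd, neg_add_cancel]
  threeTerm t a b c := hφ _ fun i => by
    simp only [map_add, map_mul]
    exact (hf i).threeTerm t a b c

end ThetaLike

/-- The value of an entire function at a point. -/
def valueAt (c : ℂ) (f : Entire) : ℂ := f.1 c

section HolComp
variable {U : TopologicalSpace.Opens ℂ}

/-- The function `u ↦ f(c + au)` on `U`. -/
def holComp (U : TopologicalSpace.Opens ℂ) (c a : ℂ) (f : Entire) : Hol U :=
  ⟨fun u => f.1 (c + a * u),
    ((f.2.comp ((differentiable_id.const_mul a).const_add c)).differentiableOn).congr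
      (extendZero_eqOn fun _ => rfl)⟩

lemma evalHol_holComp (u : U) (c a : ℂ) (f : Entire) :
    evalHol u (holComp U c a f) = valueAt (c + a * u) f := rfl

lemma evalHol_injective {f : Hol U} (h : ∀ u, evalHol u f = 0) : f = 0 :=
  Subtype.ext (funext h)

lemma holDeriv_holComp (c a : ℂ) (f : Entire) :
    holDeriv U (holComp U c a f) = a • holComp U c a f.der := by
  refine Subtype.ext (funext fun u => ?_)
  change deriv (extendZero (holComp U c a f).1) u = a * deriv f.1 (c + a * u)
  have h : extendZero (holComp U c a f).1 =ᶠ[nhds (u : ℂ)] fun z => f.1 (c + a * z) := by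
    filter_upwards [U.isOpen.mem_nhds u.2] with z hz
    exact extendZero_coe (holComp U c a f).1 ⟨z, hz⟩
  rw [h.deriv_eq]
  have h₁ : HasDerivAt (fun z => c + a * z) a (u : ℂ) := by
    simpa using ((hasDerivAt_id (u : ℂ)).const_mul a).const_add c
  have := (f.2 (c + a * u)).hasDerivAt.comp (u : ℂ) h₁
  rw [mul_comm]
  exact this.deriv

end HolComp

section FormalTheta
variable {n : ℕ} {τ : ℂ} (hτ : 0 < τ.im)

/-- The theta function as an entire function. -/
def thetaEntire : Entire := ⟨theta τ, differentiable_theta hτ⟩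

lemma thetaLike_theta : ThetaLike fun c : ℂ => valueAt c (thetaEntire hτ) :=
  ⟨theta_neg, threeTerm_theta hτ⟩

lemma thetaLike_hol (U : TopologicalSpace.Opens ℂ) :
    ThetaLike fun p : ℂ × ℂ => holComp U p.1 p.2 (thetaEntire hτ) :=
  ThetaLike.of_injective (S' := fun _ : U => ℂ) (fun u => (evalHol u).toRingHom)
    (fun _ => evalHol_injective) fun u =>
      (thetaLike_theta hτ).comp (AddMonoidHom.mk' (fun p : ℂ × ℂ => p.1 + p.2 * u) fun p q => by
        simp only [Prod.fst_add, Prod.snd_add]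
        ring)

/-- The Taylor series at `0` of an entire function. -/
def taylorAtZero : Hol ⊤ →+* ℂ⟦X⟧ :=
  ((mapHbar (evalHol (U := ⊤) ⟨0, trivial⟩)).toRingHom.comp (expShift (holDeriv ⊤)).toRingHom).comp
    PowerSeries.C

lemma taylorAtZero_holComp (c a : ℂ) (f : Entire) :
    taylorAtZero (holComp ⊤ c a f) = expSeries (valueAt c) a f := by
  change mapHbar (evalHol (U := ⊤) ⟨0, trivial⟩)
    (expShift (holDeriv ⊤) (PowerSeries.C (holComp ⊤ c a f))) = _
  rw [expShift_C_of_der (holDeriv_holComp c a), mapHbar_expSeries]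
  congr 1
  funext f
  rw [evalHol_holComp, mul_zero, add_zero]

lemma thetaLike_series :
    ThetaLike fun p : ℂ × ℂ => expSeries (valueAt p.1) p.2 (thetaEntire hτ) := by
  have := (thetaLike_hol hτ ⊤).map taylorAtZero
  simpa only [taylorAtZero_holComp] using this

lemma thetaLike_taylorSeries : ThetaLike fun p : ℂ × (Fin n → ℂ) =>
    taylorSeries (valueAt p.1) p.2 (thetaEntire hτ) := by
  refine ThetaLike.of_injective (S' := fun _ : Fin n → ℂ => ℂ⟦X⟧) lineHom
    (fun _ => eq_zero_of_lineHom) fun a => ?_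
  simp only [lineHom_taylorSeries]
  exact (thetaLike_series hτ).comp
    (AddMonoidHom.mk' (fun p : ℂ × (Fin n → ℂ) => (p.1, ∑ k, p.2 k * a k)) fun p q =>
      Prod.ext rfl (by simp [add_mul, Finset.sum_add_distrib]))

/-- `θ(c + au + ∑ᵢ ℓᵢλᵢ)` as a power series in `λ` with coefficients holomorphic in `u`. -/
def holTaylor (U : TopologicalSpace.Opens ℂ) (c a : ℂ) (l : Fin n → ℂ) (f : Entire) :
    MvPowerSeries (Fin n) (Hol U) := taylorSeries (holComp U c a) l f

lemma map_holTaylor {U : TopologicalSpace.Opens ℂ} (u : U) (c a : ℂ) (l : Fin n → ℂ) (f : Entire) :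
    MvPowerSeries.mapAlgHom (evalHol u) (holTaylor U c a l f)
      = taylorSeries (valueAt (c + a * u)) l f :=
  mapAlgHom_taylorSeries _ _ _ _

lemma holTaylor_injective {U : TopologicalSpace.Opens ℂ} {F : MvPowerSeries (Fin n) (Hol U)}
    (h : ∀ u, MvPowerSeries.mapAlgHom (evalHol u) F = 0) : F = 0 := by
  ext d : 1
  exact evalHol_injective fun u => congrArg (MvPowerSeries.coeff d) (h u)

lemma thetaLike_holTaylor (U : TopologicalSpace.Opens ℂ) :
    ThetaLike fun p : ℂ × (Fin n → ℂ) × ℂ => holTaylor U p.1 p.2.2 p.2.1 (thetaEntire hτ) := by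
  refine ThetaLike.of_injective (S' := fun _ : U => MvPowerSeries (Fin n) ℂ)
    (fun u => (MvPowerSeries.mapAlgHom (evalHol u)).toRingHom)
    (fun _ => holTaylor_injective) fun u => ?_
  have : ∀ p : ℂ × (Fin n → ℂ) × ℂ, (MvPowerSeries.mapAlgHom (evalHol u)).toRingHom
      (holTaylor U p.1 p.2.2 p.2.1 (thetaEntire hτ))
      = taylorSeries (valueAt (p.1 + p.2.2 * u)) p.2.1 (thetaEntire hτ) := fun p =>
    map_holTaylor u _ _ _ _
  simp only [this]
  exact (thetaLike_taylorSeries hτ).comp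
    (AddMonoidHom.mk' (fun p : ℂ × (Fin n → ℂ) × ℂ => (p.1 + p.2.2 * u, p.2.1)) fun p q =>
      Prod.ext (by simp only [Prod.fst_add, Prod.snd_add]; ring) rfl)

/-- The function `f(c + ∑ᵢ ℓᵢλᵢ)` as an element of `𝔸ₙ`. -/
def lambdaTaylor (c : ℂ) (l : Fin n → ℂ) (f : Entire) : LambdaField n :=
  algebraMap (MvPowerSeries (Fin n) ℂ) (LambdaField n) (taylorSeries (valueAt c) l f)

/-- The function `θ(c + ∑ᵢ ℓᵢλᵢ + κℏ)`. -/
def formalTheta (p : ℂ × (Fin n → ℂ) × ℂ) : (LambdaField n)⟦X⟧ :=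
  expSeries (lambdaTaylor p.1 p.2.1) p.2.2 (thetaEntire hτ)

/-- The variable ℏ is produced from a spectral variable u on the whole plane: applying exp(ℏ d/du)
and then setting u = 0 replaces κu by κℏ. These operations are ring homomorphisms and so preserve
the relations. -/
lemma thetaLike_formalTheta : ThetaLike (formalTheta (n := n) hτ) := by
  have := (thetaLike_holTaylor (n := n) hτ ⊤).map
    (((mapHbar ((IsScalarTower.toAlgHom ℂ (MvPowerSeries (Fin n) ℂ) (LambdaField n)).comp
      (MvPowerSeries.mapAlgHom (evalHol (U := ⊤) ⟨0, trivial⟩)))).toRingHom.comp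
        (expShift (coeffDer (holDeriv ⊤))).toRingHom).comp PowerSeries.C)
  convert this using 2 with p
  change _ = mapHbar ((IsScalarTower.toAlgHom ℂ (MvPowerSeries (Fin n) ℂ) (LambdaField n)).comp
      (MvPowerSeries.mapAlgHom (evalHol (U := ⊤) ⟨0, trivial⟩))) (expShift (coeffDer (holDeriv ⊤))
        (PowerSeries.C (holTaylor ⊤ p.1 p.2.2 p.2.1 (thetaEntire hτ))))
  rw [holTaylor, expShift_C_of_der (κ := p.2.2) (E := taylorSeries (holComp ⊤ p.1 p.2.2) p.2.1)
    (coeffDer_taylorSeries (holDeriv_holComp p.1 p.2.2) p.2.1), mapHbar_expSeries, formalTheta]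
  congr 1
  funext f
  rw [AlgHom.comp_apply, mapAlgHom_taylorSeries]
  simp only [evalHol_holComp, mul_zero, add_zero]
  rfl

lemma dLambda_lambdaTaylor (c : ℂ) (l : Fin n → ℂ) (f : Entire) (k : Fin n) :
    dLambda k (lambdaTaylor c l f) = l k • lambdaTaylor c l f.der := by
  rw [lambdaTaylor, dLambda, locDer_algebraMap, pderiv_taylorSeries, lambdaTaylor, Algebra.smul_def,
    Algebra.smul_def, map_mul, ← IsScalarTower.algebraMap_apply]

lemma dir_lambdaTaylor (μ : Fin n → ℤ) (c : ℂ) (l : Fin n → ℂ) (f : Entire) :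
    (lambdaDerivatives n).dir μ (lambdaTaylor c l f) = (∑ k, μ k * l k) • lambdaTaylor c l f.der := by
  rw [PartialDerivatives.dir_apply, Finset.sum_smul]
  refine Finset.sum_congr rfl fun k _ => ?_
  change μ k • dLambda k _ = _
  rw [dLambda_lambdaTaylor, mul_smul, Int.cast_smul_eq_zsmul]

lemma shift_formalTheta (μ : Fin n → ℤ) (c : ℂ) (l : Fin n → ℂ) (κ : ℂ) :
    (lambdaDerivatives n).shS.map μ (formalTheta hτ (c, l, κ))
      = formalTheta hτ (c, l, (∑ k, μ k * l k) + κ) :=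
  expShift_expSeries (dir_lambdaTaylor μ c l) κ _

lemma lambdaTaylor_zero (c : ℂ) (f : Entire) :
    lambdaTaylor (n := n) c 0 f = algebraMap ℂ (LambdaField n) (f.1 c) := by
  rw [lambdaTaylor, IsScalarTower.algebraMap_apply ℂ (MvPowerSeries (Fin n) ℂ) (LambdaField n)]
  congr 1
  refine eq_of_lineHom fun a => ?_
  rw [lineHom_taylorSeries]
  simp only [Pi.zero_apply, zero_mul, Finset.sum_const_zero, expSeries_zero]
  exact ((MvPowerSeries.substAlgHom (R := ℂ) (hasSubst_line a)).commutes _).symm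

lemma thetaSeries_eq (c : ℂ) : thetaSeries τ c = expSeries (valueAt c) 1 (thetaEntire hτ) := by
  ext j
  rw [thetaSeries, PowerSeries.coeff_mk, coeff_expSeries, one_pow, valueAt, Entire.coe_der_iterate,
    smul_eq_mul, div_eq_inv_mul, one_div]
  rfl

lemma algebraMap_thetaSeries (c : ℂ) :
    algebraMap ℂ⟦X⟧ (LambdaField n)⟦X⟧ (thetaSeries τ c) = formalTheta hτ (c, 0, 1) := by
  rw [thetaSeries_eq hτ]
  ext j
  rw [PowerSeries.algebraMap_apply'', PowerSeries.coeff_map, coeff_expSeries, formalTheta,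
    coeff_expSeries]
  change _ = (1 ^ j / (j.factorial : ℂ)) • lambdaTaylor c 0 (Entire.der^[j] (thetaEntire hτ))
  rw [lambdaTaylor_zero, smul_eq_mul, map_mul, Algebra.smul_def]
  rfl

lemma thetaLambda_eq (c : ℂ) (i j : Fin n) :
    thetaLambda τ c i j = lambdaTaylor c (Pi.single i 1 - Pi.single j 1) (thetaEntire hτ) := by
  rw [thetaLambda, lambdaTaylor]
  congr 1
  refine eq_of_lineHom fun a => ?_
  have h : (MvPowerSeries.X i - MvPowerSeries.X j : MvPowerSeries (Fin n) ℂ)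
      = ∑ k, (Pi.single i 1 - Pi.single j 1 : Fin n → ℂ) k • MvPowerSeries.X k := by
    simp [sub_smul, Finset.sum_sub_distrib, Pi.single_apply]
  rw [h, lineHom_subst, lineHom_taylorSeries, thetaSeries_eq hτ]
  ext m
  rw [PowerSeries.coeff_rescale, coeff_expSeries, coeff_expSeries, one_pow, smul_eq_mul, smul_eq_mul,
    ← mul_assoc, mul_one_div]

/-- On the k-th coordinate axis the linear coefficient is `l k` times θ'(0) = 1. -/
lemma lambdaTaylor_theta_ne_zero {l : Fin n → ℂ} (hl : l ≠ 0) :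
    lambdaTaylor 0 l (thetaEntire hτ) ≠ 0 := by
  obtain ⟨k, hk⟩ := Function.ne_iff.1 hl
  intro h
  have h₁ : taylorSeries (valueAt 0) l (thetaEntire hτ) = 0 :=
    IsFractionRing.injective (MvPowerSeries (Fin n) ℂ) (LambdaField n) (h.trans (map_zero _).symm)
  have h₂ := congrArg (fun f => PowerSeries.coeff 1 (lineHom (Pi.single k 1) f)) h₁
  simp only [lineHom_taylorSeries, map_zero, coeff_expSeries, pow_one, Nat.factorial_one, Nat.cast_one,
    div_one, Function.iterate_one] at h₂
  have h₃ : valueAt 0 (thetaEntire hτ).der = 1 := deriv_theta_zero hτ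
  rw [h₃, smul_eq_mul, mul_one] at h₂
  exact hk (by simpa [Pi.single_apply] using h₂)

lemma isUnit_formalTheta {l : Fin n → ℂ} (hl : l ≠ 0) (κ : ℂ) :
    IsUnit (formalTheta hτ (0, l, κ)) := by
  rw [PowerSeries.isUnit_iff_constantCoeff, ← PowerSeries.coeff_zero_eq_constantCoeff_apply,
    formalTheta, coeff_expSeries]
  simpa using lambdaTaylor_theta_ne_zero hτ hl

end FormalTheta

end DynamicalElliptic
end

noncomputable section
namespace DynamicalElliptic
open Matrix PowerSeries TensorProduct
open Finset.HasAntidiagonal (antidiagonal mem_antidiagonal)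

/-! ### The coefficients of the elliptic exchange relations -/

section ThetaIdentities
variable {G S : Type*} [AddCommGroup G] [CommRing S] {f : G → S}

lemma ThetaLike.mixed (hf : ThetaLike f) (z u v h : G) :
    f (z + h) * f (v + h) * f (z + (u + v)) * f u
      = f (z + h + v) * f h * f (z + u) * f (u + v)
        - f (z + h + (u + v)) * f z * f (-u + h) * f v := by
  have := hf.threeTerm (z - v) (h + v) (u + v) v
  rw [show z - v + (h + v) + (u + v) = z + h + (u + v) by abel, show h + v - (u + v) = -u + h by abel,
    show z - v + v = z by abel, show z - v + (u + v) + v = z + (u + v) by abel,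
    show u + v - v = u by abel, show z - v + (h + v) = z + h by abel,
    show z + (h + v) = z + h + v by abel, show v - (h + v) = -h by abel,
    show z - v + (u + v) = z + u by abel, hf.odd, add_comm h v] at this
  linear_combination this

lemma ThetaLike.double (hf : ThetaLike f) (z u h : G) :
    f z * f z * f (u + h) * f (u - h)
      = f (z + h) * f (z - h) * f u * f u - f (z + u) * f (z - u) * f h * f h := by
  have := hf.threeTerm 0 u h z
  rw [show (0 : G) + u + h = u + h by abel, show (0 : G) + z = z by abel,
    show (0 : G) + h + z = z + h by abel, show (0 : G) + u = u by abel,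
    show (0 : G) + h = h by abel,
    show h - z = -(z - h) by abel, hf.odd] at this
  linear_combination this

end ThetaIdentities

section Coefficients
variable {n : ℕ} {S : Type*} [CommRing S]

/-- The linear form `λᵢ - λⱼ`. -/
def rootForm (i j : Fin n) : Fin n → ℂ := Pi.single i 1 - Pi.single j 1

lemma rootForm_ne_zero {i j : Fin n} (h : i ≠ j) : rootForm i j ≠ 0 := fun e => by
  have := congrFun e i
  simp [rootForm, h] at this

lemma neg_rootForm (i j : Fin n) : -rootForm i j = rootForm j i := neg_sub _ _

lemma rootForm_add (i j k : Fin n) : rootForm i j + rootForm j k = rootForm i k :=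
  sub_add_sub_cancel _ _ _

lemma sum_mul_rootForm (μ : Fin n → ℤ) (i j : Fin n) :
    ∑ k, (μ k : ℂ) * rootForm i j k = μ i - μ j := by
  simp [rootForm, mul_sub, Finset.sum_sub_distrib, Pi.single_apply]

/-- Theta functions `f(a, ℓ, κ)` of `az + ∑ᵢ ℓᵢλᵢ + κℏ`, for a fixed `z`. -/
structure ThetaSystem (sh : Translations n S) (f : ℂ × (Fin n → ℂ) × ℂ → S) : Prop where
  thetaLike : ThetaLike f
  shift : ∀ μ a l κ, sh.map μ (f (a, l, κ)) = f (a, l, (∑ k, μ k * l k) + κ)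
  isUnit : ∀ l κ, l ≠ 0 → IsUnit (f (0, l, κ))

variable (f : ℂ × (Fin n → ℂ) × ℂ → S)

/-- The inverse of `θ(λᵢⱼ + κℏ)`. -/
def rootInv (i j : Fin n) (κ : ℂ) : S := Ring.inverse (f (0, rootForm i j, κ))

/-- The diagonal coefficients of the `R`-matrix `θ(z + kℏ) R(z + kℏ; λ)`. -/
def diagCoeff (a k : ℂ) (i j : Fin n) : S :=
  if i = j then f (a, 0, k + 1) else f (a, 0, k) * f (0, rootForm i j, 1) * rootInv f i j 0

/-- The off-diagonal coefficients of the `R`-matrix `θ(z + kℏ) R(z + kℏ; λ)`. -/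
def offCoeff (a k : ℂ) (i j : Fin n) : S :=
  if i = j then 0 else f (a, rootForm i j, k) * f (0, 0, 1) * rootInv f i j 0

variable {f} {sh : Translations n S} (hf : ThetaSystem sh f)

lemma diagCoeff_self (a k : ℂ) (i : Fin n) : diagCoeff f a k i i = f (a, 0, k + 1) := if_pos rfl

lemma diagCoeff_of_ne (a k : ℂ) {i j : Fin n} (h : i ≠ j) :
    diagCoeff f a k i j = f (a, 0, k) * f (0, rootForm i j, 1) * rootInv f i j 0 := if_neg h

lemma offCoeff_self (a k : ℂ) (i : Fin n) : offCoeff f a k i i = 0 := if_pos rfl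

lemma offCoeff_of_ne (a k : ℂ) {i j : Fin n} (h : i ≠ j) :
    offCoeff f a k i j = f (a, rootForm i j, k) * f (0, 0, 1) * rootInv f i j 0 := if_neg h

lemma ThetaSystem.rootInv_mul (hf : ThetaSystem sh f) {i j : Fin n} (h : i ≠ j) (κ : ℂ) :
    rootInv f i j κ * f (0, rootForm i j, κ) = 1 :=
  Ring.inverse_mul_cancel _ (hf.isUnit _ _ (rootForm_ne_zero h))

lemma ThetaSystem.root_neg (hf : ThetaSystem sh f) (i j : Fin n) (κ : ℂ) :
    f (0, rootForm i j, -κ) = -f (0, rootForm j i, κ) := by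
  rw [← hf.thetaLike.odd]
  congr 1
  ext <;> simp [rootForm]

lemma ThetaSystem.rootInv_neg (hf : ThetaSystem sh f) {i j : Fin n} (h : i ≠ j) (κ : ℂ) :
    rootInv f i j (-κ) = -rootInv f j i κ := by
  refine left_inv_eq_right_inv (hf.rootInv_mul h (-κ)) ?_
  rw [hf.root_neg, neg_mul_neg, mul_comm, hf.rootInv_mul h.symm]

lemma ThetaSystem.shift_root (hf : ThetaSystem sh f) (μ : Fin n → ℤ) (a : ℂ) (i j : Fin n) (κ : ℂ) :
    sh.map μ (f (a, rootForm i j, κ)) = f (a, rootForm i j, μ i - μ j + κ) := by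
  rw [hf.shift, sum_mul_rootForm]

lemma ThetaSystem.shift_const (hf : ThetaSystem sh f) (μ : Fin n → ℤ) (a κ : ℂ) :
    sh.map μ (f (a, 0, κ)) = f (a, 0, κ) := by
  rw [hf.shift]
  simp

lemma ThetaSystem.shift_rootInv (hf : ThetaSystem sh f) (μ : Fin n → ℤ) {i j : Fin n} (h : i ≠ j)
    (κ : ℂ) : sh.map μ (rootInv f i j κ) = rootInv f i j (μ i - μ j + κ) := by
  refine left_inv_eq_right_inv (a := f (0, rootForm i j, μ i - μ j + κ)) ?_ ?_
  · rw [← hf.shift_root, ← map_mul, hf.rootInv_mul h, map_one]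
  · rw [mul_comm, hf.rootInv_mul h]

lemma ThetaSystem.shift_diagCoeff (hf : ThetaSystem sh f) (μ : Fin n → ℤ) (a k : ℂ) {i j : Fin n}
    (h : i ≠ j) : sh.map μ (diagCoeff f a k i j)
      = f (a, 0, k) * f (0, rootForm i j, μ i - μ j + 1) * rootInv f i j (μ i - μ j) := by
  rw [diagCoeff_of_ne _ _ h, map_mul, map_mul, hf.shift_const, hf.shift_root, hf.shift_rootInv μ h,
    add_zero]

lemma ThetaSystem.shift_diagCoeff_self (hf : ThetaSystem sh f) (μ : Fin n → ℤ) (a k : ℂ) (i : Fin n) :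
    sh.map μ (diagCoeff f a k i i) = f (a, 0, k + 1) := by
  rw [diagCoeff_self, hf.shift_const]

lemma ThetaSystem.shift_offCoeff (hf : ThetaSystem sh f) (μ : Fin n → ℤ) (a k : ℂ) {i j : Fin n}
    (h : i ≠ j) : sh.map μ (offCoeff f a k i j)
      = f (a, rootForm i j, μ i - μ j + k) * f (0, 0, 1) * rootInv f i j (μ i - μ j) := by
  rw [offCoeff_of_ne _ _ h, map_mul, map_mul, hf.shift_const, hf.shift_root, hf.shift_rootInv μ h,
    add_zero]

lemma ThetaSystem.mixed (hf : ThetaSystem sh f) (a k : ℂ) (i j l : Fin n) :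
    f (a, 0, k + 1) * f (0, rootForm j l, 1) * f (a, rootForm i l, k) * f (0, rootForm i j, 0)
      = f (a, rootForm j l, k + 1) * f (0, 0, 1) * f (a, rootForm i j, k) * f (0, rootForm i l, 0)
        - f (a, rootForm i l, k + 1) * f (a, 0, k) * f (0, rootForm j i, 1)
          * f (0, rootForm j l, 0) := by
  have := hf.thetaLike.mixed (a, 0, k) (0, rootForm i j, 0) (0, rootForm j l, 0) (0, 0, 1)
  simpa only [Prod.mk_add_mk, Prod.neg_mk, neg_zero, add_zero, zero_add, rootForm_add,
    neg_rootForm] using this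

lemma ThetaSystem.double (hf : ThetaSystem sh f) (a k κ : ℂ) (i j : Fin n) :
    f (a, 0, k) * f (a, 0, k) * f (0, rootForm i j, κ + 1) * f (0, rootForm i j, κ - 1)
      = f (a, 0, k + 1) * f (a, 0, k - 1) * f (0, rootForm i j, κ) * f (0, rootForm i j, κ)
        - f (a, rootForm i j, k + κ) * f (a, -rootForm i j, k - κ) * f (0, 0, 1) * f (0, 0, 1) := by
  have := hf.thetaLike.double (a, 0, k) (0, rootForm i j, κ) (0, 0, 1)
  simpa only [Prod.mk_add_mk, Prod.mk_sub_mk, sub_zero, add_zero, zero_add, zero_sub] using this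

/-- The step from k to k + 1 in the spectral parameter is what makes the products degenerate. Once
the theta functions of the roots in the denominators are cleared, `mixed` with distinct indices and
`double` are instances of the three-term relation. The identity `perm` and the case `i = j` of
`mixed` are mere cancellations. -/
theorem ThetaSystem.leftFusion (hf : ThetaSystem sh f) (a k : ℂ) :
    LeftFusion sh (diagCoeff f a k) (offCoeff f a k) (diagCoeff f a (k + 1))
      (offCoeff f a (k + 1)) where
  perm i j l hi hj := by
    rcases eq_or_ne i j with rfl | h
    · rfl
    · rw [hf.shift_diagCoeff _ _ _ hi.symm, hf.shift_diagCoeff _ _ _ hj.symm,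
        diagCoeff_of_ne _ _ hi.symm, diagCoeff_of_ne _ _ hj.symm]
      simp [h, h.symm, hi, hj]
      ring
  mixed i j l hi hj := by
    rcases eq_or_ne i j with rfl | h
    · rw [hf.shift_offCoeff _ _ _ hi.symm, hf.shift_diagCoeff_self, offCoeff_self, map_zero,
        diagCoeff_of_ne _ _ hi.symm, offCoeff_of_ne _ _ hi.symm]
      have := hf.rootInv_mul hi.symm 1
      simp [hi]
      rw [add_comm 1 k]
      linear_combination (f (a, 0, k + 1) * rootInv f i l 0 * f (a, rootForm i l, k + 1) * f (0, 0, 1))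
        * this
    · rw [hf.shift_offCoeff _ _ _ hi.symm, hf.shift_offCoeff _ _ _ h, hf.shift_diagCoeff _ _ _ h.symm,
        diagCoeff_of_ne _ _ hj.symm, offCoeff_of_ne _ _ hj.symm, offCoeff_of_ne _ _ hi.symm]
      simp [h, hj, hi.symm, hj.symm]
      have e := hf.mixed a k i j l
      have h₁ := hf.rootInv_mul h 0
      have h₂ := hf.rootInv_mul hi.symm 0
      have h₃ := hf.rootInv_mul hj.symm 0
      have h₄ := hf.rootInv_neg h.symm 0
      rw [neg_zero] at h₄
      rw [h₄]
      -- The theta identity is multiplied by all inverse roots; `h₁`, `h₂`, `h₃` cancel in each term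
      -- the root that also occurs in the numerator.
      linear_combination (rootInv f i j 0 * rootInv f i l 0 * rootInv f j l 0 * f (0, 0, 1)) * e
        - (f (a, 0, k + 1) * f (0, rootForm j l, 1) * f (a, rootForm i l, k) * f (0, 0, 1)
            * rootInv f i l 0 * rootInv f j l 0) * h₁
        + (f (a, rootForm j l, k + 1) * f (0, 0, 1) * f (a, rootForm i j, k) * f (0, 0, 1)
            * rootInv f i j 0 * rootInv f j l 0) * h₂
        - (f (a, rootForm i l, k + 1) * f (a, 0, k) * f (0, rootForm j i, 1) * f (0, 0, 1)
            * rootInv f i j 0 * rootInv f i l 0) * h₃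
  double i j h := by
    rw [hf.shift_diagCoeff_self, offCoeff_self, offCoeff_self, map_zero, hf.shift_diagCoeff _ _ _ h.symm,
      hf.shift_offCoeff _ _ _ h, diagCoeff_of_ne _ _ h.symm, offCoeff_of_ne _ _ h.symm, diagCoeff_self]
    simp [h.symm]
    have e := hf.double a (k + 1) 0 j i
    have h₁ := hf.rootInv_mul h.symm 0
    have h₂ := hf.rootInv_mul h.symm (-1)
    have h₃ : rootInv f i j 1 = -rootInv f j i (-1) := by rw [hf.rootInv_neg h.symm, neg_neg]
    rw [add_zero, sub_zero, zero_add, zero_sub, neg_rootForm, add_sub_cancel_right] at e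
    rw [h₃, add_comm 1 k]
    linear_combination (rootInv f j i 0 * rootInv f j i (-1)) * e
      - (f (a, 0, k + 1) * f (a, 0, k + 1) * f (0, rootForm j i, 1) * rootInv f j i 0) * h₂
      + (f (a, 0, k + 1 + 1) * f (a, 0, k) * f (0, rootForm j i, 0) * rootInv f j i (-1)) * h₁

/-- Here the shifted parameter k + 1 belongs to the front pair of positions. In `double` the theta
identity is taken at λᵢⱼ + ℏ, since the weight of the index `i` behind translates λᵢⱼ by ℏ. -/
theorem ThetaSystem.rightFusion (hf : ThetaSystem sh f) (a k : ℂ) :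
    RightFusion sh (diagCoeff f a (k + 1)) (offCoeff f a (k + 1)) (diagCoeff f a k)
      (offCoeff f a k) where
  perm i j l hi hj := by
    rcases eq_or_ne j l with rfl | h
    · rfl
    · rw [hf.shift_diagCoeff _ _ _ hi, hf.shift_diagCoeff _ _ _ hj,
        diagCoeff_of_ne _ _ hi, diagCoeff_of_ne _ _ hj]
      simp [h, h.symm, hi, hj]
      ring
  mixed i j l hi hj := by
    rcases eq_or_ne j l with rfl | h
    · rw [hf.shift_offCoeff _ _ _ hi, hf.shift_diagCoeff _ _ _ hi, offCoeff_self,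
        diagCoeff_self, offCoeff_of_ne _ _ hi]
      have := hf.rootInv_mul hi 0
      simp [hi]
      linear_combination (f (a, 0, k + 1) * rootInv f i j (-1) * f (a, rootForm i j, k) * f (0, 0, 1))
        * this
    · rw [hf.shift_offCoeff _ _ _ hi, hf.shift_offCoeff _ _ _ hj, hf.shift_diagCoeff _ _ _ hi,
        diagCoeff_of_ne _ _ h.symm, offCoeff_of_ne _ _ hj, offCoeff_of_ne _ _ h]
      simp [h, hi, hj, h.symm]
      have e := hf.thetaLike.mixed (a, 0, k) (0, rootForm j l, 0) (0, rootForm i j, 0) (0, 0, 1)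
      rw [show ((0, rootForm j l, 0) + (0, rootForm i j, 0) : ℂ × (Fin n → ℂ) × ℂ)
        = (0, rootForm i l, 0) by simp [add_comm (rootForm j l), rootForm_add]] at e
      simp only [Prod.mk_add_mk, Prod.neg_mk, neg_zero, add_zero, zero_add, neg_rootForm] at e
      have h₁ := hf.rootInv_mul hi 0
      have h₂ := hf.rootInv_mul hj 0
      have h₃ := hf.rootInv_mul h 0
      have h₄ := hf.rootInv_neg h.symm 0
      rw [neg_zero] at h₄
      rw [h₄]
      linear_combination (rootInv f i j 0 * rootInv f i l 0 * rootInv f j l 0 * f (0, 0, 1)) * e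
        - (f (a, 0, k + 1) * f (0, rootForm i j, 1) * f (a, rootForm i l, k) * f (0, 0, 1)
            * rootInv f i j 0 * rootInv f i l 0) * h₃
        + (f (a, rootForm i j, k + 1) * f (0, 0, 1) * f (a, rootForm j l, k) * f (0, 0, 1)
            * rootInv f i j 0 * rootInv f j l 0) * h₂
        - (f (a, rootForm i l, k + 1) * f (a, 0, k) * f (0, rootForm l j, 1) * f (0, 0, 1)
            * rootInv f i l 0 * rootInv f j l 0) * h₁
  double i j h := by
    rw [hf.shift_diagCoeff_self, offCoeff_self, offCoeff_self, map_zero, hf.shift_diagCoeff _ _ _ h,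
      hf.shift_offCoeff _ _ _ h, diagCoeff_of_ne _ _ h, offCoeff_of_ne _ _ h.symm, diagCoeff_self]
    simp [h]
    have e := hf.double a (k + 1) 1 i j
    have h₁ := hf.rootInv_mul h 0
    have h₂ := hf.rootInv_mul h 1
    have h₃ := hf.rootInv_neg h.symm 0
    rw [neg_zero] at h₃
    rw [neg_rootForm, add_sub_cancel_right, sub_self] at e
    rw [h₃, add_comm 1 (k + 1)]
    linear_combination -(rootInv f i j 0 * rootInv f i j 1) * e
      + (f (a, 0, k + 1) * f (a, 0, k + 1) * f (0, rootForm i j, 1 + 1) * rootInv f i j 1) * h₁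
      - (f (a, 0, k + 1 + 1) * f (a, 0, k) * f (0, rootForm i j, 1) * rootInv f i j 0) * h₂

end Coefficients

end DynamicalElliptic
end

noncomputable section
namespace DynamicalElliptic
open Matrix PowerSeries TensorProduct
open Finset.HasAntidiagonal (antidiagonal mem_antidiagonal)

/-! ### Functions of the spectral parameter -/

section MapDerivation
variable {A B C : Type*} [CommRing A] [CommRing B] [CommRing C] [Algebra A B]
  [Algebra ℂ B] [Algebra ℂ C]

lemma map_derivation_of_localization (S : Submonoid A) [IsLocalization S B] (φ : B →ₐ[ℂ] C)
    {D : Derivation ℂ B B} {D' : Derivation ℂ C C}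
    (h : ∀ a, φ (D (algebraMap A B a)) = D' (φ (algebraMap A B a))) (x : B) :
    φ (D x) = D' (φ x) := by
  obtain ⟨a, s, rfl⟩ := IsLocalization.exists_mk'_eq S x
  have hu := (IsLocalization.map_units B s).map φ
  refine hu.mul_left_cancel ?_
  have h₁ := congrArg (fun y => φ (D y)) (IsLocalization.mk'_spec' B a s)
  have h₂ := congrArg (fun y => D' (φ y)) (IsLocalization.mk'_spec' B a s)
  simp only [map_mul, Derivation.leibniz, smul_eq_mul, map_add, h] at h₁ h₂
  linear_combination h₁ - h₂

end MapDerivation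

section SpectralFun
variable {U : TopologicalSpace.Opens ℂ} {n : ℕ}

lemma evalSpectral_algebraMap (u : U) (F : MvPowerSeries (Fin n) (Hol U)) :
    evalSpectral n u (algebraMap _ (SpectralFun U n) F)
      = algebraMap _ (LambdaField n) (MvPowerSeries.mapAlgHom (evalHol u) F) :=
  IsLocalization.lift_eq _ _

variable (U n) in
/-- The partial derivatives `∂/∂λₖ` on functions of `(u, λ)`. -/
def spectralDerivatives : PartialDerivatives n (SpectralFun U n) where
  d k := locDer _ (denominators U n) ((MvPowerSeries.pderiv (Hol U) k).restrictScalars ℂ)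
  comm k l x := by
    refine locDer_commute _ _ (fun F => ?_) x
    change MvPowerSeries.pderiv (Hol U) k (MvPowerSeries.pderiv (Hol U) l F)
      = MvPowerSeries.pderiv (Hol U) l (MvPowerSeries.pderiv (Hol U) k F)
    ext d : 1
    simp only [MvPowerSeries.coeff_pderiv, add_right_comm d, Finsupp.add_apply]
    rcases eq_or_ne k l with rfl | h
    · rfl
    · simp [h, h.symm]
      ring

lemma spectralDerivatives_algebraMap (k : Fin n) (F : MvPowerSeries (Fin n) (Hol U)) :
    (spectralDerivatives U n).d k (algebraMap _ _ F)
      = algebraMap _ _ (MvPowerSeries.pderiv (Hol U) k F) :=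
  locDer_algebraMap _ _ _ _

lemma dSpectral_algebraMap (F : MvPowerSeries (Fin n) (Hol U)) :
    dSpectral U n (algebraMap _ _ F) = algebraMap _ _ (coeffDer (holDeriv U) F) :=
  locDer_algebraMap _ _ _ _

lemma evalSpectral_derivative (u : U) (k : Fin n) (F : SpectralFun U n) :
    evalSpectral n u ((spectralDerivatives U n).d k F) = dLambda k (evalSpectral n u F) := by
  refine map_derivation_of_localization (denominators U n) (evalSpectral n u) (fun F => ?_) F
  rw [spectralDerivatives_algebraMap, evalSpectral_algebraMap, evalSpectral_algebraMap, dLambda,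
    locDer_algebraMap]
  congr 1

lemma dSpectral_comm (k : Fin n) (F : SpectralFun U n) :
    dSpectral U n ((spectralDerivatives U n).d k F)
      = (spectralDerivatives U n).d k (dSpectral U n F) := by
  refine locDer_commute _ _ (fun F => ?_) F
  ext d : 1
  change holDeriv U (MvPowerSeries.coeff d (MvPowerSeries.pderiv (Hol U) k F))
    = MvPowerSeries.coeff d (MvPowerSeries.pderiv (Hol U) k (coeffDer (holDeriv U) F))
  rw [MvPowerSeries.coeff_pderiv, MvPowerSeries.coeff_pderiv]
  have h : ((d k : Hol U) + 1) = algebraMap ℂ (Hol U) ((d k : ℂ) + 1) := by simp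
  rw [h, mul_comm, ← Algebra.smul_def, Derivation.map_smul, mul_comm, ← Algebra.smul_def]
  rfl

/-- A holomorphic function that vanishes off the zeros of a nonzero entire function is zero. -/
lemma hol_eq_zero {g : ℂ → ℂ} (hg : Differentiable ℂ g) (hne : ∃ z, g z ≠ 0) {f : Hol U}
    (h : ∀ u : U, g u ≠ 0 → evalHol u f = 0) : f = 0 := by
  refine evalHol_injective fun u => ?_
  by_contra hu
  obtain ⟨z, hz⟩ := hne
  -- Where `f` is nonzero `g` must vanish, so `f u ≠ 0` would make `g` vanish near `u` and hence on
  -- the whole plane.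
  refine hz (eq_zero_of_eventuallyEq hg (a := u) ?_ z)
  have h₁ : extendZero f.1 u ≠ 0 := by rwa [extendZero_coe]
  filter_upwards [(Hol_differentiableAt f u).continuousAt.eventually_ne h₁,
    U.isOpen.mem_nhds u.2] with w hw hwU
  by_contra hgw
  exact hw ((extendZero_coe f.1 ⟨w, hwU⟩).trans (h ⟨w, hwU⟩ hgw))

/-- After multiplication by the denominator, each coefficient of the numerator is a holomorphic
function vanishing off the zeros of `g`. Because `g` is entire, `U` need not be connected. -/
lemma spectral_eq_zero {g : ℂ → ℂ} (hg : Differentiable ℂ g) (hne : ∃ z, g z ≠ 0)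
    {F : SpectralFun U n} (h : ∀ u : U, g u ≠ 0 → evalSpectral n u F = 0) : F = 0 := by
  obtain ⟨p, q, rfl⟩ := IsLocalization.exists_mk'_eq (denominators U n) F
  have hp : p = 0 := by
    ext d : 1
    refine hol_eq_zero hg hne fun u hu => ?_
    have h₁ := congrArg (evalSpectral n u) (IsLocalization.mk'_spec (SpectralFun U n) p q)
    rw [map_mul, h u hu, zero_mul, evalSpectral_algebraMap] at h₁
    have h₂ := IsFractionRing.injective (MvPowerSeries (Fin n) ℂ) (LambdaField n)
      (h₁.symm.trans (map_zero _).symm)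
    exact congrArg (MvPowerSeries.coeff d) h₂
  rw [hp, IsLocalization.mk'_zero]

lemma spectral_eq_zero_of_forall {F : SpectralFun U n} (h : ∀ u : U, evalSpectral n u F = 0) :
    F = 0 :=
  spectral_eq_zero (differentiable_const 1) ⟨0, one_ne_zero⟩ fun u _ => h u

variable (U n) in
/-- Functions of `λ` as functions of `(u, λ)`. -/
def constSpectral : LambdaField n →ₐ[ℂ] SpectralFun U n :=
  IsLocalization.liftAlgHom (M := nonZeroDivisors (MvPowerSeries (Fin n) ℂ))
    (f := (IsScalarTower.toAlgHom ℂ (MvPowerSeries (Fin n) (Hol U)) (SpectralFun U n)).comp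
      (MvPowerSeries.mapAlgHom (Algebra.ofId ℂ (Hol U))))
    (fun q => IsLocalization.map_units (SpectralFun U n) (⟨_, fun u => by
      have : MvPowerSeries.map (evalHol u : Hol U →+* ℂ)
          (MvPowerSeries.mapAlgHom (Algebra.ofId ℂ (Hol U)) q.1) = q := by
        ext d
        rfl
      exact this ▸ nonZeroDivisors.coe_ne_zero q⟩ : denominators U n))

lemma constSpectral_algebraMap (F : MvPowerSeries (Fin n) ℂ) :
    constSpectral U n (algebraMap _ _ F)
      = algebraMap _ _ (MvPowerSeries.mapAlgHom (Algebra.ofId ℂ (Hol U)) F) :=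
  IsLocalization.lift_eq _ _

lemma evalSpectral_const (u : U) (F : LambdaField n) :
    evalSpectral n u (constSpectral U n F) = F := by
  have : (evalSpectral n u : SpectralFun U n →+* LambdaField n).comp
      (constSpectral U n : LambdaField n →+* SpectralFun U n) = RingHom.id _ := by
    refine IsLocalization.ringHom_ext (nonZeroDivisors (MvPowerSeries (Fin n) ℂ))
      (RingHom.ext fun F => ?_)
    change evalSpectral n u (constSpectral U n (algebraMap _ _ F)) = algebraMap _ _ F
    rw [constSpectral_algebraMap, evalSpectral_algebraMap]
    congr 1
  exact congrArg (fun f => f F) this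

lemma dSpectral_const (F : LambdaField n) : dSpectral U n (constSpectral U n F) = 0 := by
  have := map_derivation_of_localization (nonZeroDivisors (MvPowerSeries (Fin n) ℂ))
    (constSpectral U n) (D := 0) (D' := dSpectral U n) (fun F => ?_) F
  · rw [← this, Derivation.zero_apply, map_zero]
  · rw [Derivation.zero_apply, map_zero, constSpectral_algebraMap, dSpectral_algebraMap]
    have : coeffDer (holDeriv U) (MvPowerSeries.mapAlgHom (Algebra.ofId ℂ (Hol U)) F) = 0 := by
      ext d : 1
      exact (holDeriv U).map_algebraMap _
    rw [this, map_zero]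

lemma evalShifted_apply (u : U) (c : ℂ) (F : (SpectralFun U n)⟦X⟧) :
    evalShifted n u c F = mapHbar (evalSpectral n u) (expShift (c • dSpectral U n) F) := rfl

lemma evalShifted_const (u : U) (c : ℂ) (F : (LambdaField n)⟦X⟧) :
    evalShifted n u c (mapHbar (constSpectral U n) F) = F := by
  rw [evalShifted_apply, ← mapHbar_expShift (D := 0) (constSpectral U n) (fun F => by
    rw [Derivation.zero_apply, map_zero, Derivation.smul_apply, dSpectral_const, smul_zero]),
    expShift_zero]
  ext m
  simp only [coeff_mapHbar, AlgHom.id_apply, evalSpectral_const]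

/-- The function `f(c + au + ∑ᵢ ℓᵢλᵢ)` of `(u, λ)`. -/
def spectralTaylor (U : TopologicalSpace.Opens ℂ) (c a : ℂ) (l : Fin n → ℂ) (f : Entire) :
    SpectralFun U n := algebraMap _ _ (holTaylor U c a l f)

lemma evalSpectral_taylor (u : U) (c a : ℂ) (l : Fin n → ℂ) (f : Entire) :
    evalSpectral n u (spectralTaylor U c a l f) = lambdaTaylor (c + a * u) l f := by
  rw [spectralTaylor, evalSpectral_algebraMap, map_holTaylor]
  rfl

lemma dSpectral_taylor (c a : ℂ) (l : Fin n → ℂ) (f : Entire) :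
    dSpectral U n (spectralTaylor U c a l f) = a • spectralTaylor U c a l f.der := by
  rw [spectralTaylor, dSpectral_algebraMap, holTaylor,
    coeffDer_taylorSeries (holDeriv_holComp c a), spectralTaylor, holTaylor]
  exact map_smul (IsScalarTower.toAlgHom ℂ (MvPowerSeries (Fin n) (Hol U)) (SpectralFun U n)) a _

lemma evalShifted_taylor (u : U) (k c a : ℂ) (l : Fin n → ℂ) (κ : ℂ) (f : Entire) :
    evalShifted n u k (expSeries (spectralTaylor U c a l) κ f)
      = expSeries (lambdaTaylor (c + a * u) l) (k * a + κ) f := by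
  rw [evalShifted_apply, expShift_expSeries (κ := k * a) (fun f => by
    rw [Derivation.smul_apply, dSpectral_taylor, smul_smul]), mapHbar_expSeries]
  congr 1
  funext f
  rw [evalSpectral_taylor]

end SpectralFun

end DynamicalElliptic
end

noncomputable section
namespace DynamicalElliptic
open Matrix PowerSeries TensorProduct
open Finset.HasAntidiagonal (antidiagonal mem_antidiagonal)

/-! ### Naturality of the relations -/

section Natural
variable {n : ℕ} {K : Type*} [CommRing K] [Algebra ℂ K] {K' : Type*} [CommRing K'] [Algebra ℂ K']
  {K'' : Type*} [CommRing K''] [Algebra ℂ K'']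
  {R : Type*} [Ring R] [Algebra ℂ⟦X⟧ R] {h : Fin n → R} {hh : ∀ i j, Commute (h i) (h j)}
  {D : PartialDerivatives n K} {D' : PartialDerivatives n K'} {D'' : PartialDerivatives n K''}

lemma dynamicalPair_ι (f : K⟦X⟧) : (dynamicalPair hh D).ι f = ofFun f := rfl

lemma dynamicalPair_c (f : K⟦X⟧) : (dynamicalPair hh D).c f = cartanHom hh D f := rfl

lemma dynamicalPair_shT : (dynamicalPair hh D).shT = D.shT R := rfl

variable (hh D D') in
/-- Homomorphisms of scalar functions that commute with the translations and with the shifts by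
Cartan elements. -/
structure IsNatural (φ : K⟦X⟧ →ₐ[ℂ⟦X⟧] K'⟦X⟧) : Prop where
  shift : ∀ μ f, φ (D.shS.map μ f) = D'.shS.map μ (φ f)
  cartan : ∀ f, tensorMap φ (cartanHom hh D f) = cartanHom hh D' (φ f)

variable {φ : K⟦X⟧ →ₐ[ℂ⟦X⟧] K'⟦X⟧}

lemma IsNatural.tensorMap_shT (hφ : IsNatural hh D D' φ) (μ : Fin n → ℤ) (x : CompletedTensor K R) :
    tensorMap φ ((D.shT R).map μ x) = (D'.shT R).map μ (tensorMap φ x) := by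
  change tensorMap φ (tensorMap (expShift (D.dir μ)) x)
    = tensorMap (expShift (D'.dir μ)) (tensorMap φ x)
  rw [← tensorMap_comp, ← tensorMap_comp]
  congr 2
  exact AlgHom.ext (hφ.shift μ)

lemma isNatural_mapHbar (φ : K →ₐ[ℂ] K') (hφ : ∀ k x, φ (D.d k x) = D'.d k (φ x)) :
    IsNatural hh D D' (mapHbar φ) where
  shift μ f := mapHbar_expShift φ (fun x => by
    simp only [D.dir_apply, D'.dir_apply, map_sum, map_zsmul, hφ]) f
  cartan f := cartanHom_mapHbar hh D φ hφ f

lemma isNatural_expShift (E : Derivation ℂ K K) (hE : ∀ k x, E (D.d k x) = D.d k (E x)) :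
    IsNatural hh D D (expShift E) where
  shift μ f := expShift_comm (fun x => by simp only [D.dir_apply, map_sum, map_zsmul, hE]) f
  cartan f := cartanHom_expShift hh D E hE f

lemma IsNatural.comp {ψ : K'⟦X⟧ →ₐ[ℂ⟦X⟧] K''⟦X⟧} (hψ : IsNatural hh D' D'' ψ)
    (hφ : IsNatural hh D D' φ) : IsNatural hh D D'' (ψ.comp φ) where
  shift μ f := by rw [AlgHom.comp_apply, hφ.shift, hψ.shift, AlgHom.comp_apply]
  cartan f := by rw [tensorMap_comp, hφ.cartan, hψ.cartan, AlgHom.comp_apply]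

variable {X Y : Matrix (Fin n) (Fin n) (CompletedTensor K R)}

lemma IsNatural.exchange (hφ : IsNatural hh D D' φ) {α β : Fin n → Fin n → K⟦X⟧}
    (hE : (dynamicalPair hh D).Exchange X Y α β) :
    (dynamicalPair hh D').Exchange (X.map (tensorMap φ)) (Y.map (tensorMap φ))
      (fun i j => φ (α i j)) (fun i j => φ (β i j)) := fun i j k l => by
  have := congrArg (tensorMap φ) (hE i j k l)
  simpa only [Matrix.map_apply, map_add, map_mul, dynamicalPair_ι, dynamicalPair_c, dynamicalPair_shT,
    tensorMap_ofFun, hφ.cartan, hφ.tensorMap_shT] using this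

lemma IsNatural.fused (hφ : IsNatural hh D D' φ) (hE : (dynamicalPair hh D).Fused X Y) :
    (dynamicalPair hh D').Fused (X.map (tensorMap φ)) (Y.map (tensorMap φ)) := fun i j k l => by
  have := congrArg (tensorMap φ) (hE i j k l)
  simpa only [Matrix.map_apply, map_add, map_mul, dynamicalPair_shT, hφ.tensorMap_shT] using this

variable {σ : Type*} {φ : σ → K →ₐ[ℂ] K'}

/-- Each natural homomorphism transports both sides of the relation. Joint injectivity on scalar
functions extends to functions with values in `R` by `eq_of_tensorMap`, so the relation may be
tested after the homomorphisms. -/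
lemma exchange_of_natural (hφ : ∀ w, IsNatural hh D D' (mapHbar (φ w)))
    (hi : ∀ k, (∀ w, φ w k = 0) → k = 0) {α β : Fin n → Fin n → K⟦X⟧}
    (hE : ∀ w, (dynamicalPair hh D').Exchange (X.map (tensorMap (mapHbar (φ w))))
      (Y.map (tensorMap (mapHbar (φ w)))) (fun i j => mapHbar (φ w) (α i j))
      (fun i j => mapHbar (φ w) (β i j))) :
    (dynamicalPair hh D).Exchange X Y α β := fun i j k l => eq_of_tensorMap φ hi fun w => by
  simpa only [Matrix.map_apply, map_add, map_mul, dynamicalPair_ι, dynamicalPair_c, dynamicalPair_shT,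
    tensorMap_ofFun, (hφ w).cartan, (hφ w).tensorMap_shT] using hE w i j k l

lemma fused_of_natural (hφ : ∀ w, IsNatural hh D D' (mapHbar (φ w)))
    (hi : ∀ k, (∀ w, φ w k = 0) → k = 0)
    (hE : ∀ w, (dynamicalPair hh D').Fused (X.map (tensorMap (mapHbar (φ w))))
      (Y.map (tensorMap (mapHbar (φ w))))) :
    (dynamicalPair hh D).Fused X Y := fun i j k l => eq_of_tensorMap φ hi fun w => by
  simpa only [Matrix.map_apply, map_add, map_mul, dynamicalPair_shT, (hφ w).tensorMap_shT] using hE w i j k l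

/-- The weight relation between a matrix and the Cartan elements. -/
def CartanWeighted (h : Fin n → R) (M : Matrix (Fin n) (Fin n) (CompletedTensor K R)) : Prop :=
  ∀ a b k, ofAlg (h k) * M a b
    = M a b * (ofAlg (h k) + (((unitWeight b - unitWeight a) k : ℤ) : CompletedTensor K R))

lemma CartanWeighted.map {M : Matrix (Fin n) (Fin n) (CompletedTensor K R)}
    (hM : CartanWeighted h M) (φ : K⟦X⟧ →ₐ[ℂ⟦X⟧] K'⟦X⟧) :
    CartanWeighted h (M.map (tensorMap φ)) := fun a b k => by
  have := congrArg (tensorMap φ) (hM a b k)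
  simpa only [Matrix.map_apply, map_add, map_mul, tensorMap_ofAlg, map_intCast] using this

lemma cartanWeighted_of_map {M : Matrix (Fin n) (Fin n) (CompletedTensor K R)}
    (hi : ∀ k, (∀ w, φ w k = 0) → k = 0)
    (hM : ∀ w, CartanWeighted h (M.map (tensorMap (mapHbar (φ w))))) :
    CartanWeighted h M := fun a b k => eq_of_tensorMap φ hi fun w => by
  simpa only [Matrix.map_apply, map_add, map_mul, tensorMap_ofAlg, map_intCast] using hM w a b k

lemma CartanWeighted.isWeighted {M : Matrix (Fin n) (Fin n) (CompletedTensor K R)}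
    (hM : CartanWeighted h M) : (dynamicalPair hh D).IsWeighted M := fun a b s =>
  cartanHom_mul hh D (hM a b) s

end Natural

/-! ### Theta functions of the spectral parameter -/

section Systems
variable {n : ℕ} {S S' : Type*} [CommRing S] [CommRing S']

lemma ThetaSystem.map {sh : Translations n S} {sh' : Translations n S'}
    {f : ℂ × (Fin n → ℂ) × ℂ → S} (hf : ThetaSystem sh f) (φ : S →+* S')
    (hφ : ∀ μ x, φ (sh.map μ x) = sh'.map μ (φ x)) : ThetaSystem sh' fun p => φ (f p) where
  thetaLike := hf.thetaLike.map φ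
  shift μ a l κ := by rw [← hφ, hf.shift]
  isUnit l κ hl := (hf.isUnit l κ hl).map φ

variable {f : ℂ × (Fin n → ℂ) × ℂ → S} {g : ℂ × (Fin n → ℂ) × ℂ → S'} {φ : S →+* S'} {δ : ℂ}

lemma map_rootInv (hfg : ∀ a l κ, φ (f (a, l, κ)) = g (a, l, κ + a * δ))
    (hu : ∀ l κ, l ≠ 0 → IsUnit (f (0, l, κ))) {i j : Fin n} (h : i ≠ j) (κ : ℂ) :
    φ (rootInv f i j κ) = rootInv g i j κ := by
  have e : φ (f (0, rootForm i j, κ)) = g (0, rootForm i j, κ) := by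
    rw [hfg, zero_mul, add_zero]
  rw [rootInv, rootInv, ← e]
  refine left_inv_eq_right_inv (a := φ (f (0, rootForm i j, κ))) ?_
    (Ring.mul_inverse_cancel _ ((hu _ _ (rootForm_ne_zero h)).map φ))
  rw [← map_mul, Ring.inverse_mul_cancel _ (hu _ _ (rootForm_ne_zero h)), map_one]

lemma map_diagCoeff (hfg : ∀ a l κ, φ (f (a, l, κ)) = g (a, l, κ + a * δ))
    (hu : ∀ l κ, l ≠ 0 → IsUnit (f (0, l, κ))) (k : ℂ) (i j : Fin n) :
    φ (diagCoeff f 1 k i j) = diagCoeff g 1 (k + δ) i j := by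
  rcases eq_or_ne i j with rfl | h
  · rw [diagCoeff_self, diagCoeff_self, hfg]
    congr 3
    ring
  · rw [diagCoeff_of_ne _ _ h, diagCoeff_of_ne _ _ h, map_mul, map_mul, map_rootInv hfg hu h, hfg,
      hfg, one_mul, zero_mul, add_zero]

lemma map_offCoeff (hfg : ∀ a l κ, φ (f (a, l, κ)) = g (a, l, κ + a * δ))
    (hu : ∀ l κ, l ≠ 0 → IsUnit (f (0, l, κ))) (k : ℂ) (i j : Fin n) :
    φ (offCoeff f 1 k i j) = offCoeff g 1 (k + δ) i j := by
  rcases eq_or_ne i j with rfl | h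
  · rw [offCoeff_self, offCoeff_self, map_zero]
  · rw [offCoeff_of_ne _ _ h, offCoeff_of_ne _ _ h, map_mul, map_mul, map_rootInv hfg hu h, hfg,
      hfg, one_mul, zero_mul, add_zero]

end Systems

section SpectralTheta
variable {n : ℕ} {τ : ℂ} (hτ : 0 < τ.im) {U : TopologicalSpace.Opens ℂ}

/-- The theta functions `θ(az + ∑ᵢ ℓᵢλᵢ + κℏ)` for a complex number `z`. -/
def pointTheta (n : ℕ) (z : ℂ) (p : ℂ × (Fin n → ℂ) × ℂ) : (LambdaField n)⟦X⟧ :=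
  formalTheta hτ (p.1 * z, p.2.1, p.2.2)

/-- The theta functions `θ(a(c + su) + ∑ᵢ ℓᵢλᵢ + κℏ)` as functions of `(u, λ)`. -/
def spectralTheta (U : TopologicalSpace.Opens ℂ) (n : ℕ) (c s : ℂ) (p : ℂ × (Fin n → ℂ) × ℂ) :
    (SpectralFun U n)⟦X⟧ :=
  expSeries (spectralTaylor U (p.1 * c) (p.1 * s) p.2.1) p.2.2 (thetaEntire hτ)

lemma thetaLike_pointTheta (z : ℂ) : ThetaLike (pointTheta hτ n z) :=
  (thetaLike_formalTheta hτ).comp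
    (AddMonoidHom.mk' (fun p : ℂ × (Fin n → ℂ) × ℂ => (p.1 * z, p.2.1, p.2.2))
      fun _ _ => Prod.ext (add_mul _ _ _) rfl)

lemma isUnit_pointTheta (z : ℂ) (l : Fin n → ℂ) (κ : ℂ) (hl : l ≠ 0) :
    IsUnit (pointTheta hτ n z (0, l, κ)) := by
  rw [pointTheta, zero_mul]
  exact isUnit_formalTheta hτ hl κ

lemma evalShifted_spectralTheta (u : U) (k c s a : ℂ) (l : Fin n → ℂ) (κ : ℂ) :
    evalShifted n u k (spectralTheta hτ U n c s (a, l, κ))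
      = pointTheta hτ n (c + s * u) (a, l, κ + a * (k * s)) := by
  rw [spectralTheta, evalShifted_taylor, pointTheta, formalTheta,
    show a * c + a * s * u = a * (c + s * u) by ring,
    show k * (a * s) + κ = κ + a * (k * s) by ring]

lemma evalShifted_zero (u : U) (F : (SpectralFun U n)⟦X⟧) :
    evalShifted n u 0 F = mapHbar (evalSpectral n u) F := by
  rw [evalShifted_apply, zero_smul, expShift_zero]
  rfl

lemma mapHbar_spectralTheta (u : U) (c s : ℂ) (p : ℂ × (Fin n → ℂ) × ℂ) :
    mapHbar (evalSpectral n u) (spectralTheta hτ U n c s p) = pointTheta hτ n (c + s * u) p := by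
  rw [← evalShifted_zero, evalShifted_spectralTheta, zero_mul, mul_zero, add_zero]

lemma spectralSeries_ext {F G : (SpectralFun U n)⟦X⟧}
    (h : ∀ u : U, mapHbar (evalSpectral n u) F = mapHbar (evalSpectral n u) G) : F = G := by
  ext m
  refine sub_eq_zero.1 (spectral_eq_zero_of_forall fun u => ?_)
  rw [map_sub, ← coeff_mapHbar, ← coeff_mapHbar, h, sub_self]

lemma evalSpectral_natural {R : Type*} [Ring R] [Algebra ℂ⟦X⟧ R] {h : Fin n → R}
    (hh : ∀ i j, Commute (h i) (h j)) (u : U) :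
    IsNatural hh (spectralDerivatives U n) (lambdaDerivatives n) (mapHbar (evalSpectral n u)) :=
  isNatural_mapHbar _ fun k F => evalSpectral_derivative u k F

lemma expShift_spectral_natural {R : Type*} [Ring R] [Algebra ℂ⟦X⟧ R] {h : Fin n → R}
    (hh : ∀ i j, Commute (h i) (h j)) (c : ℂ) :
    IsNatural hh (spectralDerivatives U n) (spectralDerivatives U n)
      (expShift (c • dSpectral U n)) :=
  isNatural_expShift _ fun k F => by
    rw [Derivation.smul_apply, Derivation.smul_apply, dSpectral_comm, Derivation.map_smul]

lemma evalShifted_natural {R : Type*} [Ring R] [Algebra ℂ⟦X⟧ R] {h : Fin n → R}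
    (hh : ∀ i j, Commute (h i) (h j)) (u : U) (c : ℂ) :
    IsNatural hh (spectralDerivatives U n) (lambdaDerivatives n) (evalShifted n u c) :=
  (evalSpectral_natural hh u).comp (expShift_spectral_natural hh c)

lemma isUnit_spectralTheta (c s : ℂ) (l : Fin n → ℂ) (κ : ℂ) (hl : l ≠ 0) :
    IsUnit (spectralTheta hτ U n c s (0, l, κ)) := by
  rw [PowerSeries.isUnit_iff_constantCoeff, ← PowerSeries.coeff_zero_eq_constantCoeff_apply,
    spectralTheta, coeff_expSeries]
  simp only [pow_zero, Nat.factorial_zero, Nat.cast_one, div_one, one_smul,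
    Function.iterate_zero, id_eq, zero_mul]
  refine IsLocalization.map_units (SpectralFun U n)
    (⟨_, fun u hu => ?_⟩ : denominators U n)
  refine lambdaTaylor_theta_ne_zero (n := n) hτ hl ?_
  have h₁ := evalSpectral_taylor (n := n) u 0 0 l (thetaEntire hτ)
  rw [zero_mul, add_zero] at h₁
  rw [← h₁, spectralTaylor, evalSpectral_algebraMap]
  exact (congrArg _ hu).trans (map_zero _)

lemma thetaSystem_spectralTheta (c s : ℂ) :
    ThetaSystem (spectralDerivatives U n).shS (spectralTheta hτ U n c s) where
  thetaLike := .of_injective (S' := fun _ : U => (LambdaField n)⟦X⟧)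
    (fun u : U => (mapHbar (evalSpectral n u) : (SpectralFun U n)⟦X⟧ →+* (LambdaField n)⟦X⟧))
    (fun _ h => spectralSeries_ext fun u => (h u).trans (map_zero _).symm) fun u => by
      have e : (fun p => (mapHbar (evalSpectral n u) : (SpectralFun U n)⟦X⟧ →+* (LambdaField n)⟦X⟧)
          (spectralTheta hτ U n c s p)) = pointTheta hτ n (c + s * u) :=
        funext (mapHbar_spectralTheta hτ u c s)
      rw [e]
      exact thetaLike_pointTheta hτ _
  shift μ a l κ := spectralSeries_ext fun u => by
    -- Only compatibility with translations is wanted, so any algebra with Cartan elements will do;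
    -- ℂ⟦ℏ⟧ with zero Cartan elements is used.
    have e := (evalSpectral_natural (R := ℂ⟦X⟧) (h := 0) (fun _ _ => Commute.zero_left _) u).shift
      μ (spectralTheta hτ U n c s (a, l, κ))
    rw [e, mapHbar_spectralTheta, mapHbar_spectralTheta]
    exact shift_formalTheta hτ μ _ l κ
  isUnit l κ hl := isUnit_spectralTheta hτ c s l κ hl

end SpectralTheta

end DynamicalElliptic
end

noncomputable section
namespace DynamicalElliptic
open Matrix PowerSeries TensorProduct
open Finset.HasAntidiagonal (antidiagonal mem_antidiagonal)

/-! ### The exchange relations of an `L`-operator -/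

section FelderMatrix
variable {n : ℕ} {τ : ℂ} (hτ : 0 < τ.im)

lemma formalTheta_zero (c : ℂ) (l : Fin n → ℂ) :
    formalTheta hτ (c, l, 0) = PowerSeries.C (lambdaTaylor c l (thetaEntire hτ)) :=
  expSeries_zero _ _

lemma rootInv_pointTheta (z : ℂ) {i j : Fin n} (h : i ≠ j) :
    rootInv (pointTheta hτ n z) i j 0 = PowerSeries.C (thetaLambda τ 0 i j)⁻¹ := by
  have e : pointTheta hτ n z (0, rootForm i j, 0) = PowerSeries.C (thetaLambda τ 0 i j) := by
    rw [pointTheta, zero_mul, formalTheta_zero, thetaLambda_eq hτ]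
    rfl
  have h₀ : thetaLambda τ 0 i j ≠ 0 := by
    rw [thetaLambda_eq hτ]
    exact lambdaTaylor_theta_ne_zero hτ (rootForm_ne_zero h)
  have hu := isUnit_pointTheta hτ z _ 0 (rootForm_ne_zero h)
  rw [rootInv]
  refine left_inv_eq_right_inv (Ring.inverse_mul_cancel _ hu) ?_
  rw [e, ← map_mul, mul_inv_cancel₀ h₀, map_one]

lemma pointTheta_one_zero (z : ℂ) : pointTheta hτ n z (1, 0, 0)
    = PowerSeries.C (algebraMap ℂ (LambdaField n) (theta τ z)) := by
  rw [pointTheta, one_mul, formalTheta_zero, lambdaTaylor_zero]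
  rfl

/-- The factor θ(z) clears the denominators θ(z) of the R-matrix. The cleared coefficients make
sense for every z, which is what allows the exchange relation to be continued to zeros of θ(u - v).
-/
lemma theta_mul_felderR {z : ℂ} (hz : theta τ z ≠ 0) (p q : Fin n × Fin n) :
    PowerSeries.C (algebraMap ℂ (LambdaField n) (theta τ z)) * felderR n τ z p q
      = (if p = q then diagCoeff (pointTheta hτ n z) 1 0 p.1 p.2 else 0)
        + (if p = q.swap then offCoeff (pointTheta hτ n z) 1 0 p.2 p.1 else 0) := by
  have hz' : algebraMap ℂ (LambdaField n) (theta τ z) ≠ 0 :=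
    (map_ne_zero (algebraMap ℂ (LambdaField n))).2 hz
  rw [felderR]
  by_cases hpq : p = q
  · subst hpq
    rw [if_pos rfl, if_pos rfl]
    obtain ⟨i, j⟩ := p
    by_cases hij : i = j
    · subst hij
      simp only [if_true, diagCoeff_self, offCoeff_self, ite_self, add_zero]
      rw [map_mul, PowerSeries.algebraMap_apply'', PowerSeries.map_C, ← mul_assoc, ← map_mul,
        ← map_mul, mul_inv_cancel₀ hz, map_one, map_one, one_mul, algebraMap_thetaSeries hτ,
        pointTheta, one_mul, zero_add]
    · have e : expShift (dLambda i) (PowerSeries.C (thetaLambda τ 0 i j))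
          = pointTheta hτ n z (0, rootForm i j, 1) := by
        rw [pointTheta, zero_mul, thetaLambda_eq hτ]
        refine expShift_C_of_der (κ := 1) (E := lambdaTaylor 0 (rootForm i j)) (fun f => ?_) _
        rw [dLambda_lambdaTaylor]
        simp [rootForm, hij]
      rw [if_neg hij, if_neg (fun e => hij (congrArg Prod.fst e) : ¬(i, j) = (i, j).swap), add_zero,
        diagCoeff_of_ne _ _ hij, rootInv_pointTheta hτ z hij, pointTheta_one_zero, ← e, mul_assoc,
        mul_comm (PowerSeries.C (thetaLambda _ _ _ _)⁻¹)]
  · rw [if_neg hpq, if_neg hpq, zero_add]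
    split_ifs with h
    · obtain ⟨i, j⟩ := q
      subst h
      have hij : i ≠ j := fun e => hpq (by subst e; rfl)
      have h₀ : thetaLambda τ 0 i j ≠ 0 := by
        rw [thetaLambda_eq hτ]
        exact lambdaTaylor_theta_ne_zero hτ (rootForm_ne_zero hij)
      change PowerSeries.C _ * (PowerSeries.C (thetaLambda τ z i j
        * (algebraMap ℂ _ (theta τ z) * thetaLambda τ 0 i j)⁻¹) * _)
          = offCoeff (pointTheta hτ n z) 1 0 i j
      rw [offCoeff_of_ne _ _ hij, rootInv_pointTheta hτ z hij, ← mul_assoc, ← map_mul,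
        mul_inv, mul_left_comm, mul_inv_cancel_left₀ hz', map_mul, algebraMap_thetaSeries hτ,
        pointTheta, pointTheta, zero_mul, one_mul, formalTheta_zero, thetaLambda_eq hτ z]
      rw [mul_right_comm]
      rfl
    · rw [mul_zero]

variable {R : Type*} [Ring R] [Algebra ℂ⟦X⟧ R] {h : Fin n → R}

lemma leg₁Shift_mul_leg₂ (A B : Matrix (Fin n) (Fin n) (CompletedTensor (LambdaField n) R))
    (x q : Fin n × Fin n) :
    (leg₁Shift A * leg₂ B) x q = translate (Pi.single x.2 1) (A x.1 q.1) * B x.2 q.2 := by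
  rw [mul_apply, Finset.sum_eq_single (q.1, x.2)]
  · simp [leg₁Shift, leg₂]
  · rintro ⟨y₁, y₂⟩ - hy
    by_cases h₂ : x.2 = y₂
    · have h₁ : y₁ ≠ q.1 := fun e => hy (by rw [e, h₂])
      simp [leg₂, h₁]
    · simp [leg₁Shift, h₂]
  · simp

lemma leg₂Shift_mul_leg₁ (A B : Matrix (Fin n) (Fin n) (CompletedTensor (LambdaField n) R))
    (p x : Fin n × Fin n) :
    (leg₂Shift B * leg₁ A) p x = translate (Pi.single p.1 1) (B p.2 x.2) * A p.1 x.1 := by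
  rw [mul_apply, Finset.sum_eq_single (p.1, x.2)]
  · simp [leg₂Shift, leg₁]
  · rintro ⟨y₁, y₂⟩ - hy
    by_cases h₁ : p.1 = y₁
    · have h₂ : y₂ ≠ x.2 := fun e => hy (by rw [e, h₁])
      simp [leg₁, h₂]
    · simp [leg₂Shift, h₁]
  · simp

/-- This is θ(z) times the entry with row (j, i) and column (k, l), where at most two entries of R
contribute on each side. The scalar θ(z) does not depend on λ, so it is fixed by λ ↦ λ + ℏh and can
be absorbed into R on the right as well as on the left. -/
theorem exchange_of_rll (hh : ∀ i j, Commute (h i) (h j)) {z : ℂ} (hz : theta τ z ≠ 0)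
    {A B : Matrix (Fin n) (Fin n) (CompletedTensor (LambdaField n) R)}
    (hr : (felderR n τ z).map ofFun * leg₁Shift A * leg₂ B
      = leg₂Shift B * leg₁ A * (felderR n τ z).map (cartanShift h)) :
    (dynamicalPair hh (lambdaDerivatives n)).Exchange A B (diagCoeff (pointTheta hτ n z) 1 0)
      (offCoeff (pointTheta hτ n z) 1 0) := fun i j k l => by
  set s : (LambdaField n)⟦X⟧ := PowerSeries.C (algebraMap ℂ (LambdaField n) (theta τ z)) with hs
  have hc : cartanHom hh (lambdaDerivatives n) s = ofFun s := by
    have e : s = algebraMap ℂ⟦X⟧ _ (PowerSeries.C (theta τ z)) := by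
      rw [PowerSeries.algebraMap_apply'', PowerSeries.map_C]
    rw [e, cartanHom_algebraMap]
  have h₁ := congrArg (fun M => ofFun s * M (j, i) (k, l)) hr
  rw [mul_assoc] at h₁
  simp only [mul_apply (M := (felderR n τ z).map ofFun), mul_apply (M := leg₂Shift B * leg₁ A),
    Finset.mul_sum, leg₁Shift_mul_leg₂, leg₂Shift_mul_leg₁, Matrix.map_apply] at h₁
  have e₁ : ∀ x, ofFun s * (ofFun (felderR n τ z (j, i) x)
        * (translate (Pi.single x.2 1) (A x.1 k) * B x.2 l))
      = (if (j, i) = x then ofFun (diagCoeff (pointTheta hτ n z) 1 0 j i)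
            * (translate (Pi.single x.2 1) (A x.1 k) * B x.2 l) else 0)
        + (if (i, j) = x then ofFun (offCoeff (pointTheta hτ n z) 1 0 i j)
            * (translate (Pi.single x.2 1) (A x.1 k) * B x.2 l) else 0) := fun x => by
    have e : ((j, i) = x.swap) = ((i, j) = x) := by
      rw [← Prod.swap_inj, Prod.swap_swap]; rfl
    rw [← mul_assoc, ← map_mul, theta_mul_felderR hτ hz]
    simp only [e, map_add, add_mul]
    congr 1 <;> split_ifs <;> simp only [map_zero, zero_mul]
  have e₂ : ∀ x, ofFun s * ((translate (Pi.single j 1) (B i x.2) * A j x.1)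
        * cartanShift h (felderR n τ z x (k, l)))
      = (if x = (k, l) then translate (Pi.single j 1) (B i x.2) * A j x.1
            * cartanHom hh (lambdaDerivatives n) (diagCoeff (pointTheta hτ n z) 1 0 k l) else 0)
        + (if x = (l, k) then translate (Pi.single j 1) (B i x.2) * A j x.1
            * cartanHom hh (lambdaDerivatives n) (offCoeff (pointTheta hτ n z) 1 0 k l) else 0) :=
      fun x => by
    rw [cartanShift_eq hh, ofFun_mul_comm, mul_assoc, ← hc, ← map_mul, mul_comm _ s,
      theta_mul_felderR hτ hz]
    change _ * cartanHom hh _ (_ + if x = (l, k) then _ else _) = _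
    rw [map_add, mul_add]
    congr 1 <;> split_ifs with hx <;> first | rw [hx] | rw [map_zero, mul_zero]
  simp only [e₁, e₂, Finset.sum_add_distrib, Finset.sum_ite_eq, Finset.sum_ite_eq',
    Finset.mem_univ, if_true] at h₁
  exact h₁

end FelderMatrix
end DynamicalElliptic
end

noncomputable section
namespace DynamicalElliptic
open Matrix PowerSeries TensorProduct
open Finset.HasAntidiagonal (antidiagonal mem_antidiagonal)

/-! ### Continuation of the relations in the spectral parameters -/

section Continuation
variable {n : ℕ} {τ : ℂ} (hτ : 0 < τ.im) {U : TopologicalSpace.Opens ℂ}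
  {R : Type*} [Ring R] [Algebra ℂ⟦X⟧ R] {h : Fin n → R}

lemma exists_theta_sub_ne_zero (hτ : 0 < τ.im) (v : ℂ) : ∃ z, theta τ (z - v) ≠ 0 := by
  by_contra! H
  have := deriv_theta_zero hτ
  rw [show theta τ = fun _ => 0 from funext fun z => by
    simpa only [add_sub_cancel_right] using H (z + v), deriv_const] at this
  exact zero_ne_one this

/-- A matrix of functions of `λ` as a matrix of functions of `(u, λ)`. -/
def constL (U : TopologicalSpace.Opens ℂ)
    (Y : Matrix (Fin n) (Fin n) (CompletedTensor (LambdaField n) R)) :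
    Matrix (Fin n) (Fin n) (CompletedTensor (SpectralFun U n) R) :=
  Y.map (tensorMap (mapHbar (constSpectral U n)))

lemma evalL_constL (Y : Matrix (Fin n) (Fin n) (CompletedTensor (LambdaField n) R)) (u : U) (c : ℂ) :
    evalL (constL U Y) u c = Y := by
  ext i j
  change tensorMap (evalShifted n u c) (tensorMap (mapHbar (constSpectral U n)) (Y i j)) = Y i j
  rw [← tensorMap_comp, show (evalShifted n u c).comp (mapHbar (constSpectral U n))
    = AlgHom.id ℂ⟦X⟧ _ from AlgHom.ext (evalShifted_const u c), tensorMap_id]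

lemma map_evalSpectral (L : Matrix (Fin n) (Fin n) (CompletedTensor (SpectralFun U n) R)) (u : U) :
    L.map (tensorMap (mapHbar (evalSpectral n u))) = evalL L u 0 := by
  rw [evalL, show evalShifted n u 0 = mapHbar (evalSpectral n u) from
    AlgHom.ext (evalShifted_zero u)]

lemma evalShifted_diagCoeff (u : U) (k c s : ℂ) (i j : Fin n) (κ : ℂ) :
    evalShifted n u k (diagCoeff (spectralTheta hτ U n c s) 1 κ i j)
      = diagCoeff (pointTheta hτ n (c + s * u)) 1 (κ + k * s) i j :=
  map_diagCoeff (φ := (evalShifted n u k : (SpectralFun U n)⟦X⟧ →+* (LambdaField n)⟦X⟧))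
    (fun a l κ => evalShifted_spectralTheta hτ u k c s a l κ)
    (isUnit_spectralTheta hτ c s) κ i j

lemma evalShifted_offCoeff (u : U) (k c s : ℂ) (i j : Fin n) (κ : ℂ) :
    evalShifted n u k (offCoeff (spectralTheta hτ U n c s) 1 κ i j)
      = offCoeff (pointTheta hτ n (c + s * u)) 1 (κ + k * s) i j :=
  map_offCoeff (φ := (evalShifted n u k : (SpectralFun U n)⟦X⟧ →+* (LambdaField n)⟦X⟧))
    (fun a l κ => evalShifted_spectralTheta hτ u k c s a l κ)
    (isUnit_spectralTheta hτ c s) κ i j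

variable {L M : Matrix (Fin n) (Fin n) (CompletedTensor (SpectralFun U n) R)}
  (hh : ∀ i j, Commute (h i) (h j))

/-- An exchange relation that holds for generic values of the spectral parameter holds
identically. -/
lemma exchange_spectral {g : ℂ → ℂ} (hg : Differentiable ℂ g) (hne : ∃ z, g z ≠ 0) {c s κ : ℂ}
    (hE : ∀ u : U, g u ≠ 0 → (dynamicalPair hh (lambdaDerivatives n)).Exchange (evalL L u 0)
      (evalL M u 0) (diagCoeff (pointTheta hτ n (c + s * u)) 1 κ)
      (offCoeff (pointTheta hτ n (c + s * u)) 1 κ)) :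
    (dynamicalPair hh (spectralDerivatives U n)).Exchange L M
      (diagCoeff (spectralTheta hτ U n c s) 1 κ) (offCoeff (spectralTheta hτ U n c s) 1 κ) := by
  refine exchange_of_natural (σ := {u : U // g u ≠ 0}) (φ := fun u => evalSpectral n u.1)
    (fun u => evalSpectral_natural hh u.1)
    (fun F hF => spectral_eq_zero hg hne fun u hu => hF ⟨u, hu⟩) fun u => ?_
  simp only [← evalShifted_zero, evalShifted_diagCoeff, evalShifted_offCoeff, zero_mul, add_zero,
    map_evalSpectral]
  exact hE u.1 u.2

lemma exchange_evalL {c s κ : ℂ} (hE : (dynamicalPair hh (spectralDerivatives U n)).Exchange L M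
      (diagCoeff (spectralTheta hτ U n c s) 1 κ) (offCoeff (spectralTheta hτ U n c s) 1 κ))
    (u : U) (k : ℂ) : (dynamicalPair hh (lambdaDerivatives n)).Exchange (evalL L u k)
      (evalL M u k) (diagCoeff (pointTheta hτ n (c + s * u)) 1 (κ + k * s))
      (offCoeff (pointTheta hτ n (c + s * u)) 1 (κ + k * s)) := by
  have := (evalShifted_natural hh u k).exchange hE
  simp only [evalShifted_diagCoeff, evalShifted_offCoeff] at this
  exact this

/-- The hypothesis gives the relation only for θ(u - v) ≠ 0 and unshifted arguments. With v fixed,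
the cleared relation holds for generic u, hence as an identity between functions of u, which can be
evaluated at u + kℏ. Then L(u + kℏ) is held fixed and the argument is repeated in v, where the theta
functions depend on u - v and hence on v with slope -1. -/
theorem IsDynamicalLOperator.exchange (hL : IsDynamicalLOperator τ L h) (u v : U) (k l : ℂ) :
    (dynamicalPair hL.cartan_commute (lambdaDerivatives n)).Exchange (evalL L u k) (evalL L v l)
      (diagCoeff (pointTheta hτ n (u - v)) 1 (k - l))
      (offCoeff (pointTheta hτ n (u - v)) 1 (k - l)) := by
  have h₁ : ∀ u v : U, ∀ k, (dynamicalPair hL.cartan_commute (lambdaDerivatives n)).Exchange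
      (evalL L u k) (evalL L v 0) (diagCoeff (pointTheta hτ n (u - v)) 1 k)
      (offCoeff (pointTheta hτ n (u - v)) 1 k) := fun u v k => by
    have := exchange_evalL hτ hL.cartan_commute (exchange_spectral hτ hL.cartan_commute (L := L)
      (M := constL U (evalL L v 0)) (g := fun z => theta τ (z - v)) (c := -v) (s := 1) (κ := 0)
      ((differentiable_theta hτ).comp (differentiable_id.sub_const (v : ℂ)))
      (exists_theta_sub_ne_zero hτ v) fun u hu => ?_) u k
    · rwa [evalL_constL, one_mul, neg_add_eq_sub, zero_add, mul_one] at this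
    · rw [evalL_constL, one_mul, neg_add_eq_sub]
      exact exchange_of_rll hτ hL.cartan_commute hu (hL.rll u v hu)
  have := exchange_evalL hτ hL.cartan_commute (exchange_spectral hτ hL.cartan_commute
    (L := constL U (evalL L u k)) (M := L) (g := fun _ => 1) (c := u) (s := -1) (κ := k)
    (differentiable_const 1) ⟨0, one_ne_zero⟩ fun v _ => ?_) v l
  · rwa [evalL_constL, neg_one_mul, ← sub_eq_add_neg, mul_neg_one, ← sub_eq_add_neg] at this
  · rw [evalL_constL, neg_one_mul, ← sub_eq_add_neg]
    exact h₁ u v k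

/-- The weight relation is assumed pointwise in u. As an identity between functions of u it becomes
available at the shifted arguments u + cℏ. -/
theorem IsDynamicalLOperator.cartanWeighted (hL : IsDynamicalLOperator τ L h) :
    CartanWeighted h L := by
  refine cartanWeighted_of_map (φ := fun u : U => evalSpectral n u)
    (fun F hF => spectral_eq_zero_of_forall hF) fun u a b k => ?_
  rw [map_evalSpectral]
  have h₁ := congrFun (congrFun (hL.weight u k) a) b
  rw [add_mul, mul_add, Matrix.add_apply, Matrix.add_apply, Matrix.scalar_apply,
    Matrix.diagonal_mul, Matrix.mul_diagonal] at h₁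
  have h₂ : (Matrix.single k k (1 : CompletedTensor (LambdaField n) R) * evalL L u 0) a b
      = ((unitWeight a k : ℤ) : CompletedTensor (LambdaField n) R) * evalL L u 0 a b := by
    by_cases hak : a = k
    · subst hak
      simp [unitWeight]
    · rw [Matrix.single_mul_apply_of_ne _ _ _ _ _ hak]
      simp [unitWeight, Ne.symm hak]
  have h₃ : (evalL L u 0 * Matrix.single k k (1 : CompletedTensor (LambdaField n) R)) a b
      = evalL L u 0 a b * ((unitWeight b k : ℤ) : CompletedTensor (LambdaField n) R) := by
    by_cases hbk : b = k
    · subst hbk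
      simp [unitWeight]
    · rw [Matrix.mul_single_apply_of_ne _ _ _ _ _ hbk]
      simp [unitWeight, Ne.symm hbk]
  rw [h₂, h₃, ← eq_sub_iff_add_eq'] at h₁
  rw [h₁, Pi.sub_apply, Int.cast_sub, (Int.cast_commute (unitWeight a k) _).eq]
  noncomm_ring

lemma CartanWeighted.evalL (hL : CartanWeighted h L) (u : U) (c : ℂ) :
    CartanWeighted h (evalL L u c) := hL.map _

end Continuation
end DynamicalElliptic
end

noncomputable section
namespace DynamicalElliptic
open Matrix PowerSeries TensorProduct
open Finset.HasAntidiagonal (antidiagonal mem_antidiagonal)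

/-! ### Divided differences in the spectral parameter -/

section DividedDifference
variable {n : ℕ} {U : TopologicalSpace.Opens ℂ}

/-- The function `u - u₀`. -/
def spectralVar (U : TopologicalSpace.Opens ℂ) (n : ℕ) (u₀ : ℂ) : SpectralFun U n :=
  spectralTaylor U (-u₀) 1 0 ⟨fun z => z, differentiable_id⟩

lemma evalSpectral_var (u : U) (u₀ : ℂ) :
    evalSpectral n u (spectralVar U n u₀) = algebraMap ℂ _ (u - u₀) := by
  rw [spectralVar, evalSpectral_taylor, lambdaTaylor_zero, one_mul, neg_add_eq_sub]

lemma spectralDerivatives_var (k : Fin n) (u₀ : ℂ) :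
    (spectralDerivatives U n).d k (spectralVar U n u₀) = 0 :=
  spectral_eq_zero_of_forall fun u => by
    rw [evalSpectral_derivative, evalSpectral_var, Derivation.map_algebraMap]

lemma evalShifted_var (u : U) (k : ℂ) :
    evalShifted n u k (PowerSeries.C (spectralVar U n u))
      = algebraMap ℂ⟦X⟧ _ (PowerSeries.C k * PowerSeries.X) := by
  rw [spectralVar, ← expSeries_zero, evalShifted_taylor, one_mul, neg_add_cancel, mul_one, add_zero]
  ext j
  rw [coeff_expSeries, lambdaTaylor_zero, Entire.coe_der_iterate, iteratedDeriv_fun_id,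
    PowerSeries.algebraMap_apply'', PowerSeries.coeff_map, PowerSeries.coeff_C_mul,
    PowerSeries.coeff_X, Algebra.smul_def, ← map_mul]
  congr 1
  obtain _ | _ | j := j <;> simp

/-- The slope function at u₀ supplies the quotient; it is holomorphic by removal of the singularity.
-/
lemma exists_hol_eq_mul {u₀ : U} {f : Hol U} (hf : evalHol u₀ f = 0) :
    ∃ g : Hol U, ∀ u : U, evalHol u f = (u - u₀) * evalHol u g := by
  refine ⟨⟨fun u => dslope (extendZero f.1) u₀ u, ?_⟩, fun u => ?_⟩
  · exact ((Complex.differentiableOn_dslope (U.isOpen.mem_nhds u₀.2)).2 f.2).congr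
      (extendZero_eqOn fun _ => rfl)
  · have := sub_smul_dslope (extendZero f.1) u₀ u
    rw [extendZero_coe, extendZero_coe] at this
    change f.1 u₀ = 0 at hf
    rw [hf, sub_zero] at this
    exact this.symm

lemma exists_eq_var_mul {u₀ : U} {F : SpectralFun U n} (hF : evalSpectral n u₀ F = 0) :
    ∃ G, F = spectralVar U n u₀ * G := by
  obtain ⟨p, q, rfl⟩ := IsLocalization.exists_mk'_eq (denominators U n) F
  have hev : ∀ (u : U) (p : MvPowerSeries (Fin n) (Hol U)),
      algebraMap _ (LambdaField n) (MvPowerSeries.mapAlgHom (evalHol u) q.1)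
        * evalSpectral n u (IsLocalization.mk' (SpectralFun U n) p q)
      = algebraMap _ (LambdaField n) (MvPowerSeries.mapAlgHom (evalHol u) p) := fun u p => by
    rw [← evalSpectral_algebraMap, ← evalSpectral_algebraMap, ← map_mul]
    exact congrArg _ (IsLocalization.mk'_spec' (SpectralFun U n) p q)
  have hp : ∀ d, evalHol u₀ (MvPowerSeries.coeff d p) = 0 := fun d => by
    have h₁ := hev u₀ p
    rw [hF, mul_zero] at h₁
    have h₂ := IsFractionRing.injective (MvPowerSeries (Fin n) ℂ) (LambdaField n)
      (h₁.symm.trans (map_zero _).symm)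
    exact congrArg (MvPowerSeries.coeff d) h₂
  choose g hg using fun d => exists_hol_eq_mul (hp d)
  let p' : MvPowerSeries (Fin n) (Hol U) := g
  refine ⟨IsLocalization.mk' _ p' q, sub_eq_zero.1 (spectral_eq_zero_of_forall fun u => ?_)⟩
  have hq : algebraMap _ (LambdaField n)
      (MvPowerSeries.mapAlgHom (evalHol u) q.1) ≠ 0 := fun h₀ =>
    q.2 u (IsFractionRing.injective (MvPowerSeries (Fin n) ℂ) (LambdaField n)
      (h₀.trans (map_zero _).symm))
  refine mul_left_cancel₀ hq ?_
  rw [mul_zero, map_sub, map_mul, mul_sub, mul_left_comm, hev, hev, evalSpectral_var, sub_eq_zero,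
    IsScalarTower.algebraMap_apply ℂ (MvPowerSeries (Fin n) ℂ), ← map_mul, ← Algebra.smul_def]
  congr 1
  ext d
  exact hg d u

lemma spectralVar_mul_injective (u₀ : U) :
    LinearMap.ker (LinearMap.mulLeft ℂ (spectralVar U n u₀)) = ⊥ := by
  refine LinearMap.ker_eq_bot'.2 fun F hF => ?_
  refine spectral_eq_zero (g := fun z => z - u₀) (differentiable_id.sub_const _)
    ⟨u₀ + 1, by simp⟩ fun u hu => ?_
  have h₁ := congrArg (evalSpectral n u) hF
  rw [LinearMap.mulLeft_apply, map_mul, evalSpectral_var, map_zero] at h₁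
  exact (mul_eq_zero.1 h₁).resolve_left ((map_ne_zero _).2 hu)

/-- The divided difference `F ↦ (F(u) - F(u₀)) / (u - u₀)`. -/
lemma exists_dividedDifference (n : ℕ) (u₀ : U) : ∃ δ : SpectralFun U n →ₗ[ℂ] SpectralFun U n,
    LinearMap.id = (constSpectral U n).toLinearMap ∘ₗ (evalSpectral n u₀).toLinearMap
      + LinearMap.mulLeft ℂ (spectralVar U n u₀) ∘ₗ δ := by
  -- Any ℂ-linear left inverse of multiplication by u - u₀ returns the true quotient on multiples of
  -- u - u₀. Being defined and linear on all functions, it extends to functions with values in `R`.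
  obtain ⟨g, hg⟩ := LinearMap.exists_leftInverse_of_injective _ (spectralVar_mul_injective (n := n) u₀)
  refine ⟨g ∘ₗ (LinearMap.id - (constSpectral U n).toLinearMap ∘ₗ (evalSpectral n u₀).toLinearMap),
    LinearMap.ext fun F => ?_⟩
  obtain ⟨G, hG⟩ := exists_eq_var_mul (u₀ := u₀)
    (F := F - constSpectral U n (evalSpectral n u₀ F)) (by rw [map_sub, evalSpectral_const, sub_self])
  have e : g (F - constSpectral U n (evalSpectral n u₀ F)) = G := by
    rw [hG]
    exact congrArg (fun f => f G) hg
  change F = constSpectral U n (evalSpectral n u₀ F)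
    + spectralVar U n u₀ * g (F - constSpectral U n (evalSpectral n u₀ F))
  rw [e, ← hG, add_sub_cancel]

lemma exists_series_eq (u₀ : U) (f : (SpectralFun U n)⟦X⟧) :
    ∃ g, f = mapHbar (constSpectral U n) (mapHbar (evalSpectral n u₀) f)
      + PowerSeries.C (spectralVar U n u₀) * g := by
  obtain ⟨δ, hδ⟩ := exists_dividedDifference n u₀
  refine ⟨PowerSeries.mk fun m => δ (PowerSeries.coeff m f), ?_⟩
  ext m
  rw [map_add, coeff_mapHbar, coeff_mapHbar, PowerSeries.coeff_C_mul, PowerSeries.coeff_mk]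
  exact congrArg (fun f' => f' (PowerSeries.coeff m f)) hδ

variable {R : Type*} [Ring R] [Algebra ℂ⟦X⟧ R]

/-- Divisibility holds without any flatness of `R` over ℂ⟦ℏ⟧, because the decomposition by the
divided difference takes place in the scalar factor. -/
lemma exists_eq_var_mul_of_eval {u₀ : U} {x : CompletedTensor (SpectralFun U n) R}
    (hx : tensorMap (mapHbar (evalSpectral n u₀)) x = 0) :
    ∃ y, x = ofFun (PowerSeries.C (spectralVar U n u₀)) * y := by
  obtain ⟨δ, hδ⟩ := exists_dividedDifference n u₀
  refine ⟨linMap δ x, ?_⟩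
  have := congrArg (fun f => linMap f x) hδ
  rwa [linMap_id, linMap_add, linMap_comp, linMap_comp, linMap_algHom, linMap_algHom, hx, map_zero, zero_add,
    linMap_mulLeft] at this

/-- A linear left inverse on scalar functions persists with values in `R`. So u - u₀ can be
cancelled there, while ℏ in general cannot. -/
lemma eq_zero_of_var_mul {u₀ : U} {x : CompletedTensor (SpectralFun U n) R}
    (hx : ofFun (PowerSeries.C (spectralVar U n u₀)) * x = 0) : x = 0 := by
  obtain ⟨g, hg⟩ := LinearMap.exists_leftInverse_of_injective _ (spectralVar_mul_injective (n := n) u₀)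
  have := congrArg (fun f => linMap f x) hg
  rwa [linMap_comp, linMap_mulLeft, hx, map_zero, linMap_id, eq_comm] at this

end DividedDifference

section CartanConst
variable {n : ℕ} {K : Type*} [CommRing K] [Algebra ℂ K] {R : Type*} [Ring R] [Algebra ℂ⟦X⟧ R]
  {h : Fin n → R} (hh : ∀ i j, Commute (h i) (h j)) (D : PartialDerivatives n K)

lemma cartanHom_C_of_der {a : K} (ha : ∀ k, D.d k a = 0) :
    cartanHom hh D (PowerSeries.C a) = ofFun (PowerSeries.C a) := by
  rw [cartanHom_apply, mapHbar_C, ← cartanEval_mapHbar hh, mapHbar_C]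
  congr 1
  ext m : 1
  rw [coeff_expShift, Finset.sum_eq_single (0, m)]
  · rw [divPow_zero]; rfl
  · rintro ⟨i, j⟩ hij hne
    obtain _ | i := i
    · exact absurd (by simpa using hij) hne
    · rw [PowerSeries.coeff_C]
      split_ifs
      · rw [divPow, LinearMap.smul_apply, pow_succ, Module.End.mul_apply, Derivation.coeFn_coe,
          D.poly_apply]
        simp only [constPoly_apply, polyDer_C, ha, map_zero, mul_zero, Finset.sum_const_zero,
          smul_zero]
      · rw [map_zero]
  · simp

end CartanConst
end DynamicalElliptic
end

noncomputable section
namespace DynamicalElliptic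
open Matrix PowerSeries TensorProduct
open Finset.HasAntidiagonal (antidiagonal mem_antidiagonal)

/-! ### Fusion of an `L`-operator -/

section FusionPoint
variable {n : ℕ} {τ : ℂ} (hτ : 0 < τ.im)

lemma thetaSystem_pointTheta (z : ℂ) :
    ThetaSystem (lambdaDerivatives n).shS (pointTheta hτ n z) where
  thetaLike := thetaLike_pointTheta hτ z
  shift μ _ l κ := shift_formalTheta hτ μ _ l κ
  isUnit := isUnit_pointTheta hτ z

lemma pointTheta_zero_left (a a' : ℂ) (l : Fin n → ℂ) (κ : ℂ) :
    pointTheta hτ n 0 (a, l, κ) = pointTheta hτ n 0 (a', l, κ) := by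
  rw [pointTheta, pointTheta, mul_zero, mul_zero]

lemma pointTheta_hbar (a : ℂ) :
    pointTheta hτ n 0 (a, 0, 1) = algebraMap ℂ⟦X⟧ _ (thetaSeries τ 0) := by
  rw [pointTheta, mul_zero, algebraMap_thetaSeries hτ]

lemma pointTheta_neg_hbar (a : ℂ) :
    pointTheta hτ n 0 (a, 0, -1) = -algebraMap ℂ⟦X⟧ _ (thetaSeries τ 0) := by
  rw [← pointTheta_hbar hτ 0, ← (thetaLike_pointTheta hτ 0).odd, pointTheta_zero_left hτ a 0]
  simp

lemma pointTheta_zero (a : ℂ) : pointTheta hτ n 0 (a, 0, 0) = 0 := by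
  rw [pointTheta, mul_zero, formalTheta_zero, lambdaTaylor_zero]
  change PowerSeries.C (algebraMap ℂ _ (theta τ 0)) = 0
  rw [theta_zero, map_zero, map_zero]

lemma diagCoeff_pointTheta_zero {i j : Fin n} (h : i ≠ j) :
    diagCoeff (pointTheta hτ n 0) 1 0 i j = 0 := by
  rw [diagCoeff_of_ne _ _ h, pointTheta_zero, zero_mul, zero_mul]

lemma offCoeff_pointTheta_zero {i j : Fin n} (h : i ≠ j) :
    offCoeff (pointTheta hτ n 0) 1 0 i j = algebraMap ℂ⟦X⟧ _ (thetaSeries τ 0) := by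
  rw [offCoeff_of_ne _ _ h, pointTheta_hbar, mul_right_comm, pointTheta_zero_left hτ 1 0, mul_comm (pointTheta _ _ _ _),
    (thetaSystem_pointTheta hτ 0).rootInv_mul h, one_mul]

/-- At z = 0 the matrix θ(z)R(z) is θ(ℏ) times the flip. -/
lemma diag_add_offCoeff_zero (k l : Fin n) :
    diagCoeff (pointTheta hτ n 0) 1 0 k l + offCoeff (pointTheta hτ n 0) 1 0 l k
      = algebraMap ℂ⟦X⟧ _ (thetaSeries τ 0) := by
  rcases eq_or_ne k l with rfl | h
  · rw [diagCoeff_self, offCoeff_self, add_zero, zero_add, pointTheta_hbar]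
  · rw [diagCoeff_pointTheta_zero hτ h, offCoeff_pointTheta_zero hτ h.symm, zero_add]

/-- The ratio `θ(λᵢⱼ + ℏ) / θ(λᵢⱼ)`. -/
def rootRatio (i j : Fin n) : (LambdaField n)⟦X⟧ :=
  pointTheta hτ n 0 (0, rootForm i j, 1) * rootInv (pointTheta hτ n 0) i j 0

lemma isUnit_rootRatio {i j : Fin n} (h : i ≠ j) : IsUnit (rootRatio hτ i j) := by
  refine (isUnit_pointTheta hτ 0 _ 1 (rootForm_ne_zero h)).mul ?_
  exact IsUnit.of_mul_eq_one _ ((thetaSystem_pointTheta hτ 0).rootInv_mul h 0)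

lemma diagCoeff_pointTheta_neg_one {i j : Fin n} (h : i ≠ j) :
    diagCoeff (pointTheta hτ n 0) 1 (-1) i j
      = -(algebraMap ℂ⟦X⟧ _ (thetaSeries τ 0) * rootRatio hτ i j) := by
  rw [diagCoeff_of_ne _ _ h, pointTheta_neg_hbar, rootRatio]
  ring

lemma offCoeff_pointTheta_neg_one {i j : Fin n} (h : i ≠ j) :
    offCoeff (pointTheta hτ n 0) 1 (-1) i j
      = algebraMap ℂ⟦X⟧ _ (thetaSeries τ 0) * rootRatio hτ j i := by
  have e := (thetaSystem_pointTheta (n := n) hτ 0).rootInv_neg h 0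
  rw [neg_zero] at e
  rw [offCoeff_of_ne _ _ h, pointTheta_zero_left hτ 1 0, (thetaSystem_pointTheta hτ 0).root_neg,
    pointTheta_hbar, e, rootRatio]
  ring

/-- The degeneration of the R-matrix at z = -ℏ, from which fusion comes: the columns (k, l) and (l,
k) cancel. -/
lemma diag_add_offCoeff_neg_one (k l : Fin n) :
    diagCoeff (pointTheta hτ n 0) 1 (-1) k l + offCoeff (pointTheta hτ n 0) 1 (-1) l k = 0 := by
  rcases eq_or_ne k l with rfl | h
  · rw [diagCoeff_self, offCoeff_self, add_zero, neg_add_cancel, pointTheta_zero]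
  · rw [diagCoeff_pointTheta_neg_one hτ h, offCoeff_pointTheta_neg_one hτ h.symm, neg_add_cancel]

lemma exists_thetaSeries_eq (hτ : 0 < τ.im) : ∃ η : ℂ⟦X⟧, IsUnit η ∧ thetaSeries τ 0 = PowerSeries.X * η := by
  have h₀ : PowerSeries.constantCoeff (thetaSeries τ 0) = 0 := by
    rw [← PowerSeries.coeff_zero_eq_constantCoeff_apply, thetaSeries, PowerSeries.coeff_mk,
      iteratedDeriv_zero, theta_zero, zero_div]
  obtain ⟨η, hη⟩ := PowerSeries.X_dvd_iff.2 h₀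
  refine ⟨η, ?_, hη⟩
  have h₁ := congrArg (PowerSeries.coeff 1) hη
  rw [thetaSeries, PowerSeries.coeff_mk, iteratedDeriv_one, deriv_theta_zero hτ, ← zero_add 1,
    PowerSeries.coeff_succ_X_mul] at h₁
  rw [PowerSeries.isUnit_iff_constantCoeff, ← PowerSeries.coeff_zero_eq_constantCoeff_apply, ← h₁]
  simp

end FusionPoint

section Fusion
variable {n : ℕ} {τ : ℂ} (hτ : 0 < τ.im) {U : TopologicalSpace.Opens ℂ}
  {R : Type*} [Ring R] [Algebra ℂ⟦X⟧ R] {h : Fin n → R}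
  {L : Matrix (Fin n) (Fin n) (CompletedTensor (SpectralFun U n) R)}

/-- The terms free of `z` combine to θ(P' - Q - Q'), which is itself a multiple of `z`; after this
substitution the whole relation is divisible by `z`. -/
lemma mul_sum_eq_zero {T : Type*} [Ring T] {z θ a b P P' Q Q' γ γ' W : T}
    (hz : ∀ x, z * x = x * z) (hθ : ∀ x, θ * x = x * θ)
    (hE : z * a * P + (θ + z * b) * P' = Q * (θ + z * γ) + Q' * (θ + z * γ'))
    (hW : P' - Q - Q' = z * W) :
    z * (a * P + b * P' - Q * γ - Q' * γ' + θ * W) = 0 := by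
  have h₁ : z * (θ * W) = θ * (P' - Q - Q') := by rw [hW, ← mul_assoc, hz, mul_assoc]
  have h₂ : ∀ Q γ, z * (Q * γ) = Q * (z * γ) := fun Q γ => by
    rw [← mul_assoc, hz, mul_assoc]
  rw [mul_add, h₁, mul_sub, mul_sub, h₂ Q, h₂ Q', mul_sub, mul_sub, hθ Q, hθ Q']
  rw [← sub_eq_zero] at hE
  rw [← hE]
  noncomm_ring

lemma mul_eq_of_sum_eq_zero {T : Type*} [Ring T] {N V P P' Q Q' X W : T} (hN : ∀ x, N * x = x * N)
    (hE : N * V * P + (N - N * V) * P' - Q * N - Q' * N + X * N * W = 0)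
    (hW : P' - Q - Q' = -(X * W)) : N * V * P = N * V * P' := by
  have h₁ : X * N * W = -(N * (P' - Q - Q')) := by rw [hW, mul_neg, neg_neg, ← hN, mul_assoc]
  rw [h₁, ← hN Q, ← hN Q'] at hE
  rw [← sub_eq_zero, ← hE]
  noncomm_ring

lemma exists_series_eq_of_eval (u : U) {f : (SpectralFun U n)⟦X⟧} {η : ℂ⟦X⟧}
    {r : (LambdaField n)⟦X⟧}
    (h₀ : evalShifted n u 0 f = algebraMap ℂ⟦X⟧ _ (PowerSeries.X * η))
    (h₁ : evalShifted n u (-1) f = algebraMap ℂ⟦X⟧ _ PowerSeries.X * r) :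
    ∃ g, f = algebraMap ℂ⟦X⟧ _ (PowerSeries.X * η) + PowerSeries.C (spectralVar U n u) * g ∧
      evalShifted n u (-1) g = algebraMap ℂ⟦X⟧ _ η - r := by
  obtain ⟨g, hg⟩ := exists_series_eq u f
  rw [← evalShifted_zero, h₀, AlgHom.commutes] at hg
  refine ⟨g, hg, ?_⟩
  have hX : (algebraMap ℂ⟦X⟧ (LambdaField n)⟦X⟧) PowerSeries.X ≠ 0 := by
    rw [PowerSeries.algebraMap_apply'', PowerSeries.map_X]
    exact PowerSeries.X_ne_zero
  refine mul_left_cancel₀ hX ?_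
  rw [mul_sub, ← h₁]
  conv_rhs => rw [hg]
  rw [map_add, map_mul (evalShifted n u (-1)), evalShifted_var, AlgHom.commutes]
  simp only [map_mul, map_neg, map_one]
  ring

/-- Adding the exchange relations for the columns (k, l) and (l, k) at the arguments u - ℏ and u
gives the claim multiplied by θ(ℏ), which cannot be cancelled when `R` has ℏ-torsion. So the first
argument w is kept free and z = w - u. At z = 0 the summed relation is a tautology up to θ(ℏ), hence
all of it can be written with a factor z. Cancel z and then put z = -ℏ. What is left is the claim
times θ(ℏ)/ℏ and the ratio `rootRatio`, both of them units. -/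
lemma fused_of_exchange (hh : ∀ i j, Commute (h i) (h j)) (u : U)
    {α β : Fin n → Fin n → (SpectralFun U n)⟦X⟧}
    (hE : (dynamicalPair hh (spectralDerivatives U n)).Exchange L (constL U (evalL L u 0)) α β)
    (hα : ∀ c i j, evalShifted n u c (α i j) = diagCoeff (pointTheta hτ n 0) 1 c i j)
    (hβ : ∀ c i j, evalShifted n u c (β i j) = offCoeff (pointTheta hτ n 0) 1 c i j) :
    (dynamicalPair hh (lambdaDerivatives n)).Fused (evalL L u (-1)) (evalL L u 0) := by
  intro i j k l
  rcases eq_or_ne i j with rfl | hij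
  · rfl
  obtain ⟨η, hη, hθη⟩ := exists_thetaSeries_eq hτ
  have hγ : ∀ k l, ∃ g, α k l + β l k
      = algebraMap ℂ⟦X⟧ _ (PowerSeries.X * η) + PowerSeries.C (spectralVar U n u) * g ∧
      evalShifted n u (-1) g = algebraMap ℂ⟦X⟧ _ η := fun k l => by
    -- The column sums are θ(ℏ) at z = 0 and vanish at z = -ℏ, so their divided difference equals
    -- θ(ℏ)/ℏ at z = -ℏ.
    obtain ⟨g, hg, hg'⟩ := exists_series_eq_of_eval u (f := α k l + β l k) (η := η) (r := 0)
      (by rw [map_add, hα, hβ, diag_add_offCoeff_zero, hθη])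
      (by rw [map_add, hα, hβ, diag_add_offCoeff_neg_one, mul_zero])
    exact ⟨g, hg, by rw [hg', sub_zero]⟩
  obtain ⟨a, ha, ha'⟩ := exists_series_eq_of_eval u (f := α j i) (η := 0)
    (r := -(algebraMap ℂ⟦X⟧ _ η * rootRatio hτ j i))
    (by rw [hα, diagCoeff_pointTheta_zero hτ hij.symm, mul_zero, map_zero])
    (by rw [hα, diagCoeff_pointTheta_neg_one hτ hij.symm, hθη, map_mul, mul_neg, mul_assoc])
  obtain ⟨b, hb, hb'⟩ := exists_series_eq_of_eval u (f := β i j) (η := η)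
    (r := algebraMap ℂ⟦X⟧ _ η * rootRatio hτ j i)
    (by rw [hβ, offCoeff_pointTheta_zero hτ hij, hθη])
    (by rw [hβ, offCoeff_pointTheta_neg_one hτ hij, hθη, map_mul, mul_assoc])
  obtain ⟨γ, hγ₁, hγ₁'⟩ := hγ k l
  obtain ⟨γ', hγ₂, hγ₂'⟩ := hγ l k
  rw [mul_zero, map_zero, zero_add] at ha
  rw [map_zero, zero_sub, neg_neg] at ha'
  set Y := constL U (evalL L u 0) with hY
  set z := PowerSeries.C (spectralVar U n u) with hz
  set θ : (SpectralFun U n)⟦X⟧ := algebraMap ℂ⟦X⟧ _ (PowerSeries.X * η) with hθ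
  set sh := (spectralDerivatives U n).shT R
  set c := cartanHom hh (spectralDerivatives U n)
  have hc : ∀ {f f' g}, f + f' = θ + z * g → c f + c f' = ofFun θ + ofFun z * c g :=
    fun {f f' g} e => by
      rw [← map_add, e, map_add, map_mul, cartanHom_C_of_der hh _ (spectralDerivatives_var · _),
        cartanHom_algebraMap]
  have hev : ∀ i j, tensorMap (mapHbar (evalSpectral n u)) (Y i j)
      = tensorMap (mapHbar (evalSpectral n u)) (L i j) := fun i j => by
    have e := congrFun (congrFun (evalL_constL (evalL L u 0) u 0) i) j
    rw [← map_evalSpectral] at e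
    exact e.trans (congrFun (congrFun (map_evalSpectral L u).symm i) j)
  have hsh : ∀ μ x, tensorMap (mapHbar (evalSpectral n u)) (sh.map μ x)
      = ((lambdaDerivatives n).shT R).map μ (tensorMap (mapHbar (evalSpectral n u)) x) :=
    (evalSpectral_natural hh u).tensorMap_shT
  have hsh' : ∀ μ x, tensorMap (evalShifted n u (-1)) (sh.map μ x)
      = ((lambdaDerivatives n).shT R).map μ (tensorMap (evalShifted n u (-1)) x) :=
    (evalShifted_natural hh u (-1)).tensorMap_shT
  have hc' : ∀ f, tensorMap (evalShifted n u (-1)) (c f)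
      = cartanHom hh (lambdaDerivatives n) (evalShifted n u (-1) f) :=
    (evalShifted_natural hh u (-1)).cartan
  have hY' : ∀ i j, tensorMap (evalShifted n u (-1)) (Y i j) = evalL L u 0 i j := fun i j =>
    congrFun (congrFun (evalL_constL (evalL L u 0) u (-1)) i) j
  have hL' : ∀ i j, tensorMap (evalShifted n u (-1)) (L i j) = evalL L u (-1) i j := fun _ _ => rfl
  -- At z = 0 the matrices `L` and `Y` have the same value, so the four products cancel in pairs.
  obtain ⟨W, hW⟩ := exists_eq_var_mul_of_eval (u₀ := u)
    (x := sh.map (unitWeight j) (L i k) * Y j l + sh.map (unitWeight j) (L i l) * Y j k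
      - sh.map (unitWeight j) (Y i l) * L j k - sh.map (unitWeight j) (Y i k) * L j l) (by
    simp only [map_sub, map_add, map_mul, hsh, hev]
    abel)
  have E : ofFun z * ofFun a * (sh.map (unitWeight i) (L j k) * Y i l
        + sh.map (unitWeight i) (L j l) * Y i k)
      + (ofFun θ + ofFun z * ofFun b) * (sh.map (unitWeight j) (L i k) * Y j l
        + sh.map (unitWeight j) (L i l) * Y j k)
      = sh.map (unitWeight j) (Y i l) * L j k * (ofFun θ + ofFun z * c γ)
        + sh.map (unitWeight j) (Y i k) * L j l * (ofFun θ + ofFun z * c γ') := by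
    rw [← map_mul, ← map_mul ofFun z b, ← map_add, ← ha, ← hb, ← hc hγ₁, ← hc hγ₂]
    have E₁ : ofFun (α j i) * (sh.map (unitWeight i) (L j k) * Y i l)
        + ofFun (β i j) * (sh.map (unitWeight j) (L i k) * Y j l)
        = sh.map (unitWeight j) (Y i l) * L j k * c (α k l)
          + sh.map (unitWeight j) (Y i k) * L j l * c (β k l) := hE i j k l
    have E₂ : ofFun (α j i) * (sh.map (unitWeight i) (L j l) * Y i k)
        + ofFun (β i j) * (sh.map (unitWeight j) (L i l) * Y j k)
        = sh.map (unitWeight j) (Y i k) * L j l * c (α l k)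
          + sh.map (unitWeight j) (Y i l) * L j k * c (β l k) := hE i j l k
    rw [mul_add, mul_add, mul_add, mul_add, add_add_add_comm, E₁, E₂]
    abel
  have Z := eq_zero_of_var_mul (mul_sum_eq_zero (ofFun_mul_comm z) (ofFun_mul_comm θ) E hW)
  replace Z := congrArg (tensorMap (evalShifted n u (-1))) Z
  replace hW := congrArg (tensorMap (evalShifted n u (-1))) hW
  simp only [map_add, map_sub, map_mul, map_zero, hsh', hY', hL', hc', tensorMap_ofFun, ha', hb',
    hγ₁', hγ₂', hθ, AlgHom.commutes, cartanHom_algebraMap] at Z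
  simp only [map_add, map_sub, map_mul, hsh', hY', hL', tensorMap_ofFun, evalShifted_var,
    map_neg, map_one, neg_mul, one_mul] at hW
  have hu : IsUnit (ofFun (algebraMap ℂ⟦X⟧ _ η) * ofFun (rootRatio hτ j i) :
      CompletedTensor (LambdaField n) R) :=
    ((hη.map _).map _).mul ((isUnit_rootRatio hτ hij.symm).map _)
  exact hu.mul_left_cancel (mul_eq_of_sum_eq_zero (ofFun_mul_comm _) Z hW)

lemma IsDynamicalLOperator.fused_neg_one (hτ : 0 < τ.im) (hL : IsDynamicalLOperator τ L h) (u : U) :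
    (dynamicalPair hL.cartan_commute (lambdaDerivatives n)).Fused (evalL L u (-1)) (evalL L u 0) := by
  refine fused_of_exchange hτ hL.cartan_commute u
    (α := diagCoeff (spectralTheta hτ U n (-u) 1) 1 0)
    (β := offCoeff (spectralTheta hτ U n (-u) 1) 1 0) ?_ (fun c i j => ?_) (fun c i j => ?_)
  · refine exchange_spectral hτ hL.cartan_commute
      (g := fun _ => 1) (differentiable_const 1) ⟨0, one_ne_zero⟩ fun w _ => ?_
    have := hL.exchange hτ w u 0 0
    rw [sub_zero] at this
    rwa [evalL_constL, one_mul, neg_add_eq_sub]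
  · rw [evalShifted_diagCoeff, one_mul, neg_add_cancel, zero_add, mul_one]
  · rw [evalShifted_offCoeff, one_mul, neg_add_cancel, zero_add, mul_one]

lemma evalShifted_expShift (u : U) (a b : ℂ) (f : (SpectralFun U n)⟦X⟧) :
    evalShifted n u a (expShift (b • dSpectral U n) f) = evalShifted n u (a + b) f := by
  have e : Commute (a • dSpectral U n : Derivation ℂ _ _).toLinearMap
      (b • dSpectral U n : Derivation ℂ _ _).toLinearMap :=
    LinearMap.ext fun x => by
      change a • dSpectral U n (b • dSpectral U n x) = b • dSpectral U n (a • dSpectral U n x)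
      rw [Derivation.map_smul, Derivation.map_smul, smul_comm]
  rw [evalShifted_apply, evalShifted_apply, add_smul, expShift_add e]
  rfl

lemma evalL_expShift (u : U) (a b : ℂ) :
    evalL (L.map (tensorMap (expShift (b • dSpectral U n)))) u a = evalL L u (a + b) := by
  ext i j
  change tensorMap (evalShifted n u a) (tensorMap (expShift (b • dSpectral U n)) (L i j))
    = tensorMap (evalShifted n u (a + b)) (L i j)
  rw [← tensorMap_comp]
  congr 2
  exact AlgHom.ext (evalShifted_expShift u a b)

/-- The relation between L(w - ℏ) and L(w) holds for every w in `U`, hence between functions of w,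
and is then evaluated at w = u + (k + 1)ℏ. -/
theorem IsDynamicalLOperator.fused (hτ : 0 < τ.im) (hL : IsDynamicalLOperator τ L h) (u : U)
    (k : ℂ) : (dynamicalPair hL.cartan_commute (lambdaDerivatives n)).Fused (evalL L u k)
      (evalL L u (k + 1)) := by
  have h₁ : (dynamicalPair hL.cartan_commute (spectralDerivatives U n)).Fused
      (L.map (tensorMap (expShift ((-1 : ℂ) • dSpectral U n)))) L := by
    refine fused_of_natural (φ := fun u : U => evalSpectral n u)
      (fun u => evalSpectral_natural hL.cartan_commute u)
      (fun F hF => spectral_eq_zero_of_forall hF) fun w => ?_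
    rw [map_evalSpectral, map_evalSpectral, evalL_expShift, zero_add]
    exact hL.fused_neg_one hτ w
  have h₂ := (evalShifted_natural hL.cartan_commute u (k + 1)).fused h₁
  have h₃ := evalL_expShift (L := L) u (k + 1) (-1)
  rw [add_neg_cancel_right] at h₃
  rw [← h₃]
  exact h₂

end Fusion
end DynamicalElliptic
end

noncomputable section
namespace DynamicalElliptic
open Matrix PowerSeries TensorProduct
open Finset.HasAntidiagonal (antidiagonal mem_antidiagonal)

/-! ### Commutation of the traces for all values of the spectral parameters -/

section NaturalWords
variable {n N : ℕ} {K : Type*} [CommRing K] [Algebra ℂ K] {K' : Type*} [CommRing K'] [Algebra ℂ K']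
  {R : Type*} [Ring R] [Algebra ℂ⟦X⟧ R] {h : Fin n → R} {hh : ∀ i j, Commute (h i) (h j)}
  {D : PartialDerivatives n K} {D' : PartialDerivatives n K'} {φ : K⟦X⟧ →ₐ[ℂ⟦X⟧] K'⟦X⟧}

lemma IsNatural.wordMatrix (hφ : IsNatural hh D D' φ)
    (x : ℕ → Matrix (Fin n) (Fin n) (CompletedTensor K R)) (a b : Fin N → Fin n) :
    tensorMap φ (wordMatrix (D.shT R) N x a b)
      = DynamicalElliptic.wordMatrix (D'.shT R) N (fun k => (x k).map (tensorMap φ)) a b := by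
  induction N generalizing x with
  | zero =>
    change tensorMap φ ((1 : Matrix _ _ (CompletedTensor K R)) a b) = (1 : Matrix _ _ _) a b
    rw [Matrix.one_apply, Matrix.one_apply]
    split_ifs
    · exact map_one _
    · exact map_zero _
  | succ N ih => rw [wordMatrix_succ, wordMatrix_succ, map_mul, hφ.tensorMap_shT, ih]; rfl

lemma partialAntisymmetrizer_eq (S : Type*) [CommRing S] [Algebra ℂ S] {m : ℕ} (e : Fin m ↪ Fin N) :
    partialAntisymmetrizer S n e = (partialAntisymmetrizer ℂ n e).map (algebraMap ℂ S) := by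
  ext a b
  simp only [partialAntisymmetrizer, Matrix.map_apply, Matrix.smul_apply, Matrix.sum_apply, permOp,
    Matrix.of_apply, smul_eq_mul, map_mul, map_sum, apply_ite (algebraMap ℂ S), map_one, map_zero]
  simp only [Algebra.smul_def]

lemma blockAntisymmetrizer_eq (S : Type*) [CommRing S] [Algebra ℂ S]
    {p m q s : ℕ} (h : p + m ≤ N) (h' : q + s ≤ N) :
    blockAntisymmetrizer S n p m q s N h h'
      = (blockAntisymmetrizer ℂ n p m q s N h h').map (algebraMap ℂ S) := by
  rw [blockAntisymmetrizer, blockAntisymmetrizer, Matrix.map_mul, ← partialAntisymmetrizer_eq,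
    ← partialAntisymmetrizer_eq]

lemma algebraMap_complex_series (z : ℂ) :
    algebraMap ℂ K⟦X⟧ z = algebraMap ℂ⟦X⟧ K⟦X⟧ (PowerSeries.C z) := by
  rw [PowerSeries.algebraMap_apply'', PowerSeries.map_C, PowerSeries.algebraMap_apply]

lemma blockAntisymmetrizer_map (φ : K⟦X⟧ →ₐ[ℂ⟦X⟧] K'⟦X⟧) {p m q s : ℕ} (h : p + m ≤ N)
    (h' : q + s ≤ N) (a b : Fin N → Fin n) :
    φ (blockAntisymmetrizer K⟦X⟧ n p m q s N h h' a b)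
      = blockAntisymmetrizer K'⟦X⟧ n p m q s N h h' a b := by
  rw [blockAntisymmetrizer_eq, blockAntisymmetrizer_eq K'⟦X⟧, Matrix.map_apply, Matrix.map_apply,
    algebraMap_complex_series, algebraMap_complex_series, AlgHom.commutes]

/-- The trace over the basis vectors of weight `μ` of a word, antisymmetrized in the first `m` and in
the last `s` factors. -/
def blockTrace (D : PartialDerivatives n K) {m s : ℕ} (hN : N = m + s) (μ : Fin n → ℤ)
    (x : ℕ → Matrix (Fin n) (Fin n) (CompletedTensor K R)) : CompletedTensor K R :=
  weightTrace μ ((blockAntisymmetrizer K⟦X⟧ n 0 m m s N (by omega) (by omega)).map ofFun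
    * DynamicalElliptic.wordMatrix (D.shT R) N x)

lemma IsNatural.blockTrace (hφ : IsNatural hh D D' φ) {m s : ℕ} (hN : N = m + s) (μ : Fin n → ℤ)
    (x : ℕ → Matrix (Fin n) (Fin n) (CompletedTensor K R)) :
    tensorMap φ (blockTrace D hN μ x)
      = DynamicalElliptic.blockTrace D' hN μ fun k => (x k).map (tensorMap φ) := by
  simp only [DynamicalElliptic.blockTrace, weightTrace, map_sum, apply_ite (tensorMap φ), map_zero,
    mul_apply, map_mul, hφ.wordMatrix, Matrix.map_apply, tensorMap_ofFun, blockAntisymmetrizer_map]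

lemma concat_map {A B : Type*} (f : A → B) (m : ℕ) (x y : ℕ → A) (k : ℕ) :
    f (concat m x y k) = concat m (fun k => f (x k)) (fun k => f (y k)) k := by
  rw [concat, concat, apply_ite f]

end NaturalWords

/-! ### Invertibility of exchange operators -/

section ExchangeUnit
variable {n N : ℕ} {K : Type*} [CommRing K] [Algebra ℂ K]

lemma constantCoeff_shS (D : PartialDerivatives n K) (μ : Fin n → ℤ) (f : K⟦X⟧) :
    PowerSeries.constantCoeff (D.shS.map μ f) = PowerSeries.constantCoeff f := by
  change PowerSeries.constantCoeff (expShift (D.dir μ) f) = _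
  rw [← PowerSeries.coeff_zero_eq_constantCoeff_apply, coeff_expShift,
    ← PowerSeries.coeff_zero_eq_constantCoeff_apply]
  simp [divPow_zero]

/-- Modulo ℏ the operator is `c` times a permutation, since translations are trivial modulo ℏ. A
power series determinant is a unit as soon as its constant coefficient is. -/
lemma isUnit_exchangeOp (D : PartialDerivatives n K) (i : ℕ) {α β : Fin n → Fin n → K⟦X⟧} {c : K}
    (hc : IsUnit c) (hα : ∀ i j, PowerSeries.constantCoeff (α i j) = c)
    (hβ : ∀ i j, PowerSeries.constantCoeff (β i j) = 0) :
    IsUnit (exchangeOp D.shS N i α β) := by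
  by_cases hi : i + 1 < N
  · rw [Matrix.isUnit_iff_isUnit_det, PowerSeries.isUnit_iff_constantCoeff, RingHom.map_det,
      ← Matrix.isUnit_iff_isUnit_det]
    have e : (PowerSeries.constantCoeff (R := K)).mapMatrix (exchangeOp D.shS N i α β)
        = algebraMap K _ c * flipOp K n N i := by
      ext a b
      rw [← Algebra.smul_def, Matrix.smul_apply, smul_eq_mul, flipOp, exchangeOp, if_pos hi,
        RingHom.mapMatrix_apply, Matrix.map_apply, Matrix.of_apply, Matrix.of_apply, map_add,
        apply_ite PowerSeries.constantCoeff, apply_ite PowerSeries.constantCoeff,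
        localCoeff_of_lt _ hi, localCoeff_of_lt _ hi, constantCoeff_shS, constantCoeff_shS, hα, hβ,
        map_zero]
      simp
    rw [e]
    exact (hc.map _).mul (IsUnit.of_mul_eq_one _ (flipOp_mul_self i))
  · rw [exchangeOp, if_neg hi]
    exact isUnit_one

end ExchangeUnit

/-! ### Comparison of traces at generic values and descent to all values -/

section Generic
variable {n : ℕ}

/-- Pointwise derivatives of families of functions. -/
def PartialDerivatives.pi {K : Type*} [CommRing K] [Algebra ℂ K] (D : PartialDerivatives n K)
    (σ : Type*) : PartialDerivatives n (σ → K) where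
  d k := Derivation.mk' (LinearMap.pi fun w => (D.d k).toLinearMap ∘ₗ LinearMap.proj w)
    fun a b => funext fun w => (D.d k).leibniz (a w) (b w)
  comm k l x := funext fun w => D.comm k l (x w)

variable {τ : ℂ} (hτ : 0 < τ.im) {U : TopologicalSpace.Opens ℂ}

/-- The points at which `θ(u - v)` does not vanish. -/
abbrev GenericPoints (τ : ℂ) (v : U) : Type := {w : U // theta τ (w - v) ≠ 0}

/-- The values of a function of `(u, λ)` at all generic points `u`. -/
def genericValues (n : ℕ) (τ : ℂ) (v : U) :
    SpectralFun U n →ₐ[ℂ] (GenericPoints τ v → LambdaField n) :=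
  AlgHom.pi fun w => evalSpectral n w.1

/-- The value of a family at a generic point. -/
def evalGeneric {v : U} (n : ℕ) (w : GenericPoints τ v) :
    (GenericPoints τ v → LambdaField n) →ₐ[ℂ] LambdaField n := Pi.evalAlgHom ℂ _ w

variable (v : U) {R : Type*} [Ring R] [Algebra ℂ⟦X⟧ R] {h : Fin n → R}
  (hh : ∀ i j, Commute (h i) (h j))

lemma genericValues_natural : IsNatural hh (spectralDerivatives U n)
    ((lambdaDerivatives n).pi (GenericPoints τ v)) (mapHbar (genericValues n τ v)) :=
  isNatural_mapHbar _ fun k F => funext fun w => evalSpectral_derivative w.1 k F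

lemma evalGeneric_natural (w : GenericPoints τ v) :
    IsNatural hh ((lambdaDerivatives n).pi (GenericPoints τ v)) (lambdaDerivatives n)
      (mapHbar (evalGeneric n w)) :=
  isNatural_mapHbar _ fun _ _ => rfl

lemma map_genericValues (M : Matrix (Fin n) (Fin n) (CompletedTensor (SpectralFun U n) R))
    (w : GenericPoints τ v) : (M.map (tensorMap (mapHbar (genericValues n τ v)))).map
      (tensorMap (mapHbar (evalGeneric n w))) = evalL M w.1 0 := by
  rw [← map_evalSpectral]
  ext i j
  change tensorMap _ (tensorMap _ _) = tensorMap _ _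
  rw [← tensorMap_comp]
  congr 2

lemma genericValues_injective (hτ : 0 < τ.im) : LinearMap.ker (genericValues n τ v).toLinearMap = ⊥ :=
  LinearMap.ker_eq_bot'.2 fun _ hF =>
    spectral_eq_zero ((differentiable_theta hτ).comp (differentiable_id.sub_const (v : ℂ)))
      (exists_theta_sub_ne_zero hτ v) fun u hu => congrFun hF ⟨u, hu⟩

/-- The theta functions of `u - v` at the generic points `u`. -/
def genericTheta (n : ℕ) (v : U) (p : ℂ × (Fin n → ℂ) × ℂ) :
    (GenericPoints τ v → LambdaField n)⟦X⟧ :=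
  mapHbar (genericValues n τ v) (spectralTheta hτ U n (-v) 1 p)

lemma thetaSystem_genericTheta :
    ThetaSystem ((lambdaDerivatives n).pi (GenericPoints τ v)).shS (genericTheta hτ n v) :=
  (thetaSystem_spectralTheta (n := n) hτ (U := U) (-v) 1).map
    (mapHbar (genericValues n τ v) :
      (SpectralFun U n)⟦X⟧ →+* (GenericPoints τ v → LambdaField n)⟦X⟧)
    (genericValues_natural (R := ℂ⟦X⟧) (h := 0) v fun _ _ => Commute.zero_left _).shift

lemma mapHbar_genericTheta (w : GenericPoints τ v) (p : ℂ × (Fin n → ℂ) × ℂ) :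
    mapHbar (evalGeneric n w) (genericTheta hτ n v p) = pointTheta hτ n (w.1 - v) p := by
  rw [genericTheta, ← mapHbar_comp, ← neg_add_eq_sub, ← one_mul (w.1 : ℂ), ← mapHbar_spectralTheta]
  rfl

lemma mapHbar_diagCoeff_genericTheta (w : GenericPoints τ v) (κ : ℂ) (i j : Fin n) :
    mapHbar (evalGeneric n w) (diagCoeff (genericTheta hτ n v) 1 κ i j)
      = diagCoeff (pointTheta hτ n (w.1 - v)) 1 κ i j := by
  have := map_diagCoeff (δ := 0) (φ := (mapHbar (evalGeneric n w) :
      (GenericPoints τ v → LambdaField n)⟦X⟧ →+* (LambdaField n)⟦X⟧))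
    (f := genericTheta hτ n v) (g := pointTheta hτ n (w.1 - v))
    (fun a l κ => by rw [mul_zero, add_zero]; exact mapHbar_genericTheta hτ v w (a, l, κ))
    (thetaSystem_genericTheta hτ v).isUnit κ i j
  rwa [add_zero] at this

lemma mapHbar_offCoeff_genericTheta (w : GenericPoints τ v) (κ : ℂ) (i j : Fin n) :
    mapHbar (evalGeneric n w) (offCoeff (genericTheta hτ n v) 1 κ i j)
      = offCoeff (pointTheta hτ n (w.1 - v)) 1 κ i j := by
  have := map_offCoeff (δ := 0) (φ := (mapHbar (evalGeneric n w) :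
      (GenericPoints τ v → LambdaField n)⟦X⟧ →+* (LambdaField n)⟦X⟧))
    (f := genericTheta hτ n v) (g := pointTheta hτ n (w.1 - v))
    (fun a l κ => by rw [mul_zero, add_zero]; exact mapHbar_genericTheta hτ v w (a, l, κ))
    (thetaSystem_genericTheta hτ v).isUnit κ i j
  rwa [add_zero] at this

lemma constantCoeff_pointTheta (z κ : ℂ) (p : ℂ × (Fin n → ℂ)) :
    PowerSeries.constantCoeff (pointTheta hτ n z (p.1, p.2, κ))
      = lambdaTaylor (p.1 * z) p.2 (thetaEntire hτ) := by
  rw [pointTheta, formalTheta, ← PowerSeries.coeff_zero_eq_constantCoeff_apply, coeff_expSeries]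
  simp

lemma constantCoeff_diagCoeff (z κ : ℂ) (i j : Fin n) :
    PowerSeries.constantCoeff (diagCoeff (pointTheta hτ n z) 1 κ i j)
      = algebraMap ℂ (LambdaField n) (theta τ z) := by
  have e : algebraMap ℂ (LambdaField n) (theta τ z) = lambdaTaylor (1 * z) 0 (thetaEntire hτ) := by
    rw [lambdaTaylor_zero, one_mul]; rfl
  rw [e]
  rcases eq_or_ne i j with rfl | hij
  · rw [diagCoeff_self]
    exact constantCoeff_pointTheta hτ z _ (1, 0)
  · have h₁ := congrArg PowerSeries.constantCoeff
      ((thetaSystem_pointTheta hτ z).rootInv_mul hij 0)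
    rw [map_mul, map_one, constantCoeff_pointTheta hτ z 0 (0, _)] at h₁
    rw [diagCoeff_of_ne _ _ hij, map_mul, map_mul, constantCoeff_pointTheta hτ z κ (1, 0),
      constantCoeff_pointTheta hτ z 1 (0, _), mul_assoc, mul_comm (lambdaTaylor (0 * z) _ _), h₁,
      mul_one]

lemma constantCoeff_offCoeff (z κ : ℂ) (i j : Fin n) :
    PowerSeries.constantCoeff (offCoeff (pointTheta hτ n z) 1 κ i j) = 0 := by
  rcases eq_or_ne i j with rfl | hij
  · rw [offCoeff_self, map_zero]
  · rw [offCoeff_of_ne _ _ hij, map_mul, map_mul, constantCoeff_pointTheta hτ z 1 (0, 0),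
      zero_mul, lambdaTaylor_zero]
    change _ * algebraMap ℂ _ (theta τ 0) * _ = 0
    rw [theta_zero, map_zero, mul_zero, zero_mul]

lemma constantCoeff_mapHbar {K K' : Type*} [CommRing K] [Algebra ℂ K] [CommRing K'] [Algebra ℂ K']
    (φ : K →ₐ[ℂ] K') (f : K⟦X⟧) :
    PowerSeries.constantCoeff (mapHbar φ f) = φ (PowerSeries.constantCoeff f) := by
  simpa only [PowerSeries.coeff_zero_eq_constantCoeff_apply] using coeff_mapHbar φ f 0

lemma isUnit_exchangeOp_genericTheta (N i : ℕ) (κ : ℂ) :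
    IsUnit (exchangeOp ((lambdaDerivatives n).pi (GenericPoints τ v)).shS N i
      (diagCoeff (genericTheta hτ n v) 1 κ) (offCoeff (genericTheta hτ n v) 1 κ)) := by
  refine isUnit_exchangeOp _ i
    (c := fun w => algebraMap ℂ (LambdaField n) (theta τ (w.1 - v))) ?_ (fun i j => ?_)
    fun i j => ?_
  · exact Pi.isUnit_iff.2 fun w => (Ne.isUnit w.2).map (algebraMap ℂ (LambdaField n))
  · funext w
    rw [← constantCoeff_diagCoeff hτ _ κ i j, ← mapHbar_diagCoeff_genericTheta]
    exact (constantCoeff_mapHbar (evalGeneric n w) _).symm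
  · funext w
    change _ = (0 : LambdaField n)
    rw [← constantCoeff_offCoeff hτ (w.1 - v) κ i j, ← mapHbar_offCoeff_genericTheta]
    exact (constantCoeff_mapHbar (evalGeneric n w) _).symm

variable {v} {L : Matrix (Fin n) (Fin n) (CompletedTensor (SpectralFun U n) R)}

/-- The matrix `L(u + rℏ; λ)` of functions of `(u, λ)`. -/
def shiftL (L : Matrix (Fin n) (Fin n) (CompletedTensor (SpectralFun U n) R)) (r : ℂ) :
    Matrix (Fin n) (Fin n) (CompletedTensor (SpectralFun U n) R) :=
  L.map (tensorMap (expShift (r • dSpectral U n)))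

lemma evalL_shiftL (u : U) (r : ℂ) : evalL (shiftL L r) u 0 = evalL L u r := by
  rw [shiftL, evalL_expShift, zero_add]

/-- The values of a matrix at all generic points. -/
def genericL (τ : ℂ) (v : U) (M : Matrix (Fin n) (Fin n) (CompletedTensor (SpectralFun U n) R)) :
    Matrix (Fin n) (Fin n) (CompletedTensor (GenericPoints τ v → LambdaField n) R) :=
  M.map (tensorMap (mapHbar (genericValues n τ v)))

lemma generic_exchange (hL : IsDynamicalLOperator τ L h) (r p : ℂ) :
    (dynamicalPair hL.cartan_commute ((lambdaDerivatives n).pi (GenericPoints τ v))).Exchange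
      (genericL τ v (shiftL L r)) (genericL τ v (constL U (evalL L v p)))
      (diagCoeff (genericTheta hτ n v) 1 (r - p)) (offCoeff (genericTheta hτ n v) 1 (r - p)) := by
  refine exchange_of_natural (φ := evalGeneric n)
    (fun w => evalGeneric_natural v hL.cartan_commute w) (fun _ hF => funext hF) fun w => ?_
  simp only [mapHbar_diagCoeff_genericTheta, mapHbar_offCoeff_genericTheta]
  rw [genericL, genericL, map_genericValues, map_genericValues, evalL_shiftL, evalL_constL]
  exact hL.exchange hτ w.1 v r p

lemma generic_fused (hL : IsDynamicalLOperator τ L h)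
    {X Y : Matrix (Fin n) (Fin n) (CompletedTensor (SpectralFun U n) R)}
    (hXY : ∀ u : U, (dynamicalPair hL.cartan_commute (lambdaDerivatives n)).Fused (evalL X u 0)
      (evalL Y u 0)) :
    (dynamicalPair hL.cartan_commute ((lambdaDerivatives n).pi (GenericPoints τ v))).Fused
      (genericL τ v X) (genericL τ v Y) := by
  refine fused_of_natural (φ := evalGeneric n)
    (fun w => evalGeneric_natural v hL.cartan_commute w) (fun _ hF => funext hF) fun w => ?_
  rw [genericL, genericL, map_genericValues, map_genericValues]
  exact hXY w.1

/-- The traces of antisymmetrized words commute modulo the Cartan elements, in the functions of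
`(u, λ)`. -/
theorem spectral_blockTrace_sub (hτ : 0 < τ.im) (hL : IsDynamicalLOperator τ L h) (v : U)
    {N m s : ℕ} (hN : N = m + s) (hN' : N = s + m) (μ : Fin n → ℤ) :
    ∃ A : Fin n → CompletedTensor (SpectralFun U n) R,
      blockTrace (spectralDerivatives U n) hN μ
          (concat m (fun r => shiftL L (r : ℂ)) fun p => constL U (evalL L v (p : ℂ)))
        - blockTrace (spectralDerivatives U n) hN' μ
          (concat s (fun p => constL U (evalL L v (p : ℂ))) fun r => shiftL L (r : ℂ))
      = ∑ k, A k * ofAlg (h k) := by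
  set hh := hL.cartan_commute
  let D := (lambdaDerivatives n).pi (GenericPoints τ v)
  let J : Ideal (CompletedTensor (GenericPoints τ v → LambdaField n) R) :=
    Ideal.span (Set.range fun k => ofAlg (h k))
  have hf := thetaSystem_genericTheta (n := n) hτ v
  have hw : ∀ k l : ℂ, k - l = k + 1 - (l + 1) := fun k l => by ring
  -- The comparison is made in the ring of all functions on the generic points: there θ(u - v) is a
  -- unit, so the exchange operators are invertible.
  have key := weightTrace_concat_sub_mem (P := dynamicalPair hh D) hN (J := J)
    (U := fun r => genericL τ v (shiftL L (r : ℂ)))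
    (V := fun p => genericL τ v (constL U (evalL L v (p : ℂ))))
    (α := fun r p => diagCoeff (genericTheta hτ n v) 1 ((r : ℂ) - p))
    (β := fun r p => offCoeff (genericTheta hτ n v) 1 ((r : ℂ) - p))
    (fun f => by
      obtain ⟨A, hA⟩ := cartanHom_sub_ofFun hh D f
      change cartanHom hh D f - ofFun f ∈ J
      rw [hA]
      exact sum_mem fun k _ => J.mul_mem_left _ (Ideal.subset_span ⟨k, rfl⟩))
    (fun r p => generic_exchange hτ hL r p)
    (fun i r p => isUnit_exchangeOp_genericTheta hτ v N i _)
    (fun r p => by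
      have := hf.leftFusion 1 ((r : ℂ) - p)
      rwa [show (r : ℂ) - p + 1 = ((r + 1 : ℕ) : ℂ) - p by push_cast; ring] at this)
    (fun r p => by
      have := hf.rightFusion 1 ((r : ℂ) - (p + 1 : ℕ))
      rwa [show (r : ℂ) - (p + 1 : ℕ) + 1 = (r : ℂ) - p by push_cast; ring] at this)
    (fun r => ((hL.cartanWeighted.map _).map _).isWeighted)
    (fun p => (((hL.cartanWeighted.map _).map _).map _).isWeighted)
    (fun r => generic_fused hL fun u => by
      rw [evalL_shiftL, evalL_shiftL, Nat.cast_succ]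
      exact hL.fused hτ u r)
    (fun p => generic_fused hL fun u => by
      rw [evalL_constL, evalL_constL, Nat.cast_succ]
      exact hL.fused hτ v p) μ
  set x := blockTrace (spectralDerivatives U n) hN μ
    (concat m (fun r => shiftL L (r : ℂ)) fun p => constL U (evalL L v (p : ℂ))) with hx
  set y := blockTrace (spectralDerivatives U n) hN' μ
    (concat s (fun p => constL U (evalL L v (p : ℂ))) fun r => shiftL L (r : ℂ)) with hy
  have hxy : tensorMap (mapHbar (genericValues n τ v)) (x - y) ∈ J := by
    rw [map_sub, hx, hy, (genericValues_natural v hh).blockTrace,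
      (genericValues_natural v hh).blockTrace]
    simp only [concat_map fun M : Matrix (Fin n) (Fin n) (CompletedTensor (SpectralFun U n) R) =>
      M.map (tensorMap (mapHbar (genericValues n τ v)))]
    exact key
  obtain ⟨A, hA⟩ := (Submodule.mem_span_range_iff_exists_fun _).1 hxy
  -- The coefficients `A` are arbitrary functions of the generic point, with no holomorphy in u. A
  -- linear left inverse of the inclusion makes them holomorphic while leaving the right factors hₖ
  -- untouched.
  obtain ⟨g, hg⟩ := LinearMap.exists_leftInverse_of_injective _
    (genericValues_injective (n := n) v hτ)
  refine ⟨fun k => linMap g (A k), ?_⟩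
  have h₁ := congrArg (fun f => linMap f (x - y)) hg
  rw [linMap_comp, linMap_algHom, ← hA, map_sum, linMap_id] at h₁
  rw [← h₁]
  exact Finset.sum_congr rfl fun k _ => linMap_mul_ofAlg g _ _

/-- The traces of antisymmetrized words commute modulo the Cartan elements. -/
theorem blockTrace_sub (hτ : 0 < τ.im) (hL : IsDynamicalLOperator τ L h) (u v : U)
    {N m s : ℕ} (hN : N = m + s) (hN' : N = s + m) (μ : Fin n → ℤ) :
    ∃ A : Fin n → CompletedTensor (LambdaField n) R,
      blockTrace (lambdaDerivatives n) hN μ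
          (concat m (fun r => evalL L u (r : ℂ)) fun p => evalL L v (p : ℂ))
        - blockTrace (lambdaDerivatives n) hN' μ
          (concat s (fun p => evalL L v (p : ℂ)) fun r => evalL L u (r : ℂ))
      = ∑ k, A k * ofAlg (h k) := by
  -- The identity now holds between functions on all of `U`, so it can be evaluated at `u` even when
  -- θ(u - v) = 0.
  obtain ⟨A, hA⟩ := spectral_blockTrace_sub hτ hL v hN hN' μ
  have h₁ := congrArg (tensorMap (mapHbar (evalSpectral n u))) hA
  rw [map_sub, map_sum, (evalSpectral_natural hL.cartan_commute u).blockTrace,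
    (evalSpectral_natural hL.cartan_commute u).blockTrace] at h₁
  simp only [concat_map fun M : Matrix (Fin n) (Fin n) (CompletedTensor (SpectralFun U n) R) =>
    M.map (tensorMap (mapHbar (evalSpectral n u))), map_evalSpectral, evalL_shiftL, evalL_constL,
    map_mul, tensorMap_ofAlg] at h₁
  exact ⟨_, h₁⟩

end Generic

end DynamicalElliptic
end

noncomputable section
namespace DynamicalElliptic
open Matrix PowerSeries TensorProduct

/-! ### Matrices acting in the tensor factors -/

section Legs
variable {n : ℕ}

lemma sum_words_succ {B : Type*} [AddCommMonoid B] {N : ℕ} (f : (Fin (N + 1) → Fin n) → B) :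
    ∑ c, f c = ∑ i, ∑ c, f (Fin.cons i c) := by
  rw [← Fintype.sum_prod_type', ← (Fin.consEquiv fun _ : Fin (N + 1) => Fin n).sum_comp]
  rfl

lemma sum_words_add {B : Type*} [AddCommMonoid B] {m s : ℕ} (f : (Fin (m + s) → Fin n) → B) :
    ∑ c, f c = ∑ c, ∑ c', f (Fin.append c c') := by
  rw [← Fintype.sum_prod_type', ← (Fin.appendEquiv m s).sum_comp]
  rfl

variable {B : Type*} [Semiring B]

/-- The action of a matrix in the tensor factors after the first one. -/
def legTail (n N : ℕ) (B : Type*) [Semiring B] :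
    Matrix (Fin N → Fin n) (Fin N → Fin n) B →*
      Matrix (Fin (N + 1) → Fin n) (Fin (N + 1) → Fin n) B where
  toFun X := of fun a b => if a 0 = b 0 then X (Fin.tail a) (Fin.tail b) else 0
  map_one' := by
    ext a b
    rw [of_apply, one_apply, one_apply, ← ite_and]
    refine if_congr ?_ rfl rfl
    rw [← Fin.cons_inj (α := fun _ => Fin n), Fin.cons_self_tail, Fin.cons_self_tail]
  map_mul' X Y := by
    ext a b
    rw [mul_apply, sum_words_succ, Finset.sum_eq_single (a 0)]
    · simp only [of_apply, Fin.cons_zero, Fin.tail_cons, if_true, mul_apply]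
      split_ifs <;> simp
    · intro i _ hi
      simp [hi.symm]
    · simp

lemma legTail_apply {N : ℕ} (X : Matrix (Fin N → Fin n) (Fin N → Fin n) B)
    (a b : Fin (N + 1) → Fin n) :
    legTail n N B X a b = if a 0 = b 0 then X (Fin.tail a) (Fin.tail b) else 0 := rfl

lemma leg_succ {N : ℕ} (i : Fin N) (M : Matrix (Fin n) (Fin n) B) :
    leg i.succ M = legTail n N B (leg i M) := by
  ext a b
  rw [legTail_apply, leg, leg, ← ite_and]
  refine if_congr ?_ rfl rfl
  rw [Fin.forall_fin_succ]
  simp [Fin.tail, Fin.succ_ne_zero, eq_comm]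

/-- The matrices act in different tensor factors, so a single chain of intermediate indices
contributes. The order of the factors is kept because the entries do not commute. -/
lemma prod_leg_apply {N : ℕ} (M : Fin N → Matrix (Fin n) (Fin n) B) (a b : Fin N → Fin n) :
    (List.ofFn fun i => leg i (M i)).prod a b = (List.ofFn fun i => M i (a i) (b i)).prod := by
  induction N with
  | zero => simp [Subsingleton.elim a b]
  | succ N ih =>
    have e : (List.ofFn fun i : Fin N => leg i.succ (M i.succ))
        = (List.ofFn fun i => leg i (M i.succ)).map (legTail n N B) := by
      rw [List.map_ofFn]
      exact congrArg List.ofFn (funext fun i => leg_succ i _)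
    rw [List.ofFn_succ, List.prod_cons, e, ← map_list_prod, mul_apply, sum_words_succ,
      Finset.sum_eq_single (b 0), Finset.sum_eq_single (Fin.tail a), legTail_apply,
      List.ofFn_succ, List.prod_cons]
    · rw [Fin.cons_zero, if_pos rfl, Fin.tail_cons, ih, leg, if_pos]
      · rfl
      · intro j hj
        obtain ⟨k, rfl⟩ := Fin.exists_succ_eq.2 hj
        rfl
    · intro c _ hc
      rw [leg, if_neg, zero_mul]
      intro h
      exact hc (funext fun j => (h j.succ (Fin.succ_ne_zero j)).symm)
    · simp
    · intro i _ hi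
      exact Finset.sum_eq_zero fun c _ => by
        rw [legTail_apply, Fin.cons_zero, if_neg hi, mul_zero]
    · simp

end Legs

/-! ### Antisymmetrizers in two groups of tensor factors -/

section Append
variable {n m s : ℕ}

lemma append_inj_iff {a c : Fin m → Fin n} {a' c' : Fin s → Fin n} :
    Fin.append a a' = Fin.append c c' ↔ a = c ∧ a' = c' := by
  rw [← Prod.mk_inj]
  exact (Fin.appendEquiv m s).injective.eq_iff (a := (a, a')) (b := (c, c'))

lemma append_comp_viaEmbedding_left (e : Fin m ↪ Fin (m + s)) (he : ∀ i, e i = Fin.castAdd s i)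
    (σ : Equiv.Perm (Fin m)) (c : Fin m → Fin n) (c' : Fin s → Fin n) :
    Fin.append c c' ∘ ⇑(σ.viaEmbedding e)⁻¹ = Fin.append (c ∘ ⇑σ⁻¹) c' := by
  have hi : (σ.viaEmbedding e)⁻¹ = σ⁻¹.viaEmbedding e :=
    (map_inv (Equiv.Perm.viaEmbeddingHom e) σ).symm
  rw [hi]
  funext j
  refine Fin.addCases (fun i => ?_) (fun i => ?_) j
  · rw [Function.comp, ← he, Equiv.Perm.viaEmbedding_apply, he, he, Fin.append_left,
      Fin.append_left]
    rfl
  · rw [Function.comp, Equiv.Perm.viaEmbedding_apply_of_notMem, Fin.append_right,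
      Fin.append_right]
    rintro ⟨k, hk⟩
    rw [he] at hk
    have := congrArg Fin.val hk
    simp only [Fin.val_castAdd, Fin.val_natAdd] at this
    omega

lemma append_comp_viaEmbedding_right (e : Fin s ↪ Fin (m + s)) (he : ∀ i, e i = Fin.natAdd m i)
    (σ : Equiv.Perm (Fin s)) (c : Fin m → Fin n) (c' : Fin s → Fin n) :
    Fin.append c c' ∘ ⇑(σ.viaEmbedding e)⁻¹ = Fin.append c (c' ∘ ⇑σ⁻¹) := by
  have hi : (σ.viaEmbedding e)⁻¹ = σ⁻¹.viaEmbedding e :=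
    (map_inv (Equiv.Perm.viaEmbeddingHom e) σ).symm
  rw [hi]
  funext j
  refine Fin.addCases (fun i => ?_) (fun i => ?_) j
  · rw [Function.comp, Equiv.Perm.viaEmbedding_apply_of_notMem, Fin.append_left,
      Fin.append_left]
    rintro ⟨k, hk⟩
    rw [he] at hk
    have := congrArg Fin.val hk
    simp only [Fin.val_castAdd, Fin.val_natAdd] at this
    omega
  · rw [Function.comp, ← he, Equiv.Perm.viaEmbedding_apply, he, he, Fin.append_right,
      Fin.append_right]
    rfl

lemma antisymmetrizer_apply (a b : Fin m → Fin n) :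
    antisymmetrizer n m a b = (m.factorial : ℂ)⁻¹ * ∑ σ : Equiv.Perm (Fin m),
      ((Equiv.Perm.sign σ : ℤ) : ℂ) * if a = b ∘ ⇑σ⁻¹ then 1 else 0 := by
  simp [antisymmetrizer, permMatrix, Matrix.sum_apply]

lemma partialAntisymmetrizer_apply {N : ℕ} (e : Fin m ↪ Fin N) (a b : Fin N → Fin n) :
    partialAntisymmetrizer ℂ n e a b = (m.factorial : ℂ)⁻¹ * ∑ σ : Equiv.Perm (Fin m),
      ((Equiv.Perm.sign σ : ℤ) : ℂ) * if a = b ∘ ⇑(σ.viaEmbedding e)⁻¹ then 1 else 0 := by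
  simp [partialAntisymmetrizer, permOp, Matrix.sum_apply]

lemma isZeroWeight_antisymmetrizer : IsZeroWeight (antisymmetrizer n m) := fun a b hab => by
  rw [antisymmetrizer_apply]
  refine mul_eq_zero_of_right _ (Finset.sum_eq_zero fun σ _ => ?_)
  rw [if_neg, mul_zero]
  rintro rfl
  exact hab (weight_comp b σ⁻¹)

lemma blockAntisymmetrizer_append (h : 0 + m ≤ m + s) (h' : m + s ≤ m + s)
    (a b : Fin m → Fin n) (a' b' : Fin s → Fin n) :
    blockAntisymmetrizer ℂ n 0 m m s (m + s) h h' (Fin.append a a') (Fin.append b b')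
      = antisymmetrizer n m a b * antisymmetrizer n s a' b' := by
  have hl : ∀ c c', partialAntisymmetrizer ℂ n (blockEmb 0 m (m + s) h) (Fin.append a a')
      (Fin.append c c') = if a' = c' then antisymmetrizer n m a c else 0 := fun c c' => by
    rw [partialAntisymmetrizer_apply]
    simp only [append_comp_viaEmbedding_left (n := n) (blockEmb 0 m (m + s) h)
      (fun i => Fin.ext (Nat.zero_add _)), append_inj_iff]
    split_ifs with hc
    · simp [antisymmetrizer_apply, hc]
    · simp [hc]
  have hr : ∀ c c', partialAntisymmetrizer ℂ n (blockEmb m s (m + s) h') (Fin.append c c')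
      (Fin.append b b') = if c = b then antisymmetrizer n s c' b' else 0 := fun c c' => by
    rw [partialAntisymmetrizer_apply]
    simp only [append_comp_viaEmbedding_right (n := n) (blockEmb m s (m + s) h')
      (fun i => rfl), append_inj_iff]
    split_ifs with hc
    · simp [antisymmetrizer_apply, hc]
    · simp [hc]
  rw [blockAntisymmetrizer, mul_apply, sum_words_add]
  simp only [hl, hr]
  simp

end Append

end DynamicalElliptic
end

noncomputable section
namespace DynamicalElliptic
open Matrix PowerSeries TensorProduct

/-! ### The algebra of shift operators -/

section ShiftOperators
variable {n : ℕ} {R : Type*} [Ring R] [Algebra ℂ⟦X⟧ R]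

/-- The ring homomorphism from functions of `λ` to `𝔄ₙ`. -/
def ofFunctionHom (n : ℕ) (R : Type*) [Ring R] [Algebra ℂ⟦X⟧ R] :
    CompletedTensor (LambdaField n) R →+* ShiftAlgebra n R :=
  SkewMonoidAlgebra.singleOneRingHom

lemma ofFunction_eq (F : CompletedTensor (LambdaField n) R) :
    ofFunction F = ofFunctionHom n R F := rfl

lemma ofFunction_mul (F G : CompletedTensor (LambdaField n) R) :
    ofFunction (F * G) = ofFunction F * ofFunction G := map_mul (ofFunctionHom n R) F G

lemma shiftOp_zero : shiftOp (R := R) (0 : Fin n → ℤ) = 1 := rfl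

lemma shiftOp_add (μ ν : Fin n → ℤ) :
    shiftOp (R := R) (μ + ν) = shiftOp μ * shiftOp ν := by
  rw [shiftOp, shiftOp, shiftOp, SkewMonoidAlgebra.single_mul_single, smul_one, one_mul, ofAdd_add]

lemma shiftOp_mul_ofFunction (μ : Fin n → ℤ) (F : CompletedTensor (LambdaField n) R) :
    shiftOp μ * ofFunction F = ofFunction (translate μ F) * shiftOp μ := by
  rw [shiftOp, ofFunction, ofFunction, SkewMonoidAlgebra.single_mul_single,
    SkewMonoidAlgebra.single_mul_single, smul_one, one_mul, mul_one, mul_one, one_mul]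
  rfl

lemma ofFunction_mul_shiftOp (μ : Fin n → ℤ) (F : CompletedTensor (LambdaField n) R) :
    ofFunction F * shiftOp (-μ) = shiftOp (-μ) * ofFunction (translate μ F) := by
  rw [shiftOp_mul_ofFunction, ← RingHom.comp_apply, ← translate_add, neg_add_cancel,
    translate_zero]
  rfl

lemma translate_ofFun_algebraMap (μ : Fin n → ℤ) (z : ℂ) :
    translate (R := R) μ (ofFun (algebraMap ℂ _ z)) = ofFun (algebraMap ℂ _ z) := by
  rw [translate, tensorMap_ofFun, algebraMap_complex_series, AlgHom.commutes]

lemma translate_ofAlg (μ : Fin n → ℤ) (x : R) :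
    translate μ (ofAlg x) = ofAlg x := tensorMap_ofAlg _ _

lemma ofR_mul_shiftOp (x : R) (μ : Fin n → ℤ) :
    ofR x * shiftOp μ = shiftOp μ * ofR x := by
  rw [ofR, shiftOp_mul_ofFunction, translate_ofAlg]

lemma ofComplex_comm (z : ℂ) (x : ShiftAlgebra n R) : ofComplex z * x = x * ofComplex z := by
  induction x using SkewMonoidAlgebra.induction_on' with
  | single g F =>
    have e : (SkewMonoidAlgebra.single g F : ShiftAlgebra n R)
        = ofFunction F * shiftOp g.toAdd := by
      rw [ofFunction, shiftOp, SkewMonoidAlgebra.single_mul_single, one_smul, mul_one, one_mul]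
      rfl
    rw [e, mul_assoc _ _ (ofComplex z), ofComplex, shiftOp_mul_ofFunction,
      translate_ofFun_algebraMap, ← mul_assoc, ← mul_assoc, ← ofFunction_mul, ← ofFunction_mul,
      ofFun_mul_comm]
  | add a b ha hb => rw [mul_add, add_mul, ha, hb]

lemma ofComplex_mul (z w : ℂ) : ofComplex (n := n) (R := R) (z * w) = ofComplex z * ofComplex w := by
  rw [ofComplex, map_mul, map_mul, ofFunction_mul]
  rfl

lemma ofComplex_zero : ofComplex (n := n) (R := R) 0 = 0 := by
  rw [ofComplex, map_zero, map_zero, ofFunction_eq, map_zero]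

/-- The entries of `e^{-ℏD̂⁽¹⁾} x₀⁽¹⁾(λ) e^{-ℏD̂⁽²⁾} x₁⁽²⁾(λ) ⋯`. -/
def wordEntry (N : ℕ) (x : ℕ → Matrix (Fin n) (Fin n) (CompletedTensor (LambdaField n) R))
    (a b : Fin N → Fin n) : ShiftAlgebra n R :=
  (List.ofFn fun i : Fin N => shiftOp (-unitWeight (a i)) * ofFunction (x i (a i) (b i))).prod

/-- Moving the shift operator of a later factor to the left past an earlier letter translates that
letter by the corresponding unit weight. Each letter is thus translated by the total weight of the
later row indices, as in `wordMatrix`. -/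
lemma wordEntry_eq {N : ℕ} (x : ℕ → Matrix (Fin n) (Fin n) (CompletedTensor (LambdaField n) R))
    (a b : Fin N → Fin n) :
    wordEntry N x a b = shiftOp (-weight a)
      * ofFunction (wordMatrix ((lambdaDerivatives n).shT R) N x a b) := by
  induction N generalizing x with
  | zero =>
    have e : weight a = 0 := Finset.sum_eq_zero fun i _ => i.elim0
    rw [e, neg_zero, shiftOp_zero, one_mul]
    rfl
  | succ N ih =>
    have := ih (fun k => x (k + 1)) (Fin.tail a) (Fin.tail b)
    rw [wordEntry] at this ⊢
    rw [List.ofFn_succ, List.prod_cons]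
    refine (congrArg _ this).trans ?_
    rw [wordMatrix_succ, weight_succ, neg_add, shiftOp_add, ofFunction_mul, ← translate_eq]
    simp only [mul_assoc]
    rw [← mul_assoc (ofFunction _) (shiftOp _), ofFunction_mul_shiftOp, mul_assoc]
    rfl

lemma wordEntry_append {m s : ℕ}
    (x y : ℕ → Matrix (Fin n) (Fin n) (CompletedTensor (LambdaField n) R))
    (a b : Fin m → Fin n) (a' b' : Fin s → Fin n) :
    wordEntry (m + s) (concat m x y) (Fin.append a a') (Fin.append b b')
      = wordEntry m x a b * wordEntry s y a' b' := by
  have hl : ∀ i : Fin m, Fin.castLE (Nat.le_add_right m s) i = Fin.castAdd s i := fun _ => rfl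
  have hc : ∀ i : Fin m, concat m x y i = x i := fun i => concat_of_lt x y i.is_lt
  rw [wordEntry, List.ofFn_add, List.prod_append]
  simp only [hl, Fin.append_left, Fin.append_right, Fin.val_castAdd, Fin.val_natAdd, concat_add, hc]
  rfl

/-- The trace of the product of a matrix of constants and a word. -/
def wordTrace {N : ℕ} (A : Matrix (Fin N → Fin n) (Fin N → Fin n) ℂ)
    (x : ℕ → Matrix (Fin n) (Fin n) (CompletedTensor (LambdaField n) R)) : ShiftAlgebra n R :=
  ∑ a, ∑ b, ofComplex (A a b) * wordEntry N x b a

/-- Complex constants are central in 𝔄ₙ, so the coefficients of the second antisymmetrizer pass the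
first word while the letters keep their order. -/
lemma wordTrace_mul_wordTrace {m s : ℕ}
    (x y : ℕ → Matrix (Fin n) (Fin n) (CompletedTensor (LambdaField n) R)) :
    wordTrace (antisymmetrizer n m) x * wordTrace (antisymmetrizer n s) y
      = wordTrace (blockAntisymmetrizer ℂ n 0 m m s (m + s) (by omega) le_rfl)
          (concat m x y) := by
  rw [wordTrace, wordTrace, wordTrace, sum_words_add, Finset.sum_mul]
  refine Finset.sum_congr rfl fun a _ => ?_
  rw [Finset.mul_sum]
  refine Finset.sum_congr rfl fun a' _ => ?_
  rw [sum_words_add, Finset.sum_mul]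
  refine Finset.sum_congr rfl fun b _ => ?_
  rw [Finset.mul_sum]
  refine Finset.sum_congr rfl fun b' _ => ?_
  rw [blockAntisymmetrizer_append, wordEntry_append, ofComplex_mul, mul_assoc, mul_assoc,
    ← mul_assoc (wordEntry m x b a), ← ofComplex_comm, mul_assoc]

/-- The shift operator of an entry depends only on the weight of its row. Since `A` preserves
weights, the terms group by the weight over which the trace is taken. -/
lemma wordTrace_eq_sum {N : ℕ} {A : Matrix (Fin N → Fin n) (Fin N → Fin n) ℂ}
    (hA : IsZeroWeight A)
    (x : ℕ → Matrix (Fin n) (Fin n) (CompletedTensor (LambdaField n) R)) :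
    wordTrace A x = ∑ μ ∈ Finset.univ.image (weight (n := n) (N := N)), shiftOp (-μ) * ofFunction
      (weightTrace μ ((A.map (algebraMap ℂ (LambdaField n)⟦X⟧)).map ofFun
        * wordMatrix ((lambdaDerivatives n).shT R) N x)) := by
  have e : ∀ μ : Fin n → ℤ, shiftOp (-μ) * ofFunction
      (weightTrace μ ((A.map (algebraMap ℂ (LambdaField n)⟦X⟧)).map ofFun
        * wordMatrix ((lambdaDerivatives n).shT R) N x))
      = ∑ a, if weight a = μ then ∑ b, ofComplex (A a b) * wordEntry N x b a else 0 := fun μ => by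
    rw [weightTrace, ofFunction_eq, map_sum, Finset.mul_sum]
    refine Finset.sum_congr rfl fun a _ => ?_
    split_ifs with ha
    · rw [mul_apply, map_sum, Finset.mul_sum]
      refine Finset.sum_congr rfl fun b _ => ?_
      by_cases hab : weight a = weight b
      · rw [wordEntry_eq, ← mul_assoc, ofComplex_comm, mul_assoc, ← hab, ha, map_mul]
        rfl
      · rw [Matrix.map_apply, Matrix.map_apply, hA a b hab, ofComplex_zero, map_zero, map_zero,
          zero_mul, zero_mul, map_zero, mul_zero]
    · rw [map_zero, mul_zero]
  rw [Finset.sum_congr rfl fun μ _ => e μ, Finset.sum_comm, wordTrace]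
  refine Finset.sum_congr rfl fun a _ => ?_
  rw [Finset.sum_ite_eq, if_pos (Finset.mem_image_of_mem _ (Finset.mem_univ a))]

lemma CartanWeighted.wordMatrix {h : Fin n → R}
    {x : ℕ → Matrix (Fin n) (Fin n) (CompletedTensor (LambdaField n) R)}
    (hx : ∀ i, CartanWeighted h (x i)) {N : ℕ} (a b : Fin N → Fin n) (k : Fin n) :
    ofAlg (h k) * wordMatrix ((lambdaDerivatives n).shT R) N x a b
      = wordMatrix ((lambdaDerivatives n).shT R) N x a b * (ofAlg (h k)
        + (((weight b - weight a) k : ℤ) : CompletedTensor (LambdaField n) R)) := by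
  induction N generalizing x with
  | zero =>
    rw [Subsingleton.elim a b, sub_self, Pi.zero_apply, Int.cast_zero, add_zero]
    change _ * 1 = 1 * _
    rw [mul_one, one_mul]
  | succ N ih =>
    have h₁ := congrArg (translate (weight (Fin.tail a))) (hx 0 (a 0) (b 0) k)
    rw [map_mul, map_mul, map_add, translate_ofAlg, map_intCast] at h₁
    have h₂ := ih (fun i => hx (i + 1)) (Fin.tail a) (Fin.tail b)
    have e : (weight b - weight a) k = (weight (Fin.tail b) - weight (Fin.tail a)) k
        + (unitWeight (b 0) - unitWeight (a 0)) k := by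
      rw [weight_succ a, weight_succ b]
      simp only [Pi.add_apply, Pi.sub_apply]
      ring
    rw [wordMatrix_succ, ← translate_eq, ← mul_assoc, h₁, mul_assoc, add_mul, h₂, mul_assoc,
      Int.cast_comm, ← mul_add, add_assoc, ← Int.cast_add, e]

/-- Only entries whose row and column have equal weight meet a nonzero entry of `A`, and for these
the commutator with hₖ vanishes. -/
lemma ofR_mul_wordTrace {h : Fin n → R}
    {x : ℕ → Matrix (Fin n) (Fin n) (CompletedTensor (LambdaField n) R)}
    (hx : ∀ i, CartanWeighted h (x i)) {N : ℕ}
    {A : Matrix (Fin N → Fin n) (Fin N → Fin n) ℂ} (hA : IsZeroWeight A) (k : Fin n) :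
    ofR (h k) * wordTrace A x = wordTrace A x * ofR (h k) := by
  rw [wordTrace, Finset.mul_sum, Finset.sum_mul]
  refine Finset.sum_congr rfl fun a _ => ?_
  rw [Finset.mul_sum, Finset.sum_mul]
  refine Finset.sum_congr rfl fun b _ => ?_
  by_cases hab : weight a = weight b
  · have := CartanWeighted.wordMatrix hx b a k
    rw [hab, sub_self, Pi.zero_apply, Int.cast_zero, add_zero] at this
    rw [wordEntry_eq, ← mul_assoc, ← ofComplex_comm, mul_assoc, mul_assoc, mul_assoc,
      ← mul_assoc (ofR _), ofR_mul_shiftOp, mul_assoc, ofR, ← ofFunction_mul, this,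
      ofFunction_mul]
  · rw [hA a b hab, ofComplex_zero, zero_mul, zero_mul, mul_zero]

end ShiftOperators

/-! ### Transfer matrices -/

section Transfer
open TopologicalSpace
variable {n : ℕ} {R : Type*} [Ring R] [Algebra ℂ⟦X⟧ R] {τ : ℂ} {U : Opens ℂ}
  {L : Matrix (Fin n) (Fin n) (CompletedTensor (SpectralFun U n) R)} {h : Fin n → R}

lemma transfer_eq (L : Matrix (Fin n) (Fin n) (CompletedTensor (SpectralFun U n) R)) (m : ℕ)
    (u : U) : transfer L m u = wordTrace (antisymmetrizer n m) fun k => evalL L u (k : ℂ) := by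
  rw [transfer, Matrix.trace, wordTrace]
  refine Finset.sum_congr rfl fun a _ => ?_
  rw [diag_apply, mul_apply]
  refine Finset.sum_congr rfl fun b _ => ?_
  rw [Matrix.map_apply, fusedL, prod_leg_apply]
  simp only [shiftedL, diagonal_mul, Matrix.map_apply]
  rfl

lemma ofR_mul_transfer (hL : IsDynamicalLOperator τ L h) (m : ℕ) (u : U) (k : Fin n) :
    ofR (h k) * transfer L m u = transfer L m u * ofR (h k) := by
  rw [transfer_eq]
  exact ofR_mul_wordTrace (fun i => CartanWeighted.evalL hL.cartanWeighted u _)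
    isZeroWeight_antisymmetrizer k

lemma ofR_mem_cartanIdeal (h : Fin n → R) (k : Fin n) : ofR (h k) ∈ cartanIdeal h :=
  Ideal.subset_span ⟨h k, NonUnitalAlgebra.subset_adjoin _ ⟨k, rfl⟩, rfl⟩

/-- Testing the generators suffices: in a product of Cartan elements the last one already sends `x`
into the left ideal. -/
lemma mem_cartanNormalizer {x : ShiftAlgebra n R}
    (hx : ∀ k, ofR (h k) * x ∈ cartanIdeal h) : x ∈ cartanNormalizer h := fun y hy => by
  induction hy using NonUnitalAlgebra.adjoin_induction with
  | mem y hy =>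
    obtain ⟨k, rfl⟩ := hy
    exact hx k
  | add y z _ _ hy hz =>
    rw [ofR, map_add, ofFunction_eq, map_add, add_mul]
    exact add_mem hy hz
  | zero =>
    rw [ofR, map_zero, ofFunction_eq, map_zero, zero_mul]
    exact zero_mem _
  | mul y z _ _ _ hz =>
    rw [ofR, map_mul, ofFunction_mul, mul_assoc]
    exact Ideal.mul_mem_left _ _ hz
  | smul c y _ hy =>
    rw [Algebra.smul_def, ofR, map_mul, ofFunction_mul, mul_assoc]
    exact Ideal.mul_mem_left _ _ hy

lemma mul_mem_cartanIdeal {x y : ShiftAlgebra n R} (hx : x ∈ cartanIdeal h)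
    (hy : y ∈ cartanNormalizer h) : x * y ∈ cartanIdeal h := by
  refine Submodule.span_induction ?_ ?_ ?_ ?_ hx
  · rintro _ ⟨w, hw, rfl⟩
    exact hy w hw
  · rw [zero_mul]
    exact zero_mem _
  · intro a b _ _ ha hb
    rw [add_mul]
    exact add_mem ha hb
  · intro c a _ ha
    rw [smul_eq_mul, mul_assoc]
    exact Ideal.mul_mem_left _ c ha

lemma transfer_mem_cartanNormalizer (hL : IsDynamicalLOperator τ L h) (m : ℕ) (u : U) :
    transfer L m u ∈ cartanNormalizer h :=
  mem_cartanNormalizer fun k => by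
    rw [ofR_mul_transfer hL]
    exact Ideal.mul_mem_left _ _ (ofR_mem_cartanIdeal h k)

lemma wordTrace_block_eq {N m s : ℕ} (hN : N = m + s)
    (x : ℕ → Matrix (Fin n) (Fin n) (CompletedTensor (LambdaField n) R)) :
    wordTrace (blockAntisymmetrizer ℂ n 0 m m s N (by omega) (by omega)) x
      = ∑ μ ∈ Finset.univ.image (weight (n := n) (N := N)),
          shiftOp (-μ) * ofFunction (blockTrace (lambdaDerivatives n) hN μ x) := by
  rw [wordTrace_eq_sum (isZeroWeight_blockAntisymmetrizer ℂ _ _)]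
  simp only [blockTrace, blockAntisymmetrizer_eq (LambdaField n)⟦X⟧]

lemma transfer_mul_transfer (L : Matrix (Fin n) (Fin n) (CompletedTensor (SpectralFun U n) R))
    {N m s : ℕ} (hN : N = m + s) (u v : U) :
    transfer L m u * transfer L s v
      = ∑ μ ∈ Finset.univ.image (weight (n := n) (N := N)),
          shiftOp (-μ) * ofFunction (blockTrace (lambdaDerivatives n) hN μ
            (concat m (fun r => evalL L u (r : ℂ)) fun p => evalL L v (p : ℂ))) := by
  rw [← wordTrace_block_eq, transfer_eq, transfer_eq, wordTrace_mul_wordTrace]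
  subst hN
  rfl

/-- The transfer matrices commute modulo the left ideal of the Cartan elements. -/
theorem transfer_mul_transfer_sub_mem (hτ : 0 < τ.im) (hL : IsDynamicalLOperator τ L h)
    (m s : ℕ) (u v : U) :
    transfer L m u * transfer L s v - transfer L s v * transfer L m u ∈ cartanIdeal h := by
  rw [transfer_mul_transfer L rfl, transfer_mul_transfer L (Nat.add_comm m s),
    ← Finset.sum_sub_distrib]
  refine sum_mem fun μ _ => ?_
  obtain ⟨A, hA⟩ := blockTrace_sub hτ hL u v rfl (Nat.add_comm m s) μ
  rw [← mul_sub, ofFunction_eq, ofFunction_eq, ← map_sub, hA, map_sum]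
  refine Ideal.mul_mem_left _ _ (sum_mem fun k _ => ?_)
  rw [map_mul]
  exact Ideal.mul_mem_left _ _ (ofR_mem_cartanIdeal h k)

end Transfer

end DynamicalElliptic
end

theorem mainTheorem1 (n : ℕ) (τ : ℂ) (hτ : 0 < τ.im)
    (R : Type*) [Ring R] [Algebra ℂ⟦X⟧ R]
    (U : TopologicalSpace.Opens ℂ)
    (L : Matrix (Fin n) (Fin n) (CompletedTensor (SpectralFun U n) R)) (h : Fin n → R)
    (hL : IsDynamicalLOperator τ L h) :
    (∀ (m : ℕ) (u : U) (k : Fin n),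
      ofR (h k) * transfer L m u = transfer L m u * ofR (h k)) ∧
    (∀ (m : ℕ) (u : U), transfer L m u ∈ cartanNormalizer h) ∧
    (∀ x ∈ cartanIdeal h, x ∈ cartanNormalizer h ∧
      ∀ y ∈ cartanNormalizer h, y * x ∈ cartanIdeal h ∧ x * y ∈ cartanIdeal h) ∧
    (∀ (m s : ℕ) (u v : U),
      transfer L m u * transfer L s v - transfer L s v * transfer L m u ∈ cartanIdeal h) :=
  ⟨ofR_mul_transfer hL, transfer_mem_cartanNormalizer hL,
    fun _ hx => ⟨mem_cartanNormalizer fun _ => Ideal.mul_mem_left _ _ hx,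
      fun _ hy => ⟨Ideal.mul_mem_left _ _ hx, mul_mem_cartanIdeal hx hy⟩⟩,
    transfer_mul_transfer_sub_mem hτ hL⟩
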